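/- Let $\Omega\subset\mathbb R^2$ be a bounded domain, and let $\Omega_f\neq\emptyset$ (fluid) and $\Omega_s$ (solid) be disjoint open subsets of $\Omega$ with Lipschitz boundaries and $\overline\Omega=\overline{\Omega_f}\cup\overline{\Omega_s}$. Assume that the interface $\Gamma^i:=\overline{\Omega_f}\cap\overline{\Omega_s}$ is a $C^1$ curve contained in $\Omega$, and let $\boldsymbol n$ be the unit normal on $\Gamma^i$ that points out of $\Omega_f$. Put $\Gamma_f^D:=\partial\Omega_f\cap\partial\Omega$. **Meshes.** Let $\{\mathcal T^h\}$ be a quasi-uniform (in particular shape-regular) family of conforming meshes of $\Omega$ into open convex quadrilaterals, fitted to $\partial\Omega$ but not necessarily to $\Gamma^i$; $h$ is the maximal cell diameter, and $\xi_K$ is the bilinear bijection of $(0,1)^2$ onto the cell $K$. For $i\in\{f,s\}$ let $\mathcal T_i^h:=\{K\in\mathcal T^h: K\cap\Omega_i\ne\emptyset\}$ and $\Omega_i^{\mathcal T}:=\bigcup_{K\in\mathcal T_i^h}\overline K$; let $G^h:=\Omega_f^{\mathcal T}\cap\Omega_s^{\mathcal T}$ and $\Omega_f^{\circ}:=\Omega_f\setminus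 G^h$. Let $\mathcal F_G^f$ be the set of common faces $F=\overline K\cap\overline{K'}$ of two cells $K,K'\in\mathcal T_f^h$ that do not lie on $\partial\Omega$ and for which $K$ or $K'$ meets $\Gamma^i$. Assume that there is a number $N$, independent of the mesh, such that to each cell $K\subseteq G^h$ one can assign a cell $K_f\subseteq\Omega_f^{\circ}$ that is reached from $K$ by crossing at most $N$ faces of $\mathcal F_G^f$, and such that no cell is assigned to more than $N$ cells $K$. **Spaces.** Let $m\ge 2$. For $r\in\mathbb N$ let $V_f^{h,r}$ be the space of all $\varphi\in C(\Omega_f^{\mathcal T})$ with $\varphi|_K\circ\xi_K\in Q_r$ for all $K\in\mathcal T_f^h$, where $Q_r$ is the space of polynomials of degree at most $r$ in each of the two variables. Let $\mathcal P^h:=V_f^{h,m-1}$ and $\mathcal V_f^h:=\{w\in (V_f^{h,m})^2: w=0\text{ on }\Gamma_f^D\}$. **Ghost penalty.** Let $\gamma_p>0$, $w_{\max}\ge1$, $\kappa_K:=|K\cap\Omega_f|/|K|$, and $w_F:=\sum_{K:F\subset\overline K}\tfrac12 w_{\max}^{1-2\kappa_K}$ for a face $F$. With the jump $[\cdot]$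 over $F$ of the derivatives in the direction normal to $F$, put $$g_p(p,p):=\gamma_p\sum_{F\in\mathcal F_G^f}w_F\sum_{l=1}^{m-1}\frac{h^{2l+1}}{(l!)^2}\,\bigl\|[\partial_{\boldsymbol n_F}^l p]\bigr\|_{L^2(F)}^2 .$$ **Claim.** There are constants $\gamma_1,C,\gamma_2,h_0>0$, independent of the mesh and of the functions, such that for each mesh of the family with $h\le h_0$ and each $p^h\in\mathcal P^h$ the following holds. 1. There is $w^h\in\mathcal V_f^h$ with $$\gamma_1h^2\|\nabla p^h\|^2_{L^2(\Omega_f^{\mathcal T})}\le(\operatorname{div}w^h,p^h)_{\Omega_f}-(w^h\cdot\boldsymbol n,p^h)_{\Gamma^i}+g_p(p^h,p^h),$$ $$\|w^h\|_{H^k(\Omega_f^{\mathcal T})}\le C\,h^{2-k}\,\|\nabla p^h\|_{L^2(\Omega_f^{\circ})}\qquad\text{for }k\in\{0,1\}.$$ 2. The following inf-sup condition holds, where the supremum is over the $w^h$ with $\|\nabla w^h\|_{L^2(\Omega_f)}\ne0$ (and may be $+\infty$): $$\gamma_2\,h\,\|\nabla p^h\|_{L^2(\Omega_f^{\mathcal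 T})}\le\sup_{w^h\in\mathcal V_f^h}\frac{(\operatorname{div}w^h,p^h)_{\Omega_f}-(w^h\cdot\boldsymbol n,p^h)_{\Gamma^i}}{\|\nabla w^h\|_{L^2(\Omega_f)}}+g_p(p^h,p^h)^{1/2}.$$ -/

import Mathlib

open Set Topology MeasureTheory

noncomputable section

namespace CutFEM

/-- The Euclidean plane. -/
abbrev E := EuclideanSpace ℝ (Fin 2)

/-! ### Domains -/

/-- Near `x`, the set `D` is the strict subgraph, in some orthonormal coordinate system, of a
function `g` from the class `P`. -/
def IsSubgraphAt (P : (ℝ → ℝ) → Prop) (D : Set E) (x : E) : Prop :=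
  ∃ (b : OrthonormalBasis (Fin 2) ℝ E) (g : ℝ → ℝ), P g ∧
    ∀ᶠ y in 𝓝 x, (y ∈ D ↔ b.repr y 1 < g (b.repr y 0))

/-- `D` has a Lipschitz boundary. -/
def HasLipschitzBoundary (D : Set E) : Prop :=
  ∀ x ∈ frontier D, IsSubgraphAt (fun g => ∃ L, LipschitzWith L g) D x

/-- The interface `Γ^i` between the two subdomains. -/
def interface (Ωf Ωs : Set E) : Set E := closure Ωf ∩ closure Ωs

/-- A bounded domain `Ω` of the plane, partitioned into a fluid domain `Ωf` and a solid domain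
`Ωs` with Lipschitz boundaries, such that the interface is a `C¹` curve inside `Ω`. -/
structure IsFSIDomain (Ω Ωf Ωs : Set E) : Prop where
  isOpen : IsOpen Ω
  isBounded : Bornology.IsBounded Ω
  isConnected : IsConnected Ω
  isOpen_fluid : IsOpen Ωf
  isOpen_solid : IsOpen Ωs
  nonempty_fluid : Ωf.Nonempty
  fluid_subset : Ωf ⊆ Ω
  solid_subset : Ωs ⊆ Ω
  disjoint : Disjoint Ωf Ωs
  closure_eq : closure Ω = closure Ωf ∪ closure Ωs
  lipschitz_fluid : HasLipschitzBoundary Ωf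
  lipschitz_solid : HasLipschitzBoundary Ωs
  interface_subset : interface Ωf Ωs ⊆ Ω
  interface_smooth : ∀ x ∈ interface Ωf Ωs, IsSubgraphAt (ContDiff ℝ 1) Ωf x

/-- `ν` is the outer unit normal of `D` at the boundary point `x`: up to `o(‖y - x‖)`, the set `D`
is the half-plane `⟪ν, y - x⟫ < 0` near `x`. There is at most one such `ν`. -/
def IsOuterUnitNormal (D : Set E) (x ν : E) : Prop :=
  ‖ν‖ = 1 ∧ ∀ ε > 0, ∀ᶠ y in 𝓝 x,
    (inner ℝ ν (y - x) < -(ε * ‖y - x‖) → y ∈ D) ∧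
    (ε * ‖y - x‖ < inner ℝ ν (y - x) → y ∉ D)

open Classical in
/-- The outer unit normal field of `D` (zero where there is none). -/
def outerNormal (D : Set E) (x : E) : E :=
  if hν : ∃ ν, IsOuterUnitNormal D x ν then hν.choose else 0

/-! ### Norms and differential operators

The functions that occur below are smooth inside every cell of a mesh, so that the classical
derivative exists outside the mesh skeleton (a null set) and is the weak derivative. -/

variable {F : Type*} [NormedAddCommGroup F] [NormedSpace ℝ F]

/-- The partial derivative `∂ᵢ f`. -/
def pderiv (i : Fin 2) (f : E → F) (x : E) : F := fderiv ℝ f x (EuclideanSpace.single i 1)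

/-- The divergence of a vector field. -/
def divergence (w : E → E) (x : E) : ℝ := ∑ i, pderiv i w x i

/-- `‖f‖_S`, the norm of `L²(S)`. -/
def l2Norm (S : Set E) (f : E → F) : ℝ := √(∫ x in S, ‖f x‖ ^ 2)

/-- `‖∇f‖_S`, the `L²(S)` norm of the gradient. -/
def gradNorm (S : Set E) (f : E → F) : ℝ := √(∫ x in S, ∑ i, ‖pderiv i f x‖ ^ 2)

/-- `‖f‖_{H¹(S)}`. -/
def h1Norm (S : Set E) (f : E → F) : ℝ := √(l2Norm S f ^ 2 + gradNorm S f ^ 2)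

/-! ### Quadrilateral meshes -/

/-- The determinant of two vectors of the plane. -/
def det2 (u v : E) : ℝ := u 0 * v 1 - u 1 * v 0

/-- The bilinear map of the unit square onto the quadrilateral with corners `A 0, …, A 3`. -/
def bilinearMap (A : Fin 4 → E) (s t : ℝ) : E :=
  ((1 - s) * (1 - t)) • A 0 + (s * (1 - t)) • A 1 + (s * t) • A 2 + ((1 - s) * t) • A 3

/-- The open quadrilateral cell with corners `A 0, …, A 3`. -/
def quad (A : Fin 4 → E) : Set E := {x | ∃ s ∈ Ioo (0 : ℝ) 1, ∃ t ∈ Ioo (0 : ℝ) 1,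
  bilinearMap A s t = x}

/-- The Jacobian determinant of the bilinear map at the corner `A e`, which is twice the signed area
of the triangle spanned by that corner and the two corners next to it. -/
def cornerDet (A : Fin 4 → E) (e : Fin 4) : ℝ := det2 (A (e + 1) - A e) (A (e + 3) - A e)

/-- The (closed) edge from `A e` to `A (e + 1)`. -/
def quadEdge (A : Fin 4 → E) (e : Fin 4) : Set E := segment ℝ (A e) (A (e + 1))

/-- A unit normal vector of that edge. -/
def quadNormal (A : Fin 4 → E) (e : Fin 4) : E :=
  ‖A (e + 1) - A e‖⁻¹ • !₂[(A (e + 1) - A e) 1, -(A (e + 1) - A e) 0]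

/-- A conforming mesh of `Ω` into finitely many (nondegenerate, convex) quadrilaterals with
counterclockwise corners, fitted to the boundary of `Ω`. -/
structure QuadMesh (Ω : Set E) where
  /-- the number of cells -/
  n : ℕ
  corner : Fin n → Fin 4 → E
  cornerDet_pos : ∀ K e, 0 < cornerDet (corner K) e
  disjoint : ∀ K K', K ≠ K' → Disjoint (quad (corner K)) (quad (corner K'))
  cover : ⋃ K, closure (quad (corner K)) = closure Ω
  /-- two closed cells are disjoint, or share a corner, or share an edge -/
  conforming : ∀ K K', K ≠ K' →
    closure (quad (corner K)) ∩ closure (quad (corner K')) = ∅ ∨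
    (∃ a a', corner K a = corner K' a' ∧
      closure (quad (corner K)) ∩ closure (quad (corner K')) = {corner K a}) ∨
    (∃ e e', quadEdge (corner K) e = quadEdge (corner K') e' ∧
      closure (quad (corner K)) ∩ closure (quad (corner K')) = quadEdge (corner K) e)

namespace QuadMesh

variable {Ω : Set E} (M : QuadMesh Ω)

/-- The open cell `K`. -/
def cell (K : Fin M.n) : Set E := quad (M.corner K)

/-- The edge number `e` of the cell `K`. -/
def edge (K : Fin M.n) (e : Fin 4) : Set E := quadEdge (M.corner K) e

/-- The mesh size `h`, the largest diameter of a cell. -/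
def size : ℝ := ⨆ K, Metric.diam (M.cell K)

/-- The subtriangulation of the cells that meet `D`. -/
def sub (D : Set E) : Set (Fin M.n) := {K | (M.cell K ∩ D).Nonempty}

/-- The computational domain spanned by the cells that meet `D`. -/
def compDomain (D : Set E) : Set E := ⋃ K ∈ M.sub D, closure (M.cell K)

/-- The interface zone `G^h`. -/
def interfaceZone (Ωf Ωs : Set E) : Set E := M.compDomain Ωf ∩ M.compDomain Ωs

/-- The interior fluid domain `Ωf ∖ G^h`. -/
def innerFluid (Ωf Ωs : Set E) : Set E := Ωf \ M.interfaceZone Ωf Ωs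

/-- The finite element space `V^{h,r}` of continuous mapped `Q_r` functions on the computational
domain of `D`. Its elements are represented by functions on the plane, whose values outside the
computational domain play no role. -/
def feSpace (D : Set E) (r : ℕ) : Set (E → ℝ) :=
  {φ | ContinuousOn φ (M.compDomain D) ∧ ∀ K ∈ M.sub D,
    ∃ q ∈ MvPolynomial.restrictDegree (Fin 2) ℝ r, ∀ s ∈ Ioo (0 : ℝ) 1, ∀ t ∈ Ioo (0 : ℝ) 1,
      φ (bilinearMap (M.corner K) s t) = MvPolynomial.eval ![s, t] q}

/-- The velocity space `V_f^h`: both components are continuous mapped `Q_m` functions, and the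
trace on the Dirichlet boundary `∂Ωf ∩ ∂Ω` vanishes. -/
def velocitySpace (Ωf : Set E) (m : ℕ) : Set (E → E) :=
  {w | (∀ i, (fun x => w x i) ∈ M.feSpace Ωf m) ∧ ∀ x ∈ frontier Ωf ∩ frontier Ω, w x = 0}

/-- The pressure space `P^h`. -/
def pressureSpace (Ωf : Set E) (m : ℕ) : Set (E → ℝ) := M.feSpace Ωf (m - 1)

/-- The edge `e` of `K` is a fluid ghost penalty face, and `K'` is the cell on its other side. -/
def IsGhostFace (Ωf Ωs : Set E) (K : Fin M.n) (e : Fin 4) (K' : Fin M.n) : Prop :=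
  K ≠ K' ∧ K ∈ M.sub Ωf ∧ K' ∈ M.sub Ωf ∧
  closure (M.cell K) ∩ closure (M.cell K') = M.edge K e ∧
  ¬ M.edge K e ⊆ frontier Ω ∧
  ((M.cell K ∩ interface Ωf Ωs).Nonempty ∨ (M.cell K' ∩ interface Ωf Ωs).Nonempty)

/-- The fraction `κ` of the cell `K` that lies in `D`. -/
def fraction (D : Set E) (K : Fin M.n) : ℝ := volume.real (M.cell K ∩ D) / volume.real (M.cell K)

/-- The weight `w(κ)` of the cell `K`. -/
def weight (D : Set E) (wmax : ℝ) (K : Fin M.n) : ℝ := 1 / 2 * wmax ^ (1 - 2 * M.fraction D K)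

/-- The trace on the edge `e` of `K`, taken from inside `K'`, of the `l`-th derivative in the
direction of the normal of that edge. -/
def normalDeriv (K : Fin M.n) (e : Fin 4) (K' : Fin M.n) (l : ℕ) (φ : E → ℝ) (x : E) : ℝ :=
  iteratedFDerivWithin ℝ l φ (closure (M.cell K')) x (fun _ => quadNormal (M.corner K) e)

/-- The jump of the `l`-th normal derivative over the common edge `e` of `K` and `K'`. -/
def jump (K : Fin M.n) (e : Fin 4) (K' : Fin M.n) (l : ℕ) (φ : E → ℝ) (x : E) : ℝ :=
  M.normalDeriv K e K l φ x - M.normalDeriv K e K' l φ x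

open Classical in
/-- The pressure ghost penalty `g_p^{h,w}`. The sum runs over the two sides of every ghost face, so
that each face occurs twice with the same contribution; this is what the factor `1 / 2` corrects. -/
def ghostPenalty (Ωf Ωs : Set E) (m : ℕ) (γp wmax : ℝ) (φ₁ φ₂ : E → ℝ) : ℝ :=
  γp * (1 / 2 * ∑ K, ∑ e, ∑ K', if M.IsGhostFace Ωf Ωs K e K' then
    (M.weight Ωf wmax K + M.weight Ωf wmax K') *
      ∑ l ∈ Finset.Icc 1 (m - 1), M.size ^ (2 * l + 1) / (l.factorial : ℝ) ^ 2 *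
        ∫ x in M.edge K e, M.jump K e K' l φ₁ x * M.jump K e K' l φ₂ x ∂μH[1]
    else 0)

end QuadMesh

/-- The form `(div w, p)_{Ωf} - (w · n, p)_{Γ^i}`, with the outer unit normal `n` of `Ωf`. -/
def pressureForm (Ωf Ωs : Set E) (w : E → E) (p : E → ℝ) : ℝ :=
  (∫ x in Ωf, divergence w x * p x) -
    ∫ x in interface Ωf Ωs, inner ℝ (w x) (outerNormal Ωf x) * p x ∂μH[1]

/-- A quasi-uniform family of meshes: with one constant `σ`, all cells of a mesh have a diameter
comparable to the mesh size, and are shape-regular, i.e. the triangles spanned by any three corners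
of a cell have an area comparable to the squared diameter of the cell. -/
def IsQuasiUniform {Ω : Set E} {J : Type*} (𝒯 : J → QuadMesh Ω) : Prop :=
  ∃ σ : ℝ, ∀ j, ∀ K : Fin (𝒯 j).n,
    (𝒯 j).size ≤ σ * Metric.diam ((𝒯 j).cell K) ∧
    ∀ e, Metric.diam ((𝒯 j).cell K) ^ 2 ≤ σ * cornerDet ((𝒯 j).corner K) e

/-- Every fluid cell `K` of the interface zone is joined to a cell `a K` inside `Ωf ∖ G^h` by
crossing at most `N` ghost penalty faces, and no cell is used more than `N` times as such a final
cell, with a bound `N` for all meshes of the family. -/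
def HasGhostPaths {Ω : Set E} {J : Type*} (𝒯 : J → QuadMesh Ω) (Ωf Ωs : Set E) : Prop :=
  ∃ N : ℕ, ∀ j, ∃ a : Fin (𝒯 j).n → Fin (𝒯 j).n,
    (∀ K, (𝒯 j).cell K ⊆ (𝒯 j).interfaceZone Ωf Ωs →
      (𝒯 j).cell (a K) ⊆ (𝒯 j).innerFluid Ωf Ωs ∧
      ∃ k ≤ N, ∃ path : ℕ → Fin (𝒯 j).n, path 0 = K ∧ path k = a K ∧
        ∀ l < k, ∃ e, (𝒯 j).IsGhostFace Ωf Ωs (path l) e (path (l + 1))) ∧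
    ∀ K', {K | (𝒯 j).cell K ⊆ (𝒯 j).interfaceZone Ωf Ωs ∧ a K = K'}.ncard ≤ N

end CutFEM

end

open CutFEM

noncomputable section

open scoped ContDiff

namespace CutFEM

/-! Write `h` for the mesh size and `r = m - 1` for the degree of the pressure. Because `w` vanishes
on the outer boundary, integration by parts (`pressureForm_eq`) turns the form into the integral of
`-w · ∇p` over `Ωf`. Wanted is a discrete velocity of size `h² |∇p|` for which this integral
dominates `h² ‖∇p‖²` on the uncut fluid cells, while the cut cells contribute nothing negative. The
ghost penalty then extends the control of `∇p` to the cut cells.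

Only an unknown part of a cut cell belongs to the fluid, so there the sign must hold at every point.
In reference coordinates `(s, t)` the field `cutField`, which is `-(s(1-s) p_s ∂_s ξ + t(1-t) p_t
∂_t ξ)`, has this property (`neg_det2_cutField`) and has degree at most `m` in each variable. Its
trace on an edge is tangential and depends only on the trace of `p` on that edge. On an uncut cell
the velocity is a sum over the interior edges of functions with the same traces, each corrected by a
cell bubble (`innerField`). Hence the pieces fit together continuously (`localField_eq`), and
leaving out the edges on the outer boundary gives the Dirichlet condition. Small `h` guarantees that
cut cells have no edge on the outer boundary and that every cell has at least one interior edge.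

The heart is coercivity on an uncut cell: one edge function together with the bubble controls the
whole gradient (`exists_edgeForm_add_bubbleForm`). Scaled shapes form a compact set, so it suffices
that the edge form is positive wherever all moments of the gradient against bubbles vanish
(`edgeForm_pos`). In that case the tangential component of the gradient, integrated along the edge
direction against a weighted polynomial, is in the transversal variable a multiple of a Gegenbauer
polynomial. A one-point quadrature formula for this polynomial rewrites the edge form as a weighted
square integral of the tangential derivative on the edge. If that is zero, the tangential component
vanishes throughout, because the Taylor coefficients of the Gegenbauer polynomial at points outside
the unit interval are nonzero. The pressure is then a function of the distance to the edge alone,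
and one more bubble test makes it constant.

For the ghost penalty, a mapped polynomial is determined up to a constant by its tangential
derivative and its normal derivatives up to order `r` on one edge (`eq_zero_of_edge_data`).
Continuity transfers the tangential derivative across the edge and the penalty transfers the normal
ones, so the gradient on a cell is bounded by that on its neighbour plus jumps
(`exists_cellGrad_le`). Summation along the assumed paths gives `exists_sum_cellGrad_le`.

The conclusion is a dichotomy. If the penalty dominates `h² ‖∇p‖²`, the zero velocity serves for the
first claim and nonnegativity of the supremum for the second. Otherwise the gradient on the uncut
cells dominates, and the constructed velocity serves for both. The divergence theorem on `Ωf` rests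
on Fubini's theorem, cutoffs below a graph, and a partition of unity. -/

/-! ### The bilinear map of a quadrilateral -/

/-- The bilinear map of a quadrilateral, with the reference square in the plane. -/
def xi (A : Fin 4 → E) (z : E) : E := bilinearMap A (z 0) (z 1)

/-- The coefficients `(a, b, c)` of `A 0 + s a + t c + s t b`. -/
abbrev Shape := E × E × E

/-- The shape of a quadrilateral: its bilinear map up to translation. -/
def shape (A : Fin 4 → E) : Shape := (A 1 - A 0, A 2 - A 1 - A 3 + A 0, A 3 - A 0)

/-- The derivative of the bilinear map in the first variable. -/
def tanS (S : Shape) (z : E) : E := S.1 + z 1 • S.2.1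

/-- The derivative of the bilinear map in the second variable. -/
def tanT (S : Shape) (z : E) : E := S.2.2 + z 0 • S.2.1

/-- The Jacobian determinant of the bilinear map. -/
def jac (S : Shape) (z : E) : ℝ := det2 (tanS S z) (tanT S z)

/-- The point `(s, t)` of the plane. -/
def pt (s t : ℝ) : E := !₂[s, t]

@[simp] lemma pt_zero (s t : ℝ) : pt s t 0 = s := rfl
@[simp] lemma pt_one (s t : ℝ) : pt s t 1 = t := rfl

lemma pt_eta (z : E) : pt (z 0) (z 1) = z := by
  ext i; fin_cases i <;> rfl

/-- The open reference square. -/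
def sq : Set E := {z | 0 < z 0 ∧ z 0 < 1 ∧ 0 < z 1 ∧ z 1 < 1}

/-- The closed reference square. -/
def csq : Set E := {z | 0 ≤ z 0 ∧ z 0 ≤ 1 ∧ 0 ≤ z 1 ∧ z 1 ≤ 1}

lemma sq_subset_csq : sq ⊆ csq := fun _ h => ⟨h.1.le, h.2.1.le, h.2.2.1.le, h.2.2.2.le⟩

@[fun_prop] lemma continuous_coord (i : Fin 2) : Continuous fun z : E => z i := by fun_prop

lemma isOpen_sq : IsOpen sq := by
  have h0 := continuous_coord 0
  have h1 := continuous_coord 1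
  exact ((isOpen_lt continuous_const h0).inter ((isOpen_lt h0 continuous_const).inter
    ((isOpen_lt continuous_const h1).inter (isOpen_lt h1 continuous_const))))

lemma isClosed_csq : IsClosed csq := by
  have h0 := continuous_coord 0
  have h1 := continuous_coord 1
  exact ((isClosed_le continuous_const h0).inter ((isClosed_le h0 continuous_const).inter
    ((isClosed_le continuous_const h1).inter (isClosed_le h1 continuous_const))))

lemma norm_sq_eq (z : E) : ‖z‖ ^ 2 = z 0 ^ 2 + z 1 ^ 2 := by
  rw [EuclideanSpace.norm_sq_eq]; simp [Fin.sum_univ_two]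

lemma abs_coord_le (z : E) (i : Fin 2) : |z i| ≤ ‖z‖ := PiLp.norm_apply_le z i

lemma isCompact_csq : IsCompact csq := by
  refine Metric.isCompact_of_isClosed_isBounded isClosed_csq ?_
  refine (Metric.isBounded_iff_subset_closedBall 0).2 ⟨2, fun z hz => ?_⟩
  rw [mem_closedBall_zero_iff]
  have := norm_sq_eq z
  obtain ⟨h1, h2, h3, h4⟩ := hz
  nlinarith [norm_nonneg z]

lemma csq_subset_closure_sq : csq ⊆ closure sq := by
  intro z hz
  rw [Metric.mem_closure_iff]
  intro ε hε
  obtain ⟨h1, h2, h3, h4⟩ := hz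
  set δ := min (1 / 2) (ε / 4) with hδ
  have hδ0 : 0 < δ := by positivity
  have hδ1 : δ ≤ 1 / 2 := min_le_left _ _
  have hδ2 : δ ≤ ε / 4 := min_le_right _ _
  -- The point is contracted towards the centre of the square by the factor `1 - δ`.
  refine ⟨pt ((1 - δ) * z 0 + δ / 2) ((1 - δ) * z 1 + δ / 2),
    ⟨by simp; nlinarith, by simp; nlinarith, by simp; nlinarith, by simp; nlinarith⟩, ?_⟩
  rw [dist_eq_norm]
  have := norm_sq_eq (z - pt ((1 - δ) * z 0 + δ / 2) ((1 - δ) * z 1 + δ / 2))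
  simp only [PiLp.sub_apply, pt_zero, pt_one] at this
  refine lt_of_pow_lt_pow_left₀ 2 hε.le ?_
  rw [this]
  have e0 : (z 0 - ((1 - δ) * z 0 + δ / 2)) = δ * (z 0 - 1 / 2) := by ring
  have e1 : (z 1 - ((1 - δ) * z 1 + δ / 2)) = δ * (z 1 - 1 / 2) := by ring
  rw [e0, e1]
  have k0 : (z 0 - 1 / 2) ^ 2 ≤ 1 := by nlinarith
  have k1 : (z 1 - 1 / 2) ^ 2 ≤ 1 := by nlinarith
  have : δ ^ 2 ≤ ε ^ 2 / 16 := by nlinarith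
  nlinarith [sq_nonneg δ]

lemma closure_sq : closure sq = csq :=
  (closure_minimal sq_subset_csq isClosed_csq).antisymm csq_subset_closure_sq

lemma coord_combo (a b : ℝ) (x y : E) (i : Fin 2) : (a • x + b • y) i = a * x i + b * y i := rfl

lemma convex_csq : Convex ℝ csq := by
  rintro x ⟨h1, h2, h3, h4⟩ y ⟨k1, k2, k3, k4⟩ a b ha hb hab
  refine ⟨?_, ?_, ?_, ?_⟩ <;> rw [coord_combo] <;> nlinarith

lemma convex_sq : Convex ℝ sq := by
  have hs : sq = ((fun z : E => z 0) ⁻¹' Ioo 0 1) ∩ ((fun z : E => z 1) ⁻¹' Ioo 0 1) := by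
    ext z; simp [sq, and_assoc]
  rw [hs]
  have l0 : IsLinearMap ℝ (fun z : E => z 0) := ⟨fun _ _ => rfl, fun _ _ => rfl⟩
  have l1 : IsLinearMap ℝ (fun z : E => z 1) := ⟨fun _ _ => rfl, fun _ _ => rfl⟩
  exact ((convex_Ioo 0 1).is_linear_preimage l0).inter ((convex_Ioo 0 1).is_linear_preimage l1)

lemma sq_nonempty : sq.Nonempty := ⟨pt (1 / 2) (1 / 2), by norm_num [sq]⟩

lemma uniqueDiffOn_csq : UniqueDiffOn ℝ csq :=
  uniqueDiffOn_convex convex_csq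
    (sq_nonempty.mono (interior_maximal sq_subset_csq isOpen_sq))

/-! ### Determinants of plane vectors. -/

lemma det2_add_left (u v w : E) : det2 (u + v) w = det2 u w + det2 v w := by
  simp only [det2, PiLp.add_apply]; ring
lemma det2_add_right (u v w : E) : det2 u (v + w) = det2 u v + det2 u w := by
  simp only [det2, PiLp.add_apply]; ring
lemma det2_smul_left (k : ℝ) (u v : E) : det2 (k • u) v = k * det2 u v := by
  simp only [det2, PiLp.smul_apply, smul_eq_mul]; ring
lemma det2_smul_right (k : ℝ) (u v : E) : det2 u (k • v) = k * det2 u v := by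
  simp only [det2, PiLp.smul_apply, smul_eq_mul]; ring
lemma det2_neg_left (u v : E) : det2 (-u) v = -det2 u v := by
  simp only [det2, PiLp.neg_apply]; ring
lemma det2_self (u : E) : det2 u u = 0 := by simp only [det2]; ring

/-- Lagrange's identity. It gives the bound `abs_det2_le`, and it shows that nonzero orthogonal
vectors have nonzero determinant. -/
lemma det2_sq_add_inner_sq (u v : E) : det2 u v ^ 2 + inner ℝ u v ^ 2 = ‖u‖ ^ 2 * ‖v‖ ^ 2 := by
  rw [norm_sq_eq, norm_sq_eq, PiLp.inner_apply]
  simp only [det2, Fin.sum_univ_two, RCLike.inner_apply, conj_trivial]; ring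

lemma abs_det2_le (u v : E) : |det2 u v| ≤ ‖u‖ * ‖v‖ := by
  refine abs_le_of_sq_le_sq ?_ (by positivity)
  rw [mul_pow, ← det2_sq_add_inner_sq]
  nlinarith [sq_nonneg (inner ℝ u v)]

/-- The solution of a linear system of two equations by determinants. -/
lemma det2_cramer (u v x : E) (h : det2 u v ≠ 0) :
    (det2 x v / det2 u v) • u + (det2 u x / det2 u v) • v = x := by
  have h' := h
  simp only [det2] at h'
  ext i
  fin_cases i
  · simp only [det2, PiLp.add_apply, PiLp.smul_apply, smul_eq_mul, Fin.zero_eta]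
    rw [div_mul_eq_mul_div, div_mul_eq_mul_div, ← add_div, div_eq_iff h']; ring
  · simp only [det2, PiLp.add_apply, PiLp.smul_apply, smul_eq_mul, Fin.mk_one]
    rw [div_mul_eq_mul_div, div_mul_eq_mul_div, ← add_div, div_eq_iff h']; ring

/-- The coefficient of `z 0 * z 1` is the determinant of a vector with itself, so the Jacobian is
affine. Lower bounds at the corners therefore hold on the square, and the positivity set is convex.
-/
lemma jac_eq (S : Shape) (z : E) :
    jac S z = det2 S.1 S.2.2 + det2 S.1 S.2.1 * z 0 + det2 S.2.1 S.2.2 * z 1 := by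
  simp only [jac, tanS, tanT, det2, PiLp.add_apply, PiLp.smul_apply, smul_eq_mul]; ring

lemma xi_eq (A : Fin 4 → E) (z : E) :
    xi A z = A 0 + z 0 • (shape A).1 + z 1 • (shape A).2.2 + (z 0 * z 1) • (shape A).2.1 := by
  ext i
  simp only [xi, bilinearMap, shape, PiLp.add_apply, PiLp.smul_apply, smul_eq_mul, PiLp.sub_apply]
  ring

/-- A quadratic map has exact differences given by its derivative at the midpoint. -/
lemma xi_sub (A : Fin 4 → E) (z z' : E) :
    xi A z - xi A z' = (z 0 - z' 0) • tanS (shape A) ((1 / 2 : ℝ) • (z + z')) +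
      (z 1 - z' 1) • tanT (shape A) ((1 / 2 : ℝ) • (z + z')) := by
  ext i
  simp only [xi_eq, tanS, tanT, PiLp.add_apply, PiLp.smul_apply, smul_eq_mul, PiLp.sub_apply]
  ring

/-! ### Injectivity, derivative and smooth inverse of the bilinear map. -/

/-- The half plane on which the Jacobian determinant is positive. -/
def posHalf (S : Shape) : Set E := {z | 0 < jac S z}

lemma continuous_jac (S : Shape) : Continuous (jac S) := by
  simp_rw [funext (jac_eq S)]; fun_prop

lemma isOpen_posHalf (S : Shape) : IsOpen (posHalf S) :=
  isOpen_lt continuous_const (continuous_jac S)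

/-- The midpoint of two points with positive Jacobian has positive Jacobian, and by `xi_sub` the
invertible derivative at the midpoint annihilates their difference. -/
lemma xi_injOn (A : Fin 4 → E) : InjOn (xi A) (posHalf (shape A)) := by
  intro z hz z' hz' h
  have h0 := xi_sub A z z'
  rw [h, sub_self] at h0
  set w := (1 / 2 : ℝ) • (z + z') with hw
  have hj : 0 < jac (shape A) w := by
    have : jac (shape A) w = (jac (shape A) z + jac (shape A) z') / 2 := by
      simp only [jac_eq, hw, PiLp.smul_apply, PiLp.add_apply, smul_eq_mul]; ring
    rw [this]
    have := hz.out; have := hz'.out; linarith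
  have k0 : (z 0 - z' 0) * jac (shape A) w = 0 := by
    have := congrArg (fun x => det2 x (tanT (shape A) w)) h0
    simp only [det2_add_left, det2_smul_left, det2_self] at this
    rw [jac, ← add_zero (_ * _)]
    simpa [det2] using this.symm
  have k1 : (z 1 - z' 1) * jac (shape A) w = 0 := by
    have := congrArg (fun x => det2 (tanS (shape A) w) x) h0
    simp only [det2_add_right, det2_smul_right, det2_self] at this
    rw [jac]
    simpa [det2] using this.symm
  have e0 : z 0 = z' 0 := by
    have := (mul_eq_zero.1 k0).resolve_right hj.ne'; linarith
  have e1 : z 1 = z' 1 := by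
    have := (mul_eq_zero.1 k1).resolve_right hj.ne'; linarith
  ext i; fin_cases i
  · exact e0
  · exact e1

lemma contDiff_xi (A : Fin 4 → E) {n : WithTop ℕ∞} : ContDiff ℝ n (xi A) := by
  unfold xi bilinearMap; fun_prop

/-- The derivative of the bilinear map. -/
def jacLin (S : Shape) (z : E) : E →L[ℝ] E :=
  (EuclideanSpace.proj 0 : E →L[ℝ] ℝ).smulRight (tanS S z) +
    (EuclideanSpace.proj 1 : E →L[ℝ] ℝ).smulRight (tanT S z)

lemma jacLin_apply (S : Shape) (z v : E) :
    jacLin S z v = v 0 • tanS S z + v 1 • tanT S z := by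
  simp [jacLin]

lemma hasFDerivAt_xi (A : Fin 4 → E) (z : E) : HasFDerivAt (xi A) (jacLin (shape A) z) z := by
  have c (i : Fin 2) : HasFDerivAt (fun z : E => z i) (EuclideanSpace.proj i : E →L[ℝ] ℝ) z :=
    (EuclideanSpace.proj i : E →L[ℝ] ℝ).hasFDerivAt
  have h := ((((hasFDerivAt_const (A 0) z).add ((c 0).smul_const (shape A).1)).add
    ((c 1).smul_const (shape A).2.2)).add (((c 0).mul (c 1)).smul_const (shape A).2.1))
  have e : xi A = fun z => A 0 + z 0 • (shape A).1 + z 1 • (shape A).2.2 +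
    (z 0 * z 1) • (shape A).2.1 := funext (xi_eq A)
  rw [e]
  refine HasFDerivAt.congr_fderiv h ?_
  refine ContinuousLinearMap.ext fun v => ?_
  rw [jacLin_apply]
  ext i
  simp [tanS, tanT]
  ring

/-- The inverse of the derivative. -/
def jacInv (S : Shape) (z v : E) : E :=
  pt (det2 v (tanT S z) / jac S z) (det2 (tanS S z) v / jac S z)

lemma jacLin_jacInv {S : Shape} {z : E} (hz : jac S z ≠ 0) (v : E) :
    jacLin S z (jacInv S z v) = v := by
  rw [jacLin_apply]; exact det2_cramer _ _ _ hz

lemma jacInv_jacLin {S : Shape} {z : E} (hz : jac S z ≠ 0) (v : E) :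
    jacInv S z (jacLin S z v) = v := by
  rw [jacLin_apply, jacInv, ← pt_eta v]
  simp only [det2_add_left, det2_add_right, det2_smul_left, det2_smul_right, det2_self, pt_zero,
    pt_one, mul_zero, add_zero, zero_add]
  rw [← jac, mul_div_cancel_right₀ _ hz, mul_div_cancel_right₀ _ hz]

lemma det_jacLin (S : Shape) (z : E) : (jacLin S z).det = jac S z := by
  rw [ContinuousLinearMap.det, ← LinearMap.det_toMatrix (EuclideanSpace.basisFun (Fin 2) ℝ).toBasis,
    Matrix.det_fin_two]
  simp [LinearMap.toMatrix_apply, jacLin_apply, jac, det2]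
  ring

/-- The derivative as a continuous linear equivalence. -/
def jacEquiv {S : Shape} {z : E} (hz : jac S z ≠ 0) : E ≃L[ℝ] E :=
  (LinearEquiv.ofBijective (jacLin S z).toLinearMap
    ⟨Function.LeftInverse.injective (jacInv_jacLin hz),
      Function.RightInverse.surjective (jacLin_jacInv hz)⟩).toContinuousLinearEquiv

lemma coe_jacEquiv {S : Shape} {z : E} (hz : jac S z ≠ 0) :
    (jacEquiv hz : E →L[ℝ] E) = jacLin S z := by
  ext; rfl

lemma hasStrictFDerivAt_xi (A : Fin 4 → E) {z : E} (hz : jac (shape A) z ≠ 0) :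
    HasStrictFDerivAt (xi A) (jacEquiv hz : E →L[ℝ] E) z := by
  rw [coe_jacEquiv]
  exact ((contDiff_xi A (n := 1)).contDiffAt.hasStrictFDerivAt (by simp)).congr_fderiv
    (hasFDerivAt_xi A z).fderiv

/-- The inverse of the bilinear map. -/
def xiInv (A : Fin 4 → E) : E → E := Function.invFunOn (xi A) (posHalf (shape A))

lemma xiInv_xi (A : Fin 4 → E) {z : E} (hz : z ∈ posHalf (shape A)) : xiInv A (xi A z) = z :=
  (xi_injOn A).leftInvOn_invFunOn hz

lemma isOpen_image_xi (A : Fin 4 → E) {O : Set E} (hO : IsOpen O) (hs : O ⊆ posHalf (shape A)) :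
    IsOpen (xi A '' O) := by
  rw [isOpen_iff_mem_nhds]
  rintro _ ⟨z, hz, rfl⟩
  rw [← (hasStrictFDerivAt_xi A (hs hz).ne').map_nhds_eq_of_equiv]
  exact Filter.image_mem_map (hO.mem_nhds hz)

/-- Near an image point the global inverse on `posHalf` agrees with the local inverse of the inverse
function theorem, whose values stay in the open set `posHalf`. -/
lemma contDiffAt_xiInv (A : Fin 4 → E) {z : E} (hz : z ∈ posHalf (shape A)) {n : WithTop ℕ∞}
    (hn : n ≠ 0) : ContDiffAt ℝ n (xiInv A) (xi A z) := by
  have hs := hasStrictFDerivAt_xi A (z := z) (ne_of_gt hz)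
  have h1 : ContDiffAt ℝ n (hs.localInverse (xi A) (jacEquiv (ne_of_gt hz)) z) (xi A z) :=
    ContDiffAt.to_localInverse (contDiff_xi A).contDiffAt hs.hasFDerivAt hn
  refine h1.congr_of_eventuallyEq ?_
  have h2 := hs.eventually_right_inverse
  have h3 := hs.localInverse_continuousAt
  have h4 : hs.localInverse (xi A) (jacEquiv (ne_of_gt hz)) z (xi A z) = z :=
    hs.localInverse_apply_image
  have h5 := h3.eventually_mem (by rw [h4]; exact (isOpen_posHalf _).mem_nhds hz)
  filter_upwards [h2, h5] with y hy hy'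
  conv_lhs => rw [← hy]
  exact xiInv_xi A hy'

/-! ### Quadrilaterals -/

/-- A quadrilateral that is nondegenerate and convex. -/
def IsConvexQuad (A : Fin 4 → E) : Prop := ∀ e, 0 < cornerDet A e

lemma jac_corners (A : Fin 4 → E) :
    cornerDet A 0 = jac (shape A) (pt 0 0) ∧ cornerDet A 1 = jac (shape A) (pt 1 0) ∧
    cornerDet A 2 = jac (shape A) (pt 1 1) ∧ cornerDet A 3 = jac (shape A) (pt 0 1) := by
  have e1 : (1 : Fin 4) + 1 = 2 := rfl
  have e2 : (1 : Fin 4) + 3 = 0 := rfl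
  have e3 : (2 : Fin 4) + 1 = 3 := rfl
  have e4 : (2 : Fin 4) + 3 = 1 := rfl
  have e5 : (3 : Fin 4) + 1 = 0 := rfl
  have e6 : (3 : Fin 4) + 3 = 2 := rfl
  simp only [cornerDet, jac_eq, shape, det2, e1, e2, e3, e4, e5, e6, zero_add, pt_zero, pt_one,
    PiLp.sub_apply, PiLp.add_apply]
  refine ⟨?_, ?_, ?_, ?_⟩ <;> ring

/-- A lower bound of the Jacobian determinant at the corners holds on the square. -/
lemma le_jac_of_corners {S : Shape} {μ : ℝ} (h0 : μ ≤ jac S (pt 0 0)) (h1 : μ ≤ jac S (pt 1 0))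
    (h2 : μ ≤ jac S (pt 1 1)) (h3 : μ ≤ jac S (pt 0 1)) {z : E} (hz : z ∈ csq) : μ ≤ jac S z := by
  obtain ⟨a, b, c, d⟩ := hz
  simp only [jac_eq, pt_zero, pt_one, mul_zero, mul_one, add_zero] at *
  set α := det2 S.1 S.2.2
  set β := det2 S.1 S.2.1
  set γ := det2 S.2.1 S.2.2
  -- An affine function on the square is the average of its corner values with bilinear weights.
  have : α + β * z 0 + γ * z 1 - μ = (1 - z 0) * (1 - z 1) * (α - μ) +
    z 0 * (1 - z 1) * (α + β - μ) + z 0 * z 1 * (α + β + γ - μ) +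
    (1 - z 0) * z 1 * (α + γ - μ) := by ring
  have p0 : 0 ≤ 1 - z 0 := by linarith
  have p1 : 0 ≤ 1 - z 1 := by linarith
  have q0 : 0 ≤ α - μ := by linarith
  have q1 : 0 ≤ α + β - μ := by linarith
  have q2 : 0 ≤ α + β + γ - μ := by linarith
  have q3 : 0 ≤ α + γ - μ := by linarith
  have : 0 ≤ α + β * z 0 + γ * z 1 - μ := by rw [this]; positivity
  linarith

lemma le_jac {A : Fin 4 → E} {μ : ℝ} (h : ∀ e, μ ≤ cornerDet A e) {z : E} (hz : z ∈ csq) :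
    μ ≤ jac (shape A) z := by
  obtain ⟨h0, h1, h2, h3⟩ := jac_corners A
  exact le_jac_of_corners (h0 ▸ h 0) (h1 ▸ h 1) (h2 ▸ h 2) (h3 ▸ h 3) hz

lemma IsConvexQuad.csq_subset {A : Fin 4 → E} (hA : IsConvexQuad A) : csq ⊆ posHalf (shape A) := by
  intro z hz
  obtain ⟨e, he⟩ := Finite.exists_min (cornerDet A)
  exact (hA e).trans_le (le_jac he hz)

lemma IsConvexQuad.sq_subset {A : Fin 4 → E} (hA : IsConvexQuad A) : sq ⊆ posHalf (shape A) :=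
  sq_subset_csq.trans hA.csq_subset

lemma quad_eq_image (A : Fin 4 → E) : quad A = xi A '' sq := by
  ext x; constructor
  · rintro ⟨s, hs, t, ht, rfl⟩
    exact ⟨pt s t, ⟨hs.1, hs.2, ht.1, ht.2⟩, rfl⟩
  · rintro ⟨z, ⟨h1, h2, h3, h4⟩, rfl⟩
    exact ⟨z 0, ⟨h1, h2⟩, z 1, ⟨h3, h4⟩, rfl⟩

lemma closure_quad (A : Fin 4 → E) : closure (quad A) = xi A '' csq := by
  have hc : Continuous (xi A) := (contDiff_xi A (n := 0)).continuous
  rw [quad_eq_image]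
  refine (closure_minimal (image_mono sq_subset_csq) (isCompact_csq.image hc).isClosed).antisymm ?_
  rw [← closure_sq]
  exact image_closure_subset_closure_image hc

lemma IsConvexQuad.isOpen_quad {A : Fin 4 → E} (hA : IsConvexQuad A) : IsOpen (quad A) := by
  rw [quad_eq_image]; exact isOpen_image_xi A isOpen_sq hA.sq_subset

lemma isCompact_closure_quad (A : Fin 4 → E) : IsCompact (closure (quad A)) := by
  rw [closure_quad]; exact isCompact_csq.image (contDiff_xi A (n := 0)).continuous

lemma isPreconnected_quad (A : Fin 4 → E) : IsPreconnected (quad A) := by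
  rw [quad_eq_image]
  exact convex_sq.isPreconnected.image _ (contDiff_xi A (n := 0)).continuous.continuousOn

lemma quad_nonempty (A : Fin 4 → E) : (quad A).Nonempty := by
  rw [quad_eq_image]; exact sq_nonempty.image _

/-- Makes the one-sided derivatives on a closed cell, which enter the jumps, equal to the
derivatives of any smooth extension. -/
lemma IsConvexQuad.uniqueDiffOn {A : Fin 4 → E} (hA : IsConvexQuad A) :
    UniqueDiffOn ℝ (closure (quad A)) := by
  rw [closure_quad]
  refine uniqueDiffOn_csq.image (f' := fun z => jacLin (shape A) z)
    (fun z _ => (hasFDerivAt_xi A z).hasFDerivWithinAt) fun z hz => ?_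
  exact (Function.RightInverse.surjective
    (jacLin_jacInv (ne_of_gt (hA.csq_subset hz)))).denseRange

/-- Change of variables from a cell to the reference square. -/
lemma IsConvexQuad.integral_quad {A : Fin 4 → E} (hA : IsConvexQuad A) (f : E → ℝ) :
    ∫ x in quad A, f x = ∫ z in sq, jac (shape A) z * f (xi A z) := by
  rw [quad_eq_image, integral_image_eq_integral_abs_det_fderiv_smul volume isOpen_sq.measurableSet
    (fun z _ => (hasFDerivAt_xi A z).hasFDerivWithinAt) ((xi_injOn A).mono hA.sq_subset)]
  refine setIntegral_congr_fun isOpen_sq.measurableSet fun z hz => ?_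
  simp only [det_jacLin, smul_eq_mul, abs_of_pos (hA.sq_subset hz).out]

/-- The boundary of the convex square is a null set, and differentiable maps of the plane preserve
null sets. -/
lemma volume_closure_quad_diff (A : Fin 4 → E) :
    volume (closure (quad A) \ quad A) = 0 := by
  have h1 : closure (quad A) \ quad A ⊆ xi A '' (csq \ sq) := by
    rw [closure_quad, quad_eq_image]
    rintro _ ⟨⟨z, hz, rfl⟩, h⟩
    exact ⟨z, ⟨hz, fun hz' => h ⟨z, hz', rfl⟩⟩, rfl⟩
  refine measure_mono_null h1 ?_
  refine addHaar_image_eq_zero_of_differentiableOn_of_addHaar_eq_zero volume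
    ((contDiff_xi A (n := 1)).differentiable (by simp)).differentiableOn ?_
  have h2 : csq \ sq ⊆ frontier sq := by
    rw [frontier, closure_sq, isOpen_sq.interior_eq]
  exact measure_mono_null h2 (convex_sq.addHaar_frontier volume)

/-! ### Polynomials on the reference square -/

/-- The functions on the plane that are polynomials of degree at most `k` in the first and at most
`l` in the second variable. -/
def Qsp (k l : ℕ) : Submodule ℝ (E → ℝ) :=
  Submodule.span ℝ {f | ∃ i ≤ k, ∃ j ≤ l, f = fun z => z 0 ^ i * z 1 ^ j}

lemma Qsp.monomial {k l i j : ℕ} (hi : i ≤ k) (hj : j ≤ l) :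
    (fun z : E => z 0 ^ i * z 1 ^ j) ∈ Qsp k l := Submodule.subset_span ⟨i, hi, j, hj, rfl⟩

lemma Qsp.mono {k l k' l' : ℕ} (hk : k ≤ k') (hl : l ≤ l') : Qsp k l ≤ Qsp k' l' :=
  Submodule.span_mono fun _ ⟨i, hi, j, hj, h⟩ => ⟨i, hi.trans hk, j, hj.trans hl, h⟩

lemma Qsp.const (a : ℝ) (k l : ℕ) : (fun _ : E => a) ∈ Qsp k l := by
  have := (Qsp k l).smul_mem a (Qsp.monomial (Nat.zero_le k) (Nat.zero_le l))
  simpa [Pi.smul_def] using this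

lemma Qsp.fst {k l : ℕ} (hk : 1 ≤ k) : (fun z : E => z 0) ∈ Qsp k l := by
  simpa using Qsp.monomial hk (Nat.zero_le l)

lemma Qsp.snd {k l : ℕ} (hl : 1 ≤ l) : (fun z : E => z 1) ∈ Qsp k l := by
  simpa using Qsp.monomial (Nat.zero_le k) hl

lemma Qsp.mul {k l k' l' : ℕ} {f g : E → ℝ} (hf : f ∈ Qsp k l) (hg : g ∈ Qsp k' l') :
    (fun z => f z * g z) ∈ Qsp (k + k') (l + l') := by
  change f * g ∈ _
  induction hf using Submodule.span_induction with
  | zero => simp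
  | add x y _ _ hx hy => rw [add_mul]; exact add_mem hx hy
  | smul a x _ hx => rw [smul_mul_assoc]; exact Submodule.smul_mem _ _ hx
  | mem x hx =>
    obtain ⟨i, hi, j, hj, rfl⟩ := hx
    induction hg using Submodule.span_induction with
    | zero => simp
    | add x y _ _ hx hy => rw [mul_add]; exact add_mem hx hy
    | smul a x _ hx => rw [mul_smul_comm]; exact Submodule.smul_mem _ _ hx
    | mem x hx =>
      obtain ⟨i', hi', j', hj', rfl⟩ := hx
      convert Qsp.monomial (Nat.add_le_add hi hi') (Nat.add_le_add hj hj') using 1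
      ext z; simp only [Pi.mul_apply]; ring

lemma Qsp.mul' {k l k' l' K L : ℕ} {f g : E → ℝ} (hf : f ∈ Qsp k l) (hg : g ∈ Qsp k' l')
    (hK : k + k' ≤ K) (hL : l + l' ≤ L) : (fun z => f z * g z) ∈ Qsp K L :=
  Qsp.mono hK hL (Qsp.mul hf hg)

lemma Qsp.add {k l : ℕ} {f g : E → ℝ} (hf : f ∈ Qsp k l) (hg : g ∈ Qsp k l) :
    (fun z => f z + g z) ∈ Qsp k l := add_mem hf hg

lemma Qsp.neg {k l : ℕ} {f : E → ℝ} (hf : f ∈ Qsp k l) :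
    (fun z => - f z) ∈ Qsp k l := neg_mem hf

lemma Qsp.sub {k l : ℕ} {f g : E → ℝ} (hf : f ∈ Qsp k l) (hg : g ∈ Qsp k l) :
    (fun z => f z - g z) ∈ Qsp k l := sub_mem hf hg

lemma Qsp.sum {k l : ℕ} {ι : Type*} (s : Finset ι) {f : ι → E → ℝ} (hf : ∀ i ∈ s, f i ∈ Qsp k l) :
    (fun z => ∑ i ∈ s, f i z) ∈ Qsp k l := by
  have := sum_mem hf
  convert this using 1
  ext z; simp

/-! ### Quarter turns of the reference square. -/

/-- The rotation of the reference square that moves every corner to the next one. -/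
def rot (z : E) : E := pt (1 - z 1) (z 0)

lemma rot_mem_csq {z : E} (hz : z ∈ csq) : rot z ∈ csq := by
  obtain ⟨h1, h2, h3, h4⟩ := hz
  exact ⟨by simp [rot]; linarith, by simp [rot]; linarith, by simp [rot]; linarith,
    by simp [rot]; linarith⟩

lemma rot_mem_sq {z : E} : rot z ∈ sq ↔ z ∈ sq := by
  simp only [sq, rot, mem_ofPred_eq, pt_zero, pt_one]
  constructor <;> rintro ⟨h1, h2, h3, h4⟩ <;> refine ⟨?_, ?_, ?_, ?_⟩ <;> linarith

lemma rot_rot_rot_rot (z : E) : rot (rot (rot (rot z))) = z := by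
  ext i; fin_cases i <;> simp [rot]

/-- A quarter turn exchanges the variables up to a reflection, hence it exchanges the two degrees.
-/
lemma Qsp.comp_rot {k l : ℕ} {f : E → ℝ} (hf : f ∈ Qsp k l) : (fun z => f (rot z)) ∈ Qsp l k := by
  induction hf using Submodule.span_induction with
  | zero => exact zero_mem (Qsp l k)
  | add x y _ _ hx hy => exact add_mem hx hy
  | smul a x _ hx => exact Submodule.smul_mem _ _ hx
  | mem x hx =>
    obtain ⟨i, hi, j, hj, rfl⟩ := hx
    have h1 : ∀ i, (fun z : E => (1 - z 1) ^ i) ∈ Qsp 0 i := by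
      intro i
      induction i with
      | zero => simpa using Qsp.const 1 0 0
      | succ i ih =>
        simp_rw [pow_succ]
        exact Qsp.mul' ih (Qsp.sub (Qsp.const 1 0 1) (Qsp.snd le_rfl)) le_rfl le_rfl
    have := Qsp.mul' (h1 i) (Qsp.monomial hj (Nat.zero_le 0)) (K := l) (L := k) (by simp)
      (by simpa using hi)
    simpa [rot] using this

lemma Qsp.comp_rot_iterate {k : ℕ} {f : E → ℝ} (hf : f ∈ Qsp k k) (n : ℕ) :
    (fun z => f (rot^[n] z)) ∈ Qsp k k := by
  induction n generalizing f with
  | zero => exact hf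
  | succ n ih =>
    have := ih (Qsp.comp_rot hf)
    simp_rw [Function.iterate_succ_apply']
    exact this

/-! ### Coefficients, values and gradients of polynomials. -/

/-- The coefficients of a polynomial of degree at most `r` in each of two variables. -/
abbrev Coef (r : ℕ) := Fin (r + 1) → Fin (r + 1) → ℝ

/-- The value of the polynomial with coefficients `c`. -/
def pev {r : ℕ} (c : Coef r) (z : E) : ℝ := ∑ i, ∑ j, c i j * (z 0 ^ (i : ℕ) * z 1 ^ (j : ℕ))

/-- The first partial derivative of a polynomial. -/
def pds {r : ℕ} (c : Coef r) (z : E) : ℝ :=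
  ∑ i, ∑ j, c i j * ((i : ℕ) * z 0 ^ ((i : ℕ) - 1) * z 1 ^ (j : ℕ))

/-- The second partial derivative of a polynomial. -/
def pdt {r : ℕ} (c : Coef r) (z : E) : ℝ :=
  ∑ i, ∑ j, c i j * (z 0 ^ (i : ℕ) * ((j : ℕ) * z 1 ^ ((j : ℕ) - 1)))

/-- The polynomial with the constant coefficient removed. -/
def red {r : ℕ} (c : Coef r) : Coef r := fun i j => if i = 0 ∧ j = 0 then 0 else c i j

lemma red_zero_zero {r : ℕ} (c : Coef r) : red c 0 0 = 0 := by simp [red]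

lemma pds_red {r : ℕ} (c : Coef r) (z : E) : pds (red c) z = pds c z := by
  refine Finset.sum_congr rfl fun i _ => Finset.sum_congr rfl fun j _ => ?_
  by_cases h : i = 0 ∧ j = 0
  · simp [h.1]
  · simp [red, h]

lemma pdt_red {r : ℕ} (c : Coef r) (z : E) : pdt (red c) z = pdt c z := by
  refine Finset.sum_congr rfl fun i _ => Finset.sum_congr rfl fun j _ => ?_
  by_cases h : i = 0 ∧ j = 0
  · simp [h.2]
  · simp [red, h]

lemma pev_mem_Qsp {r : ℕ} (c : Coef r) : pev c ∈ Qsp r r :=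
  Qsp.sum _ fun i _ => Qsp.sum _ fun j _ =>
    (Qsp r r).smul_mem (c i j) (Qsp.monomial (Nat.le_of_lt_succ i.2) (Nat.le_of_lt_succ j.2))

lemma pds_mem_Qsp {r : ℕ} (c : Coef r) : pds c ∈ Qsp (r - 1) r :=
  Qsp.sum _ fun i _ => Qsp.sum _ fun j _ => by
    have := (Qsp (r - 1) r).smul_mem (c i j * (i : ℕ))
      (Qsp.monomial (i := i - 1) (j := j) (k := r - 1) (by omega) (Nat.le_of_lt_succ j.2))
    convert this using 1
    ext z; simp; ring

lemma pdt_mem_Qsp {r : ℕ} (c : Coef r) : pdt c ∈ Qsp r (r - 1) :=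
  Qsp.sum _ fun i _ => Qsp.sum _ fun j _ => by
    have := (Qsp r (r - 1)).smul_mem (c i j * (j : ℕ))
      (Qsp.monomial (i := i) (j := j - 1) (l := r - 1) (Nat.le_of_lt_succ i.2) (by omega))
    convert this using 1
    ext z; simp; ring

lemma exists_coef {r : ℕ} {f : E → ℝ} (hf : f ∈ Qsp r r) : ∃ c : Coef r, f = pev c := by
  induction hf using Submodule.span_induction with
  | zero => exact ⟨0, by ext z; simp [pev]⟩
  | add x y _ _ hx hy =>
    obtain ⟨c, rfl⟩ := hx
    obtain ⟨d, rfl⟩ := hy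
    exact ⟨c + d, by ext z; simp [pev, add_mul, Finset.sum_add_distrib]⟩
  | smul a x _ hx =>
    obtain ⟨c, rfl⟩ := hx
    exact ⟨a • c, by ext z; simp [pev, Finset.mul_sum, mul_assoc]⟩
  | mem x hx =>
    obtain ⟨i, hi, j, hj, rfl⟩ := hx
    refine ⟨fun i' j' => if i' = ⟨i, by omega⟩ then (if j' = ⟨j, by omega⟩ then 1 else 0) else 0, ?_⟩
    ext z
    simp [pev, ite_mul]

lemma continuous_pev_uncurry {r : ℕ} : Continuous fun x : Coef r × E => pev x.1 x.2 := by
  unfold pev; fun_prop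
lemma continuous_pds_uncurry {r : ℕ} : Continuous fun x : Coef r × E => pds x.1 x.2 := by
  unfold pds; fun_prop
lemma continuous_pdt_uncurry {r : ℕ} : Continuous fun x : Coef r × E => pdt x.1 x.2 := by
  unfold pdt; fun_prop

lemma continuous_pev {r : ℕ} (c : Coef r) : Continuous (pev c) := by unfold pev; fun_prop
lemma continuous_pds {r : ℕ} (c : Coef r) : Continuous (pds c) := by unfold pds; fun_prop
lemma continuous_pdt {r : ℕ} (c : Coef r) : Continuous (pdt c) := by unfold pdt; fun_prop

lemma contDiff_pev {r : ℕ} (c : Coef r) {n : WithTop ℕ∞} : ContDiff ℝ n (pev c) := by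
  unfold pev; fun_prop

lemma pev_smul {r : ℕ} (a : ℝ) (c : Coef r) (z : E) : pev (a • c) z = a * pev c z := by
  simp [pev, Finset.mul_sum, mul_assoc]
lemma pds_smul {r : ℕ} (a : ℝ) (c : Coef r) (z : E) : pds (a • c) z = a * pds c z := by
  simp [pds, Finset.mul_sum, mul_assoc]
lemma pdt_smul {r : ℕ} (a : ℝ) (c : Coef r) (z : E) : pdt (a • c) z = a * pdt c z := by
  simp [pdt, Finset.mul_sum, mul_assoc]

/-- The derivative of a polynomial. -/
def pgrad {r : ℕ} (c : Coef r) (z : E) : E →L[ℝ] ℝ :=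
  pds c z • (EuclideanSpace.proj 0 : E →L[ℝ] ℝ) + pdt c z • (EuclideanSpace.proj 1 : E →L[ℝ] ℝ)

lemma pgrad_apply {r : ℕ} (c : Coef r) (z v : E) :
    pgrad c z v = pds c z * v 0 + pdt c z * v 1 := by simp [pgrad]

lemma hasFDerivAt_pev {r : ℕ} (c : Coef r) (z : E) : HasFDerivAt (pev c) (pgrad c z) z := by
  have cd (i : Fin 2) : HasFDerivAt (fun z : E => z i) (EuclideanSpace.proj i : E →L[ℝ] ℝ) z :=
    (EuclideanSpace.proj i : E →L[ℝ] ℝ).hasFDerivAt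
  have h : HasFDerivAt (pev c) _ z := HasFDerivAt.fun_sum (u := Finset.univ) fun i _ =>
    HasFDerivAt.fun_sum (u := Finset.univ) fun j _ =>
      (((cd 0).pow (i : ℕ)).mul ((cd 1).pow (j : ℕ))).const_mul (c i j)
  refine h.congr_fderiv ?_
  refine ContinuousLinearMap.ext fun v => ?_
  rw [pgrad_apply, pds, pdt]
  simp only [sum_apply, Finset.sum_mul, ← Finset.sum_add_distrib]
  refine Finset.sum_congr rfl fun i _ => Finset.sum_congr rfl fun j _ => ?_
  simp
  ring

/-! ### Conversion to multivariate polynomials -/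

lemma eval_mem_Qsp {r : ℕ} {q : MvPolynomial (Fin 2) ℝ}
    (hq : q ∈ MvPolynomial.restrictDegree (Fin 2) ℝ r) :
    (fun z : E => MvPolynomial.eval ![z 0, z 1] q) ∈ Qsp r r := by
  simp only [MvPolynomial.eval_eq', Fin.prod_univ_two, Matrix.cons_val_zero, Matrix.cons_val_one]
  refine Qsp.sum _ fun d hd => ?_
  rw [MvPolynomial.mem_restrictDegree] at hq
  exact (Qsp r r).smul_mem _ (Qsp.monomial (hq d hd 0) (hq d hd 1))

lemma exists_mvPolynomial {r : ℕ} {f : E → ℝ} (hf : f ∈ Qsp r r) :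
    ∃ q ∈ MvPolynomial.restrictDegree (Fin 2) ℝ r,
      ∀ z : E, f z = MvPolynomial.eval ![z 0, z 1] q := by
  induction hf using Submodule.span_induction with
  | zero => exact ⟨0, zero_mem _, by simp⟩
  | add x y _ _ hx hy =>
    obtain ⟨p, hp, h⟩ := hx
    obtain ⟨q, hq, h'⟩ := hy
    exact ⟨p + q, add_mem hp hq, by simp [h, h']⟩
  | smul a x _ hx =>
    obtain ⟨p, hp, h⟩ := hx
    exact ⟨a • p, Submodule.smul_mem _ _ hp, by simp [h, MvPolynomial.smul_eval]⟩
  | mem x hx =>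
    obtain ⟨i, hi, j, hj, rfl⟩ := hx
    refine ⟨MvPolynomial.monomial (Finsupp.single 0 i + Finsupp.single 1 j) 1, ?_, ?_⟩
    · rw [MvPolynomial.mem_restrictDegree]
      intro s hs k
      have := MvPolynomial.support_monomial_subset hs
      rw [Finset.mem_singleton] at this
      subst this
      fin_cases k <;> simp [hi, hj]
    · intro z
      rw [MvPolynomial.eval_monomial, Finsupp.prod_fintype _ _ (by simp)]
      simp [Fin.prod_univ_two]

/-! ### Compactness and norm equivalence -/

/-- A positive function that is homogeneous of degree two in a finite-dimensional variable is
bounded below by a multiple of the squared norm, uniformly over a compact set of parameters. -/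
lemma exists_pos_mul_norm_sq_le {X V : Type*} [TopologicalSpace X] [NormedAddCommGroup V]
    [NormedSpace ℝ V] [ProperSpace V] {k : Set X} (hk : IsCompact k) {W : Set V} (hW : IsClosed W)
    (hWs : ∀ v ∈ W, ∀ a : ℝ, a • v ∈ W) (Φ : X → V → ℝ)
    (hΦ : ContinuousOn (fun y : X × V => Φ y.1 y.2) (k ×ˢ univ))
    (hom : ∀ x ∈ k, ∀ v, ∀ a : ℝ, Φ x (a • v) = a ^ 2 * Φ x v)
    (hpos : ∀ x ∈ k, ∀ v ∈ W, v ≠ 0 → 0 < Φ x v) :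
    ∃ κ > 0, ∀ x ∈ k, ∀ v ∈ W, κ * ‖v‖ ^ 2 ≤ Φ x v := by
  -- By homogeneity only unit vectors in `W` matter; there the positive continuous function attains
  -- its minimum.
  set Z := k ×ˢ (Metric.sphere (0 : V) 1 ∩ W)
  have hZ : IsCompact Z := hk.prod ((isCompact_sphere 0 1).inter_right hW)
  have key : ∃ κ > 0, ∀ y ∈ Z, κ ≤ Φ y.1 y.2 := by
    rcases Z.eq_empty_or_nonempty with h | h
    · exact ⟨1, one_pos, by simp [h]⟩
    · obtain ⟨y, hy, hmin⟩ := hZ.exists_isMinOn h (hΦ.mono (prod_mono_right (subset_univ _)))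
      exact ⟨_, hpos y.1 hy.1 y.2 hy.2.2 (ne_zero_of_mem_unit_sphere ⟨y.2, hy.2.1⟩),
        fun y' hy' => hmin hy'⟩
  obtain ⟨κ, hκ, h⟩ := key
  refine ⟨κ, hκ, fun x hx v hv => ?_⟩
  by_cases h0 : v = 0
  · have := hom x hx 0 0
    simp [h0] at this ⊢; rw [this]
  have hn : 0 < ‖v‖ := norm_pos_iff.2 h0
  have h1 := h (x, ‖v‖⁻¹ • v) ⟨hx, by simp [norm_smul, hn.ne'], hWs v hv _⟩
  simp only [hom x hx] at h1
  rw [inv_pow, ← div_eq_inv_mul, le_div_iff₀ (by positivity)] at h1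
  exact h1

/-- A function that is homogeneous of degree two in a finite-dimensional variable is bounded above
by a multiple of the squared norm, uniformly over a compact set of parameters. -/
lemma exists_le_mul_norm_sq {X V : Type*} [TopologicalSpace X] [NormedAddCommGroup V]
    [NormedSpace ℝ V] [ProperSpace V] {k : Set X} (hk : IsCompact k) (Φ : X → V → ℝ)
    (hΦ : ContinuousOn (fun y : X × V => Φ y.1 y.2) (k ×ˢ univ))
    (hom : ∀ x ∈ k, ∀ v, ∀ a : ℝ, Φ x (a • v) = a ^ 2 * Φ x v) :
    ∃ C > 0, ∀ x ∈ k, ∀ v, Φ x v ≤ C * ‖v‖ ^ 2 := by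
  set Z := k ×ˢ (Metric.sphere (0 : V) 1)
  have hZ : IsCompact Z := hk.prod (isCompact_sphere 0 1)
  obtain ⟨C, hC⟩ := (hZ.image_of_continuousOn
    (hΦ.mono (prod_mono_right (subset_univ _)))).bddAbove
  refine ⟨max C 1, by positivity, fun x hx v => ?_⟩
  by_cases h0 : v = 0
  · have := hom x hx 0 0
    simp [h0] at this ⊢; rw [this]
  have hn : 0 < ‖v‖ := norm_pos_iff.2 h0
  have h1 : Φ x (‖v‖⁻¹ • v) ≤ C :=
    hC ⟨(x, ‖v‖⁻¹ • v), ⟨hx, by simp [norm_smul, hn.ne']⟩, rfl⟩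
  rw [hom x hx, inv_pow, ← div_eq_inv_mul, div_le_iff₀ (by positivity)] at h1
  exact h1.trans (mul_le_mul_of_nonneg_right (le_max_left _ _) (by positivity))

lemma coef_eq_zero_of_forall {r : ℕ} {a : Fin (r + 1) → ℝ}
    (h : ∀ s ∈ Ioo (0 : ℝ) 1, ∑ i, a i * s ^ (i : ℕ) = 0) : a = 0 := by
  set p : Polynomial ℝ := ∑ i : Fin (r + 1), Polynomial.monomial (i : ℕ) (a i) with hp
  have h0 : p = 0 := by
    refine Polynomial.eq_zero_of_infinite_isRoot p ((Ioo_infinite one_pos).mono fun s hs => ?_)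
    simp [hp, Polynomial.IsRoot, Polynomial.eval_finsetSum, h s hs]
  ext i
  have := congrArg (fun q => q.coeff i) h0
  simpa [hp, Polynomial.finsetSum_coeff, Polynomial.coeff_monomial, Fin.val_inj] using this

lemma eq_zero_of_pev {r : ℕ} {c : Coef r} (h : ∀ z ∈ sq, pev c z = 0) : c = 0 := by
  have h1 : ∀ t ∈ Ioo (0 : ℝ) 1, (fun i => ∑ j, c i j * t ^ (j : ℕ)) = 0 := by
    intro t ht
    refine coef_eq_zero_of_forall fun s hs => ?_
    have := h (pt s t) ⟨hs.1, hs.2, ht.1, ht.2⟩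
    rw [← this, pev]
    refine Finset.sum_congr rfl fun i _ => ?_
    rw [Finset.sum_mul]
    exact Finset.sum_congr rfl fun j _ => by simp; ring
  ext i : 1
  exact coef_eq_zero_of_forall fun t ht => congrFun (h1 t ht) i

lemma setIntegral_eq_zero_imp {O : Set E} (hO : IsOpen O) {f : E → ℝ} (hf : ContinuousOn f O)
    (hi : IntegrableOn f O) (h0 : ∀ z ∈ O, 0 ≤ f z) (h : ∫ z in O, f z = 0) : ∀ z ∈ O, f z = 0 := by
  have h1 : f =ᵐ[volume.restrict O] 0 :=
    (integral_eq_zero_iff_of_nonneg_ae (ae_restrict_of_forall_mem hO.measurableSet h0) hi).1 h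
  have := Measure.eqOn_open_of_ae_eq h1 hO hf continuousOn_const
  exact fun z hz => this hz

lemma integrableOn_sq {f : E → ℝ} (hf : ContinuousOn f csq) : IntegrableOn f sq :=
  (hf.integrableOn_compact isCompact_csq).mono_set sq_subset_csq

lemma volume_sq_lt_top : volume sq < ⊤ :=
  (measure_mono sq_subset_csq).trans_lt isCompact_csq.measure_lt_top

lemma continuous_integral_sq {X : Type*} [TopologicalSpace X] [FirstCountableTopology X]
    [LocallyCompactSpace X] {F : X → E → ℝ} (hF : Continuous (Function.uncurry F)) :
    Continuous fun x => ∫ z in sq, F x z := by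
  -- Continuity of parameter integrals is available over compact sets; the boundary of the square is
  -- a null set.
  have h : (fun x => ∫ z in sq, F x z) = fun x => ∫ z in csq, F x z := by
    ext x
    refine (setIntegral_congr_set ?_)
    have h2 : csq \ sq ⊆ frontier sq := by rw [frontier, closure_sq, isOpen_sq.interior_eq]
    have h3 := measure_mono_null h2 (convex_sq.addHaar_frontier volume)
    exact (LE.le.eventuallyLE sq_subset_csq).antisymm
      (ae_le_set.2 h3)
  rw [h]
  exact continuous_parametric_integral_of_continuous hF isCompact_csq

/-- The polynomial is constant on the connected square; subtracting this constant from the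
coefficient at `(0, 0)` leaves the zero polynomial. -/
lemma red_eq_zero_of_grad {r : ℕ} {c : Coef r} (h : ∀ z ∈ sq, pds c z = 0 ∧ pdt c z = 0) :
    red c = 0 := by
  have h1 : ∀ z ∈ sq, pev c z = pev c (pt (1 / 2) (1 / 2)) := fun z hz =>
    isOpen_sq.is_const_of_fderiv_eq_zero (𝕜 := ℝ) convex_sq.isPreconnected
      (fun z _ => (hasFDerivAt_pev c z).differentiableAt.differentiableWithinAt)
      (fun z hz => by
        rw [(hasFDerivAt_pev c z).fderiv]
        refine ContinuousLinearMap.ext fun v => ?_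
        simp [pgrad_apply, h z hz]) hz (by norm_num [sq])
  set k := pev c (pt (1 / 2) (1 / 2))
  have h2 : (fun i j => c i j - if i = 0 ∧ j = 0 then k else 0 : Coef r) = 0 := by
    refine eq_zero_of_pev fun z hz => ?_
    have : pev (fun i j => c i j - if i = 0 ∧ j = 0 then k else 0 : Coef r) z = pev c z - k := by
      simp only [pev, sub_mul, Finset.sum_sub_distrib]
      congr 1
      simp [ite_mul, ite_and]
    rw [this, h1 z hz, sub_self]
  ext i j
  have := congrFun (congrFun h2 i) j
  by_cases hij : i = 0 ∧ j = 0
  · simp [red, hij]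
  · simpa [red, hij] using this

/-- The gradient controls the coefficients up to the constant one. -/
lemma exists_red_le_integral (r : ℕ) : ∃ κ > 0, ∀ c : Coef r,
    κ * ‖red c‖ ^ 2 ≤ ∫ z in sq, (pds c z ^ 2 + pdt c z ^ 2) := by
  obtain ⟨κ, hκ, h⟩ := exists_pos_mul_norm_sq_le (X := Unit) (V := Coef r) (k := univ)
    -- The coefficients with `c 0 0 = 0` represent the polynomials modulo constants, on which the
    -- Dirichlet integral is definite.
    isCompact_univ (W := {c | c 0 0 = 0})
    (isClosed_eq (by fun_prop) continuous_const) (by intro v hv a; simp [hv.out])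
    (fun _ c => ∫ z in sq, (pds c z ^ 2 + pdt c z ^ 2))
    (Continuous.continuousOn (by
      have h1 := continuous_pds_uncurry (r := r)
      have h2 := continuous_pdt_uncurry (r := r)
      have h3 : Continuous fun c : Coef r => ∫ z in sq, (pds c z ^ 2 + pdt c z ^ 2) :=
        continuous_integral_sq ((h1.pow 2).add (h2.pow 2))
      exact h3.comp continuous_snd))
    (by
      intro _ _ c a
      rw [← integral_const_mul]
      congr 1; ext z
      rw [pds_smul, pdt_smul]; ring)
    (by
      intro _ _ c hc hc0
      have hcont : Continuous fun z => pds c z ^ 2 + pdt c z ^ 2 :=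
        ((continuous_pds c).pow 2).add ((continuous_pdt c).pow 2)
      have hnn : ∀ z, 0 ≤ pds c z ^ 2 + pdt c z ^ 2 := fun z => by positivity
      refine lt_of_le_of_ne (integral_nonneg hnn) fun h0 => hc0 ?_
      have := setIntegral_eq_zero_imp isOpen_sq hcont.continuousOn
        (integrableOn_sq hcont.continuousOn) (fun z _ => hnn z) h0.symm
      have h2 : red c = 0 := red_eq_zero_of_grad fun z hz => by
        have := this z hz
        constructor <;> nlinarith [sq_nonneg (pds c z), sq_nonneg (pdt c z)]
      rw [← h2]
      ext i j
      by_cases hij : i = 0 ∧ j = 0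
      · simp [red, hij, hc.out]
      · simp [red, hij])
  refine ⟨κ, hκ, fun c => ?_⟩
  simpa only [pds_red, pdt_red] using h () trivial (red c) (red_zero_zero c)

lemma exists_grad_le (r : ℕ) : ∃ C > 0, ∀ c : Coef r, ∀ z ∈ csq,
    pds c z ^ 2 + pdt c z ^ 2 ≤ C * ‖red c‖ ^ 2 := by
  obtain ⟨C, hC, h⟩ := exists_le_mul_norm_sq (V := Coef r) isCompact_csq
    (fun z c => pds c z ^ 2 + pdt c z ^ 2)
    (Continuous.continuousOn (((continuous_pds_uncurry.comp continuous_swap).pow 2).add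
      ((continuous_pdt_uncurry.comp continuous_swap).pow 2)))
    (by intro z _ c a; simp only [pds_smul, pdt_smul]; ring)
  exact ⟨C, hC, fun c z hz => by simpa only [pds_red, pdt_red] using h z hz (red c)⟩

/-- An inverse estimate for polynomials. -/
lemma exists_grad_le_of_abs_le (r : ℕ) : ∃ C > 0, ∀ c : Coef r, ∀ B : ℝ,
    (∀ z ∈ csq, |pev c z| ≤ B) → ∀ z ∈ csq, pds c z ^ 2 + pdt c z ^ 2 ≤ C * B ^ 2 := by
  obtain ⟨κ, hκ, h⟩ := exists_pos_mul_norm_sq_le (X := Unit) (V := Coef r) (k := univ)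
    isCompact_univ (W := univ) isClosed_univ (by simp) (fun _ c => ∫ z in sq, pev c z ^ 2)
    (Continuous.continuousOn (by
      have h3 : Continuous fun c : Coef r => ∫ z in sq, pev c z ^ 2 :=
        continuous_integral_sq ((continuous_pev_uncurry (r := r)).pow 2)
      exact h3.comp continuous_snd))
    (by
      intro _ _ c a
      rw [← integral_const_mul]
      congr 1; ext z
      rw [pev_smul]; ring)
    (by
      intro _ _ c _ hc0
      have hcont : Continuous fun z => pev c z ^ 2 := (continuous_pev c).pow 2
      refine lt_of_le_of_ne (integral_nonneg fun z => by positivity) fun h0 => hc0 ?_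
      have := setIntegral_eq_zero_imp isOpen_sq hcont.continuousOn
        (integrableOn_sq hcont.continuousOn) (fun z _ => by positivity) h0.symm
      exact eq_zero_of_pev fun z hz => by simpa using this z hz)
  obtain ⟨C, hC, h'⟩ := exists_grad_le r
  -- The bound `B` controls the `L²` norm, this controls all coefficients, and these control the
  -- gradient. Adding `1` to the area is only a cheap way to keep the constant positive.
  refine ⟨C * (κ⁻¹ * (volume.real sq + 1)), by positivity, fun c B hB z hz => (h' c z hz).trans ?_⟩
  have h1 : ∫ z in sq, pev c z ^ 2 ≤ B ^ 2 * volume.real sq := by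
    have hcont : Continuous fun z => pev c z ^ 2 := (continuous_pev c).pow 2
    calc ∫ z in sq, pev c z ^ 2 ≤ ∫ z in sq, B ^ 2 := by
          refine setIntegral_mono_on (integrableOn_sq hcont.continuousOn)
            (integrableOn_const volume_sq_lt_top.ne) isOpen_sq.measurableSet fun z hz => ?_
          rw [← sq_abs]
          exact pow_le_pow_left₀ (abs_nonneg _) (hB z (sq_subset_csq hz)) 2
      _ = B ^ 2 * volume.real sq := by simp [mul_comm]
  have h2 : ‖red c‖ ≤ ‖c‖ := by
    refine (pi_norm_le_iff_of_nonneg (norm_nonneg _)).2 fun i =>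
      (pi_norm_le_iff_of_nonneg (norm_nonneg _)).2 fun j => ?_
    by_cases hij : i = 0 ∧ j = 0
    · simp [red, hij]
    · simp only [red, hij, if_false]
      exact (norm_le_pi_norm (c i) j).trans (norm_le_pi_norm c i)
  have h3 := (h () trivial c trivial).trans h1
  have h4 : ‖red c‖ ^ 2 ≤ κ⁻¹ * (volume.real sq + 1) * B ^ 2 := by
    have : ‖c‖ ^ 2 ≤ κ⁻¹ * (B ^ 2 * volume.real sq) := by
      rw [← div_eq_inv_mul, le_div_iff₀ hκ]; linarith
    calc ‖red c‖ ^ 2 ≤ ‖c‖ ^ 2 := pow_le_pow_left₀ (norm_nonneg _) h2 2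
      _ ≤ κ⁻¹ * (B ^ 2 * volume.real sq) := this
      _ ≤ κ⁻¹ * (volume.real sq + 1) * B ^ 2 := by
        have : 0 ≤ κ⁻¹ * B ^ 2 := by positivity
        nlinarith
  calc C * ‖red c‖ ^ 2 ≤ C * (κ⁻¹ * (volume.real sq + 1) * B ^ 2) := by gcongr
    _ = _ := by ring

/-! ### Integrals over the plane -/

lemma measurePreserving_pt : MeasurePreserving (fun p : ℝ × ℝ => pt p.1 p.2) := by
  have h := (PiLp.volume_preserving_toLp (Fin 2)).comp (volume_preserving_finTwoArrow ℝ).symm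
  have e : (fun p : ℝ × ℝ => pt p.1 p.2) =
      WithLp.toLp 2 ∘ (MeasurableEquiv.finTwoArrow (α := ℝ)).symm := by
    ext p i; fin_cases i <;> rfl
  rw [e]; exact h

lemma measurableEmbedding_pt : MeasurableEmbedding (fun p : ℝ × ℝ => pt p.1 p.2) := by
  refine (Topology.IsClosedEmbedding.measurableEmbedding ?_)
  refine Topology.IsClosedEmbedding.of_continuous_injective_isClosedMap ?_ ?_ ?_
  · unfold pt; fun_prop
  · intro p q h
    have h0 := congrArg (fun z : E => z 0) h
    have h1 := congrArg (fun z : E => z 1) h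
    exact Prod.ext h0 h1
  · refine IsClosedMap.of_inverse (f' := fun z : E => (z 0, z 1)) ?_ ?_ ?_
    · fun_prop
    · intro z; exact pt_eta z
    · intro p; rfl

lemma pt_preimage_sq : (fun p : ℝ × ℝ => pt p.1 p.2) ⁻¹' sq = Ioo 0 1 ×ˢ Ioo 0 1 := by
  ext p; simp [sq, and_assoc]

lemma setIntegral_sq_mul (f g : ℝ → ℝ) :
    ∫ z in sq, f (z 0) * g (z 1) = (∫ x in (0 : ℝ)..1, f x) * ∫ x in (0 : ℝ)..1, g x := by
  rw [← measurePreserving_pt.setIntegral_preimage_emb measurableEmbedding_pt, pt_preimage_sq]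
  simp only [pt_zero, pt_one]
  rw [Measure.volume_eq_prod, setIntegral_prod_mul, intervalIntegral.integral_of_le zero_le_one,
    intervalIntegral.integral_of_le zero_le_one, integral_Ioc_eq_integral_Ioo,
    integral_Ioc_eq_integral_Ioo]

/-! ### Legendre polynomials -/

open Polynomial in
/-- The polynomial `(x (1 - x)) ^ m`. -/
def rodrigues (m : ℕ) : ℝ[X] := X ^ m * (1 - X) ^ m

open Polynomial in
/-- The derivative of the Legendre polynomial of degree `m` on the unit interval (up to a factor),
which is an orthogonal polynomial of degree `m - 1` for the weight `x (1 - x)`. -/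
def gegenbauer (m : ℕ) : ℝ[X] := derivative^[m + 1] (rodrigues m)

open Polynomial in
/-- The integral of a polynomial over the unit interval. -/
def pint (p : ℝ[X]) : ℝ := ∫ x in (0 : ℝ)..1, p.eval x

open Polynomial in
/-- The weight `x (1 - x)`. -/
def om : ℝ[X] := X * (1 - X)

section Polynomials
open Polynomial

lemma intervalIntegrable_eval (p : ℝ[X]) (a b : ℝ) :
    IntervalIntegrable (fun x => p.eval x) volume a b := p.continuous.intervalIntegrable _ _

lemma pint_add (p q : ℝ[X]) : pint (p + q) = pint p + pint q := by
  simp only [pint, eval_add]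
  exact intervalIntegral.integral_add (intervalIntegrable_eval _ _ _) (intervalIntegrable_eval _ _ _)

lemma pint_neg (p : ℝ[X]) : pint (-p) = -pint p := by
  simp [pint]

lemma pint_sub (p q : ℝ[X]) : pint (p - q) = pint p - pint q := by
  rw [sub_eq_add_neg, pint_add, pint_neg, sub_eq_add_neg]

lemma pint_C_mul (a : ℝ) (p : ℝ[X]) : pint (C a * p) = a * pint p := by
  simp [pint]

lemma pint_sum {ι : Type*} (s : Finset ι) (p : ι → ℝ[X]) :
    pint (∑ i ∈ s, p i) = ∑ i ∈ s, pint (p i) := by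
  classical
  induction s using Finset.induction_on with
  | empty => simp [pint]
  | insert i s hi ih => rw [Finset.sum_insert hi, Finset.sum_insert hi, pint_add, ih]

lemma pint_derivative (p : ℝ[X]) : pint (derivative p) = p.eval 1 - p.eval 0 :=
  intervalIntegral.integral_eq_sub_of_hasDerivAt (fun x _ => p.hasDerivAt x)
    (intervalIntegrable_eval _ _ _)

lemma pint_pos_or_eq_zero {p q : ℝ[X]} (hp : ∀ x ∈ Ioo (0 : ℝ) 1, 0 < p.eval x) :
    0 ≤ pint (p * q ^ 2) ∧ (pint (p * q ^ 2) = 0 → q = 0) := by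
  have hnn : ∀ x ∈ Ioo (0 : ℝ) 1, 0 ≤ (p * q ^ 2).eval x := fun x hx => by
    simp only [eval_mul, eval_pow]; exact mul_nonneg (hp x hx).le (sq_nonneg _)
  have hi : IntegrableOn (fun x => (p * q ^ 2).eval x) (Ioo 0 1) :=
    ((p * q ^ 2).continuous.continuousOn.integrableOn_compact isCompact_Icc).mono_set
      Ioo_subset_Icc_self
  have e : pint (p * q ^ 2) = ∫ x in Ioo (0 : ℝ) 1, (p * q ^ 2).eval x := by
    rw [pint, intervalIntegral.integral_of_le zero_le_one, integral_Ioc_eq_integral_Ioo]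
  constructor
  · rw [e]; exact setIntegral_nonneg measurableSet_Ioo hnn
  · intro h
    rw [e] at h
    have h1 := (integral_eq_zero_iff_of_nonneg_ae
      (ae_restrict_of_forall_mem measurableSet_Ioo hnn) hi).1 h
    have h2 := Measure.eqOn_open_of_ae_eq h1 isOpen_Ioo
      (p * q ^ 2).continuous.continuousOn continuousOn_const
    refine eq_zero_of_infinite_isRoot q ((Ioo_infinite (zero_lt_one' ℝ)).mono fun x hx => ?_)
    have h3 : p.eval x * q.eval x ^ 2 = 0 := by
      have := h2 hx
      simpa only [eval_mul, eval_pow, Pi.zero_apply] using this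
    have := (mul_eq_zero.1 h3).resolve_left (hp x hx).ne'
    simpa using this

lemma om_pos : ∀ x ∈ Ioo (0 : ℝ) 1, 0 < om.eval x := fun x hx => by
  simp only [om, eval_mul, eval_X, eval_sub, eval_one]
  exact mul_pos hx.1 (by linarith [hx.2])

lemma eval_zero_iterate_derivative (p : ℝ[X]) (k : ℕ) :
    (derivative^[k] p).eval 0 = k.factorial * p.coeff k := by
  rw [← coeff_zero_eq_eval_zero, coeff_iterate_derivative]
  simp [Nat.descFactorial_self]

lemma rodrigues_eval_zero {m k : ℕ} (hk : k < m) : (derivative^[k] (rodrigues m)).eval 0 = 0 := by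
  rw [eval_zero_iterate_derivative, rodrigues, coeff_X_pow_mul', if_neg (by omega), mul_zero]

lemma rodrigues_eval_one {m k : ℕ} (hk : k < m) : (derivative^[k] (rodrigues m)).eval 1 = 0 := by
  have h := iterate_derivative_comp_one_sub_X (rodrigues m) k
  have h1 : (rodrigues m).comp (1 - X) = rodrigues m := by
    simp only [rodrigues, mul_comp, pow_comp, X_comp, sub_comp, one_comp, sub_sub_cancel]
    rw [mul_comm]
  rw [h1] at h
  have := congrArg (eval 1) h
  simp only [eval_mul, eval_comp, eval_sub, eval_one, eval_X, sub_self,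
    rodrigues_eval_zero hk, mul_zero] at this
  exact this

/-- Repeated integration by parts: the boundary terms vanish since `x ^ m (1 - x) ^ m` has zeros of
order `m` at both ends, and the low degree factor is differentiated away. -/
lemma pint_mul_rodrigues {m : ℕ} : ∀ (n : ℕ), n ≤ m → ∀ g : ℝ[X], g.natDegree < n →
    pint (g * derivative^[n] (rodrigues m)) = 0
  | 0, _, _, hg => absurd hg (Nat.not_lt_zero _)
  | n + 1, hn, g, hg => by
    have h := pint_derivative (g * derivative^[n] (rodrigues m))
    rw [derivative_mul, pint_add, eval_mul, eval_mul, rodrigues_eval_one (by omega),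
      rodrigues_eval_zero (by omega), mul_zero, mul_zero, sub_zero] at h
    rw [Function.iterate_succ_apply']
    have h2 : pint (derivative g * derivative^[n] (rodrigues m)) = 0 := by
      by_cases h0 : derivative g = 0
      · simp [h0, pint]
      · refine pint_mul_rodrigues n (by omega) _ ?_
        have h3 : g.natDegree ≠ 0 := fun h => h0 (by
          rw [natDegree_eq_zero] at h; obtain ⟨a, rfl⟩ := h; simp)
        have := natDegree_derivative_lt h3
        omega
    linarith

/-- The weight kills the boundary terms of one integration by parts. This leaves the derivative of
`om * q`, of degree at most `r`, against the Legendre polynomial of degree `r + 1`. -/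
lemma gegenbauer_orthogonal {r : ℕ} {q : ℝ[X]} (hq : q.natDegree < r) :
    pint (om * q * gegenbauer (r + 1)) = 0 := by
  have h := pint_derivative (om * q * derivative^[r + 1] (rodrigues (r + 1)))
  have e0 : om.eval 0 = 0 := by simp [om]
  have e1 : om.eval 1 = 0 := by simp [om]
  rw [derivative_mul, pint_add, eval_mul, eval_mul, eval_mul, eval_mul, e0, e1] at h
  rw [gegenbauer, Function.iterate_succ_apply']
  have h2 : pint (derivative (om * q) * derivative^[r + 1] (rodrigues (r + 1))) = 0 := by
    refine pint_mul_rodrigues _ le_rfl _ ?_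
    have h3 : om.natDegree ≤ 2 := by
      unfold om; compute_degree
    have h4 := natDegree_derivative_le (om * q)
    have h5 := natDegree_mul_le (p := om) (q := q)
    omega
  rw [h2] at h
  simpa using h

lemma taylor_derivative_iterate (a : ℝ) (p : ℝ[X]) (n : ℕ) :
    taylor a (derivative^[n] p) = derivative^[n] (taylor a p) := by
  induction n generalizing p with
  | zero => rfl
  | succ n ih =>
    rw [Function.iterate_succ_apply, ih, Function.iterate_succ_apply]
    congr 1
    simp [taylor_apply, derivative_comp]

/-- Products of linear factors whose constant terms have the same sign have no zero coefficient. -/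
lemma coeff_mul_X_add_C {ε a : ℝ} (hε : ε ^ 2 = 1) (ha : 0 < ε * a) {n : ℕ} {f : ℝ[X]}
    (hn : f.natDegree ≤ n) (hf : ∀ j ≤ n, 0 < ε ^ (n + j) * f.coeff j) :
    (f * (X + C a)).natDegree ≤ n + 1 ∧
      ∀ j ≤ n + 1, 0 < ε ^ (n + 1 + j) * (f * (X + C a)).coeff j := by
  refine ⟨?_, ?_⟩
  · refine natDegree_mul_le.trans (Nat.add_le_add hn ?_)
    compute_degree
  · intro j hj
    rw [mul_add, coeff_add, coeff_mul_C]
    -- For `ε = 1` all coefficients are positive, for `ε = -1` their signs alternate. In both cases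
    -- the two contributions to a new coefficient have the same sign and cannot cancel.
    have key : ∀ j ≤ n, 0 < ε ^ (n + 1 + j) * (f.coeff j * a) := fun j hj => by
      have := mul_pos (hf j hj) ha
      calc 0 < _ := this
        _ = _ := by ring
    rcases j with _ | j
    · simpa using key 0 (Nat.zero_le _)
    · rw [coeff_mul_X]
      have e : ε ^ (n + 1 + (j + 1)) * f.coeff j = ε ^ (n + j) * f.coeff j := by
        rw [show n + 1 + (j + 1) = n + j + 2 by ring, pow_add, hε, mul_one]
      rw [mul_add, e]
      have h1 := hf j (by omega)
      by_cases h : j + 1 ≤ n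
      · exact add_pos h1 (key _ h)
      · rw [coeff_eq_zero_of_natDegree_lt (n := j + 1) (by omega)]
        simpa using h1

/-- All zeros lie in `{0, 1}`. Seen from a point `a` outside the unit interval they lie on one side,
so after the shift all linear factors have constant terms of one sign and `coeff_mul_X_add_C`
applies. -/
lemma taylor_rodrigues_coeff_ne {m : ℕ} {a : ℝ} (ha : a < 0 ∨ 1 < a) {j : ℕ} (hj : j ≤ 2 * m) :
    (taylor a (rodrigues m)).coeff j ≠ 0 := by
  obtain ⟨ε, hε, h1, h2⟩ : ∃ ε : ℝ, ε ^ 2 = 1 ∧ 0 < ε * a ∧ 0 < ε * (a - 1) := by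
    rcases ha with h | h
    · exact ⟨-1, by norm_num, by linarith, by linarith⟩
    · exact ⟨1, by norm_num, by linarith, by linarith⟩
  have key : ∀ m : ℕ, ((X + C a) ^ m * (X + C (a - 1)) ^ m : ℝ[X]).natDegree ≤ 2 * m ∧
      ∀ j ≤ 2 * m, 0 < ε ^ (2 * m + j) * ((X + C a) ^ m * (X + C (a - 1)) ^ m : ℝ[X]).coeff j := by
    intro m
    induction m with
    | zero => simp
    | succ m ih =>
      have h3 := coeff_mul_X_add_C hε h1 ih.1 ih.2
      have h4 := coeff_mul_X_add_C hε h2 h3.1 h3.2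
      convert h4 using 3 <;> ring_nf
  have e : taylor a (rodrigues m) = C ((-1) ^ m) * ((X + C a) ^ m * (X + C (a - 1)) ^ m) := by
    rw [rodrigues, taylor_mul, taylor_pow, taylor_pow, taylor_X, map_sub, taylor_X, taylor_one]
    rw [show (C 1 - (X + C a) : ℝ[X]) = C (-1) * (X + C (a - 1)) by
      simp only [map_sub, map_neg, map_one]; ring]
    rw [mul_pow, ← C_pow]; ring
  rw [e, coeff_C_mul]
  have := (key m).2 j hj
  exact mul_ne_zero (by simp) (right_ne_zero_of_mul this.ne')

/-- Differentiation only shifts the Taylor coefficients and multiplies them by nonzero factors. -/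
lemma taylor_gegenbauer_coeff_ne {r : ℕ} {a : ℝ} (ha : a < 0 ∨ 1 < a) {k : ℕ} (hk : k ≤ r) :
    (taylor a (gegenbauer (r + 1))).coeff k ≠ 0 := by
  rw [gegenbauer, taylor_derivative_iterate, coeff_iterate_derivative, nsmul_eq_mul]
  refine mul_ne_zero ?_ (taylor_rodrigues_coeff_ne ha (by omega))
  rw [Nat.cast_ne_zero, ne_eq, Nat.descFactorial_eq_zero_iff_lt]
  omega

lemma natDegree_gegenbauer_le (r : ℕ) : (gegenbauer (r + 1)).natDegree ≤ r := by
  have h1 : (rodrigues (r + 1)).natDegree ≤ 2 * (r + 1) := by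
    unfold rodrigues
    refine natDegree_mul_le.trans ?_
    have h2 : ((1 : ℝ[X]) - X).natDegree ≤ 1 := by compute_degree
    have h3 := natDegree_pow_le_of_le (r + 1) h2
    rw [natDegree_X_pow]; omega
  have := natDegree_iterate_derivative (rodrigues (r + 1)) (r + 1 + 1)
  rw [gegenbauer]; omega

/-- A Taylor shift preserves the degree, so the top coefficient can be tested at any point outside
the unit interval, here `2`. -/
lemma gegenbauer_coeff_ne (r : ℕ) : (gegenbauer (r + 1)).coeff r ≠ 0 := by
  intro h
  have h1 := natDegree_gegenbauer_le r
  have h2 := taylor_gegenbauer_coeff_ne (r := r) (a := 2) (Or.inr (by norm_num)) le_rfl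
  refine h2 ?_
  by_cases h0 : r = 0
  · subst h0
    have : gegenbauer 1 = C 0 := by
      rw [eq_C_of_natDegree_le_zero h1, h]
    simp only [zero_add, this]; simp
  · refine coeff_eq_zero_of_natDegree_lt ?_
    rw [natDegree_taylor]
    refine lt_of_le_of_ne h1 fun h3 => ?_
    have h4 : (gegenbauer (r + 1)).leadingCoeff = 0 := by rw [leadingCoeff, h3, h]
    rw [leadingCoeff_eq_zero] at h4
    rw [h4] at h3
    simp at h3; exact h0 h3.symm

lemma coeff_rodrigues_self (m : ℕ) : (rodrigues m).coeff m = 1 := by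
  rw [rodrigues, coeff_X_pow_mul', if_pos le_rfl, Nat.sub_self, coeff_zero_eq_eval_zero]; simp

lemma coeff_rodrigues_succ (m : ℕ) : (rodrigues m).coeff (m + 1) = -m := by
  rw [rodrigues, coeff_X_pow_mul', if_pos (by omega), Nat.add_sub_cancel_left]
  have := eval_zero_iterate_derivative ((1 - X) ^ m : ℝ[X]) 1
  simp [derivative_pow] at this
  rw [← this]

/-- A one-point quadrature formula for multiples of the orthogonal polynomial. -/
lemma pint_one_sub_mul_gegenbauer (r : ℕ) : ∃ κ > 0,
    pint ((1 - X) * gegenbauer (r + 1)) = κ * (gegenbauer (r + 1)).eval 0 := by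
  have h := pint_derivative ((1 - X) * derivative^[r + 1] (rodrigues (r + 1)))
  rw [derivative_mul, pint_add, ← Function.iterate_succ_apply' derivative] at h
  have h1 : pint (derivative (1 - X) * derivative^[r + 1] (rodrigues (r + 1))) = 0 := by
    refine pint_mul_rodrigues _ le_rfl _ ?_
    simp
  rw [h1, zero_add] at h
  have e1 := eval_zero_iterate_derivative (rodrigues (r + 1)) (r + 1)
  have e2 := eval_zero_iterate_derivative (rodrigues (r + 1)) (r + 1 + 1)
  rw [coeff_rodrigues_self] at e1
  rw [coeff_rodrigues_succ] at e2
  -- Integration by parts leaves `-(r + 1)!`, the negative of the derivative of order `r + 1` at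
  -- `0`, while the Gegenbauer polynomial has the value `-(r + 1) (r + 2)!` at `0`. The common sign
  -- makes the weight positive.
  refine ⟨1 / ((r + 1) * (r + 2)), by positivity, ?_⟩
  rw [gegenbauer, e2]
  refine h.trans ?_
  simp only [eval_mul, e1]
  simp only [Nat.factorial_succ]
  push_cast
  simp
  field_simp
  ring

lemma gegenbauer_eval_zero_ne (r : ℕ) : (gegenbauer (r + 1)).eval 0 ≠ 0 := by
  rw [gegenbauer, eval_zero_iterate_derivative, coeff_rodrigues_succ]
  exact mul_ne_zero (by positivity) (by push_cast; exact neg_ne_zero.2 (by positivity))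

/-- Subtracting the multiple with the same top coefficient lowers the degree below `r`. The
remainder is then orthogonal to itself for a positive weight, so it is zero. -/
lemma exists_eq_C_mul_gegenbauer {r : ℕ} {g : ℝ[X]} (hg : g.natDegree ≤ r)
    (h : ∀ q : ℝ[X], q.natDegree < r → pint (om * q * g) = 0) :
    ∃ u : ℝ, g = C u * gegenbauer (r + 1) := by
  set P := gegenbauer (r + 1) with hP
  have hP0 : P.coeff r ≠ 0 := gegenbauer_coeff_ne r
  refine ⟨g.coeff r / P.coeff r, ?_⟩
  set f := g - C (g.coeff r / P.coeff r) * P with hf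
  rw [← sub_eq_zero, ← hf]
  have hd : f.natDegree ≤ r := by
    refine (natDegree_sub_le _ _).trans (max_le hg ?_)
    exact (natDegree_C_mul_le _ _).trans (natDegree_gegenbauer_le r)
  have hc : f.coeff r = 0 := by
    rw [hf, coeff_sub, coeff_C_mul, div_mul_cancel₀ _ hP0, sub_self]
  by_cases hr : r = 0
  · subst hr
    rw [eq_C_of_natDegree_le_zero hd, hc, C_0]
  by_contra h0
  have hd' : f.natDegree < r := by
    refine lt_of_le_of_ne hd fun h3 => ?_
    have h4 : f.leadingCoeff = 0 := by rw [leadingCoeff, h3, hc]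
    exact h0 (leadingCoeff_eq_zero.1 h4)
  have h1 : pint (om * f ^ 2) = 0 := by
    have : om * f ^ 2 = om * f * g - C (g.coeff r / P.coeff r) * (om * f * P) := by
      rw [hf]; ring
    rw [this, pint_sub, pint_C_mul, h f hd', gegenbauer_orthogonal hd']; ring
  exact h0 ((pint_pos_or_eq_zero om_pos).2 h1)

end Polynomials

/-! ### Coercivity of the edge and bubble functions -/

/-- Up to a rotation, the gradient of a mapped polynomial times the Jacobian determinant. -/
def vvec {r : ℕ} (S : Shape) (c : Coef r) (z : E) : E := pds c z • tanT S z - pdt c z • tanS S z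

/-- The weight of the cell bubble. -/
def bub (z : E) : ℝ := z 0 * (1 - z 0) * (z 1 * (1 - z 1))

/-- The moments of the gradient against the cell bubbles. -/
def moment {r : ℕ} (S : Shape) (c : Coef r) (i : Fin 2) (j k : Fin r) : ℝ :=
  ∫ z in sq, bub z * (z 0 ^ (j : ℕ) * z 1 ^ (k : ℕ)) * vvec S c z i

/-- The sum of the squares of the moments. -/
def bubbleForm {r : ℕ} (S : Shape) (c : Coef r) : ℝ := ∑ i, ∑ j, ∑ k, moment S c i j k ^ 2

/-- The quadratic form that belongs to the edge function of the edge `t = 0`. -/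
def edgeForm {r : ℕ} (S : Shape) (c : Coef r) : ℝ :=
  ∫ z in sq, z 0 * (1 - z 0) * (1 - z 1) * pds c (pt (z 0) 0) * det2 S.1 (vvec S c z)

lemma continuous_vvec_uncurry {r : ℕ} :
    Continuous fun x : (Shape × Coef r) × E => vvec x.1.1 x.1.2 x.2 := by
  have h1 : Continuous fun x : (Shape × Coef r) × E => pds x.1.2 x.2 :=
    continuous_pds_uncurry.comp (by fun_prop : Continuous fun x : (Shape × Coef r) × E =>
      (x.1.2, x.2))
  have h2 : Continuous fun x : (Shape × Coef r) × E => pdt x.1.2 x.2 :=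
    continuous_pdt_uncurry.comp (by fun_prop : Continuous fun x : (Shape × Coef r) × E =>
      (x.1.2, x.2))
  have h3 : Continuous fun x : (Shape × Coef r) × E => tanT x.1.1 x.2 := by unfold tanT; fun_prop
  have h4 : Continuous fun x : (Shape × Coef r) × E => tanS x.1.1 x.2 := by unfold tanS; fun_prop
  exact (h1.smul h3).sub (h2.smul h4)

lemma continuous_vvec {r : ℕ} (S : Shape) (c : Coef r) : Continuous (vvec S c) := by
  have h3 : Continuous (tanT S) := by unfold tanT; fun_prop
  have h4 : Continuous (tanS S) := by unfold tanS; fun_prop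
  exact ((continuous_pds c).smul h3).sub ((continuous_pdt c).smul h4)

lemma continuous_bub : Continuous bub := by unfold bub; fun_prop

lemma bub_pos {z : E} (hz : z ∈ sq) : 0 < bub z := by
  obtain ⟨h1, h2, h3, h4⟩ := hz
  exact mul_pos (mul_pos h1 (by linarith)) (mul_pos h3 (by linarith))

lemma continuous_moment {r : ℕ} (i : Fin 2) (j k : Fin r) :
    Continuous fun x : Shape × Coef r => moment x.1 x.2 i j k := by
  have h : Continuous fun x : (Shape × Coef r) × E => vvec x.1.1 x.1.2 x.2 i :=
    (continuous_coord i).comp continuous_vvec_uncurry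
  have h1 : Continuous fun x : (Shape × Coef r) × E => bub x.2 :=
    continuous_bub.comp continuous_snd
  have h2 : Continuous fun x : (Shape × Coef r) × E => x.2 0 ^ (j : ℕ) * x.2 1 ^ (k : ℕ) := by
    fun_prop
  exact continuous_integral_sq (F := fun (x : Shape × Coef r) z =>
    bub z * (z 0 ^ (j : ℕ) * z 1 ^ (k : ℕ)) * vvec x.1 x.2 z i) ((h1.mul h2).mul h)

lemma continuous_bubbleForm {r : ℕ} : Continuous fun x : Shape × Coef r => bubbleForm x.1 x.2 := by
  unfold bubbleForm
  exact continuous_finsetSum _ fun i _ => continuous_finsetSum _ fun j _ =>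
    continuous_finsetSum _ fun k _ => (continuous_moment i j k).pow 2

lemma continuous_det2 : Continuous fun x : E × E => det2 x.1 x.2 := by unfold det2; fun_prop

lemma continuous_edgeForm {r : ℕ} : Continuous fun x : Shape × Coef r => edgeForm x.1 x.2 := by
  have h := continuous_vvec_uncurry (r := r)
  have h1 : Continuous fun x : (Shape × Coef r) × E => pds x.1.2 (pt (x.2 0) 0) :=
    continuous_pds_uncurry.comp (by unfold pt; fun_prop : Continuous
      fun x : (Shape × Coef r) × E => (x.1.2, pt (x.2 0) 0))
  have h2 : Continuous fun x : (Shape × Coef r) × E => det2 x.1.1.1 (vvec x.1.1 x.1.2 x.2) :=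
    continuous_det2.comp (continuous_fst.fst.fst.prodMk h)
  have h3 : Continuous fun x : (Shape × Coef r) × E => x.2 0 * (1 - x.2 0) * (1 - x.2 1) := by
    fun_prop
  exact continuous_integral_sq (F := fun (x : Shape × Coef r) z => z 0 * (1 - z 0) * (1 - z 1) *
    pds x.2 (pt (z 0) 0) * det2 x.1.1 (vvec x.1 x.2 z)) ((h3.mul h1).mul h2)

lemma vvec_smul {r : ℕ} (S : Shape) (a : ℝ) (c : Coef r) (z : E) :
    vvec S (a • c) z = a • vvec S c z := by
  simp only [vvec, pds_smul, pdt_smul, smul_sub, smul_smul]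

lemma bubbleForm_smul {r : ℕ} (S : Shape) (a : ℝ) (c : Coef r) :
    bubbleForm S (a • c) = a ^ 2 * bubbleForm S c := by
  have h : ∀ i j k, moment S (a • c) i j k = a * moment S c i j k := fun i j k => by
    rw [moment, moment, ← integral_const_mul]
    congr 1; ext z
    rw [vvec_smul]; simp; ring
  simp only [bubbleForm, h, Finset.mul_sum, mul_pow]

lemma edgeForm_smul {r : ℕ} (S : Shape) (a : ℝ) (c : Coef r) :
    edgeForm S (a • c) = a ^ 2 * edgeForm S c := by
  rw [edgeForm, edgeForm, ← integral_const_mul]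
  congr 1; ext z
  rw [vvec_smul, pds_smul, det2_smul_right]; ring

lemma bubbleForm_nonneg {r : ℕ} (S : Shape) (c : Coef r) : 0 ≤ bubbleForm S c :=
  Finset.sum_nonneg fun _ _ => Finset.sum_nonneg fun _ _ => Finset.sum_nonneg fun _ _ => sq_nonneg _

lemma moment_eq_zero {r : ℕ} {S : Shape} {c : Coef r} (h : bubbleForm S c = 0) (i j k) :
    moment S c i j k = 0 := by
  have h1 := (Finset.sum_eq_zero_iff_of_nonneg (fun i _ => Finset.sum_nonneg fun _ _ =>
    Finset.sum_nonneg fun _ _ => sq_nonneg _)).1 h i (Finset.mem_univ _)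
  have h2 := (Finset.sum_eq_zero_iff_of_nonneg (fun i _ =>
    Finset.sum_nonneg fun _ _ => sq_nonneg _)).1 h1 j (Finset.mem_univ _)
  have h3 := (Finset.sum_eq_zero_iff_of_nonneg (fun i _ => sq_nonneg _)).1 h2 k (Finset.mem_univ _)
  exact pow_eq_zero_iff (two_ne_zero) |>.1 h3

lemma continuous_of_mem_Qsp {k l : ℕ} {f : E → ℝ} (hf : f ∈ Qsp k l) : Continuous f := by
  induction hf using Submodule.span_induction with
  | zero => exact continuous_const
  | add x y _ _ hx hy => exact hx.add hy
  | smul a x _ hx => exact hx.const_smul a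
  | mem x hx => obtain ⟨i, hi, j, hj, rfl⟩ := hx; fun_prop

/-- If all moments vanish, the gradient is orthogonal to all cell bubbles. -/
lemma integral_bub_det2_eq_zero {r : ℕ} (hr : 1 ≤ r) {S : Shape} {c : Coef r}
    (h : bubbleForm S c = 0) {q : E → ℝ} (hq : q ∈ Qsp (r - 1) (r - 1)) (x : E) :
    ∫ z in sq, bub z * q z * det2 x (vvec S c z) = 0 := by
  have hv : ∀ i, Continuous fun z => vvec S c z i := fun i =>
    (continuous_coord i).comp (continuous_vvec S c)
  have hb := continuous_bub
  have hi : ∀ q ∈ Qsp (r - 1) (r - 1), ∀ i, IntegrableOn (fun z => bub z * q z * vvec S c z i) sq :=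
    fun q hq i => integrableOn_sq
      (((hb.mul (continuous_of_mem_Qsp hq)).mul (hv i)).continuousOn)
  have key : ∀ i, ∫ z in sq, bub z * q z * vvec S c z i = 0 := by
    intro i
    induction hq using Submodule.span_induction with
    | zero => simp
    | add x y hx' hy' hx hy =>
      have := integral_add (hi x hx' i) (hi y hy' i)
      rw [hx, hy] at this
      rw [← add_zero (0 : ℝ), ← this]
      congr 1; ext z; simp only [Pi.add_apply]; ring
    | smul a x hx' hx =>
      rw [← mul_zero a, ← hx, ← integral_const_mul]
      congr 1; ext z; simp only [Pi.smul_apply, smul_eq_mul]; ring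
    | mem x hx =>
      obtain ⟨j, hj, k, hk, rfl⟩ := hx
      exact moment_eq_zero h i ⟨j, by omega⟩ ⟨k, by omega⟩
  have e : (fun z => bub z * q z * det2 x (vvec S c z)) = fun z =>
      x 0 * (bub z * q z * vvec S c z 1) - x 1 * (bub z * q z * vvec S c z 0) := by
    ext z; simp only [det2]; ring
  rw [e, integral_sub ((hi q hq 1).const_mul _) ((hi q hq 0).const_mul _), integral_const_mul,
    integral_const_mul, key, key]
  simp

/-! ### Separation of variables and positivity of the edge form. -/

section Polynomials
open Polynomial

/-- The coefficient of `t ^ k`, as a polynomial in `s`. -/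
def rowPoly {r : ℕ} (c : Coef r) (k : Fin (r + 1)) : ℝ[X] :=
  ∑ i : Fin (r + 1), monomial (i : ℕ) (c i k)

lemma natDegree_rowPoly_le {r : ℕ} (c : Coef r) (k) : (rowPoly c k).natDegree ≤ r :=
  natDegree_sum_le_of_forall_le _ _ fun i _ => (natDegree_monomial_le _).trans (by omega)

lemma pds_eq_sum {r : ℕ} (c : Coef r) (z : E) :
    pds c z = ∑ k : Fin (r + 1), (derivative (rowPoly c k)).eval (z 0) * z 1 ^ (k : ℕ) := by
  rw [pds, Finset.sum_comm]
  refine Finset.sum_congr rfl fun k _ => ?_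
  simp only [rowPoly, derivative_sum, derivative_monomial, eval_finsetSum, eval_monomial,
    Finset.sum_mul]
  exact Finset.sum_congr rfl fun i _ => by ring

lemma pdt_eq_sum {r : ℕ} (c : Coef r) (z : E) :
    pdt c z = ∑ k : Fin (r + 1), (rowPoly c k).eval (z 0) * ((k : ℕ) * z 1 ^ ((k : ℕ) - 1)) := by
  rw [pdt, Finset.sum_comm]
  refine Finset.sum_congr rfl fun k _ => ?_
  simp only [rowPoly, eval_finsetSum, eval_monomial, Finset.sum_mul]
  exact Finset.sum_congr rfl fun i _ => by ring

/-- The coefficient of `t ^ k` in the component of the gradient tangential to the edge. -/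
def tangPoly {r : ℕ} (α β : ℝ) (c : Coef r) (k : Fin (r + 1)) : ℝ[X] :=
  (C α + C β * X) * derivative (rowPoly c k) - C ((k : ℕ) * β) * rowPoly c k

lemma natDegree_tangPoly_le {r : ℕ} (hr : 1 ≤ r) (α β : ℝ) (c : Coef r) (k) :
    (tangPoly α β c k).natDegree ≤ r := by
  have h1 := natDegree_rowPoly_le c k
  refine (natDegree_sub_le _ _).trans (max_le (natDegree_mul_le.trans ?_)
    ((natDegree_C_mul_le _ _).trans h1))
  have h2 : (C α + C β * X : ℝ[X]).natDegree ≤ 1 := by compute_degree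
  have h3 := natDegree_derivative_le (rowPoly c k)
  omega

/-- The derivative in `t` appears only with a factor `t`, which restores the lost power. Hence the
coefficient of `t ^ k` involves no row of the polynomial but the `k`-th, and one can argue row by
row. -/
lemma det2_vvec_eq_sum {r : ℕ} (S : Shape) (c : Coef r) (z : E) :
    det2 S.1 (vvec S c z) = ∑ k : Fin (r + 1),
      (tangPoly (det2 S.1 S.2.2) (det2 S.1 S.2.1) c k).eval (z 0) * z 1 ^ (k : ℕ) := by
  have e : det2 S.1 (vvec S c z) = (det2 S.1 S.2.2 + det2 S.1 S.2.1 * z 0) * pds c z -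
      det2 S.1 S.2.1 * z 1 * pdt c z := by
    simp only [vvec, tanS, tanT, det2, PiLp.sub_apply, PiLp.add_apply, PiLp.smul_apply, smul_eq_mul]
    ring
  rw [e, pds_eq_sum, pdt_eq_sum, Finset.mul_sum, Finset.mul_sum, ← Finset.sum_sub_distrib]
  refine Finset.sum_congr rfl fun k _ => ?_
  simp only [tangPoly, eval_sub, eval_mul, eval_add, eval_C, eval_X]
  rcases k with ⟨_ | k, hk⟩
  · simp
  · simp; ring

/-- The function of `t` obtained by integrating the tangential component against `om * χ`. -/
def partialMoment {r : ℕ} (α β : ℝ) (c : Coef r) (χ : ℝ[X]) : ℝ[X] :=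
  ∑ k : Fin (r + 1), monomial (k : ℕ) (pint (om * χ * tangPoly α β c k))

lemma natDegree_partialMoment_le {r : ℕ} (α β : ℝ) (c : Coef r) (χ : ℝ[X]) :
    (partialMoment α β c χ).natDegree ≤ r :=
  natDegree_sum_le_of_forall_le _ _ fun i _ => (natDegree_monomial_le _).trans (by omega)

lemma coeff_partialMoment {r : ℕ} (α β : ℝ) (c : Coef r) (χ : ℝ[X]) (k : Fin (r + 1)) :
    (partialMoment α β c χ).coeff k = pint (om * χ * tangPoly α β c k) := by
  simp [partialMoment, finsetSum_coeff, coeff_monomial, Fin.val_inj]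

/-- Fubini: integration in `s` leaves the polynomial `partialMoment` in `t`. -/
lemma integral_eq_pint {r : ℕ} (S : Shape) (c : Coef r) (χ q : ℝ[X]) :
    ∫ z in sq, (om * χ).eval (z 0) * q.eval (z 1) * det2 S.1 (vvec S c z) =
      pint (q * partialMoment (det2 S.1 S.2.2) (det2 S.1 S.2.1) c χ) := by
  simp_rw [det2_vvec_eq_sum, Finset.mul_sum]
  rw [integral_finsetSum, partialMoment, Finset.mul_sum, pint_sum]
  · refine Finset.sum_congr rfl fun k _ => ?_
    have h := setIntegral_sq_mul
      (fun s => (om * χ * tangPoly (det2 S.1 S.2.2) (det2 S.1 S.2.1) c k).eval s)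
      (fun t => (q * X ^ (k : ℕ)).eval t)
    rw [← C_mul_X_pow_eq_monomial, mul_left_comm, pint_C_mul, pint, pint, ← h]
    congr 1; ext z; simp only [eval_mul, eval_pow, eval_X]; ring
  · intro k _
    refine integrableOn_sq (Continuous.continuousOn ?_)
    have h1 := (om * χ).continuous
    have h2 := q.continuous
    have h3 := (tangPoly (det2 S.1 S.2.2) (det2 S.1 S.2.1) c k).continuous
    have c0 := continuous_coord 0
    have c1 := continuous_coord 1
    exact ((h1.comp c0).mul (h2.comp c1)).mul ((h3.comp c0).mul (c1.pow _))

lemma eval_mem_Qsp_fst {k : ℕ} {p : ℝ[X]} (hp : p.natDegree ≤ k) :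
    (fun z : E => p.eval (z 0)) ∈ Qsp k 0 := by
  simp_rw [eval_eq_sum_range]
  refine Qsp.sum _ fun i hi => ?_
  have := (Qsp k 0).smul_mem (p.coeff i) (Qsp.monomial (i := i) (j := 0) (k := k) (l := 0)
    (by rw [Finset.mem_range] at hi; omega) le_rfl)
  simpa [Pi.smul_def] using this

lemma eval_mem_Qsp_snd {k : ℕ} {p : ℝ[X]} (hp : p.natDegree ≤ k) :
    (fun z : E => p.eval (z 1)) ∈ Qsp 0 k := by
  simp_rw [eval_eq_sum_range]
  refine Qsp.sum _ fun i hi => ?_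
  have := (Qsp 0 k).smul_mem (p.coeff i) (Qsp.monomial (i := 0) (j := i) (k := 0) (l := k) le_rfl
    (by rw [Finset.mem_range] at hi; omega))
  simpa [Pi.smul_def] using this

/-- Vanishing bubble moments say that this polynomial of degree at most `r` is orthogonal to all
lower degrees for the weight `t (1 - t)`. -/
lemma partialMoment_eq {r : ℕ} (hr : 1 ≤ r) {S : Shape} {c : Coef r} (h : bubbleForm S c = 0)
    {χ : ℝ[X]} (hχ : χ.natDegree < r) :
    ∃ u : ℝ, partialMoment (det2 S.1 S.2.2) (det2 S.1 S.2.1) c χ = C u * gegenbauer (r + 1) := by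
  refine exists_eq_C_mul_gegenbauer (natDegree_partialMoment_le _ _ _ _) fun q hq => ?_
  rw [← integral_eq_pint]
  have := integral_bub_det2_eq_zero hr h (Qsp.mul' (eval_mem_Qsp_fst (k := r - 1) (p := χ) (by omega))
    (eval_mem_Qsp_snd (k := r - 1) (p := q) (by omega)) (K := r - 1) (L := r - 1) (by simp)
    (by simp)) S.1
  rw [← this]
  congr 1; ext z; simp only [eval_mul, om, bub, eval_X, eval_sub, eval_one]; ring

/-- The kernel of `p ↦ y p' - k y' p` on polynomials, for an affine function `y`. -/
lemma eq_C_mul_pow_of_ode {α β : ℝ} (hα : α ≠ 0) {k : ℕ} {p : ℝ[X]}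
    (h : (C α + C β * X) * derivative p = C (k * β) * p) :
    ∃ u : ℝ, p = C u * (C α + C β * X) ^ k := by
  by_cases hβ : β = 0
  · subst hβ
    simp only [C_0, zero_mul, add_zero, mul_zero] at h
    have h1 : derivative p = 0 := (mul_eq_zero.1 h).resolve_left (by simpa using hα)
    obtain ⟨x, hx⟩ := natDegree_eq_zero.1 (derivative_eq_zero.1 h1)
    refine ⟨x / α ^ k, ?_⟩
    rw [← hx]
    simp only [C_0, zero_mul, add_zero, ← C_pow, ← C_mul]
    congr 1; field_simp
  -- With the zero `a` of `α + β x` moved to the origin, the equation becomes `x q' = k q`, which is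
  -- diagonal on monomials and leaves only `x ^ k`.
  · set a := -α / β
    have e : (C α + C β * X : ℝ[X]) = C β * (X - C a) := by
      have : C α = - (C β * C a : ℝ[X]) := by
        rw [← C_mul, ← C_neg]; congr 1; simp only [a]; field_simp
      rw [this]; ring
    set q := taylor a p with hq
    have h1 : C β * X * derivative q = C (k * β) * q := by
      have := congrArg (taylor a) h
      rw [e, taylor_mul, taylor_mul, taylor_mul, map_sub, taylor_X, taylor_C, taylor_C, taylor_C,
        add_sub_cancel_right] at this
      rw [← this, hq]
      congr 1
      have h2 := taylor_derivative_iterate a p 1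
      simpa using h2.symm
    have h2 : ∀ i, i ≠ k → q.coeff i = 0 := by
      intro i hi
      have h3 := congrArg (fun f => coeff f i) h1
      simp only [mul_assoc, coeff_C_mul] at h3
      rcases i with _ | i
      · simp only [coeff_X_mul_zero, mul_zero] at h3
        have := mul_eq_zero.1 h3.symm
        rcases this with h | h
        · exact absurd h (Nat.cast_ne_zero.2 (Ne.symm hi))
        · exact (mul_eq_zero.1 h).resolve_left hβ
      · rw [coeff_X_mul, coeff_derivative] at h3
        have h4 : β * ((i + 1 : ℝ) - k) * q.coeff (i + 1) = 0 := by linear_combination h3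
        refine (mul_eq_zero.1 h4).resolve_left (mul_ne_zero hβ ?_)
        rw [sub_ne_zero]; exact_mod_cast hi
    have h3 : q = C (q.coeff k) * X ^ k := by
      ext i
      rw [coeff_C_mul_X_pow]
      split_ifs with h
      · rw [h]
      · exact h2 i h
    refine ⟨q.coeff k / β ^ k, ?_⟩
    have h4 : p = C (q.coeff k) * (X - C a) ^ k := by
      have : p = taylor (-a) q := by rw [hq, taylor_taylor]; simp
      rw [this]
      conv_lhs => rw [h3]
      rw [taylor_mul, taylor_C, taylor_X_pow, C_neg, sub_eq_add_neg]
    rw [h4, e, mul_pow, ← C_pow, ← mul_assoc, ← C_mul]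
    congr 2; field_simp

/-- Where all moments vanish, the edge form is positive. -/
lemma edgeForm_pos {r : ℕ} (hr : 1 ≤ r) {S : Shape} (hS : csq ⊆ posHalf S) {c : Coef r}
    (hc : c 0 0 = 0) (hc0 : c ≠ 0) (h : bubbleForm S c = 0) : 0 < edgeForm S c := by
  set α := det2 S.1 S.2.2 with hα
  set β := det2 S.1 S.2.1 with hβ
  have hα0 : 0 < α := by
    have := hS (show pt 0 0 ∈ csq by norm_num [csq])
    simpa [posHalf, jac_eq] using this
  have hα1 : 0 < α + β := by
    have := hS (show pt 1 0 ∈ csq by norm_num [csq])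
    simpa [posHalf, jac_eq] using this
  have hy : ∀ x ∈ Ioo (0 : ℝ) 1, 0 < (om * (C α + C β * X)).eval x := fun x hx => by
    rw [eval_mul]
    refine mul_pos (om_pos x hx) ?_
    simp only [eval_add, eval_mul, eval_C, eval_X]
    nlinarith [hx.1, hx.2]
  set f := derivative (rowPoly c 0) with hf
  have hfd : f.natDegree < r := by
    have h1 := natDegree_rowPoly_le c 0
    have h2 := natDegree_derivative_le (rowPoly c 0)
    rw [hf]; omega
  obtain ⟨κ, hκ, hq⟩ := pint_one_sub_mul_gegenbauer r
  have tang0 : tangPoly α β c 0 = (C α + C β * X) * f := by simp [tangPoly, hf]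
  -- For multiples of the Gegenbauer polynomial, integration against `1 - t` is evaluation at `t =
  -- 0` up to `κ`; this evaluation is the moment of the tangential component on the edge itself.
  have key : ∀ χ : ℝ[X], χ.natDegree < r →
      pint ((1 - X) * partialMoment α β c χ) = κ * pint (om * χ * tangPoly α β c 0) := by
    intro χ hχ
    obtain ⟨u, hu⟩ := partialMoment_eq hr h hχ
    have h1 := coeff_partialMoment α β c χ 0
    rw [hu, Fin.val_zero, coeff_C_mul, coeff_zero_eq_eval_zero] at h1
    rw [hu, mul_left_comm, pint_C_mul, hq, ← h1]; ring
  -- The choice `χ = f` turns the edge form into an integral of `f ^ 2` with positive weight.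
  have hE : edgeForm S c = κ * pint (om * (C α + C β * X) * f ^ 2) := by
    have h1 := key f hfd
    rw [tang0] at h1
    rw [show om * (C α + C β * X) * f ^ 2 = om * f * ((C α + C β * X) * f) by ring, ← h1,
      ← integral_eq_pint, edgeForm]
    congr 1; ext z
    have : pds c (pt (z 0) 0) = f.eval (z 0) := by
      rw [pds_eq_sum, Finset.sum_eq_single 0]
      · simp [hf]
      · intro k _ hk
        have : (k : ℕ) ≠ 0 := fun h => hk (Fin.ext h)
        simp [this]
      · simp
    rw [this]; simp only [om, eval_mul, eval_X, eval_sub, eval_one]; ring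
  obtain ⟨hnn, hz⟩ := pint_pos_or_eq_zero (q := f) hy
  rw [hE]
  refine mul_pos hκ (lt_of_le_of_ne hnn fun h0 => hc0 ?_)
  have hf0 : f = 0 := hz h0.symm
  -- the tangential component vanishes
  have hW : ∀ k, tangPoly α β c k = 0 := by
    -- The multiple is fixed by its value at `t = 0`, which is zero because `f = 0`, while the
    -- Gegenbauer polynomial does not vanish at `0`.
    have hm : ∀ χ : ℝ[X], χ.natDegree < r → partialMoment α β c χ = 0 := by
      intro χ hχ
      obtain ⟨u, hu⟩ := partialMoment_eq hr h hχ
      have h1 := coeff_partialMoment α β c χ 0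
      rw [hu, Fin.val_zero, coeff_C_mul, coeff_zero_eq_eval_zero, tang0, hf0] at h1
      have h2 : u = 0 := by
        have : u * eval 0 (gegenbauer (r + 1)) = 0 := by rw [h1]; simp [pint]
        exact (mul_eq_zero.1 this).resolve_right (gegenbauer_eval_zero_ne r)
      rw [hu, h2, C_0, zero_mul]
    intro k
    -- The same characterization is now used in the variable `s`.
    obtain ⟨u, hu⟩ := exists_eq_C_mul_gegenbauer (natDegree_tangPoly_le hr α β c k) fun q hq => by
      rw [← coeff_partialMoment, hm q hq, coeff_zero]
    have hu0 : u = 0 := by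
      by_cases hb : β = 0
      -- In the case `β = 0` the row of `tangPoly` is a multiple of a derivative, so its coefficient
      -- of degree `r` vanishes, unlike that of the Gegenbauer polynomial.
      · have h1 := congrArg (fun p => coeff p r) hu
        simp only [coeff_C_mul] at h1
        have h2 : (tangPoly α β c k).coeff r = 0 := by
          simp only [tangPoly, hb, C_0, zero_mul, add_zero, mul_zero, sub_zero, coeff_C_mul,
            coeff_derivative]
          rw [coeff_eq_zero_of_natDegree_lt (lt_of_le_of_lt (natDegree_rowPoly_le c k) (by omega))]
          simp
        rw [h2] at h1
        exact (mul_eq_zero.1 h1.symm).resolve_right (gegenbauer_coeff_ne r)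
      -- The zero `a` of `α + β s` lies outside the unit interval. The operator `f ↦ (α + β s) f' -
      -- k β f` annihilates `(s - a) ^ k`, so the `k`-th Taylor coefficient at `a` is zero, which is
      -- impossible for a nonzero multiple.
      · set a := -α / β with ha
        have ha' : a < 0 ∨ 1 < a := by
          rcases lt_or_gt_of_ne hb with h | h
          · right; rw [ha, lt_div_iff_of_neg h]; linarith
          · left; rw [ha]; exact div_neg_of_neg_of_pos (by linarith) h
        have e : (C α + C β * X : ℝ[X]) = C β * (X - C a) := by
          have : C α = - (C β * C a : ℝ[X]) := by
            rw [← C_mul, ← C_neg]; congr 1; rw [ha]; field_simp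
          rw [this]; ring
        have h1 := congrArg (fun p => coeff (taylor a p) k) hu
        simp only [taylor_mul, taylor_C, coeff_C_mul] at h1
        have h2 : (taylor a (tangPoly α β c k)).coeff k = 0 := by
          rw [tangPoly, e, map_sub, taylor_mul, taylor_mul, taylor_mul, map_sub, taylor_X, taylor_C,
            taylor_C, taylor_C, add_sub_cancel_right]
          have h3 := taylor_derivative_iterate a (rowPoly c k) 1
          simp only [Function.iterate_one] at h3
          rw [h3, mul_assoc, coeff_sub, coeff_C_mul, coeff_C_mul]
          rcases k with ⟨_ | k, hk⟩
          · simp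
          · simp only [coeff_X_mul, coeff_derivative]; push_cast; ring
        rw [h2] at h1
        exact (mul_eq_zero.1 h1.symm).resolve_right
          (taylor_gegenbauer_coeff_ne ha' (Nat.le_of_lt_succ k.2))
    rw [hu, hu0, C_0, zero_mul]
  -- The polynomial becomes a sum of powers of `t (α + β s)`, which by `det2_xi_sub` is the distance
  -- to the edge up to a factor.
  have hrow : ∀ k : Fin (r + 1), ∃ u : ℝ, rowPoly c k = C u * (C α + C β * X) ^ (k : ℕ) := fun k =>
    eq_C_mul_pow_of_ode hα0.ne' (sub_eq_zero.1 (hW k))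
  choose u hu using hrow
  -- hence the gradient is normal to the edge
  set G : E → ℝ := fun z => ∑ k : Fin (r + 1),
    (u k * (k : ℕ)) * ((α + β * z 0) ^ ((k : ℕ) - 1) * z 1 ^ ((k : ℕ) - 1)) with hG
  have hs : ∀ z, pds c z = β * z 1 * G z := by
    intro z
    rw [pds_eq_sum, hG, Finset.mul_sum]
    refine Finset.sum_congr rfl fun k _ => ?_
    rw [hu k]
    rcases k with ⟨_ | k, hk⟩
    · simp
    · simp [derivative_pow]; ring
  have ht : ∀ z, pdt c z = (α + β * z 0) * G z := by
    intro z
    rw [pdt_eq_sum, hG, Finset.mul_sum]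
    refine Finset.sum_congr rfl fun k _ => ?_
    rw [hu k]
    rcases k with ⟨_ | k, hk⟩
    · simp
    · simp; ring
  -- The degree count makes `G` itself an admissible factor of the bubble.
  have hGQ : G ∈ Qsp (r - 1) (r - 1) := by
    refine Qsp.sum _ fun k _ => ?_
    have h1 := eval_mem_Qsp_fst (k := r - 1) (p := (C α + C β * X) ^ ((k : ℕ) - 1)) (by
      have h2 : (C α + C β * X : ℝ[X]).natDegree ≤ 1 := by compute_degree
      have h3 := natDegree_pow_le_of_le ((k : ℕ) - 1) h2
      omega)
    have h2 := Qsp.mul' h1 (Qsp.monomial (i := 0) (j := (k : ℕ) - 1) le_rfl le_rfl)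
      (K := r - 1) (L := r - 1) (by simp) (by omega)
    have := (Qsp (r - 1) (r - 1)).smul_mem (u k * (k : ℕ)) h2
    convert this using 1
    ext z; simp
  -- In the direction of the adjacent side the integrand is the positive function `bub * α * jac`
  -- times `G ^ 2`.
  have h1 := integral_bub_det2_eq_zero hr h hGQ S.2.2
  have e1 : ∀ z, bub z * G z * det2 S.2.2 (vvec S c z) = bub z * (α * jac S z) * G z ^ 2 := by
    intro z
    rw [vvec, hs, ht, jac_eq]
    simp only [hα, hβ, tanS, tanT, det2, PiLp.sub_apply, PiLp.add_apply, PiLp.smul_apply,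
      smul_eq_mul]
    ring
  simp_rw [e1] at h1
  have hcont : Continuous fun z => bub z * (α * jac S z) * G z ^ 2 :=
    (continuous_bub.mul (continuous_const.mul (continuous_jac S))).mul
      ((continuous_of_mem_Qsp hGQ).pow 2)
  have hG0 := setIntegral_eq_zero_imp isOpen_sq hcont.continuousOn
    (integrableOn_sq hcont.continuousOn) (fun z hz => mul_nonneg (mul_nonneg (bub_pos hz).le
      (mul_nonneg hα0.le (hS (sq_subset_csq hz)).out.le)) (sq_nonneg _)) h1
  have h2 : red c = 0 := by
    refine red_eq_zero_of_grad fun z hz => ?_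
    have h3 : G z = 0 := by
      have := (mul_eq_zero.1 (hG0 z hz)).resolve_left
        (mul_pos (bub_pos hz) (mul_pos hα0 (hS (sq_subset_csq hz)))).ne'
      exact pow_eq_zero_iff two_ne_zero |>.1 this
    rw [hs, ht, h3]; simp
  rw [← h2]
  ext i j
  by_cases hij : i = 0 ∧ j = 0
  · simp [red, hij, hc]
  · simp [red, hij]

end Polynomials

/-! ### Uniform coercivity over a compact set of shapes. -/

/-- The shapes whose sides are bounded and whose Jacobian determinant is bounded below. -/
def shapeSet (ε : ℝ) : Set Shape :=
  {S | ‖S.1‖ ≤ 2 ∧ ‖S.2.1‖ ≤ 2 ∧ ‖S.2.2‖ ≤ 2 ∧ ε ≤ jac S (pt 0 0) ∧ ε ≤ jac S (pt 1 0) ∧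
    ε ≤ jac S (pt 1 1) ∧ ε ≤ jac S (pt 0 1)}

lemma le_jac_of_mem {ε : ℝ} {S : Shape} (hS : S ∈ shapeSet ε) {z : E} (hz : z ∈ csq) :
    ε ≤ jac S z :=
  le_jac_of_corners hS.2.2.2.1 hS.2.2.2.2.1 hS.2.2.2.2.2.1 hS.2.2.2.2.2.2 hz

lemma continuous_jac_uncurry : Continuous fun x : Shape × E => jac x.1 x.2 := by
  unfold jac tanS tanT det2; fun_prop

lemma isCompact_shapeSet (ε : ℝ) : IsCompact (shapeSet ε) := by
  have hj : ∀ z, Continuous fun S : Shape => jac S z := fun z =>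
    continuous_jac_uncurry.comp (by fun_prop : Continuous fun S : Shape => (S, z))
  have n1 : Continuous fun S : Shape => ‖S.1‖ := by fun_prop
  have n2 : Continuous fun S : Shape => ‖S.2.1‖ := by fun_prop
  have n3 : Continuous fun S : Shape => ‖S.2.2‖ := by fun_prop
  have hcl : IsClosed (shapeSet ε) :=
    (isClosed_le n1 continuous_const).inter ((isClosed_le n2 continuous_const).inter
    ((isClosed_le n3 continuous_const).inter ((isClosed_le continuous_const (hj (pt 0 0))).inter
    ((isClosed_le continuous_const (hj (pt 1 0))).inter
    ((isClosed_le continuous_const (hj (pt 1 1))).inter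
    (isClosed_le continuous_const (hj (pt 0 1))))))))
  refine Metric.isCompact_of_isClosed_isBounded hcl
    ((Metric.isBounded_iff_subset_closedBall 0).2 ⟨2, fun S hS => ?_⟩)
  rw [mem_closedBall_zero_iff, Prod.norm_def, Prod.norm_def]
  exact max_le hS.1 (max_le hS.2.1 hS.2.2.1)

/-- Edge and bubble functions together control the polynomial up to constants. -/
lemma exists_edgeForm_add_bubbleForm {r : ℕ} (hr : 1 ≤ r) {ε : ℝ} (hε : 0 < ε) :
    ∃ lam ≥ 0, ∃ κ > 0, ∀ S ∈ shapeSet ε, ∀ c : Coef r,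
      κ * ‖red c‖ ^ 2 ≤ edgeForm S c + lam * bubbleForm S c := by
  have hpos : ∀ S ∈ shapeSet ε, csq ⊆ posHalf S := fun S hS z hz =>
    hε.trans_le (le_jac_of_mem hS hz)
  set W : Set (Coef r) := {c | c 0 0 = 0}
  have hW : IsClosed W := isClosed_eq (by fun_prop) continuous_const
  -- The bubble form has to compensate only on this compact set, where the edge form is not positive
  -- and the bubble form therefore is.
  set Z := (shapeSet ε ×ˢ (Metric.sphere (0 : Coef r) 1 ∩ W)) ∩ {x | edgeForm x.1 x.2 ≤ 0}
  have hZ : IsCompact Z := ((isCompact_shapeSet ε).prod ((isCompact_sphere 0 1).inter_right hW)).inter_right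
    (isClosed_le continuous_edgeForm continuous_const)
  have hB : ∀ x ∈ Z, 0 < bubbleForm x.1 x.2 := by
    intro x hx
    refine lt_of_le_of_ne (bubbleForm_nonneg _ _) fun h0 => ?_
    have := edgeForm_pos hr (hpos x.1 hx.1.1) hx.1.2.2
      (ne_zero_of_mem_unit_sphere ⟨x.2, hx.1.2.1⟩) h0.symm
    exact absurd hx.2 (not_le.2 this)
  obtain ⟨lam, hlam, hZl⟩ : ∃ lam ≥ 0, ∀ x ∈ Z, 0 < edgeForm x.1 x.2 + lam * bubbleForm x.1 x.2 := by
    rcases Z.eq_empty_or_nonempty with h | h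
    · exact ⟨0, le_rfl, by simp [h]⟩
    · obtain ⟨y, hy, hmin⟩ := hZ.exists_isMinOn h continuous_bubbleForm.continuousOn
      obtain ⟨y', hy', hmin'⟩ := hZ.exists_isMinOn h continuous_edgeForm.continuousOn
      have hb := hB y hy
      -- The minimum of the bubble form on `Z` times this factor exceeds the worst deficit of the
      -- edge form by `1`.
      refine ⟨(1 - edgeForm y'.1 y'.2) / bubbleForm y.1 y.2,
        div_nonneg (by linarith [hy'.2.out]) hb.le, fun x hx => ?_⟩
      have h1 : bubbleForm y.1 y.2 ≤ bubbleForm x.1 x.2 := hmin hx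
      have h2 : edgeForm y'.1 y'.2 ≤ edgeForm x.1 x.2 := hmin' hx
      have h3 : (1 - edgeForm y'.1 y'.2) ≤
          (1 - edgeForm y'.1 y'.2) / bubbleForm y.1 y.2 * bubbleForm x.1 x.2 := by
        rw [div_mul_eq_mul_div, le_div_iff₀ hb]
        exact mul_le_mul_of_nonneg_left h1 (by linarith [hy'.2.out])
      linarith
  obtain ⟨κ, hκ, h⟩ := exists_pos_mul_norm_sq_le (isCompact_shapeSet ε) hW
    (by intro v hv a; simp only [W, mem_ofPred_eq] at hv ⊢; simp [hv])
    (fun S c => edgeForm S c + lam * bubbleForm S c)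
    (continuous_edgeForm.add (continuous_const.mul continuous_bubbleForm)).continuousOn
    (by intro S _ c a; simp only [edgeForm_smul, bubbleForm_smul]; ring)
    (by
      intro S hS c hc hc0
      have hn : 0 < ‖c‖ := norm_pos_iff.2 hc0
      have h1 : 0 < edgeForm S (‖c‖⁻¹ • c) + lam * bubbleForm S (‖c‖⁻¹ • c) := by
        by_cases h2 : edgeForm S (‖c‖⁻¹ • c) ≤ 0
        · refine hZl (S, ‖c‖⁻¹ • c) ⟨⟨hS, by simp [norm_smul, hn.ne'], ?_⟩, h2⟩
          simp only [W, mem_ofPred_eq] at hc ⊢; simp [hc]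
        · exact add_pos_of_pos_of_nonneg (not_le.1 h2) (mul_nonneg hlam (bubbleForm_nonneg _ _))
      rw [edgeForm_smul, bubbleForm_smul] at h1
      have h3 : 0 < (‖c‖⁻¹) ^ 2 * (edgeForm S c + lam * bubbleForm S c) := by linarith
      exact (pos_iff_pos_of_mul_pos h3).1 (by positivity))
  refine ⟨lam, hlam, κ, hκ, fun S hS c => ?_⟩
  have h1 := h S hS (red c) (red_zero_zero c)
  have h2 : ∀ z, vvec S (red c) z = vvec S c z := fun z => by simp only [vvec, pds_red, pdt_red]
  simpa only [edgeForm, bubbleForm, moment, h2, pds_red] using h1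

/-! ### Directional derivatives in reference coordinates -/

/-- The derivative in the physical direction `n`, in reference coordinates. -/
def dirDeriv (S : Shape) (n : E) (f : E → ℝ) (z : E) : ℝ := fderiv ℝ f z (jacInv S z n)

/-- The `l`-th derivative in direction `n` of a mapped polynomial, as a function of the shape, the
direction, the coefficients, and the reference point. -/
def dnorm {r : ℕ} : ℕ → Shape × E × Coef r × E → ℝ
  | 0, x => pev x.2.2.1 x.2.2.2
  -- The derivative is taken jointly in all parameters, in a direction that moves only the reference
  -- point. This keeps joint smoothness, on which the compactness arguments over shapes and normals
  -- rely.
  | l + 1, x => fderiv ℝ (dnorm l) x (0, 0, 0, jacInv x.1 x.2.2.2 x.2.1)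

/-- The parameters with nonzero Jacobian determinant. -/
def nondeg (r : ℕ) : Set (Shape × E × Coef r × E) := {x | jac x.1 x.2.2.2 ≠ 0}

lemma isOpen_nondeg (r : ℕ) : IsOpen (nondeg r) :=
  isOpen_ne_fun (continuous_jac_uncurry.comp
    (by fun_prop : Continuous fun x : Shape × E × Coef r × E => (x.1, x.2.2.2))) continuous_const

lemma contDiff_pt : ContDiff ℝ ∞ fun p : ℝ × ℝ => pt p.1 p.2 := by
  rw [contDiff_euclidean]
  intro i
  fin_cases i
  · exact contDiff_fst
  · exact contDiff_snd

lemma contDiffOn_jacInv (r : ℕ) :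
    ContDiffOn ℝ ∞ (fun x : Shape × E × Coef r × E => jacInv x.1 x.2.2.2 x.2.1) (nondeg r) := by
  have hj : ContDiff ℝ ∞ fun x : Shape × E × Coef r × E => jac x.1 x.2.2.2 := by
    unfold jac tanS tanT det2; fun_prop
  have h0 : ContDiff ℝ ∞ fun x : Shape × E × Coef r × E => det2 x.2.1 (tanT x.1 x.2.2.2) := by
    unfold tanT det2; fun_prop
  have h1 : ContDiff ℝ ∞ fun x : Shape × E × Coef r × E => det2 (tanS x.1 x.2.2.2) x.2.1 := by
    unfold tanS det2; fun_prop
  exact contDiff_pt.comp_contDiffOn ((h0.contDiffOn.div hj.contDiffOn fun x hx => hx).prodMk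
    (h1.contDiffOn.div hj.contDiffOn fun x hx => hx))

lemma contDiffOn_dnorm {r : ℕ} (l : ℕ) : ContDiffOn ℝ ∞ (dnorm (r := r) l) (nondeg r) := by
  induction l with
  | zero =>
    have : ContDiff ℝ ∞ fun x : Shape × E × Coef r × E => pev x.2.2.1 x.2.2.2 := by
      unfold pev; fun_prop
    exact this.contDiffOn
  | succ l ih =>
    have h1 := ih.fderiv_of_isOpen (isOpen_nondeg r) (m := ∞) (by simp)
    have h2 := contDiffOn_jacInv r
    exact h1.clm_apply (contDiffOn_const.prodMk (contDiffOn_const.prodMk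
      (contDiffOn_const.prodMk h2)))

lemma dirDeriv_congr {S : Shape} {n : E} {f g : E → ℝ} {O : Set E} (hO : IsOpen O)
    (h : EqOn f g O) : EqOn (dirDeriv S n f) (dirDeriv S n g) O := fun z hz => by
  rw [dirDeriv, dirDeriv, (h.eventuallyEq_of_mem (hO.mem_nhds hz)).fderiv_eq]

lemma dirDeriv_iterate_congr {S : Shape} {n : E} {f g : E → ℝ} {O : Set E} (hO : IsOpen O)
    (h : EqOn f g O) (l : ℕ) : EqOn ((dirDeriv S n)^[l] f) ((dirDeriv S n)^[l] g) O := by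
  induction l with
  | zero => exact h
  | succ l ih =>
    rw [Function.iterate_succ_apply', Function.iterate_succ_apply']
    exact dirDeriv_congr hO ih

lemma dnorm_eq {r : ℕ} (l : ℕ) (S : Shape) (n : E) (c : Coef r) :
    EqOn (fun z => dnorm l (S, n, c, z)) ((dirDeriv S n)^[l] (pev c)) (posHalf S) := by
  induction l with
  | zero => exact fun z _ => rfl
  | succ l ih =>
    intro z hz
    rw [Function.iterate_succ_apply', ← dirDeriv_congr (isOpen_posHalf S) ih hz]
    have hd : DifferentiableAt ℝ (dnorm (r := r) l) (S, n, c, z) :=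
      ((contDiffOn_dnorm l).contDiffAt ((isOpen_nondeg r).mem_nhds
        (show (S, n, c, z) ∈ nondeg r from ne_of_gt hz))).differentiableAt (by simp)
    have hi : HasFDerivAt (fun z : E => (S, n, c, z))
        ((0 : E →L[ℝ] Shape).prod ((0 : E →L[ℝ] E).prod ((0 : E →L[ℝ] Coef r).prod
          (ContinuousLinearMap.id ℝ E)))) z :=
      (hasFDerivAt_const _ _).prodMk ((hasFDerivAt_const _ _).prodMk ((hasFDerivAt_const _ _).prodMk
        (hasFDerivAt_id _)))
    have := (hd.hasFDerivAt.comp z hi).fderiv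
    simp only [dnorm, dirDeriv]
    rw [show (fun z => dnorm l (S, n, c, z)) = dnorm l ∘ fun z : E => (S, n, c, z) from rfl, this]
    rfl

lemma dnorm_eq_iterate {r : ℕ} (l : ℕ) (S : Shape) (n : E) (c : Coef r) {z : E}
    (hz : z ∈ posHalf S) : dnorm l (S, n, c, z) = (dirDeriv S n)^[l] (pev c) z :=
  dnorm_eq l S n c hz

lemma contDiffOn_dirDeriv_iterate {r : ℕ} (l : ℕ) (S : Shape) (n : E) (c : Coef r) :
    ContDiffOn ℝ ∞ ((dirDeriv S n)^[l] (pev c)) (posHalf S) := by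
  refine ContDiffOn.congr ?_ (dnorm_eq l S n c).symm
  refine (contDiffOn_dnorm l).comp (t := nondeg r) ?_ fun z hz => (ne_of_gt hz : jac S z ≠ 0)
  fun_prop

lemma jacInv_smul {h : ℝ} (hh : h ≠ 0) (S : Shape) (z n : E) :
    jacInv (h • S) z n = h⁻¹ • jacInv S z n := by
  have e1 : tanS (h • S) z = h • tanS S z := by
    simp only [tanS, Prod.smul_fst, Prod.smul_snd, smul_add]; rw [smul_comm]
  have e2 : tanT (h • S) z = h • tanT S z := by
    simp only [tanT, Prod.smul_snd, Prod.smul_fst, smul_add]; rw [smul_comm]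
  have e3 : jac (h • S) z = h * (h * jac S z) := by
    rw [jac, e1, e2, det2_smul_left, det2_smul_right, jac]
  ext i
  fin_cases i <;>
    simp only [jacInv, e1, e2, e3, det2_smul_left, det2_smul_right, PiLp.smul_apply, smul_eq_mul,
      Fin.zero_eta, Fin.mk_one, pt_zero, pt_one] <;>
    rw [mul_div_mul_left _ _ hh, div_mul_eq_div_div_swap, div_eq_inv_mul (_ / _)]

lemma jac_smul (h : ℝ) (S : Shape) (z : E) : jac (h • S) z = h ^ 2 * jac S z := by
  simp only [jac_eq, Prod.smul_fst, Prod.smul_snd, det2_smul_left, det2_smul_right]; ring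

lemma posHalf_smul {h : ℝ} (hh : h ≠ 0) (S : Shape) : posHalf (h • S) = posHalf S := by
  ext z
  simp only [posHalf, mem_ofPred_eq, jac_smul]
  exact mul_pos_iff_of_pos_left (by positivity)

lemma dirDeriv_const_mul {S : Shape} {n : E} {f : E → ℝ} (a : ℝ) (z : E)
    (hf : DifferentiableAt ℝ f z) :
    dirDeriv S n (fun z => a * f z) z = a * dirDeriv S n f z := by
  simp only [dirDeriv]
  rw [fderiv_const_mul hf]; rfl

/-- Each derivative contributes one inverse of the linear map, hence one factor `h⁻¹`. -/
lemma dnorm_smul_shape {r : ℕ} {h : ℝ} (hh : h ≠ 0) (l : ℕ) (S : Shape) (n : E) (c : Coef r) {z : E}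
    (hz : z ∈ posHalf S) : dnorm l (h • S, n, c, z) = (h⁻¹) ^ l * dnorm l (S, n, c, z) := by
  rw [dnorm_eq_iterate l (h • S) n c (by rwa [posHalf_smul hh]), dnorm_eq_iterate l S n c hz]
  induction l generalizing z with
  | zero => simp
  | succ l ih =>
    rw [Function.iterate_succ_apply', Function.iterate_succ_apply']
    rw [dirDeriv_congr (isOpen_posHalf S) (g := fun z => (h⁻¹) ^ l * (dirDeriv S n)^[l] (pev c) z)
      (fun z hz => ih hz) hz]
    rw [dirDeriv_const_mul _ _ (((contDiffOn_dirDeriv_iterate l S n c).contDiffAt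
      ((isOpen_posHalf S).mem_nhds hz)).differentiableAt (by simp))]
    simp only [dirDeriv, jacInv_smul hh, map_smul, smul_eq_mul]
    ring

lemma dnorm_smul_coef {r : ℕ} (a : ℝ) (l : ℕ) (S : Shape) (n : E) (c : Coef r) {z : E}
    (hz : z ∈ posHalf S) : dnorm l (S, n, a • c, z) = a * dnorm l (S, n, c, z) := by
  rw [dnorm_eq_iterate l S n _ hz, dnorm_eq_iterate l S n c hz]
  induction l generalizing z with
  | zero => simp [pev_smul]
  | succ l ih =>
    rw [Function.iterate_succ_apply', Function.iterate_succ_apply']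
    rw [dirDeriv_congr (isOpen_posHalf S) (g := fun z => a * (dirDeriv S n)^[l] (pev c) z)
      (fun z hz => ih hz) hz]
    rw [dirDeriv_const_mul _ _ (((contDiffOn_dirDeriv_iterate l S n c).contDiffAt
      ((isOpen_posHalf S).mem_nhds hz)).differentiableAt (by simp))]

/-- The constant term disappears with the first derivative, so the hypothesis `1 ≤ l` is essential.
-/
lemma dnorm_red {r : ℕ} {l : ℕ} (hl : 1 ≤ l) (S : Shape) (n : E) (c : Coef r) {z : E}
    (hz : z ∈ posHalf S) : dnorm l (S, n, red c, z) = dnorm l (S, n, c, z) := by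
  rw [dnorm_eq_iterate l S n _ hz, dnorm_eq_iterate l S n c hz]
  obtain ⟨k, rfl⟩ := Nat.exists_eq_add_of_le' hl
  rw [Function.iterate_succ_apply, Function.iterate_succ_apply]
  have e : dirDeriv S n (pev (red c)) = dirDeriv S n (pev c) := by
    ext z
    rw [dirDeriv, dirDeriv, (hasFDerivAt_pev _ z).fderiv, (hasFDerivAt_pev _ z).fderiv,
      pgrad_apply, pgrad_apply, pds_red, pdt_red]
  rw [e]

/-- If `D ^ k (t ^ k G)` vanishes at a point with `t = 0`, so does `G`. -/
lemma eq_zero_of_dirDeriv_iterate {S : Shape} {n : E} (hn : det2 S.1 n ≠ 0) (k : ℕ) {z : E}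
    (hz : z ∈ posHalf S) (hz1 : z 1 = 0) {G : E → ℝ} (hG : ContDiffOn ℝ ∞ G (posHalf S))
    (h : (dirDeriv S n)^[k] (fun z => z 1 ^ k * G z) z = 0) : G z = 0 := by
  induction k generalizing G with
  | zero => simpa using h
  | succ k ih =>
    have hinv : ContDiffOn ℝ ∞ (fun z => jacInv S z n) (posHalf S) := by
      refine (contDiffOn_jacInv 0).comp (t := nondeg 0) (g := fun x => jacInv x.1 x.2.2.2 x.2.1)
        (f := fun z : E => (S, n, (0 : Coef 0), z)) ?_ fun z hz => (ne_of_gt hz : jac S z ≠ 0)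
      fun_prop
    -- One derivative of `t ^ (k + 1) G` is `t ^ k G'`. On the edge, `G'` is a multiple of `G` with
    -- the nonzero factor `(k + 1) ∂_n t`, since `n` is transversal to the edge.
    set G' : E → ℝ := fun z => (k + 1) * jacInv S z n 1 * G z + z 1 * dirDeriv S n G z with hG'
    have hG's : ContDiffOn ℝ ∞ G' (posHalf S) := by
      have h1 : ContDiffOn ℝ ∞ (fun z => jacInv S z n 1) (posHalf S) :=
        (contDiff_euclidean.1 contDiff_id 1).comp_contDiffOn hinv
      have h2 : ContDiffOn ℝ ∞ (dirDeriv S n G) (posHalf S) :=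
        (hG.fderiv_of_isOpen (isOpen_posHalf S) (m := ∞) (by simp)).clm_apply hinv
      have h3 : ContDiff ℝ ∞ fun z : E => z 1 := by fun_prop
      exact ((contDiffOn_const.mul h1).mul hG).add (h3.contDiffOn.mul h2)
    have e : EqOn (dirDeriv S n (fun z => z 1 ^ (k + 1) * G z)) (fun z => z 1 ^ k * G' z)
        (posHalf S) := by
      intro y hy
      have hd : HasFDerivAt G (fderiv ℝ G y) y := ((hG.contDiffAt
        ((isOpen_posHalf S).mem_nhds hy)).differentiableAt (by simp)).hasFDerivAt
      have h1 : HasFDerivAt (fun z : E => z 1) (EuclideanSpace.proj 1 : E →L[ℝ] ℝ) y :=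
        (EuclideanSpace.proj 1 : E →L[ℝ] ℝ).hasFDerivAt
      have h2 : HasFDerivAt (fun z : E => z 1 ^ (k + 1) * G z) _ y := (h1.pow (k + 1)).mul hd
      rw [dirDeriv, h2.fderiv]
      simp [hG', dirDeriv]
      ring
    rw [Function.iterate_succ_apply, dirDeriv_iterate_congr (isOpen_posHalf S) e k hz] at h
    have h1 := ih hG's h
    simp only [hG', hz1, zero_mul, add_zero, mul_eq_zero] at h1
    refine h1.resolve_left fun h2 => ?_
    rcases h2 with h2 | h2
    · exact absurd h2 (by positivity)
    · have h3 : tanS S z = S.1 := by simp [tanS, hz1]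
      rw [jacInv, pt_one, h3, div_eq_zero_iff] at h2
      exact h2.elim hn (ne_of_gt hz)

lemma pt_mem_csq {s : ℝ} (hs : s ∈ Icc (0 : ℝ) 1) : pt s 0 ∈ csq := by
  exact ⟨hs.1, hs.2, le_rfl, zero_le_one⟩

/-- A polynomial without constant term is determined by its tangential derivative and its normal
derivatives on the edge `t = 0`. -/
lemma eq_zero_of_edge_data {r : ℕ} {S : Shape} (hS : csq ⊆ posHalf S) {n : E}
    (hn : det2 S.1 n ≠ 0) {c : Coef r} (hc : c 0 0 = 0)
    (h0 : ∀ s ∈ Ioo (0 : ℝ) 1, pds c (pt s 0) = 0)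
    (h1 : ∀ l ∈ Finset.Icc 1 r, ∀ s ∈ Ioo (0 : ℝ) 1, dnorm l (S, n, c, pt s 0) = 0) : c = 0 := by
  -- Strong induction on the power of `t`: the tangential derivative determines the terms of order
  -- zero, and the normal derivative of order `k` those of order `k`.
  have key : ∀ k : ℕ, ∀ j : Fin (r + 1), (j : ℕ) = k → ∀ i, c i j = 0 := by
    intro k
    induction k using Nat.strong_induction_on with
    | _ k ih =>
    intro j hj i
    rcases Nat.eq_zero_or_pos k with hk | hk
    · have hj0 : j = 0 := Fin.ext (by simp [hj, hk])
      subst hj0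
      have h2 : (fun i => if i = 0 then 0 else c i 0 : Fin (r + 1) → ℝ) = 0 := by
        have h3 : ∀ s ∈ Ioo (0 : ℝ) 1, ∑ i : Fin (r + 1), c i 0 * ((i : ℕ) * s ^ ((i : ℕ) - 1)) = 0 := by
          intro s hs
          rw [← h0 s hs, pds]
          refine Finset.sum_congr rfl fun i _ => ?_
          rw [Finset.sum_eq_single 0]
          · simp
          · intro j _ hj
            have : (j : ℕ) ≠ 0 := fun h => hj (Fin.ext h)
            simp [this]
          · simp
        have h4 : (fun i : Fin (r + 1) => c i 0 * (i : ℕ)) = 0 := by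
          refine coef_eq_zero_of_forall fun s hs => ?_
          have h5 := congrArg (fun x => s * x) (h3 s hs)
          simp only [mul_zero, Finset.mul_sum] at h5
          rw [← h5]
          refine Finset.sum_congr rfl fun i _ => ?_
          rcases i with ⟨_ | i, hi⟩
          · simp
          · simp only [Nat.add_sub_cancel]; push_cast; ring
        ext i
        have := congrFun h4 i
        simp only [Pi.zero_apply, mul_eq_zero, Nat.cast_eq_zero, Fin.val_eq_zero_iff] at this
        split_ifs with h
        · rfl
        · exact this.resolve_right h
      by_cases hi : i = 0
      · rw [hi, hc]
      · have := congrFun h2 i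
        simpa [hi] using this
    -- Since the lower powers of `t` are already absent, the polynomial is `t ^ k G`, and `G`
    -- restricted to the edge carries exactly the coefficients of `t ^ k`.
    · set G : E → ℝ := fun z => ∑ i, ∑ j : Fin (r + 1),
        if k ≤ (j : ℕ) then c i j * (z 0 ^ (i : ℕ) * z 1 ^ ((j : ℕ) - k)) else 0 with hG
      have hp : pev c = fun z => z 1 ^ k * G z := by
        ext z
        simp only [pev, hG, Finset.mul_sum]
        refine Finset.sum_congr rfl fun i _ => Finset.sum_congr rfl fun j _ => ?_
        split_ifs with h
        · rw [← Nat.add_sub_cancel' h, pow_add]; simp; ring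
        · rw [ih j (not_le.1 h) j rfl i]; simp
      have hGs : ContDiff ℝ ∞ G := by
        rw [hG]
        refine ContDiff.sum fun i _ => ContDiff.sum fun j _ => ?_
        split_ifs
        · fun_prop
        · exact contDiff_const
      refine congrFun (coef_eq_zero_of_forall (a := fun i => c i j) fun s hs => ?_) i
      have hs' : pt s 0 ∈ posHalf S := hS (pt_mem_csq (Ioo_subset_Icc_self hs))
      have h2 := h1 k (Finset.mem_Icc.2 ⟨hk, by omega⟩) s hs
      rw [dnorm_eq_iterate k S n c hs', hp] at h2
      rw [← eq_zero_of_dirDeriv_iterate hn k hs' (pt_one s 0) hGs.contDiffOn h2, hG]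
      refine Finset.sum_congr rfl fun i _ => ?_
      rw [Finset.sum_eq_single j]
      · simp [hj]
      · intro j' _ hj'
        split_ifs with h
        · have : (j' : ℕ) - k ≠ 0 := fun h' => hj' (Fin.ext (by omega))
          simp [this]
        · rfl
      · simp
  ext i j
  exact key j j rfl i

/-- The trace inequality for derivatives on the edge `t = 0`. -/
lemma exists_dnorm_sq_le (r l : ℕ) (hl : 1 ≤ l) {ε : ℝ} (hε : 0 < ε) : ∃ C > 0, ∀ S ∈ shapeSet ε,
    ∀ n : E, ‖n‖ = 1 → ∀ c : Coef r, ∀ z ∈ csq, dnorm l (S, n, c, z) ^ 2 ≤ C * ‖red c‖ ^ 2 := by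
  have hpos : ∀ S ∈ shapeSet ε, csq ⊆ posHalf S := fun S hS z hz =>
    hε.trans_le (le_jac_of_mem hS hz)
  obtain ⟨C, hC, h⟩ := exists_le_mul_norm_sq (V := Coef r)
    (((isCompact_shapeSet ε).prod (isCompact_sphere (0 : E) 1)).prod isCompact_csq)
    (fun x c => dnorm l (x.1.1, x.1.2, c, x.2) ^ 2)
    (by
      refine ContinuousOn.pow ?_ 2
      refine (contDiffOn_dnorm l).continuousOn.comp (t := nondeg r) (by fun_prop) ?_
      rintro ⟨⟨⟨S, n⟩, z⟩, c⟩ ⟨⟨⟨hS, _⟩, hz⟩, _⟩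
      exact ne_of_gt (hpos S hS hz))
    (by
      rintro ⟨⟨S, n⟩, z⟩ ⟨⟨hS, _⟩, hz⟩ c a
      rw [dnorm_smul_coef a l S n c (hpos S hS hz)]; ring)
  refine ⟨C, hC, fun S hS n hn c z hz => ?_⟩
  rw [← dnorm_red hl S n c (hpos S hS hz)]
  exact h ((S, n), z) ⟨⟨hS, by simpa using hn⟩, hz⟩ (red c)

lemma det2_ne_zero_of_inner {u v : E} (hu : u ≠ 0) (hv : ‖v‖ = 1) (h : inner ℝ u v = 0) :
    det2 u v ≠ 0 := by
  intro h0
  have := det2_sq_add_inner_sq u v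
  rw [h0, h, hv] at this
  have h1 : ‖u‖ ≠ 0 := norm_ne_zero_iff.2 hu
  apply h1
  simpa using this.symm

/-- Tangential and normal derivatives on the edge `t = 0` control a polynomial up to constants. -/
lemma exists_red_le_edge (r : ℕ) {ε : ℝ} (hε : 0 < ε) : ∃ C > 0, ∀ S ∈ shapeSet ε,
    ∀ n : E, ‖n‖ = 1 → inner ℝ S.1 n = 0 → ∀ c : Coef r,
      ‖red c‖ ^ 2 ≤ C * ((∫ s in (0 : ℝ)..1, pds c (pt s 0) ^ 2) +
        ∑ l ∈ Finset.Icc 1 r, ∫ s in (0 : ℝ)..1, dnorm l (S, n, c, pt s 0) ^ 2) := by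
  have hpos : ∀ S ∈ shapeSet ε, csq ⊆ posHalf S := fun S hS z hz =>
    hε.trans_le (le_jac_of_mem hS hz)
  set k : Set (Shape × E) := (shapeSet ε ×ˢ Metric.sphere (0 : E) 1) ∩ {x | inner ℝ x.1.1 x.2 = 0}
  have hk : IsCompact k := ((isCompact_shapeSet ε).prod (isCompact_sphere (0 : E) 1)).inter_right
    (isClosed_eq (by fun_prop) continuous_const)
  have : CompactSpace k := isCompact_iff_compactSpace.1 hk
  -- Projecting the parameter onto the unit interval keeps all points on the edge, where the
  -- Jacobian is positive, and so makes the integrands continuous on the whole line.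
  set pr : ℝ → E := fun s => pt (projIcc (0 : ℝ) 1 zero_le_one s) 0 with hpr
  have hprc : Continuous pr := by
    have : Continuous fun s => ((projIcc (0 : ℝ) 1 zero_le_one s : ℝ), (0 : ℝ)) := by fun_prop
    exact contDiff_pt.continuous.comp this
  have hprm : ∀ s, pr s ∈ csq := fun s => pt_mem_csq (Subtype.prop _)
  have hpre : ∀ s ∈ Icc (0 : ℝ) 1, pr s = pt s 0 := fun s hs => by
    simp [hpr, projIcc_of_mem zero_le_one hs]
  have cd : ∀ l, Continuous fun y : (k × Coef r) × ℝ =>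
      dnorm l (y.1.1.1.1, y.1.1.1.2, y.1.2, pr y.2) := by
    intro l
    refine (contDiffOn_dnorm (r := r) l).continuousOn.comp_continuous
      (f := fun y : (k × Coef r) × ℝ => ((y.1.1.1.1, y.1.1.1.2, y.1.2, pr y.2) : Shape × E × Coef r × E))
      (by fun_prop) ?_
    rintro ⟨⟨⟨⟨S, n⟩, hx⟩, c⟩, s⟩
    exact ne_of_gt (hpos S hx.1.1 (hprm s))
  have cp : Continuous fun y : (k × Coef r) × ℝ => pds y.1.2 (pr y.2) :=
    continuous_pds_uncurry.comp (by fun_prop :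
      Continuous fun y : (k × Coef r) × ℝ => (y.1.2, pr y.2))
  obtain ⟨κ, hκ, h⟩ := exists_pos_mul_norm_sq_le (X := k) (V := Coef r) (k := univ)
    isCompact_univ (W := {c | c 0 0 = 0})
    (isClosed_eq (by fun_prop) continuous_const) (by intro v hv a; simp [hv.out])
    (fun x c => (∫ s in (0 : ℝ)..1, pds c (pr s) ^ 2) +
        ∑ l ∈ Finset.Icc 1 r, ∫ s in (0 : ℝ)..1, dnorm l (x.1.1, x.1.2, c, pr s) ^ 2)
    (Continuous.continuousOn (by
      refine Continuous.add ?_ (continuous_finsetSum _ fun l _ => ?_)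
      · exact intervalIntegral.continuous_parametric_intervalIntegral_of_continuous'
          (f := fun (y : k × Coef r) s => pds y.2 (pr s) ^ 2) (by
            simpa only [Function.uncurry_def, Pi.pow_def] using cp.pow 2) 0 1
      · exact intervalIntegral.continuous_parametric_intervalIntegral_of_continuous'
          (f := fun (y : k × Coef r) s => dnorm l (y.1.1.1, y.1.1.2, y.2, pr s) ^ 2)
          (by simpa only [Function.uncurry_def, Pi.pow_def] using (cd l).pow 2) 0 1))
    (by
      rintro ⟨⟨S, n⟩, hx⟩ _ c a
      simp only [mul_add, Finset.mul_sum, ← intervalIntegral.integral_const_mul, pds_smul,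
        dnorm_smul_coef a _ S n c (hpos S hx.1.1 (hprm _)), mul_pow])
    (by
      rintro ⟨⟨S, n⟩, hx⟩ _ c hc hc0
      -- A unit vector orthogonal to the nonzero edge vector is transversal to the edge.
      have hSn : det2 S.1 n ≠ 0 := by
        refine det2_ne_zero_of_inner ?_ (by simpa using hx.1.2) hx.2
        intro h0
        have := hpos S hx.1.1 (show pt 0 0 ∈ csq by norm_num [csq])
        simp [posHalf, jac_eq, h0, det2] at this
      have z_of : ∀ f : ℝ → ℝ, Continuous f → ∫ s in (0 : ℝ)..1, f s ^ 2 = 0 →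
          ∀ s ∈ Ioo (0 : ℝ) 1, f s = 0 := by
        intro f hf h0 s hs
        rw [intervalIntegral.integral_of_le zero_le_one, integral_Ioc_eq_integral_Ioo] at h0
        have h1 := (integral_eq_zero_iff_of_nonneg (fun s => sq_nonneg (f s))
          (((hf.pow 2).continuousOn.integrableOn_compact isCompact_Icc).mono_set
            Ioo_subset_Icc_self)).1 h0
        have h2 := Measure.eqOn_open_of_ae_eq h1 isOpen_Ioo (hf.pow 2).continuousOn
          continuousOn_const
        exact pow_eq_zero_iff two_ne_zero |>.1 (h2 hs)
      have nn : ∀ f : ℝ → ℝ, 0 ≤ ∫ s in (0 : ℝ)..1, f s ^ 2 := fun f =>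
        intervalIntegral.integral_nonneg zero_le_one fun s _ => sq_nonneg _
      have nn' : 0 ≤ ∑ l ∈ Finset.Icc 1 r, ∫ s in (0 : ℝ)..1, dnorm l (S, n, c, pr s) ^ 2 :=
        Finset.sum_nonneg fun l _ => nn _
      refine lt_of_le_of_ne (add_nonneg (nn _) nn') fun h0 => hc0 ?_
      have i1 : ∫ s in (0 : ℝ)..1, pds c (pr s) ^ 2 = 0 := by
        have := nn fun s => pds c (pr s)
        linarith
      have i2 : ∑ l ∈ Finset.Icc 1 r, ∫ s in (0 : ℝ)..1, dnorm l (S, n, c, pr s) ^ 2 = 0 := by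
        rw [i1, zero_add] at h0; exact h0.symm
      have i3 := (Finset.sum_eq_zero_iff_of_nonneg fun l _ => nn _).1 i2
      refine eq_zero_of_edge_data (hpos S hx.1.1) hSn hc ?_ ?_
      · intro s hs
        rw [← hpre s (Ioo_subset_Icc_self hs)]
        exact z_of _ ((continuous_pds c).comp hprc) i1 s hs
      · intro l hl s hs
        rw [← hpre s (Ioo_subset_Icc_self hs)]
        exact z_of _ ((cd l).comp (by fun_prop : Continuous fun s : ℝ =>
          (((⟨(S, n), hx⟩ : k), c), s))) (i3 l hl) s hs)
  refine ⟨κ⁻¹, inv_pos.2 hκ, fun S hS n hn hi c => ?_⟩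
  have h1 := h ⟨(S, n), ⟨hS, by simpa using hn⟩, hi⟩ trivial (red c) (red_zero_zero c)
  rw [← div_eq_inv_mul, le_div_iff₀ hκ, mul_comm]
  refine h1.trans (le_of_eq ?_)
  congr 1
  · refine intervalIntegral.integral_congr fun s hs => ?_
    rw [uIcc_of_le zero_le_one] at hs
    simp only [pds_red, hpre s hs]
  · refine Finset.sum_congr rfl fun l hl => intervalIntegral.integral_congr fun s hs => ?_
    rw [uIcc_of_le zero_le_one] at hs
    simp only [hpre s hs]
    rw [dnorm_red (Finset.mem_Icc.1 hl).1 S n c (hpos S hS (pt_mem_csq hs))]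

/-- The traces of the derivatives of a mapped polynomial. -/
lemma IsConvexQuad.iteratedFDerivWithin_eq {A : Fin 4 → E} (hA : IsConvexQuad A) {r : ℕ}
    {c : Coef r} {φ : E → ℝ} (hφ : ∀ z ∈ csq, φ (xi A z) = pev c z) (l : ℕ) (n : E) {z : E}
    (hz : z ∈ csq) :
    iteratedFDerivWithin ℝ l φ (closure (quad A)) (xi A z) (fun _ => n) =
      dnorm l (shape A, n, c, z) := by
  -- A smooth extension of `φ` across the boundary of the cell, since the inverse of the bilinear
  -- map is smooth on the image of `posHalf`. The one-sided derivatives are the derivatives of `F`.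
  set F : E → ℝ := fun x => pev c (xiInv A x) with hF
  have hx : xi A z ∈ closure (quad A) := by rw [closure_quad]; exact mem_image_of_mem _ hz
  have hFφ : EqOn φ F (closure (quad A)) := by
    rw [closure_quad]
    rintro _ ⟨y, hy, rfl⟩
    rw [hφ y hy, hF]
    simp only [xiInv_xi A (hA.csq_subset hy)]
  have hFs : ∀ z ∈ posHalf (shape A), ContDiffAt ℝ ∞ F (xi A z) := fun z hz =>
    (contDiff_pev c).contDiffAt.comp _ (contDiffAt_xiInv A hz (by simp))
  rw [iteratedFDerivWithin_congr hFφ hx,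
    iteratedFDerivWithin_eq_iteratedFDeriv hA.uniqueDiffOn
      ((hFs z (hA.csq_subset hz)).of_le (by exact_mod_cast le_top)) hx,
    dnorm_eq_iterate l (shape A) n c (hA.csq_subset hz)]
  have hz' := hA.csq_subset hz
  -- The induction differentiates the identity, so it needs the open set `posHalf` in place of the
  -- closed square.
  clear hx hz
  induction l generalizing z with
  | zero => simp [hF, xiInv_xi A hz']
  | succ l ih =>
    rw [iteratedFDeriv_succ_apply_left, Function.iterate_succ_apply']
    have hd : DifferentiableAt ℝ (iteratedFDeriv ℝ l F) (xi A z) :=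
      ((hFs z hz').iteratedFDeriv_right (m := 1) (i := l) (by exact_mod_cast le_top)).differentiableAt
        (by simp)
    have h1 : HasFDerivAt (fun y => iteratedFDeriv ℝ l F y (fun _ => n))
        ((ContinuousMultilinearMap.apply ℝ (fun _ : Fin l => E) ℝ (fun _ => n)).comp
          (fderiv ℝ (iteratedFDeriv ℝ l F) (xi A z))) (xi A z) :=
      (ContinuousMultilinearMap.apply ℝ (fun _ : Fin l => E) ℝ
        (fun _ => n)).hasFDerivAt.comp (xi A z) hd.hasFDerivAt
    have h2 := h1.comp z (hasFDerivAt_xi A z)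
    have h3 := h2.fderiv
    rw [dirDeriv, ← (Filter.EventuallyEq.fderiv_eq (Filter.eventuallyEq_of_mem
      ((isOpen_posHalf _).mem_nhds hz') fun y hy => ih hy)), ← Function.comp_def
        (fun y => iteratedFDeriv ℝ l F y (fun _ => n)), h3]
    simp only [ContinuousLinearMap.comp_apply, jacLin_jacInv (ne_of_gt hz')]
    rfl

/-! ### Rotated corners -/

/-- The corners of a quadrilateral, numbered from the corner `e` on. -/
def rotc (A : Fin 4 → E) (e : Fin 4) : Fin 4 → E := fun i => A (i + e)

lemma xi_rotc_one (A : Fin 4 → E) (z : E) : xi (rotc A 1) z = xi A (rot z) := by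
  have e1 : (1 : Fin 4) + 1 = 2 := rfl
  have e2 : (2 : Fin 4) + 1 = 3 := rfl
  have e3 : (3 : Fin 4) + 1 = 0 := rfl
  ext i
  simp only [xi, bilinearMap, rotc, rot, pt_zero, pt_one, PiLp.add_apply, PiLp.smul_apply,
    smul_eq_mul, zero_add, e1, e2, e3]
  ring

lemma xi_rotc (A : Fin 4 → E) (e : Fin 4) (z : E) :
    xi (rotc A e) z = xi A (rot^[(e : ℕ)] z) := by
  have e2 : rotc A 2 = rotc (rotc A 1) 1 := by
    ext1 i; simp only [rotc, add_assoc]; rfl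
  have e3 : rotc A 3 = rotc (rotc A 2) 1 := by
    ext1 i; simp only [rotc, add_assoc]; rfl
  fin_cases e
  · change xi (fun i => A (i + 0)) z = xi A z
    simp
  · exact xi_rotc_one A z
  · change xi (rotc A 2) z = xi A (rot (rot z))
    rw [e2, xi_rotc_one, xi_rotc_one]
  · change xi (rotc A 3) z = xi A (rot (rot (rot z)))
    rw [e3, xi_rotc_one, e2, xi_rotc_one, xi_rotc_one]

lemma cornerDet_rotc (A : Fin 4 → E) (e i : Fin 4) :
    cornerDet (rotc A e) i = cornerDet A (i + e) := by
  simp only [cornerDet, rotc, add_right_comm]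

lemma IsConvexQuad.rotc {A : Fin 4 → E} (hA : IsConvexQuad A) (e : Fin 4) :
    IsConvexQuad (rotc A e) := fun i => by rw [cornerDet_rotc]; exact hA _

lemma rot_image_sq : rot '' sq = sq := by
  ext z
  constructor
  · rintro ⟨y, hy, rfl⟩; exact rot_mem_sq.2 hy
  · intro hz
    exact ⟨rot (rot (rot z)), rot_mem_sq.2 (rot_mem_sq.2 (rot_mem_sq.2 hz)), rot_rot_rot_rot z⟩

lemma rot_iterate_image_sq (n : ℕ) : rot^[n] '' sq = sq := by
  induction n with
  | zero => simp
  | succ n ih => rw [Function.iterate_succ, image_comp, rot_image_sq, ih]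

lemma rot_iterate_mem_csq (n : ℕ) {z : E} (hz : z ∈ csq) : rot^[n] z ∈ csq := by
  induction n with
  | zero => exact hz
  | succ n ih => rw [Function.iterate_succ_apply']; exact rot_mem_csq ih

lemma quad_rotc (A : Fin 4 → E) (e : Fin 4) : quad (rotc A e) = quad A := by
  rw [quad_eq_image, quad_eq_image, show xi (rotc A e) = xi A ∘ rot^[(e : ℕ)] from
    funext (xi_rotc A e), image_comp, rot_iterate_image_sq]

lemma quadEdge_rotc (A : Fin 4 → E) (e : Fin 4) : quadEdge (rotc A e) 0 = quadEdge A e := by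
  simp [quadEdge, rotc, add_comm]

lemma quadNormal_rotc (A : Fin 4 → E) (e : Fin 4) : quadNormal (rotc A e) 0 = quadNormal A e := by
  simp [quadNormal, rotc, add_comm]

lemma xi_pt_zero (A : Fin 4 → E) (s : ℝ) : xi A (pt s 0) = A 0 + s • (A 1 - A 0) := by
  rw [xi_eq]; simp [shape]

/-! ### Mapped polynomials on a cell -/

section Mapped

variable {A : Fin 4 → E} (hA : IsConvexQuad A) {r : ℕ} {c : Coef r} {φ : E → ℝ}

/-- The polynomial with coefficients `c`, mapped to the cell. -/
def mapped (A : Fin 4 → E) {r : ℕ} (c : Coef r) (x : E) : ℝ := pev c (xiInv A x)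

lemma mapped_xi (A : Fin 4 → E) {r : ℕ} (c : Coef r) {z : E} (hz : z ∈ posHalf (shape A)) :
    mapped A c (xi A z) = pev c z := by rw [mapped, xiInv_xi A hz]

lemma contDiffAt_mapped (A : Fin 4 → E) {r : ℕ} (c : Coef r) {z : E}
    (hz : z ∈ posHalf (shape A)) : ContDiffAt ℝ ∞ (mapped A c) (xi A z) :=
  (contDiff_pev c).contDiffAt.comp _ (contDiffAt_xiInv A hz (by simp))

include hA in
lemma IsConvexQuad.eqOn_mapped (hφ : ∀ z ∈ csq, φ (xi A z) = pev c z) :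
    EqOn φ (mapped A c) (closure (quad A)) := by
  rw [closure_quad]
  rintro _ ⟨z, hz, rfl⟩
  rw [hφ z hz, mapped_xi A c (hA.csq_subset hz)]

lemma hasFDerivAt_mapped (A : Fin 4 → E) {r : ℕ} (c : Coef r) {z : E}
    (hz : z ∈ posHalf (shape A)) : ∃ T : E →L[ℝ] ℝ, HasFDerivAt (mapped A c) T (xi A z) ∧
      ∀ v, T v = pgrad c z (jacInv (shape A) z v) := by
  have hz' : jac (shape A) z ≠ 0 := ne_of_gt hz
  have h1 := (contDiffAt_mapped A c hz).differentiableAt (by simp)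
  refine ⟨_, h1.hasFDerivAt, fun v => ?_⟩
  have h2 : fderiv ℝ (mapped A c) (xi A z) ∘L jacLin (shape A) z = pgrad c z := by
    refine HasFDerivAt.unique (h1.hasFDerivAt.comp z (hasFDerivAt_xi A z)) ?_
    refine (hasFDerivAt_pev c z).congr_of_eventuallyEq ?_
    filter_upwards [(isOpen_posHalf _).mem_nhds hz] with y hy using mapped_xi A c hy
  rw [← h2, ContinuousLinearMap.comp_apply, jacLin_jacInv hz']

include hA in
lemma IsConvexQuad.hasFDerivAt_of_eqOn (hφ : ∀ z ∈ csq, φ (xi A z) = pev c z) {z : E} (hz : z ∈ sq) :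
    ∃ T : E →L[ℝ] ℝ, HasFDerivAt φ T (xi A z) ∧ ∀ v, T v = pgrad c z (jacInv (shape A) z v) := by
  obtain ⟨T, hT, h⟩ := hasFDerivAt_mapped A c (hA.sq_subset hz)
  refine ⟨T, hT.congr_of_eventuallyEq ?_, h⟩
  have hx : xi A z ∈ quad A := by rw [quad_eq_image]; exact mem_image_of_mem _ hz
  filter_upwards [hA.isOpen_quad.mem_nhds hx] with y hy
  exact hA.eqOn_mapped hφ (subset_closure hy)

include hA in
lemma IsConvexQuad.pderiv_eq (hφ : ∀ z ∈ csq, φ (xi A z) = pev c z) (i : Fin 2) {z : E}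
    (hz : z ∈ sq) :
    pderiv i φ (xi A z) = pgrad c z (jacInv (shape A) z (EuclideanSpace.single i 1)) := by
  obtain ⟨T, hT, h⟩ := hA.hasFDerivAt_of_eqOn hφ hz
  rw [pderiv, hT.fderiv, h]

include hA in
lemma IsConvexQuad.continuousOn_pderiv_mapped (c : Coef r) (i : Fin 2) :
    ContinuousOn (pderiv i (mapped A c)) (closure (quad A)) := by
  rw [closure_quad]
  rintro _ ⟨z, hz, rfl⟩
  have h := (contDiffAt_mapped A c (hA.csq_subset hz)).fderiv_right (m := 0) (by simp)
  exact (h.continuousAt.clm_apply continuousAt_const).continuousWithinAt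

include hA in
lemma IsConvexQuad.continuousOn_mapped (c : Coef r) :
    ContinuousOn (mapped A c) (closure (quad A)) := by
  rw [closure_quad]
  rintro _ ⟨z, hz, rfl⟩
  exact (contDiffAt_mapped A c (hA.csq_subset hz)).continuousAt.continuousWithinAt

include hA in
lemma IsConvexQuad.eqOn_pderiv (hφ : ∀ z ∈ csq, φ (xi A z) = pev c z) (i : Fin 2) :
    EqOn (pderiv i φ) (pderiv i (mapped A c)) (quad A) := by
  intro x hx
  rw [pderiv, pderiv, Filter.EventuallyEq.fderiv_eq]
  filter_upwards [hA.isOpen_quad.mem_nhds hx] with y hy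
  exact hA.eqOn_mapped hφ (subset_closure hy)

end Mapped

/-! ### Estimates on cells scaled by the mesh size. -/

/-- The Euclidean norm of the inverse derivative on scaled shapes. -/
lemma norm_tan_le {S : Shape} {ε : ℝ} (hS : S ∈ shapeSet ε) {z : E} (hz : z ∈ csq) :
    ‖tanS S z‖ ≤ 4 ∧ ‖tanT S z‖ ≤ 4 := by
  obtain ⟨h1, h2, h3, h4⟩ := hz
  obtain ⟨k1, k2, k3, -⟩ := hS
  constructor
  · refine (norm_add_le _ _).trans ?_
    rw [norm_smul, Real.norm_eq_abs, abs_of_nonneg h3]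
    nlinarith [norm_nonneg S.2.1]
  · refine (norm_add_le _ _).trans ?_
    rw [norm_smul, Real.norm_eq_abs, abs_of_nonneg h1]
    nlinarith [norm_nonneg S.2.1]

lemma abs_jac_le {S : Shape} {ε : ℝ} (hS : S ∈ shapeSet ε) {z : E} (hz : z ∈ csq) :
    |jac S z| ≤ 16 := by
  obtain ⟨h1, h2⟩ := norm_tan_le hS hz
  refine (abs_det2_le _ _).trans ?_
  nlinarith [norm_nonneg (tanS S z), norm_nonneg (tanT S z)]

lemma abs_jacInv_le {S : Shape} {ε : ℝ} (hε : 0 < ε) (hS : S ∈ shapeSet ε) {z : E} (hz : z ∈ csq)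
    (v : E) (i : Fin 2) : |jacInv S z v i| ≤ 4 / ε * ‖v‖ := by
  obtain ⟨h1, h2⟩ := norm_tan_le hS hz
  have hj := le_jac_of_mem hS hz
  have hj0 : 0 < jac S z := hε.trans_le hj
  have key : ∀ d : ℝ, |d| ≤ 4 * ‖v‖ → |d / jac S z| ≤ 4 / ε * ‖v‖ := fun d hd => by
    rw [abs_div, abs_of_pos hj0, div_mul_eq_mul_div]
    exact div_le_div₀ (by positivity) hd hε hj
  fin_cases i
  · refine key _ ((abs_det2_le _ _).trans ?_)
    nlinarith [norm_nonneg v]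
  · refine key _ ((abs_det2_le _ _).trans ?_)
    nlinarith [norm_nonneg v]

/-- The Jacobian data of a quadrilateral of size `h`. -/
def IsScaled (ε h : ℝ) (A : Fin 4 → E) : Prop := 0 < h ∧ h⁻¹ • shape A ∈ shapeSet ε

lemma IsScaled.shape_eq {ε h : ℝ} {A : Fin 4 → E} (hA : IsScaled ε h A) :
    shape A = h • (h⁻¹ • shape A) := by
  rw [smul_smul, mul_inv_cancel₀ hA.1.ne', one_smul]

lemma pgrad_sq_le {r : ℕ} (c : Coef r) (z v : E) {B : ℝ} (hv : ∀ i, |v i| ≤ B) :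
    pgrad c z v ^ 2 ≤ 2 * B ^ 2 * (pds c z ^ 2 + pdt c z ^ 2) := by
  rw [pgrad_apply]
  have h0 : v 0 ^ 2 ≤ B ^ 2 := by rw [← sq_abs]; exact pow_le_pow_left₀ (abs_nonneg _) (hv 0) 2
  have h1 : v 1 ^ 2 ≤ B ^ 2 := by rw [← sq_abs]; exact pow_le_pow_left₀ (abs_nonneg _) (hv 1) 2
  have h2 := sq_nonneg (pds c z * v 0 - pdt c z * v 1)
  have h3 : (pds c z * v 0) ^ 2 ≤ B ^ 2 * pds c z ^ 2 := by
    rw [mul_pow, mul_comm]; exact mul_le_mul_of_nonneg_right h0 (sq_nonneg _)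
  have h4 : (pdt c z * v 1) ^ 2 ≤ B ^ 2 * pdt c z ^ 2 := by
    rw [mul_pow, mul_comm]; exact mul_le_mul_of_nonneg_right h1 (sq_nonneg _)
  nlinarith

/-- The squared gradient at a point of a cell, in terms of the reference gradient. -/
lemma IsScaled.sum_pderiv_sq_le {ε h : ℝ} (hε : 0 < ε) {A : Fin 4 → E} (hA : IsScaled ε h A)
    (hA' : IsConvexQuad A) {r : ℕ} {c : Coef r} {φ : E → ℝ}
    (hφ : ∀ z ∈ csq, φ (xi A z) = pev c z) {z : E} (hz : z ∈ sq) (i : Fin 2) :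
    pderiv i φ (xi A z) ^ 2 ≤ 32 / ε ^ 2 * (h⁻¹) ^ 2 * (pds c z ^ 2 + pdt c z ^ 2) := by
  rw [hA'.pderiv_eq hφ i hz, hA.shape_eq, jacInv_smul hA.1.ne']
  refine (pgrad_sq_le (B := h⁻¹ * (4 / ε)) c z _ fun k => ?_).trans (le_of_eq ?_)
  · rw [PiLp.smul_apply, smul_eq_mul, abs_mul, abs_of_pos (inv_pos.2 hA.1)]
    have := abs_jacInv_le hε hA.2 (sq_subset_csq hz) (EuclideanSpace.single i 1) k
    rw [show ‖EuclideanSpace.single i (1 : ℝ)‖ = 1 by simp, mul_one] at this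
    exact mul_le_mul_of_nonneg_left this (inv_pos.2 hA.1).le
  · ring

/-- The reference derivatives are the physical derivative applied to the two tangent vectors, whose
lengths are at most `4 h`. -/
lemma IsScaled.grad_sq_le {ε h : ℝ} {A : Fin 4 → E} (hA : IsScaled ε h A)
    (hA' : IsConvexQuad A) {r : ℕ} {c : Coef r} {φ : E → ℝ}
    (hφ : ∀ z ∈ csq, φ (xi A z) = pev c z) {z : E} (hz : z ∈ sq) :
    pds c z ^ 2 + pdt c z ^ 2 ≤ 64 * h ^ 2 * ∑ i, ‖pderiv i φ (xi A z)‖ ^ 2 := by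
  obtain ⟨T, hT, hTv⟩ := hA'.hasFDerivAt_of_eqOn hφ hz
  have hz' : jac (shape A) z ≠ 0 := ne_of_gt (hA'.sq_subset hz)
  have e : ∀ i, pderiv i φ (xi A z) = T (EuclideanSpace.single i 1) := fun i => by
    rw [pderiv, hT.fderiv]
  have hT2 : ∀ v : E, ‖v‖ ≤ 4 * h → T v ^ 2 ≤ 32 * h ^ 2 * ∑ i, ‖pderiv i φ (xi A z)‖ ^ 2 := by
    intro v hv
    have ev : v = v 0 • EuclideanSpace.single (0 : Fin 2) (1 : ℝ) +
        v 1 • EuclideanSpace.single (1 : Fin 2) (1 : ℝ) := by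
      ext i; fin_cases i <;> simp
    have h1 : T v = v 0 * pderiv 0 φ (xi A z) + v 1 * pderiv 1 φ (xi A z) := by
      rw [e, e]; conv_lhs => rw [ev]
      simp
    have n0 := norm_sq_eq v
    have n1 : ‖v‖ ^ 2 ≤ 16 * h ^ 2 := by
      have := pow_le_pow_left₀ (norm_nonneg v) hv 2; nlinarith
    rw [Fin.sum_univ_two, Real.norm_eq_abs, Real.norm_eq_abs, sq_abs, sq_abs, h1]
    set a := pderiv 0 φ (xi A z)
    set b := pderiv 1 φ (xi A z)
    nlinarith [sq_nonneg (v 0 * b - v 1 * a), sq_nonneg a, sq_nonneg b,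
      mul_le_mul_of_nonneg_right n1 (add_nonneg (sq_nonneg a) (sq_nonneg b)), sq_nonneg h]
  have ht : ∀ k : Shape → E → E, (∀ h : ℝ, ∀ S z, k (h • S) z = h • k S z) →
      ‖k (h⁻¹ • shape A) z‖ ≤ 4 → ‖k (shape A) z‖ ≤ 4 * h := by
    intro k hk h4
    rw [hA.shape_eq, hk, norm_smul, Real.norm_eq_abs, abs_of_pos hA.1, mul_comm]
    exact mul_le_mul_of_nonneg_right h4 hA.1.le
  obtain ⟨n1, n2⟩ := norm_tan_le hA.2 (sq_subset_csq hz)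
  have s1 : T (tanS (shape A) z) = pds c z := by
    rw [hTv]
    have := jacInv_jacLin hz' (pt 1 0)
    rw [jacLin_apply] at this
    simp only [pt_zero, pt_one, one_smul, zero_smul, add_zero] at this
    rw [this, pgrad_apply]; simp
  have s2 : T (tanT (shape A) z) = pdt c z := by
    rw [hTv]
    have := jacInv_jacLin hz' (pt 0 1)
    rw [jacLin_apply] at this
    simp only [pt_zero, pt_one, one_smul, zero_smul, zero_add] at this
    rw [this, pgrad_apply]; simp
  have t1 := hT2 _ (ht tanS (fun h S z => by
    simp only [tanS, Prod.smul_fst, Prod.smul_snd, smul_add]; rw [smul_comm]) n1)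
  have t2 := hT2 _ (ht tanT (fun h S z => by
    simp only [tanT, Prod.smul_fst, Prod.smul_snd, smul_add]; rw [smul_comm]) n2)
  rw [s1] at t1
  rw [s2] at t2
  linarith

lemma IsConvexQuad.integrableOn_pderiv {A : Fin 4 → E} (hA : IsConvexQuad A) {r : ℕ} {c : Coef r}
    {φ : E → ℝ} (hφ : ∀ z ∈ csq, φ (xi A z) = pev c z) :
    IntegrableOn (fun x => ∑ i, ‖pderiv i φ x‖ ^ 2) (quad A) := by
  have h1 : IntegrableOn (fun x => ∑ i, ‖pderiv i (mapped A c) x‖ ^ 2) (closure (quad A)) :=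
    ContinuousOn.integrableOn_compact (isCompact_closure_quad A)
      (continuousOn_finsetSum _ fun i _ => (hA.continuousOn_pderiv_mapped c i).norm.pow 2)
  refine (h1.mono_set subset_closure).congr_fun (fun x hx => ?_) hA.isOpen_quad.measurableSet
  exact Finset.sum_congr rfl fun i _ => by rw [hA.eqOn_pderiv hφ i hx]

lemma IsScaled.jac_bounds {ε h : ℝ} {A : Fin 4 → E} (hA : IsScaled ε h A) {z : E} (hz : z ∈ csq) :
    ε * h ^ 2 ≤ jac (shape A) z ∧ jac (shape A) z ≤ 16 * h ^ 2 := by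
  rw [hA.shape_eq, jac_smul]
  have h1 := le_jac_of_mem hA.2 hz
  have h2 := (le_abs_self _).trans (abs_jac_le hA.2 hz)
  have h3 : 0 < h ^ 2 := pow_pos hA.1 2
  constructor <;> nlinarith

lemma integrableOn_sq_of_integrableOn_quad {A : Fin 4 → E} (hA : IsConvexQuad A) {f : E → ℝ}
    (hf : IntegrableOn f (quad A)) :
    IntegrableOn (fun z => jac (shape A) z * f (xi A z)) sq := by
  rw [quad_eq_image, integrableOn_image_iff_integrableOn_abs_det_fderiv_smul volume
    isOpen_sq.measurableSet (fun z _ => (hasFDerivAt_xi A z).hasFDerivWithinAt)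
    ((xi_injOn A).mono hA.sq_subset)] at hf
  refine hf.congr_fun (fun z hz => ?_) isOpen_sq.measurableSet
  simp only [det_jacLin, smul_eq_mul, abs_of_pos (hA.sq_subset hz).out]

/-- On a cell, the `L²` norm of the gradient is equivalent to the norm of the coefficients. -/
lemma exists_gradient_equiv (r : ℕ) {ε : ℝ} (hε : 0 < ε) : ∃ κ₁ > 0, ∃ κ₂ > 0,
    ∀ h : ℝ, ∀ A : Fin 4 → E, IsScaled ε h A → IsConvexQuad A → ∀ c : Coef r, ∀ φ : E → ℝ,
      (∀ z ∈ csq, φ (xi A z) = pev c z) →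
      κ₁ * ‖red c‖ ^ 2 ≤ ∫ x in quad A, ∑ i, ‖pderiv i φ x‖ ^ 2 ∧
      ∫ x in quad A, ∑ i, ‖pderiv i φ x‖ ^ 2 ≤ κ₂ * ‖red c‖ ^ 2 := by
  obtain ⟨κ, hκ, h1⟩ := exists_red_le_integral r
  obtain ⟨C, hC, h2⟩ := exists_grad_le r
  -- In two dimensions the factor `h ^ 2` of the Jacobian cancels the factor `h⁻¹ ^ 2` of the
  -- squared gradient, so neither constant depends on `h`.
  refine ⟨ε / 64 * κ, by positivity, 16 * (64 / ε ^ 2) * C * (volume.real sq + 1), by positivity,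
    fun h A hA hA' c φ hφ => ?_⟩
  have hi := integrableOn_sq_of_integrableOn_quad hA' (hA'.integrableOn_pderiv hφ)
  have hh : 0 < h ^ 2 := pow_pos hA.1 2
  rw [hA'.integral_quad]
  have hcg : Continuous fun z => pds c z ^ 2 + pdt c z ^ 2 :=
    ((continuous_pds c).pow 2).add ((continuous_pdt c).pow 2)
  constructor
  · calc ε / 64 * κ * ‖red c‖ ^ 2 = ε / 64 * (κ * ‖red c‖ ^ 2) := by ring
      _ ≤ ε / 64 * ∫ z in sq, (pds c z ^ 2 + pdt c z ^ 2) := by gcongr; exact h1 c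
      _ = ∫ z in sq, ε / 64 * (pds c z ^ 2 + pdt c z ^ 2) := by rw [integral_const_mul]
      _ ≤ _ := by
        refine setIntegral_mono_on ((integrableOn_sq hcg.continuousOn).const_mul _) hi
          isOpen_sq.measurableSet fun z hz => ?_
        have k1 := hA.grad_sq_le hA' hφ hz
        have k2 := (hA.jac_bounds (sq_subset_csq hz)).1
        have k3 : 0 ≤ ∑ i, ‖pderiv i φ (xi A z)‖ ^ 2 := Finset.sum_nonneg fun _ _ => by positivity
        calc ε / 64 * (pds c z ^ 2 + pdt c z ^ 2)
            ≤ ε / 64 * (64 * h ^ 2 * ∑ i, ‖pderiv i φ (xi A z)‖ ^ 2) := by gcongr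
          _ = ε * h ^ 2 * ∑ i, ‖pderiv i φ (xi A z)‖ ^ 2 := by ring
          _ ≤ _ := by gcongr
  · calc _ ≤ ∫ z in sq, 16 * (64 / ε ^ 2) * C * ‖red c‖ ^ 2 := by
          refine setIntegral_mono_on hi (integrableOn_const volume_sq_lt_top.ne)
            isOpen_sq.measurableSet fun z hz => ?_
          have k1 := fun i => hA.sum_pderiv_sq_le hε hA' hφ hz i
          have k2 := (hA.jac_bounds (sq_subset_csq hz)).2
          have k3 := h2 c z (sq_subset_csq hz)
          have k4 : ∑ i, ‖pderiv i φ (xi A z)‖ ^ 2 ≤ 64 / ε ^ 2 * (h⁻¹) ^ 2 * (C * ‖red c‖ ^ 2) := by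
            rw [Fin.sum_univ_two, Real.norm_eq_abs, Real.norm_eq_abs, sq_abs, sq_abs]
            calc _ ≤ 64 / ε ^ 2 * (h⁻¹) ^ 2 * (pds c z ^ 2 + pdt c z ^ 2) := by
                  have := k1 0; have := k1 1
                  have e : 64 / ε ^ 2 = 2 * (32 / ε ^ 2) := by ring
                  rw [e]; linarith
              _ ≤ _ := by gcongr
          calc _ ≤ 16 * h ^ 2 * (64 / ε ^ 2 * (h⁻¹) ^ 2 * (C * ‖red c‖ ^ 2)) :=
                mul_le_mul k2 k4 (Finset.sum_nonneg fun _ _ => by positivity) (by positivity)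
            _ = 16 * (64 / ε ^ 2) * C * ‖red c‖ ^ 2 := by
              have := hA.1.ne'; field_simp
      _ = 16 * (64 / ε ^ 2) * C * ‖red c‖ ^ 2 * volume.real sq := by simp [mul_comm]
      _ ≤ _ := by
        have : 0 ≤ 16 * (64 / ε ^ 2) * C * ‖red c‖ ^ 2 := by positivity
        nlinarith

/-! ### A cell near the interior of an edge -/

/-- The distance to the line through the edge factors as `z 1` times an affine function that is
positive on the closed square. So `z 1` tells the side of the line. -/
lemma det2_xi_sub (A : Fin 4 → E) (z : E) :
    det2 (A 1 - A 0) (xi A z - A 0) =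
      z 1 * (det2 (shape A).1 (shape A).2.2 + det2 (shape A).1 (shape A).2.1 * z 0) := by
  rw [xi_eq]
  simp only [shape, det2, PiLp.sub_apply, PiLp.add_apply, PiLp.smul_apply, smul_eq_mul]
  ring

lemma IsConvexQuad.mem_quad_iff {A : Fin 4 → E} (hA : IsConvexQuad A) {z : E}
    (hz : z ∈ posHalf (shape A)) : xi A z ∈ quad A ↔ z ∈ sq := by
  rw [quad_eq_image]
  exact ⟨fun ⟨y, hy, h⟩ => xi_injOn A (hA.sq_subset hy) hz h ▸ hy, fun h => mem_image_of_mem _ h⟩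

lemma IsConvexQuad.mem_closure_quad_iff {A : Fin 4 → E} (hA : IsConvexQuad A) {z : E}
    (hz : z ∈ posHalf (shape A)) : xi A z ∈ closure (quad A) ↔ z ∈ csq := by
  rw [closure_quad]
  exact ⟨fun ⟨y, hy, h⟩ => xi_injOn A (hA.csq_subset hy) hz h ▸ hy, fun h => mem_image_of_mem _ h⟩

/-- Near an interior point of an edge, a cell is a half plane. -/
lemma IsConvexQuad.eventually_iff {A : Fin 4 → E} (hA : IsConvexQuad A) {s : ℝ}
    (hs : s ∈ Ioo (0 : ℝ) 1) : ∀ᶠ y in 𝓝 (xi A (pt s 0)),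
      (y ∈ quad A ↔ 0 < det2 (A 1 - A 0) (y - A 0)) ∧
      (y ∈ closure (quad A) ↔ 0 ≤ det2 (A 1 - A 0) (y - A 0)) := by
  set α := det2 (shape A).1 (shape A).2.2
  set β := det2 (shape A).1 (shape A).2.1
  -- On this neighbourhood all constraints of the square but the one on the sign of `z 1` hold
  -- automatically.
  set O : Set E := posHalf (shape A) ∩ {z | 0 < z 0 ∧ z 0 < 1 ∧ z 1 < 1 ∧ 0 < α + β * z 0}
  have hO : IsOpen O := by
    have h0 := continuous_coord 0
    have h1 := continuous_coord 1
    exact (isOpen_posHalf _).inter ((isOpen_lt continuous_const h0).inter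
      ((isOpen_lt h0 continuous_const).inter ((isOpen_lt h1 continuous_const).inter
      (isOpen_lt continuous_const (continuous_const.add (continuous_const.mul h0))))))
  have hp : pt s 0 ∈ posHalf (shape A) := hA.csq_subset (pt_mem_csq (Ioo_subset_Icc_self hs))
  have hm : pt s 0 ∈ O := by
    refine ⟨hp, hs.1, hs.2, by simp, ?_⟩
    have := hp.out
    rw [jac_eq] at this
    simpa using this
  filter_upwards [(isOpen_image_xi A hO inter_subset_left).mem_nhds (mem_image_of_mem _ hm)]
  rintro _ ⟨z, ⟨hz, h1, h2, h3, h4⟩, rfl⟩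
  rw [hA.mem_quad_iff hz, hA.mem_closure_quad_iff hz, det2_xi_sub]
  constructor
  · rw [mul_pos_iff_of_pos_right h4]
    exact ⟨fun h => h.2.2.1, fun h => ⟨h1, h2, h, h3⟩⟩
  · rw [mul_nonneg_iff_of_pos_right h4]
    exact ⟨fun h => h.2.2.1, fun h => ⟨h1.le, h2.le, h, h3.le⟩⟩

/-- The point is approached along the normal obtained by turning `a` by a right angle. -/
lemma frequently_det2_pos {a o x : E} (ha : a ≠ 0) (hx : det2 a (x - o) = 0) :
    ∃ᶠ y in 𝓝 x, 0 < det2 a (y - o) := by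
  have hn : 0 < det2 a (pt (-a 1) (a 0)) := by
    have : det2 a (pt (-a 1) (a 0)) = ‖a‖ ^ 2 := by rw [norm_sq_eq]; simp [det2]; ring
    rw [this]; have := norm_pos_iff.2 ha; positivity
  have ht : Filter.Tendsto (fun τ : ℝ => x + τ • pt (-a 1) (a 0)) (𝓝[>] 0) (𝓝 x) := by
    have : Filter.Tendsto (fun τ : ℝ => x + τ • pt (-a 1) (a 0)) (𝓝 0)
        (𝓝 (x + (0 : ℝ) • pt (-a 1) (a 0))) := Continuous.tendsto (by fun_prop) 0
    simpa using this.mono_left nhdsWithin_le_nhds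
  refine ht.frequently (Filter.Eventually.frequently ?_)
  filter_upwards [self_mem_nhdsWithin] with τ hτ
  rw [add_sub_right_comm, det2_add_right, hx, det2_smul_right, zero_add]
  exact mul_pos hτ hn

lemma det2_pt_zero (A : Fin 4 → E) (s : ℝ) : det2 (A 1 - A 0) (xi A (pt s 0) - A 0) = 0 := by
  rw [det2_xi_sub]; simp

lemma IsConvexQuad.edge_ne {A : Fin 4 → E} (hA : IsConvexQuad A) : A 1 - A 0 ≠ 0 := by
  intro h
  have := hA 0
  simp [cornerDet, h, det2] at this

/-- End points are the extreme points of a segment. Each pair of end points is written with affine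
parameters relative to the other pair. -/
lemma segment_endpoints {x y x' y' : E} (hxy : x ≠ y) (h : segment ℝ x y = segment ℝ x' y') :
    (x' = x ∧ y' = y) ∨ (x' = y ∧ y' = x) := by
  have h1 : x' ∈ segment ℝ x y := h ▸ left_mem_segment ℝ x' y'
  have h2 : y' ∈ segment ℝ x y := h ▸ right_mem_segment ℝ x' y'
  have h3 : x ∈ segment ℝ x' y' := h ▸ left_mem_segment ℝ x y
  have h4 : y ∈ segment ℝ x' y' := h ▸ right_mem_segment ℝ x y
  rw [segment_eq_image'] at h1 h2 h3 h4
  obtain ⟨t, ht, rfl⟩ := h1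
  obtain ⟨u, hu, rfl⟩ := h2
  obtain ⟨v, hv, h3⟩ := h3
  obtain ⟨w, hw, h4⟩ := h4
  have hd : y - x ≠ 0 := sub_ne_zero.2 hxy.symm
  have e1 : (t + v * (u - t)) • (y - x) = 0 := by
    have : x + t • (y - x) + v • (x + u • (y - x) - (x + t • (y - x))) =
      x + (t + v * (u - t)) • (y - x) := by module
    simp only [this] at h3
    simpa using h3
  have e2 : (t + w * (u - t) - 1) • (y - x) = 0 := by
    have : x + t • (y - x) + w • (x + u • (y - x) - (x + t • (y - x))) =
      y + (t + w * (u - t) - 1) • (y - x) := by module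
    simp only [this] at h4
    simpa using h4
  have e1' := (smul_eq_zero.1 e1).resolve_right hd
  have e2' := (smul_eq_zero.1 e2).resolve_right hd
  obtain ⟨ht0, ht1⟩ := ht
  obtain ⟨hu0, hu1⟩ := hu
  obtain ⟨hv0, hv1⟩ := hv
  obtain ⟨hw0, hw1⟩ := hw
  -- The parameter `0` of `x` is a convex combination of the parameters `t, u ≥ 0`, so both terms
  -- vanish; the same argument at the parameter `1` gives the equations for `w`.
  have p1 : (1 - v) * t = 0 := by nlinarith [mul_nonneg (sub_nonneg.2 hv1) ht0, mul_nonneg hv0 hu0]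
  have p2 : v * u = 0 := by nlinarith [mul_nonneg (sub_nonneg.2 hv1) ht0, mul_nonneg hv0 hu0]
  have q1 : (1 - w) * (1 - t) = 0 := by
    nlinarith [mul_nonneg (sub_nonneg.2 hw1) (sub_nonneg.2 ht1), mul_nonneg hw0 (sub_nonneg.2 hu1)]
  have q2 : w * (1 - u) = 0 := by
    nlinarith [mul_nonneg (sub_nonneg.2 hw1) (sub_nonneg.2 ht1), mul_nonneg hw0 (sub_nonneg.2 hu1)]
  rcases mul_eq_zero.1 p1 with h | h
  · have hu' : u = 0 := by
      rcases mul_eq_zero.1 p2 with h' | h'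
      · linarith
      · exact h'
    have hw' : w = 0 := by
      rw [hu'] at q2; linarith
    have ht' : t = 1 := by rw [hw'] at q1; linarith
    right
    rw [ht', hu']
    constructor <;> module
  · have hw' : w = 1 := by rw [h] at q1; linarith
    have hu' : u = 1 := by rw [hw'] at q2; linarith
    left
    rw [h, hu']
    constructor <;> module

/-- Two disjoint cells with a common edge run through it in opposite directions. -/
lemma IsConvexQuad.opposite {A B : Fin 4 → E} (hA : IsConvexQuad A) (hB : IsConvexQuad B)
    (hd : Disjoint (quad A) (quad B)) (h : quadEdge A 0 = quadEdge B 0) :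
    B 0 = A 1 ∧ B 1 = A 0 := by
  have hne : A 0 ≠ A 1 := fun h => hA.edge_ne (by rw [h, sub_self])
  rcases segment_endpoints hne h with ⟨h0, h1⟩ | ⟨h0, h1⟩
  -- With equal directions both cells would lie to the left of the edge, and they would overlap near
  -- its midpoint.
  · exfalso
    have e1 : B 0 = A 0 := h0
    have e2 : B 1 = A 1 := h1
    have hs : (1 / 2 : ℝ) ∈ Ioo (0 : ℝ) 1 := by norm_num
    have k1 := hA.eventually_iff hs
    have k2 := hB.eventually_iff hs
    have hx : xi B (pt (1 / 2) 0) = xi A (pt (1 / 2) 0) := by rw [xi_pt_zero, xi_pt_zero, e1, e2]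
    rw [hx] at k2
    obtain ⟨y, hy, k1, k2⟩ := ((frequently_det2_pos hA.edge_ne
      (det2_pt_zero A (1 / 2))).and_eventually (k1.and k2)).exists
    exact disjoint_left.1 hd (k1.1.2 hy) (k2.1.2 (by rwa [e1, e2]))
  · exact ⟨h0, h1⟩

lemma quadEdge_subset_closure (A : Fin 4 → E) : quadEdge A 0 = (fun s => xi A (pt s 0)) '' Icc 0 1 := by
  simp only [xi_pt_zero]
  exact segment_eq_image' ℝ (A 0) (A 1)

/-- The points of the other three edges. -/
lemma exists_of_mem_quadEdge {A : Fin 4 → E} {e : Fin 4} (he : e ≠ 0) {x : E}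
    (hx : x ∈ quadEdge A e) : ∃ z ∈ csq, xi A z = x ∧ (z 0 = 0 ∨ z 0 = 1 ∨ z 1 = 1) := by
  rw [← quadEdge_rotc, quadEdge_subset_closure] at hx
  obtain ⟨s, hs, rfl⟩ := hx
  simp only [xi_rotc]
  refine ⟨_, rot_iterate_mem_csq _ (pt_mem_csq hs), rfl, ?_⟩
  fin_cases e
  · exact absurd rfl he
  · right; left; simp [rot]
  · right; right; simp [rot]
  · left; simp [rot]

/-- The boundary of a cell consists of its edges. -/
lemma exists_edge_of_mem_closure {A : Fin 4 → E} {x : E} (hx : x ∈ closure (quad A))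
    (hx' : x ∉ quad A) : ∃ e : Fin 4, ∃ s ∈ Icc (0 : ℝ) 1, xi (rotc A e) (pt s 0) = x := by
  rw [closure_quad] at hx
  obtain ⟨z, hz, rfl⟩ := hx
  have hz' : z ∉ sq := fun h => hx' (by rw [quad_eq_image]; exact mem_image_of_mem _ h)
  obtain ⟨h1, h2, h3, h4⟩ := hz
  have : z 1 = 0 ∨ z 0 = 1 ∨ z 1 = 1 ∨ z 0 = 0 := by
    by_contra hcon
    push Not at hcon
    exact hz' ⟨lt_of_le_of_ne h1 (Ne.symm hcon.2.2.2), lt_of_le_of_ne h2 hcon.2.1,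
      lt_of_le_of_ne h3 (Ne.symm hcon.1), lt_of_le_of_ne h4 hcon.2.2.1⟩
  have key : ∀ (e : Fin 4) (s : ℝ), rot^[(e : ℕ)] (pt s 0) = z → xi (rotc A e) (pt s 0) = xi A z :=
    fun e s h => by rw [xi_rotc, h]
  rcases this with h | h | h | h
  · refine ⟨0, z 0, ⟨h1, h2⟩, key 0 _ ?_⟩
    ext i; fin_cases i <;> simp [h]
  · refine ⟨1, z 1, ⟨h3, h4⟩, key 1 _ ?_⟩
    ext i; fin_cases i <;> simp [h, rot]
  · refine ⟨2, 1 - z 0, ⟨by linarith, by linarith⟩, key 2 _ ?_⟩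
    ext i; fin_cases i <;> simp [h, rot]
  · refine ⟨3, 1 - z 1, ⟨by linarith, by linarith⟩, key 3 _ ?_⟩
    ext i; fin_cases i <;> simp [h, rot]

/-! ### Open sets with Lipschitz boundary -/

/-- A point outside `D` lies on or above the graph, and the points strictly above it are not even in
the closure of `D`. -/
lemma IsSubgraphAt.not_mem_interior_closure {P : (ℝ → ℝ) → Prop} (hP : ∀ g, P g → Continuous g)
    {D : Set E} {x : E} (h : IsSubgraphAt P D x) (hx : x ∉ D) : x ∉ interior (closure D) := by
  obtain ⟨b, g, hg, hD⟩ := h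
  have hgc := hP g hg
  intro hi
  have hx0 : g (b.repr x 0) ≤ b.repr x 1 := not_lt.1 fun h => hx (hD.self_of_nhds.2 h)
  have ht : Filter.Tendsto (fun τ : ℝ => x + τ • b 1) (𝓝[>] 0) (𝓝 x) := by
    have : Filter.Tendsto (fun τ : ℝ => x + τ • b 1) (𝓝 0)
        (𝓝 (x + (0 : ℝ) • b 1)) := Continuous.tendsto (by fun_prop) 0
    simpa using this.mono_left nhdsWithin_le_nhds
  have h1 := ht.eventually (hD.eventually_nhds.and (isOpen_interior.mem_nhds hi))
  obtain ⟨τ, ⟨k1, k2⟩, hτ⟩ := (h1.and self_mem_nhdsWithin).exists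
  have hτ' : (0 : ℝ) < τ := hτ
  set y := x + τ • b 1
  have e0 : b.repr y 0 = b.repr x 0 := by simp [y]
  have e1 : b.repr y 1 = b.repr x 1 + τ := by simp [y]
  have hop : ∀ᶠ y' in 𝓝 y, g (b.repr y' 0) < b.repr y' 1 := by
    refine (isOpen_lt ?_ ?_).mem_nhds ?_
    · exact hgc.comp ((continuous_coord 0).comp b.repr.continuous)
    · exact (continuous_coord 1).comp b.repr.continuous
    · change g (b.repr y 0) < b.repr y 1
      rw [e0, e1]; linarith
  have hcl : y ∈ closure D := interior_subset k2
  obtain ⟨y', h3, h4⟩ := ((mem_closure_iff_frequently.1 hcl).and_eventually (k1.and hop)).exists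
  exact absurd (h4.1.1 h3) (not_lt.2 h4.2.le)

/-- Slits and missing points are excluded. This is how coverings by closed sets yield inclusions of
open cells. -/
lemma HasLipschitzBoundary.interior_closure_subset {D : Set E} (h : HasLipschitzBoundary D) :
    interior (closure D) ⊆ D := by
  intro x hx
  by_contra hxD
  have hf : x ∈ frontier D := ⟨interior_subset hx, fun h => hxD (interior_subset h)⟩
  exact (h x hf).not_mem_interior_closure (fun g ⟨L, hL⟩ => hL.continuous) hxD hx

namespace IsFSIDomain

variable {Ω Ωf Ωs : Set E} (hΩ : IsFSIDomain Ω Ωf Ωs)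
include hΩ

/-- Nothing is assumed about the boundary of `Ω` itself. A point outside `Ω` is not on the
interface, so near it only one of the two subdomains is present and the regularity of that one
applies. -/
lemma interior_closure_subset : interior (closure Ω) ⊆ Ω := by
  intro x hx
  by_contra hxΩ
  have hc : x ∈ closure Ωf ∪ closure Ωs := hΩ.closure_eq ▸ interior_subset hx
  have key : ∀ D D' : Set E, closure Ω = closure D ∪ closure D' → HasLipschitzBoundary D → D ⊆ Ω →
      x ∉ closure D' → False := by
    intro D D' hDD hD hsub hx'
    apply hxΩ
    apply hsub
    apply hD.interior_closure_subset
    rw [mem_interior_iff_mem_nhds]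
    filter_upwards [isOpen_interior.mem_nhds hx, isClosed_closure.isOpen_compl.mem_nhds hx']
      with y hy hy'
    have : y ∈ closure D ∪ closure D' := hDD ▸ interior_subset hy
    exact this.resolve_right hy'
  rcases hc with h | h
  · by_cases h' : x ∈ closure Ωs
    · exact hxΩ (hΩ.interface_subset ⟨h, h'⟩)
    · exact key Ωf Ωs hΩ.closure_eq hΩ.lipschitz_fluid hΩ.fluid_subset h'
  · by_cases h' : x ∈ closure Ωf
    · exact hxΩ (hΩ.interface_subset ⟨h', h⟩)
    · exact key Ωs Ωf (by rw [hΩ.closure_eq, union_comm]) hΩ.lipschitz_solid hΩ.solid_subset h'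

end IsFSIDomain

/-! ### Meshes -/

namespace QuadMesh

variable {Ω : Set E} (M : QuadMesh Ω)

lemma isConvex (K : Fin M.n) : IsConvexQuad (M.corner K) := M.cornerDet_pos K

lemma isConvex_rotc (K : Fin M.n) (e : Fin 4) : IsConvexQuad (rotc (M.corner K) e) :=
  (M.isConvex K).rotc e

lemma isOpen_cell (K : Fin M.n) : IsOpen (M.cell K) := (M.isConvex K).isOpen_quad

lemma cell_nonempty (K : Fin M.n) : (M.cell K).Nonempty := quad_nonempty _

lemma quad_rotc_eq_cell (K : Fin M.n) (e : Fin 4) : quad (rotc (M.corner K) e) = M.cell K :=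
  quad_rotc _ _

lemma edge_eq (K : Fin M.n) (e : Fin 4) : M.edge K e = quadEdge (rotc (M.corner K) e) 0 :=
  (quadEdge_rotc _ _).symm

lemma closure_cell_subset (K : Fin M.n) : closure (M.cell K) ⊆ closure Ω := by
  rw [← M.cover]; exact subset_iUnion (fun K => closure (quad (M.corner K))) K

lemma exists_mem_closure_cell {x : E} (hx : x ∈ closure Ω) : ∃ K, x ∈ closure (M.cell K) := by
  rw [← M.cover] at hx; exact mem_iUnion.1 hx

lemma disjoint_closure {K K' : Fin M.n} (h : K ≠ K') :
    Disjoint (M.cell K) (closure (M.cell K')) :=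
  (M.disjoint K K' h).closure_right (M.isOpen_cell K)

variable {M}

lemma eq_of_mem_closure {K K' : Fin M.n} {x : E} (h : x ∈ M.cell K)
    (h' : x ∈ closure (M.cell K')) : K = K' := by
  by_contra hne
  exact disjoint_left.1 (M.disjoint_closure hne) h h'

lemma cell_subset_interior (K : Fin M.n) : M.cell K ⊆ interior (closure Ω) :=
  interior_maximal (subset_closure.trans (M.closure_cell_subset K)) (M.isOpen_cell K)

lemma opposite {K K' : Fin M.n} (hK : K ≠ K') {e e' : Fin 4} (h : M.edge K e = M.edge K' e') :
    rotc (M.corner K') e' 0 = rotc (M.corner K) e 1 ∧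
      rotc (M.corner K') e' 1 = rotc (M.corner K) e 0 := by
  refine (M.isConvex_rotc K e).opposite (M.isConvex_rotc K' e') ?_ ?_
  · rw [quad_rotc, quad_rotc]; exact M.disjoint K K' hK
  · rwa [M.edge_eq, M.edge_eq] at h

lemma xi_opposite {K K' : Fin M.n} (hK : K ≠ K') {e e' : Fin 4} (h : M.edge K e = M.edge K' e')
    (s : ℝ) : xi (rotc (M.corner K) e) (pt s 0) = xi (rotc (M.corner K') e') (pt (1 - s) 0) := by
  obtain ⟨h0, h1⟩ := opposite hK h
  rw [xi_pt_zero, xi_pt_zero, h0, h1]; module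

variable (M)

/-- The edge `e` of `K` is an edge of another cell. -/
def Shared (K : Fin M.n) (e : Fin 4) : Prop :=
  ∃ K', K ≠ K' ∧ closure (M.cell K) ∩ closure (M.cell K') = M.edge K e

variable {M}

/-- The intersection contains two distinct corners, so of the three cases of conformity only a
common edge remains. -/
lemma exists_partner {K K' : Fin M.n} (hK : K ≠ K') {e : Fin 4}
    (h : closure (M.cell K) ∩ closure (M.cell K') = M.edge K e) :
    ∃ e', M.edge K e = M.edge K' e' := by
  have hl : M.corner K e ∈ M.edge K e := left_mem_segment ℝ _ _
  have hr : M.corner K (e + 1) ∈ M.edge K e := right_mem_segment ℝ _ _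
  rcases M.conforming K K' hK with h1 | ⟨a, a', _, h1⟩ | ⟨e1, e1', h1, h2⟩
  · rw [← h, show closure (M.cell K) ∩ closure (M.cell K') = ∅ from h1] at hl
    exact absurd hl (notMem_empty _)
  · rw [← h, show closure (M.cell K) ∩ closure (M.cell K') = {M.corner K a} from h1] at hl hr
    exfalso
    have := (M.isConvex_rotc K e).edge_ne
    simp only [rotc, zero_add, add_comm (1 : Fin 4)] at this
    exact this (by rw [mem_singleton_iff.1 hl, mem_singleton_iff.1 hr, sub_self])
  · exact ⟨e1', by rw [← h]; exact h2.trans h1⟩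

/-- Interior points of shared edges are interior points of the domain. -/
lemma Shared.mem_interior {K : Fin M.n} {e : Fin 4} (h : M.Shared K e) {s : ℝ}
    (hs : s ∈ Ioo (0 : ℝ) 1) : xi (rotc (M.corner K) e) (pt s 0) ∈ interior (closure Ω) := by
  obtain ⟨K', hK, h⟩ := h
  obtain ⟨e', he⟩ := exists_partner hK h
  rw [mem_interior_iff_mem_nhds]
  have k1 := (M.isConvex_rotc K e).eventually_iff hs
  have k2 := (M.isConvex_rotc K' e').eventually_iff
    (show 1 - s ∈ Ioo (0 : ℝ) 1 from ⟨by linarith [hs.2], by linarith [hs.1]⟩)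
  rw [← xi_opposite hK he] at k2
  obtain ⟨h0, h1⟩ := opposite hK he
  filter_upwards [k1, k2] with y hy hy'
  set A := rotc (M.corner K) e
  rcases le_total 0 (det2 (A 1 - A 0) (y - A 0)) with hd | hd
  · refine M.closure_cell_subset K ?_
    rw [← M.quad_rotc_eq_cell K e]; exact hy.2.2 hd
  · refine M.closure_cell_subset K' ?_
    rw [← M.quad_rotc_eq_cell K' e']
    refine hy'.2.2 ?_
    rw [h0, h1]
    have : det2 (A 0 - A 1) (y - A 1) = - det2 (A 1 - A 0) (y - A 0) := by
      simp only [det2, PiLp.sub_apply]; ring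
    rw [this]; linarith

/-- Interior points of edges that are not shared lie on the boundary of the domain. -/
lemma not_mem_interior_of_not_shared {K : Fin M.n} {e : Fin 4} (h : ¬ M.Shared K e) {s : ℝ}
    (hs : s ∈ Ioo (0 : ℝ) 1) : xi (rotc (M.corner K) e) (pt s 0) ∉ interior (closure Ω) := by
  set A := rotc (M.corner K) e with hA
  have hAc : IsConvexQuad A := M.isConvex_rotc K e
  set x := xi A (pt s 0) with hx
  have hz : pt s 0 ∈ csq := pt_mem_csq (Ioo_subset_Icc_self hs)
  have hxK : x ∈ closure (M.cell K) := by
    rw [← M.quad_rotc_eq_cell K e, closure_quad]; exact mem_image_of_mem _ hz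
  have hedge : ∀ e1, x ∈ M.edge K e1 → e1 = e := by
    intro e1 he1
    by_contra hne
    have h1 : M.edge K e1 = quadEdge A (e1 - e) := by
      simp only [edge, quadEdge, hA, rotc]
      rw [sub_add_cancel, add_right_comm, sub_add_cancel]
    rw [h1] at he1
    obtain ⟨z, hz', h2, h3⟩ := exists_of_mem_quadEdge (sub_ne_zero.2 hne) he1
    have h4 := xi_injOn A (hAc.csq_subset hz') (hAc.csq_subset hz) h2
    rw [h4] at h3
    simp only [pt_zero, pt_one] at h3
    rcases h3 with h3 | h3 | h3
    · exact hs.1.ne' h3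
    · exact hs.2.ne h3
    · exact zero_ne_one h3
  -- A second closed cell containing `x` would meet `K` in a corner, which lies on two edges of `K`,
  -- or in an edge that would then be shared.
  have hother : ∀ K', K' ≠ K → x ∉ closure (M.cell K') := by
    intro K' hK' hx'
    have hmem : x ∈ closure (M.cell K) ∩ closure (M.cell K') := ⟨hxK, hx'⟩
    rcases M.conforming K K' hK'.symm with h1 | ⟨a, a', _, h1⟩ | ⟨e1, e1', h1, h2⟩
    · have : closure (M.cell K) ∩ closure (M.cell K') = ∅ := h1
      rw [this] at hmem; exact hmem
    · have : closure (M.cell K) ∩ closure (M.cell K') = {M.corner K a} := h1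
      rw [this] at hmem
      have hxa : x = M.corner K a := hmem
      have e1 : a = e := hedge a (by rw [hxa]; exact left_mem_segment ℝ _ _)
      have e2 : a - 1 = e := hedge (a - 1) (by
        rw [hxa]
        change M.corner K a ∈ segment ℝ (M.corner K (a - 1)) (M.corner K (a - 1 + 1))
        rw [sub_add_cancel]
        exact right_mem_segment ℝ _ _)
      exact (by decide : ∀ a : Fin 4, a - 1 ≠ a) a (e2.trans e1.symm)
    · have h2' : closure (M.cell K) ∩ closure (M.cell K') = M.edge K e1 := h2
      rw [h2'] at hmem
      have := hedge e1 hmem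
      subst this
      exact h ⟨K', hK'.symm, h2'⟩
  intro hint
  have k1 := hAc.eventually_iff hs
  have k2 : ∀ᶠ y in 𝓝 x, ∀ K', K' ≠ K → y ∉ closure (M.cell K') := by
    rw [Filter.eventually_all]
    intro K'
    by_cases hK' : K' = K
    · simp [hK']
    · filter_upwards [isClosed_closure.isOpen_compl.mem_nhds (hother K' hK')] with y hy _ using hy
  -- Points just across the edge are in no closed cell, so they cannot belong to the closure of the
  -- domain.
  have hneg : ∃ᶠ y in 𝓝 x, 0 < det2 (-(A 1 - A 0)) (y - A 0) :=
    frequently_det2_pos (neg_ne_zero.2 hAc.edge_ne) (by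
      rw [det2_neg_left, det2_pt_zero, neg_zero])
  obtain ⟨y, hy, ⟨h1, h2⟩, h3⟩ := (hneg.and_eventually ((k1.and k2).and
    (isOpen_interior.mem_nhds hint))).exists
  obtain ⟨K', hK'⟩ := M.exists_mem_closure_cell (interior_subset h3)
  by_cases hKK : K' = K
  · subst hKK
    rw [← M.quad_rotc_eq_cell K' e] at hK'
    have := h1.2.1 hK'
    rw [det2_neg_left] at hy
    linarith
  · exact h2 K' hKK hK'

/-! ### Position of the cells relative to the two subdomains; consequences of a fine mesh. -/

variable {Ωf Ωs : Set E}

lemma cell_subset (hΩ : IsFSIDomain Ω Ωf Ωs) (K : Fin M.n) : M.cell K ⊆ Ω :=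
  (cell_subset_interior K).trans hΩ.interior_closure_subset

/-- A cell that does not meet the solid lies in the fluid. -/
lemma cell_subset_fluid (hΩ : IsFSIDomain Ω Ωf Ωs) {K : Fin M.n} (hK : K ∉ M.sub Ωs) :
    M.cell K ⊆ Ωf := by
  refine Subset.trans ?_ hΩ.lipschitz_fluid.interior_closure_subset
  refine interior_maximal (fun x hx => ?_) (M.isOpen_cell K)
  have h1 : x ∈ closure Ωf ∪ closure Ωs := hΩ.closure_eq ▸ M.closure_cell_subset K (subset_closure hx)
  refine h1.resolve_right fun h2 => hK ?_
  exact mem_closure_iff.1 h2 _ (M.isOpen_cell K) hx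

lemma closure_fluid_subset (hΩ : IsFSIDomain Ω Ωf Ωs) : closure Ωf ⊆ M.compDomain Ωf := by
  have hcl : IsClosed (M.compDomain Ωf) :=
    (toFinite (M.sub Ωf)).isClosed_biUnion fun K _ => isClosed_closure
  refine closure_minimal (fun x hx => ?_) hcl
  obtain ⟨K, hK⟩ := M.exists_mem_closure_cell (subset_closure (hΩ.fluid_subset hx))
  refine mem_biUnion (show K ∈ M.sub Ωf from ?_) hK
  obtain ⟨y, hy1, hy2⟩ := mem_closure_iff.1 hK _ hΩ.isOpen_fluid hx
  exact ⟨y, hy2, hy1⟩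

/-- A cut cell meets the interface. -/
lemma exists_mem_interface (hΩ : IsFSIDomain Ω Ωf Ωs) {K : Fin M.n} (hf : K ∈ M.sub Ωf)
    (hs : K ∈ M.sub Ωs) : (M.cell K ∩ interface Ωf Ωs).Nonempty := by
  -- The connected cell is covered by the two closures and meets both, so it meets their
  -- intersection.
  have h := isPreconnected_closed_iff.1 (isPreconnected_quad (M.corner K)) (closure Ωf) (closure Ωs)
    isClosed_closure isClosed_closure
    (by rw [← hΩ.closure_eq]; exact subset_closure.trans (M.closure_cell_subset K))
    (hf.mono (inter_subset_inter_right _ subset_closure))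
    (hs.mono (inter_subset_inter_right _ subset_closure))
  exact h

lemma size_nonneg : 0 ≤ M.size := Real.iSup_nonneg fun _ => Metric.diam_nonneg

lemma diam_le_size (K : Fin M.n) : Metric.diam (M.cell K) ≤ M.size :=
  le_ciSup (f := fun K => Metric.diam (M.cell K)) (finite_range _).bddAbove K

lemma isBounded_closure_cell (K : Fin M.n) : Bornology.IsBounded (closure (M.cell K)) :=
  (isCompact_closure_quad _).isBounded

lemma dist_le_size {K : Fin M.n} {x y : E} (hx : x ∈ closure (M.cell K))
    (hy : y ∈ closure (M.cell K)) : dist x y ≤ M.size := by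
  refine (Metric.dist_le_diam_of_mem (isBounded_closure_cell K) hx hy).trans ?_
  rw [Metric.diam_closure]; exact diam_le_size K

lemma corner_mem (K : Fin M.n) (e : Fin 4) : M.corner K e ∈ closure (M.cell K) := by
  rw [← M.quad_rotc_eq_cell K e, closure_quad]
  exact ⟨pt 0 0, pt_mem_csq (by norm_num), by rw [xi_pt_zero]; simp [rotc]⟩

/-- If no edge of a cell is shared, the cell is the whole domain. -/
lemma exists_shared (hΩ : IsFSIDomain Ω Ωf Ωs) (hsize : M.size < Metric.diam Ω) (K : Fin M.n) :
    ∃ e, M.Shared K e := by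
  by_contra hcon
  push Not at hcon
  have hopen : ∀ e, ∀ s ∈ Ioo (0 : ℝ) 1, xi (rotc (M.corner K) e) (pt s 0) ∉ Ω := fun e s hs h =>
    not_mem_interior_of_not_shared (hcon e) hs (interior_maximal subset_closure hΩ.isOpen h)
  -- The end points are included because the complement of the open set `Ω` is closed.
  have hedge : ∀ e, ∀ s ∈ Icc (0 : ℝ) 1, xi (rotc (M.corner K) e) (pt s 0) ∉ Ω := by
    intro e s hs h
    have hc : Continuous fun s => xi (rotc (M.corner K) e) (pt s 0) :=
      (contDiff_xi _ (n := 0)).continuous.comp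
        (contDiff_pt.continuous.comp (by fun_prop : Continuous fun s : ℝ => (s, (0 : ℝ))))
    have h1 : s ∈ closure (Ioo (0 : ℝ) 1) := by rwa [closure_Ioo (zero_ne_one' ℝ)]
    obtain ⟨s', hs', hs''⟩ := mem_closure_iff.1 h1 _ (hΩ.isOpen.preimage hc) h
    exact hopen e s' hs'' hs'
  -- The connected set `Ω` avoids the boundary of the cell and meets the cell, so it lies inside,
  -- contradicting the diameters.
  have hsub : Ω ⊆ M.cell K := by
    refine hΩ.isConnected.isPreconnected.subset_left_of_subset_union (M.isOpen_cell K)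
      (isClosed_closure (s := M.cell K)).isOpen_compl
      (disjoint_compl_right.mono_left subset_closure) ?_ ?_
    · intro x hx
      by_cases h1 : x ∈ closure (M.cell K)
      · left
        by_contra h2
        obtain ⟨e, s, hs, rfl⟩ := exists_edge_of_mem_closure h1 h2
        exact hedge e s hs hx
      · exact Or.inr h1
    · obtain ⟨x, hx⟩ := M.cell_nonempty K
      exact ⟨x, cell_subset hΩ K hx, hx⟩
  have := Metric.diam_mono hsub ((isBounded_closure_cell K).subset subset_closure)
  linarith [diam_le_size K]

/-- For fine meshes, all edges of the cut cells are shared. -/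
lemma exists_forall_shared (hΩ : IsFSIDomain Ω Ωf Ωs) : ∃ h₀ > 0, ∀ M : QuadMesh Ω, M.size ≤ h₀ →
    ∀ K, K ∈ M.sub Ωf → K ∈ M.sub Ωs → ∀ e, M.Shared K e := by
  have hcomp : IsCompact (interface Ωf Ωs) := by
    refine Metric.isCompact_of_isClosed_isBounded (isClosed_closure.inter isClosed_closure) ?_
    exact hΩ.isBounded.subset hΩ.interface_subset
  -- The compact interface keeps a distance `δ` from the complement of `Ω`. The midpoint of an
  -- unshared edge is outside `Ω`, but in a cut cell it is within the mesh size of the interface.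
  obtain ⟨δ, hδ, h⟩ := hcomp.exists_thickening_subset_open hΩ.isOpen hΩ.interface_subset
  refine ⟨δ / 2, by positivity, fun M hM K hf hs e => ?_⟩
  obtain ⟨x, hx, hxi⟩ := exists_mem_interface hΩ hf hs
  by_contra hns
  have hz : pt (1 / 2) 0 ∈ csq := pt_mem_csq (by norm_num)
  have hy : xi (rotc (M.corner K) e) (pt (1 / 2) 0) ∈ closure (M.cell K) := by
    rw [← M.quad_rotc_eq_cell K e, closure_quad]; exact mem_image_of_mem _ hz
  refine not_mem_interior_of_not_shared hns (s := 1 / 2) (by norm_num)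
    (interior_maximal subset_closure hΩ.isOpen (h ?_))
  rw [Metric.mem_thickening_iff]
  exact ⟨x, hxi, (dist_le_size hy (subset_closure hx)).trans_lt (by linarith)⟩

/-- The neighbours of a cell are determined by the common edge. -/
lemma neighbour_unique {L K₁ K₂ : Fin M.n} (h1 : K₁ ≠ L) (h2 : K₂ ≠ L) {e e₁ e₂ : Fin 4}
    (he1 : M.edge L e = M.edge K₁ e₁) (he2 : M.edge L e = M.edge K₂ e₂) : K₁ = K₂ := by
  by_contra hne
  -- Three cells at one edge would have pairwise opposite orientations of it.
  have k1 := opposite h1.symm he1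
  have k2 := opposite h2.symm he2
  have k3 := opposite hne (he1.symm.trans he2)
  refine (M.isConvex_rotc K₁ e₁).edge_ne ?_
  rw [k1.2, k1.1, ← k2.2, ← k2.1]
  rw [k3.1, k3.2, k1.2, k1.1, sub_eq_zero]
  rw [← k1.1, ← k1.2, ← k3.1, k2.1, k1.1]

/-- A shape-regular cell, scaled by the mesh size, has its shape in a compact set. -/
lemma isScaled_of_regular {σ : ℝ} {K : Fin M.n} (h1 : M.size ≤ σ * Metric.diam (M.cell K))
    (h2 : ∀ e, Metric.diam (M.cell K) ^ 2 ≤ σ * cornerDet (M.corner K) e) (e : Fin 4) :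
    IsScaled (1 / (|σ| ^ 3 + 1)) M.size (rotc (M.corner K) e) := by
  set d := Metric.diam (M.cell K)
  have hd0 : 0 ≤ d := Metric.diam_nonneg
  have hdist : ∀ a b, dist (M.corner K a) (M.corner K b) ≤ d := fun a b => by
    have := Metric.dist_le_diam_of_mem (isBounded_closure_cell K) (corner_mem K a) (corner_mem K b)
    rwa [Metric.diam_closure] at this
  have hd : 0 < d := by
    have h3 := (M.isConvex K).edge_ne
    have h4 := hdist 1 0
    rw [dist_eq_norm] at h4
    exact (norm_pos_iff.2 h3).trans_le h4
  have hds := diam_le_size K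
  have hs : 0 < M.size := hd.trans_le hds
  have hσ0 : 0 < σ := by
    by_contra hcon
    have := mul_nonpos_of_nonpos_of_nonneg (not_lt.1 hcon) hd0
    linarith
  -- Quasi-uniformity contributes `σ ^ 2` and shape regularity one more factor: the squared mesh
  -- size is at most `σ ^ 3` times each corner determinant.
  have hdet : ∀ i, 1 / (|σ| ^ 3 + 1) ≤ M.size⁻¹ ^ 2 * cornerDet (rotc (M.corner K) e) i := by
    intro i
    rw [cornerDet_rotc, abs_of_pos hσ0, inv_pow, ← div_eq_inv_mul,
      div_le_div_iff₀ (by positivity) (by positivity), one_mul]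
    have h3 := h2 (i + e)
    set D := cornerDet (M.corner K) (i + e)
    have h4 : M.size ^ 2 ≤ σ ^ 2 * d ^ 2 := by
      rw [← mul_pow]; exact pow_le_pow_left₀ hs.le h1 2
    have h5 : σ ^ 2 * d ^ 2 ≤ σ ^ 2 * (σ * D) := mul_le_mul_of_nonneg_left h3 (by positivity)
    have h6 : 0 < D := M.cornerDet_pos K _
    nlinarith
  have hnorm : ∀ v : E, ∀ k : ℝ, ‖v‖ ≤ k * M.size → ‖M.size⁻¹ • v‖ ≤ k := fun v k hv => by
    rw [norm_smul, norm_inv, Real.norm_eq_abs, abs_of_pos hs, ← div_eq_inv_mul, div_le_iff₀ hs]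
    exact hv
  have hn : ∀ a b, ‖rotc (M.corner K) e a - rotc (M.corner K) e b‖ ≤ M.size := fun a b => by
    rw [← dist_eq_norm]; exact (hdist _ _).trans hds
  obtain ⟨c0, c1, c2, c3⟩ := jac_corners (rotc (M.corner K) e)
  refine ⟨hs, ?_, ?_, ?_, ?_, ?_, ?_, ?_⟩
  · exact hnorm _ 2 (by have := hn 1 0; simp only [shape]; linarith)
  · refine hnorm _ 2 ?_
    have e1 : (shape (rotc (M.corner K) e)).2.1 = (rotc (M.corner K) e 2 - rotc (M.corner K) e 1) -
      (rotc (M.corner K) e 3 - rotc (M.corner K) e 0) := by simp only [shape]; abel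
    rw [e1]
    refine (norm_sub_le _ _).trans ?_
    linarith [hn 2 1, hn 3 0]
  · exact hnorm _ 2 (by have := hn 3 0; simp only [shape]; linarith)
  · rw [jac_smul, ← c0]; exact hdet 0
  · rw [jac_smul, ← c1]; exact hdet 1
  · rw [jac_smul, ← c2]; exact hdet 2
  · rw [jac_smul, ← c3]; exact hdet 3

/-- The cells of a quasi-uniform family, scaled by the mesh size, have shapes in a compact set. -/
lemma _root_.CutFEM.IsQuasiUniform.exists_isScaled {J : Type*} {𝒯 : J → QuadMesh Ω}
    (h : IsQuasiUniform 𝒯) : ∃ ε > 0, ∀ j K e,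
      IsScaled ε (𝒯 j).size (rotc ((𝒯 j).corner K) e) := by
  obtain ⟨σ, hσ⟩ := h
  exact ⟨1 / (|σ| ^ 3 + 1), by positivity,
    fun j K e => isScaled_of_regular (hσ j K).1 (hσ j K).2 e⟩

/-- Finite element functions are mapped polynomials on closed cells. -/
lemma exists_coef_of_mem_feSpace {D : Set E} {r : ℕ} {φ : E → ℝ} (hφ : φ ∈ M.feSpace D r)
    {K : Fin M.n} (hK : K ∈ M.sub D) (e : Fin 4) :
    ∃ c : Coef r, ∀ z ∈ csq, φ (xi (rotc (M.corner K) e) z) = pev c z := by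
  obtain ⟨hc, h⟩ := hφ
  obtain ⟨q, hq, hqe⟩ := h K hK
  obtain ⟨c, hcq⟩ := exists_coef (Qsp.comp_rot_iterate (eval_mem_Qsp hq) (e : ℕ))
  refine ⟨c, ?_⟩
  have h1 : ∀ z ∈ csq, φ (xi (M.corner K) z) = MvPolynomial.eval ![z 0, z 1] q := by
    have hcont : ContinuousOn (fun z => φ (xi (M.corner K) z)) csq := by
      refine hc.comp (contDiff_xi _ (n := 0)).continuous.continuousOn fun z hz => ?_
      refine mem_biUnion hK ?_
      rw [cell, closure_quad]; exact mem_image_of_mem _ hz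
    have hpc : Continuous fun z : E => MvPolynomial.eval ![z 0, z 1] q :=
      continuous_of_mem_Qsp (eval_mem_Qsp hq)
    have heq : EqOn (fun z => φ (xi (M.corner K) z)) (fun z : E => MvPolynomial.eval ![z 0, z 1] q)
        sq := fun z hz => hqe (z 0) ⟨hz.1, hz.2.1⟩ (z 1) ⟨hz.2.2.1, hz.2.2.2⟩
    -- Both sides are continuous up to the boundary of the cell.
    exact heq.of_subset_closure hcont hpc.continuousOn sq_subset_csq csq_subset_closure_sq
  intro z hz
  rw [xi_rotc, h1 _ (rot_iterate_mem_csq _ hz)]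
  exact congrFun hcq z

end QuadMesh

/-! ### Integrals over edges -/

/-- The parametrization by arc length is an isometry, so it carries Lebesgue measure to the
Hausdorff measure on its range. -/
lemma setIntegral_segment (o : E) {a : E} (ha : a ≠ 0) (f : E → ℝ) :
    ∫ x in (fun s : ℝ => o + s • a) '' Icc 0 1, f x ∂μH[1] =
      ‖a‖ * ∫ s in (0 : ℝ)..1, f (o + s • a) := by
  have hn : 0 < ‖a‖ := norm_pos_iff.2 ha
  set γ : ℝ → E := fun t => o + t • (‖a‖⁻¹ • a) with hγ
  have hiso : Isometry γ := by
    refine Isometry.of_dist_eq fun x y => ?_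
    rw [hγ, dist_add_left, dist_eq_norm, ← sub_smul, norm_smul, norm_smul, norm_inv, norm_norm,
      inv_mul_cancel₀ hn.ne', mul_one, dist_eq_norm]
  have hme : MeasurableEmbedding γ := hiso.isClosedEmbedding.measurableEmbedding
  have himg : (fun s : ℝ => o + s • a) '' Icc 0 1 = γ '' Icc 0 ‖a‖ := by
    ext x
    constructor
    · rintro ⟨s, hs, rfl⟩
      refine ⟨s * ‖a‖, ⟨mul_nonneg hs.1 hn.le, mul_le_of_le_one_left hn.le hs.2⟩, ?_⟩
      simp only [hγ, smul_smul, mul_assoc, mul_inv_cancel₀ hn.ne', mul_one]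
    · rintro ⟨t, ht, rfl⟩
      exact ⟨t / ‖a‖, ⟨div_nonneg ht.1 hn.le, (div_le_one hn).2 ht.2⟩,
        by simp only [hγ, smul_smul, div_eq_mul_inv]⟩
  have hmap : Measure.map γ volume = (μH[1] : Measure E).restrict (range γ) := by
    rw [← hausdorffMeasure_real, hiso.map_hausdorffMeasure (Or.inl zero_le_one)]
  rw [himg, ← inter_eq_self_of_subset_left (image_subset_range γ (Icc 0 ‖a‖)),
    ← Measure.restrict_restrict (hme.measurableSet_image.2 measurableSet_Icc), ← hmap,
    hme.setIntegral_map, hiso.injective.preimage_image, integral_Icc_eq_integral_Ioc,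
    ← intervalIntegral.integral_of_le hn.le]
  have h1 := intervalIntegral.mul_integral_comp_mul_right (a := 0) (b := 1)
    (f := fun t => f (γ t)) ‖a‖
  rw [zero_mul, one_mul] at h1
  rw [← h1]
  simp only [hγ, smul_smul, mul_assoc, mul_inv_cancel₀ hn.ne', mul_one]

lemma norm_quadNormal {A : Fin 4 → E} (hA : IsConvexQuad A) : ‖quadNormal A 0‖ = 1 := by
  have h := norm_pos_iff.2 hA.edge_ne
  have h1 : ‖(!₂[(A (0 + 1) - A 0) 1, -(A (0 + 1) - A 0) 0] : E)‖ = ‖A 1 - A 0‖ := by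
    rw [EuclideanSpace.norm_eq, EuclideanSpace.norm_eq]
    simp only [Fin.sum_univ_two, Real.norm_eq_abs, sq_abs, zero_add, WithLp.ofLp_toLp,
      Matrix.cons_val_zero, Matrix.cons_val_one, PiLp.sub_apply]
    congr 1; ring
  rw [quadNormal, norm_smul, h1, norm_inv, norm_norm]
  exact inv_mul_cancel₀ h.ne'

lemma inner_quadNormal (A : Fin 4 → E) : inner ℝ (A 1 - A 0) (quadNormal A 0) = 0 := by
  rw [quadNormal, inner_smul_right]
  simp [PiLp.inner_apply, Fin.sum_univ_two]
  right; ring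

/-- The Jacobian at a corner is at most the product of the adjacent sides, and the other side has
length at most `2 h`. -/
lemma IsScaled.le_norm_edge {ε h : ℝ} {A : Fin 4 → E} (hA : IsScaled ε h A) :
    ε / 2 * h ≤ ‖A 1 - A 0‖ := by
  have h1 := (hA.jac_bounds (z := 0) (by simp [csq])).1
  have h2 : |jac (shape A) 0| ≤ ‖A 1 - A 0‖ * ‖A 3 - A 0‖ := by
    refine le_trans (le_of_eq ?_) (abs_det2_le _ _)
    simp [jac, tanS, tanT, shape]
  have h3 : ‖A 3 - A 0‖ ≤ 2 * h := by
    have := hA.2.2.2.1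
    rw [Prod.smul_snd, Prod.smul_snd, norm_smul, norm_inv, Real.norm_eq_abs, abs_of_pos hA.1,
      ← div_eq_inv_mul, div_le_iff₀ hA.1] at this
    exact this
  have h4 : ε * h ^ 2 ≤ ‖A 1 - A 0‖ * (2 * h) :=
    h1.trans ((le_abs_self _).trans (h2.trans (mul_le_mul_of_nonneg_left h3 (norm_nonneg _))))
  have h5 := hA.1
  have : 0 ≤ h * (2 * ‖A 1 - A 0‖ - ε * h) := by nlinarith
  have := nonneg_of_mul_nonneg_right this h5
  linarith

lemma continuousOn_dnorm_edge {r : ℕ} (l : ℕ) {ε : ℝ} (hε : 0 < ε) {S : Shape}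
    (hS : S ∈ shapeSet ε) (n : E) (c : Coef r) :
    ContinuousOn (fun s : ℝ => dnorm l (S, n, c, pt s 0)) (Icc 0 1) := by
  refine (contDiffOn_dnorm l).continuousOn.comp (t := nondeg r)
    (f := fun s : ℝ => (S, n, c, pt s 0)) ?_ fun s hs =>
      ne_of_gt (hε.trans_le (le_jac_of_mem hS (pt_mem_csq hs)))
  have : Continuous fun s : ℝ => pt s 0 :=
    contDiff_pt.continuous.comp (by fun_prop : Continuous fun s : ℝ => (s, (0 : ℝ)))
  exact (by fun_prop : Continuous fun s : ℝ => (S, n, c, pt s 0)).continuousOn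

/-! ### Transfer of the gradient across a single face. -/

namespace QuadMesh

variable {Ω Ωf Ωs : Set E} {M : QuadMesh Ω}

/-- The squared `L²` norm of the gradient on one cell. -/
def cellGrad (M : QuadMesh Ω) (φ : E → ℝ) (K : Fin M.n) : ℝ :=
  ∫ x in M.cell K, ∑ i, ‖pderiv i φ x‖ ^ 2

/-- The scaled jumps of the normal derivatives over an edge. -/
def faceJump (M : QuadMesh Ω) (r : ℕ) (φ : E → ℝ) (K : Fin M.n) (e : Fin 4) (K' : Fin M.n) : ℝ :=
  ∑ l ∈ Finset.Icc 1 r, M.size ^ (2 * l + 1) *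
    ∫ x in M.edge K e, M.jump K e K' l φ x * M.jump K e K' l φ x ∂μH[1]

lemma cellGrad_nonneg (φ : E → ℝ) (K : Fin M.n) : 0 ≤ M.cellGrad φ K :=
  integral_nonneg fun _ => Finset.sum_nonneg fun _ _ => sq_nonneg _

lemma faceJump_nonneg (r : ℕ) (φ : E → ℝ) (K : Fin M.n) (e : Fin 4) (K' : Fin M.n) :
    0 ≤ M.faceJump r φ K e K' :=
  Finset.sum_nonneg fun _ _ => mul_nonneg (pow_nonneg size_nonneg _)
    (integral_nonneg fun _ => mul_self_nonneg _)

/-- The tangential derivatives from the two sides of an edge agree. -/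
lemma pds_opposite {r : ℕ} {K K' : Fin M.n} (hK : K ≠ K') {e e' : Fin 4}
    (h : M.edge K e = M.edge K' e') {φ : E → ℝ} {c c' : Coef r}
    (hc : ∀ z ∈ csq, φ (xi (rotc (M.corner K) e) z) = pev c z)
    (hc' : ∀ z ∈ csq, φ (xi (rotc (M.corner K') e') z) = pev c' z) (s : ℝ) (hs : s ∈ Ioo (0 : ℝ) 1) :
    pds c (pt s 0) = -pds c' (pt (1 - s) 0) := by
  have hd : ∀ (c : Coef r) (s : ℝ), HasDerivAt (fun s => pev c (pt s 0)) (pds c (pt s 0)) s := by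
    intro c s
    have h2 : HasDerivAt (fun s : ℝ => pt s 0) (pt 1 0) s := by
      rw [show (fun s : ℝ => pt s 0) = fun s : ℝ => s • pt 1 0 from by
        ext s i; fin_cases i <;> simp [pt]]
      simpa using (hasDerivAt_id s).smul_const (pt 1 0)
    have := (hasFDerivAt_pev c (pt s 0)).comp_hasDerivAt s h2
    rwa [pgrad_apply, pt_zero, pt_one, mul_one, mul_zero, add_zero] at this
  have h1 := hd c s
  have h2 : HasDerivAt (fun s => pev c' (pt (1 - s) 0)) (-pds c' (pt (1 - s) 0)) s := by
    have := (hd c' (1 - s)).comp_const_sub 1 s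
    exact this
  refine h1.unique (h2.congr_of_eventuallyEq ?_)
  filter_upwards [isOpen_Ioo.mem_nhds hs] with t ht
  rw [← hc _ (pt_mem_csq (Ioo_subset_Icc_self ht)), xi_opposite hK h,
    hc' _ (pt_mem_csq ⟨by linarith [ht.2], by linarith [ht.1]⟩)]

/-- The gradient on one side of a face is controlled by the gradient on the other side and the
jumps of the normal derivatives. -/
theorem exists_cellGrad_le (r : ℕ) {ε : ℝ} (hε : 0 < ε) : ∃ C ≥ 1, ∀ (Ω : Set E) (M : QuadMesh Ω),
    (∀ K e, IsScaled ε M.size (rotc (M.corner K) e)) → ∀ (D : Set E), ∀ φ ∈ M.feSpace D r,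
    ∀ (K : Fin M.n) (e : Fin 4) (K' : Fin M.n), K ≠ K' → K ∈ M.sub D → K' ∈ M.sub D →
      closure (M.cell K) ∩ closure (M.cell K') = M.edge K e →
      M.size ^ 2 * M.cellGrad φ K ≤ C * (M.size ^ 2 * M.cellGrad φ K' + M.faceJump r φ K e K') := by
  obtain ⟨κ₁, hκ₁, κ₂, hκ₂, hequiv⟩ := exists_gradient_equiv r hε
  obtain ⟨C1, hC1, hred⟩ := exists_red_le_edge r hε
  obtain ⟨C2, hC2, hgrad⟩ := exists_grad_le r
  have hex : ∀ l : ℕ, ∃ C > 0, 1 ≤ l → ∀ S ∈ shapeSet ε,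
    ∀ n : E, ‖n‖ = 1 → ∀ c : Coef r, ∀ z ∈ csq, dnorm l (S, n, c, z) ^ 2 ≤ C * ‖red c‖ ^ 2 := by
    intro l
    by_cases hl : 1 ≤ l
    · obtain ⟨C, hC, h⟩ := exists_dnorm_sq_le r l hl hε
      exact ⟨C, hC, fun _ => h⟩
    · exact ⟨1, one_pos, fun h => absurd h hl⟩
  choose C3 hC3 hdn using hex
  set C4 := C2 + ∑ l ∈ Finset.Icc 1 r, 2 * C3 l with hC4
  have hC4p : 0 < C4 := add_pos_of_pos_of_nonneg hC2
    (Finset.sum_nonneg fun l _ => by linarith [hC3 l])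
  refine ⟨κ₂ * C1 * (C4 / κ₁ + 4 / ε) + 1, le_add_of_nonneg_left (by positivity),
    fun Ω M hsc D φ hφ K e K' hKK' hK hK' hedge => ?_⟩
  obtain ⟨e', he'⟩ := exists_partner hKK' hedge
  obtain ⟨c, hc⟩ := exists_coef_of_mem_feSpace hφ hK e
  obtain ⟨c', hc'⟩ := exists_coef_of_mem_feSpace hφ hK' e'
  set A := rotc (M.corner K) e with hA
  set A' := rotc (M.corner K') e' with hA'
  have hAs : IsScaled ε M.size A := hsc K e
  have hAs' : IsScaled ε M.size A' := hsc K' e'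
  have hAc : IsConvexQuad A := M.isConvex_rotc K e
  have hAc' : IsConvexQuad A' := M.isConvex_rotc K' e'
  set h := M.size with hh
  have hpos : 0 < h := hAs.1
  set S := h⁻¹ • shape A with hS
  set S' := h⁻¹ • shape A' with hS'
  set n := quadNormal (M.corner K) e with hn
  have hn0 : n = quadNormal A 0 := by rw [hn, hA, quadNormal_rotc]
  have hn1 : ‖n‖ = 1 := by rw [hn0]; exact norm_quadNormal hAc
  have hn2 : inner ℝ S.1 n = 0 := by
    rw [hS, Prod.smul_fst, inner_smul_left, hn0]
    change _ * inner ℝ (A 1 - A 0) _ = 0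
    rw [inner_quadNormal, mul_zero]
  have g1 : M.cellGrad φ K ≤ κ₂ * ‖red c‖ ^ 2 := by
    have := (hequiv h A hAs hAc c φ hc).2
    rwa [hA, M.quad_rotc_eq_cell] at this
  have g2 : κ₁ * ‖red c'‖ ^ 2 ≤ M.cellGrad φ K' := by
    have := (hequiv h A' hAs' hAc' c' φ hc').1
    rwa [hA', M.quad_rotc_eq_cell] at this
  have hjac : ∀ {A : Fin 4 → E}, IsScaled ε h A → csq ⊆ posHalf (h⁻¹ • shape A) :=
    fun hA z hz => hε.trans_le (le_jac_of_mem hA.2 hz)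
  have hD : ∀ l, ∀ s ∈ Icc (0 : ℝ) 1, M.normalDeriv K e K l φ (xi A (pt s 0)) =
      (h⁻¹) ^ l * dnorm l (S, n, c, pt s 0) := by
    intro l s hs
    rw [normalDeriv, ← M.quad_rotc_eq_cell K e, hAc.iteratedFDerivWithin_eq hc l _ (pt_mem_csq hs),
      ← dnorm_smul_shape hpos.ne' l S n c (hjac hAs (pt_mem_csq hs)), ← hAs.shape_eq]
  have hD' : ∀ l, ∀ s ∈ Icc (0 : ℝ) 1, M.normalDeriv K e K' l φ (xi A (pt s 0)) =
      (h⁻¹) ^ l * dnorm l (S', n, c', pt (1 - s) 0) := by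
    intro l s hs
    have hs' : 1 - s ∈ Icc (0 : ℝ) 1 := ⟨by linarith [hs.2], by linarith [hs.1]⟩
    rw [normalDeriv, ← M.quad_rotc_eq_cell K' e', hA, xi_opposite hKK' he',
      hAc'.iteratedFDerivWithin_eq hc' l _ (pt_mem_csq hs'),
      ← dnorm_smul_shape hpos.ne' l S' n c' (hjac hAs' (pt_mem_csq hs')), ← hAs'.shape_eq]
  have hJ : ∀ l, ∫ x in M.edge K e, M.jump K e K' l φ x * M.jump K e K' l φ x ∂μH[1] =
      ‖A 1 - A 0‖ * ∫ s in (0 : ℝ)..1, ((h⁻¹) ^ l * dnorm l (S, n, c, pt s 0) -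
        (h⁻¹) ^ l * dnorm l (S', n, c', pt (1 - s) 0)) ^ 2 := by
    intro l
    rw [M.edge_eq, quadEdge_subset_closure]
    simp only [← hA, xi_pt_zero]
    rw [setIntegral_segment _ hAc.edge_ne]
    congr 1
    refine intervalIntegral.integral_congr fun s hs => ?_
    rw [uIcc_of_le zero_le_one] at hs
    simp only [← xi_pt_zero, jump, hD l s hs, hD' l s hs]
    ring
  have hle := hAs.le_norm_edge
  -- The length of the edge, at least `ε h / 2`, provides the missing power: `h⁻¹ ^ 2 * h ^ (2 * l +
  -- 1)` times this length is at least `ε / 2 * h ^ (2 * l)`.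
  have ip : ∀ l, (h ^ (2 * l)) * ∫ s in (0 : ℝ)..1, ((h⁻¹) ^ l * dnorm l (S, n, c, pt s 0) -
        (h⁻¹) ^ l * dnorm l (S', n, c', pt (1 - s) 0)) ^ 2 ≤ 2 / ε * (h⁻¹ ^ 2 *
      (h ^ (2 * l + 1) * ∫ x in M.edge K e, M.jump K e K' l φ x * M.jump K e K' l φ x ∂μH[1])) := by
    intro l
    rw [hJ]
    set I := ∫ s in (0 : ℝ)..1, ((h⁻¹) ^ l * dnorm l (S, n, c, pt s 0) -
        (h⁻¹) ^ l * dnorm l (S', n, c', pt (1 - s) 0)) ^ 2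
    have hI : 0 ≤ I := intervalIntegral.integral_nonneg zero_le_one fun s _ => sq_nonneg _
    have h1 : 2 / ε * (h⁻¹ ^ 2 * (h ^ (2 * l + 1) * (‖A 1 - A 0‖ * I))) =
        (h ^ (2 * l) * I) * (2 / ε * h⁻¹ * ‖A 1 - A 0‖) := by
      field_simp
      ring
    rw [h1]
    refine le_mul_of_one_le_right (by positivity) ?_
    have h2 : (1 : ℝ) = 2 / ε * h⁻¹ * (ε / 2 * h) := by field_simp
    exact h2.le.trans (mul_le_mul_of_nonneg_left hle (by positivity))
  have il : ∀ l ∈ Finset.Icc 1 r, ∫ s in (0 : ℝ)..1, dnorm l (S, n, c, pt s 0) ^ 2 ≤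
      4 / ε * (h⁻¹ ^ 2 * (h ^ (2 * l + 1) *
        ∫ x in M.edge K e, M.jump K e K' l φ x * M.jump K e K' l φ x ∂μH[1])) +
      2 * C3 l * ‖red c'‖ ^ 2 := by
    intro l hl
    have hc1 := continuousOn_dnorm_edge l hε hAs.2 n c
    have hc2 : ContinuousOn (fun s : ℝ => dnorm l (S', n, c', pt (1 - s) 0)) (Icc 0 1) :=
      (continuousOn_dnorm_edge l hε hAs'.2 n c').comp (by fun_prop)
        fun s hs => ⟨by linarith [hs.2], by linarith [hs.1]⟩
    -- The derivative from one side is the jump plus the derivative from the other side, and the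
    -- latter is bounded by the trace inequality for the neighbour.
    have h1 : ∫ s in (0 : ℝ)..1, dnorm l (S, n, c, pt s 0) ^ 2 ≤
        ∫ s in (0 : ℝ)..1, (2 * h ^ (2 * l) * ((h⁻¹) ^ l * dnorm l (S, n, c, pt s 0) -
        (h⁻¹) ^ l * dnorm l (S', n, c', pt (1 - s) 0)) ^ 2 + 2 * C3 l * ‖red c'‖ ^ 2) := by
      refine intervalIntegral.integral_mono_on zero_le_one ?_ ?_ fun s hs => ?_
      · exact ContinuousOn.intervalIntegrable (by rw [uIcc_of_le zero_le_one]; exact hc1.pow 2)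
      · refine ContinuousOn.intervalIntegrable ?_
        rw [uIcc_of_le zero_le_one]
        exact (continuousOn_const.mul (((continuousOn_const.mul hc1).sub
          (continuousOn_const.mul hc2)).pow 2)).add continuousOn_const
      · have k1 := hdn l (Finset.mem_Icc.1 hl).1 S' hAs'.2 n hn1 c' (pt (1 - s) 0)
          (pt_mem_csq ⟨by linarith [hs.2], by linarith [hs.1]⟩)
        set X := dnorm l (S, n, c, pt s 0)
        set Y := dnorm l (S', n, c', pt (1 - s) 0)
        have k2 : h ^ (2 * l) * ((h⁻¹) ^ l * X - (h⁻¹) ^ l * Y) ^ 2 = (X - Y) ^ 2 := by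
          rw [← mul_sub, mul_pow, ← mul_assoc, mul_comm 2 l, pow_mul, ← mul_pow (h ^ l), ← mul_pow h,
            mul_inv_cancel₀ hpos.ne', one_pow, one_pow, one_mul]
        rw [mul_assoc, k2]
        nlinarith [sq_nonneg (X - 2 * Y)]
    refine h1.trans ?_
    rw [intervalIntegral.integral_add, intervalIntegral.integral_const_mul]
    · rw [intervalIntegral.integral_const, sub_zero, one_smul, mul_assoc]
      have := ip l
      have e1 : 4 / ε = 2 * (2 / ε) := by ring
      rw [e1]
      linarith
    · refine ContinuousOn.intervalIntegrable ?_
      rw [uIcc_of_le zero_le_one]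
      exact (continuousOn_const.mul (((continuousOn_const.mul hc1).sub
        (continuousOn_const.mul hc2)).pow 2))
    · exact intervalIntegrable_const
  -- Continuity makes the tangential derivative free of jumps, so no penalty term is needed for it.
  have i0 : ∫ s in (0 : ℝ)..1, pds c (pt s 0) ^ 2 ≤ C2 * ‖red c'‖ ^ 2 := by
    have h1 : ∫ s in (0 : ℝ)..1, pds c (pt s 0) ^ 2 ≤ ∫ s in (0 : ℝ)..1, C2 * ‖red c'‖ ^ 2 := by
      have hcont : Continuous fun s : ℝ => pt s 0 :=
        contDiff_pt.continuous.comp (by fun_prop : Continuous fun s : ℝ => (s, (0 : ℝ)))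
      refine intervalIntegral.integral_mono_on_of_le_Ioo zero_le_one ?_ intervalIntegrable_const
        fun s hs => ?_
      · exact (((continuous_of_mem_Qsp (pds_mem_Qsp c)).comp hcont).pow 2).intervalIntegrable _ _
      · rw [pds_opposite hKK' he' hc hc' s hs, neg_sq]
        have := hgrad c' (pt (1 - s) 0) (pt_mem_csq ⟨by linarith [hs.2], by linarith [hs.1]⟩)
        nlinarith [sq_nonneg (pdt c' (pt (1 - s) 0))]
    simpa using h1
  have hr := hred S hAs.2 n hn1 hn2 c
  have hsum : (∫ s in (0 : ℝ)..1, pds c (pt s 0) ^ 2) +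
        ∑ l ∈ Finset.Icc 1 r, ∫ s in (0 : ℝ)..1, dnorm l (S, n, c, pt s 0) ^ 2 ≤
      C4 * ‖red c'‖ ^ 2 + 4 / ε * (h⁻¹ ^ 2 * M.faceJump r φ K e K') := by
    refine (add_le_add i0 (Finset.sum_le_sum il)).trans (le_of_eq ?_)
    rw [Finset.sum_add_distrib, ← Finset.mul_sum, ← Finset.mul_sum, ← Finset.sum_mul, hC4, faceJump]
    ring
  have hfin : M.cellGrad φ K ≤ κ₂ * (C1 * (C4 * (M.cellGrad φ K' / κ₁) +
      4 / ε * (h⁻¹ ^ 2 * M.faceJump r φ K e K'))) := by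
    refine g1.trans (mul_le_mul_of_nonneg_left (hr.trans (mul_le_mul_of_nonneg_left
      (hsum.trans ?_) hC1.le)) hκ₂.le)
    have : ‖red c'‖ ^ 2 ≤ M.cellGrad φ K' / κ₁ := by rw [le_div_iff₀ hκ₁]; linarith
    have := mul_le_mul_of_nonneg_left this hC4p.le
    linarith
  have hg := M.cellGrad_nonneg φ K'
  have hj := M.faceJump_nonneg r φ K e K'
  have hmul := mul_le_mul_of_nonneg_left hfin (sq_nonneg h)
  refine hmul.trans ?_
  have e1 : h ^ 2 * (κ₂ * (C1 * (C4 * (M.cellGrad φ K' / κ₁) +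
      4 / ε * (h⁻¹ ^ 2 * M.faceJump r φ K e K')))) =
      κ₂ * C1 * (C4 / κ₁) * (h ^ 2 * M.cellGrad φ K') + κ₂ * C1 * (4 / ε) * M.faceJump r φ K e K' := by
    field_simp
  rw [e1]
  have a1 : 0 ≤ κ₂ * C1 * (C4 / κ₁) := by positivity
  have a2 : 0 ≤ κ₂ * C1 * (4 / ε) := by positivity
  have a3 : 0 ≤ h ^ 2 * M.cellGrad φ K' := by positivity
  nlinarith [mul_nonneg a1 hj, mul_nonneg a2 a3]

end QuadMesh

/-! ### The ghost penalty controls the gradient on the interface zone -/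

namespace QuadMesh

variable {Ω Ωf Ωs : Set E} {M : QuadMesh Ω}

/-- Every cell of the interface zone is joined to a cell inside the fluid domain by crossing at most
`N` ghost penalty faces, and no cell is used more than `N` times as such a final cell. -/
def HasPaths (M : QuadMesh Ω) (Ωf Ωs : Set E) (N : ℕ) : Prop :=
  ∃ a : Fin M.n → Fin M.n,
    (∀ K, M.cell K ⊆ M.interfaceZone Ωf Ωs →
      M.cell (a K) ⊆ M.innerFluid Ωf Ωs ∧
      ∃ k ≤ N, ∃ path : ℕ → Fin M.n, path 0 = K ∧ path k = a K ∧
        ∀ l < k, ∃ e, M.IsGhostFace Ωf Ωs (path l) e (path (l + 1))) ∧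
    ∀ K', {K | M.cell K ⊆ M.interfaceZone Ωf Ωs ∧ a K = K'}.ncard ≤ N

open Classical in
/-- The cells that meet the fluid domain. -/
def fluidCells (M : QuadMesh Ω) (Ωf : Set E) : Finset (Fin M.n) := {K | K ∈ M.sub Ωf}

open Classical in
/-- The cells that meet both domains. -/
def cutCells (M : QuadMesh Ω) (Ωf Ωs : Set E) : Finset (Fin M.n) :=
  {K | K ∈ M.sub Ωf ∧ K ∈ M.sub Ωs}

open Classical in
/-- The cells that meet the fluid domain only. -/
def innerCells (M : QuadMesh Ω) (Ωf Ωs : Set E) : Finset (Fin M.n) :=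
  {K | K ∈ M.sub Ωf ∧ K ∉ M.sub Ωs}

lemma mem_fluidCells {K : Fin M.n} : K ∈ M.fluidCells Ωf ↔ K ∈ M.sub Ωf := by simp [fluidCells]

lemma mem_cutCells {K : Fin M.n} :
    K ∈ M.cutCells Ωf Ωs ↔ K ∈ M.sub Ωf ∧ K ∈ M.sub Ωs := by simp [cutCells]

lemma mem_innerCells {K : Fin M.n} :
    K ∈ M.innerCells Ωf Ωs ↔ K ∈ M.sub Ωf ∧ K ∉ M.sub Ωs := by simp [innerCells]

lemma sum_fluidCells (f : Fin M.n → ℝ) : ∑ K ∈ M.fluidCells Ωf, f K =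
    ∑ K ∈ M.innerCells Ωf Ωs, f K + ∑ K ∈ M.cutCells Ωf Ωs, f K := by
  classical
  rw [← Finset.sum_union]
  · congr 1
    ext K
    rw [Finset.mem_union, mem_fluidCells, mem_innerCells, mem_cutCells]
    tauto
  · rw [Finset.disjoint_left]
    intro K h1 h2
    exact (mem_innerCells.1 h1).2 (mem_cutCells.1 h2).2

lemma cell_subset_compDomain {D : Set E} {K : Fin M.n} (hK : K ∈ M.sub D) :
    M.cell K ⊆ M.compDomain D :=
  subset_closure.trans (subset_biUnion_of_mem (u := fun K => closure (M.cell K)) hK)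

lemma cell_subset_zone {K : Fin M.n} (hK : K ∈ M.cutCells Ωf Ωs) :
    M.cell K ⊆ M.interfaceZone Ωf Ωs :=
  subset_inter (cell_subset_compDomain (mem_cutCells.1 hK).1)
    (cell_subset_compDomain (mem_cutCells.1 hK).2)

lemma mem_innerCells_of_subset {K : Fin M.n} (h : M.cell K ⊆ M.innerFluid Ωf Ωs) :
    K ∈ M.innerCells Ωf Ωs := by
  obtain ⟨x, hx⟩ := M.cell_nonempty K
  have hf : K ∈ M.sub Ωf := ⟨x, hx, (h hx).1⟩
  refine mem_innerCells.2 ⟨hf, fun hs => ?_⟩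
  exact (h hx).2 (cell_subset_zone (mem_cutCells.2 ⟨hf, hs⟩) hx)

open Classical in
/-- The sum of a function over the neighbours of a cell across ghost faces. -/
def neighbourSum (M : QuadMesh Ω) (Ωf Ωs : Set E) (f : Fin M.n → ℝ) (K : Fin M.n) : ℝ :=
  ∑ e, ∑ K', if M.IsGhostFace Ωf Ωs K e K' then f K' else 0

lemma neighbourSum_nonneg {f : Fin M.n → ℝ} (hf : ∀ K, 0 ≤ f K) (K : Fin M.n) :
    0 ≤ M.neighbourSum Ωf Ωs f K :=
  Finset.sum_nonneg fun _ _ => Finset.sum_nonneg fun K' _ => by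
    split_ifs
    · exact hf K'
    · exact le_rfl

lemma iterate_neighbourSum_nonneg {f : Fin M.n → ℝ} (hf : ∀ K, 0 ≤ f K) (l : ℕ) (K : Fin M.n) :
    0 ≤ (M.neighbourSum Ωf Ωs)^[l] f K := by
  induction l generalizing K with
  | zero => exact hf K
  | succ l ih => rw [Function.iterate_succ_apply']; exact neighbourSum_nonneg ih K

lemma le_neighbourSum {f : Fin M.n → ℝ} (hf : ∀ K, 0 ≤ f K) {K K' : Fin M.n} {e : Fin 4}
    (h : M.IsGhostFace Ωf Ωs K e K') : f K' ≤ M.neighbourSum Ωf Ωs f K := by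
  classical
  have h0 : ∀ e K'', 0 ≤ if M.IsGhostFace Ωf Ωs K e K'' then f K'' else 0 := fun e K'' => by
    split_ifs
    · exact hf _
    · exact le_rfl
  refine le_trans ?_ (Finset.single_le_sum (f := fun e => ∑ K', if M.IsGhostFace Ωf Ωs K e K' then f K'
    else 0) (fun e _ => Finset.sum_nonneg fun K'' _ => h0 e K'') (Finset.mem_univ e))
  refine le_trans ?_ (Finset.single_le_sum (f := fun K' => if M.IsGhostFace Ωf Ωs K e K' then f K'
    else 0) (fun K'' _ => h0 e K'') (Finset.mem_univ K'))
  simp [h]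

/-- After interchanging the sums, a cell `K'` is counted once per pair `(K, e)`. Such a pair is
determined by `e` and the matching edge of `K'`, which leaves at most `4 * 4` of them. -/
lemma sum_neighbourSum_le {f : Fin M.n → ℝ} (hf : ∀ K, 0 ≤ f K) :
    ∑ K, M.neighbourSum Ωf Ωs f K ≤ 16 * ∑ K, f K := by
  classical
  have h1 : ∑ K, M.neighbourSum Ωf Ωs f K = ∑ K', ∑ x : Fin M.n × Fin 4,
      if M.IsGhostFace Ωf Ωs x.1 x.2 K' then f K' else 0 := by
    simp only [neighbourSum]
    have := Finset.sum_comm (s := (Finset.univ : Finset (Fin M.n)))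
      (t := (Finset.univ : Finset (Fin M.n × Fin 4)))
      (f := fun K' x => if M.IsGhostFace Ωf Ωs x.1 x.2 K' then f K' else 0)
    rw [this, Fintype.sum_prod_type]
  rw [h1, Finset.mul_sum]
  refine Finset.sum_le_sum fun K' _ => ?_
  rw [← Finset.sum_filter, Finset.sum_const, nsmul_eq_mul]
  refine mul_le_mul_of_nonneg_right ?_ (hf K')
  have hp : ∀ x ∈ Finset.univ.filter fun x : Fin M.n × Fin 4 => M.IsGhostFace Ωf Ωs x.1 x.2 K',
      ∃ e', M.edge x.1 x.2 = M.edge K' e' := fun x hx => by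
    have hx := (Finset.mem_filter.1 hx).2
    exact exists_partner hx.1 hx.2.2.2.1
  choose! ep hep using hp
  have hcard : (Finset.univ.filter fun x : Fin M.n × Fin 4 =>
      M.IsGhostFace Ωf Ωs x.1 x.2 K').card ≤ (Finset.univ : Finset (Fin 4 × Fin 4)).card := by
    refine Finset.card_le_card_of_injOn (fun x => (ep x, x.2)) (fun _ _ => Finset.mem_univ _) ?_
    intro x hx y hy hxy
    simp only [Prod.mk.injEq] at hxy
    have h2 := hep x hx
    have h3 := hep y hy
    rw [← hxy.1] at h3
    exact Prod.ext (neighbour_unique (Finset.mem_filter.1 hx).2.1 (Finset.mem_filter.1 hy).2.1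
      h2.symm h3.symm) hxy.2
  have : (Finset.univ : Finset (Fin 4 × Fin 4)).card = 16 := by simp
  rw [this] at hcard
  exact_mod_cast hcard

lemma sum_iterate_neighbourSum_le {f : Fin M.n → ℝ} (hf : ∀ K, 0 ≤ f K) (l : ℕ) :
    ∑ K, (M.neighbourSum Ωf Ωs)^[l] f K ≤ 16 ^ l * ∑ K, f K := by
  induction l with
  | zero => simp
  | succ l ih =>
    simp only [Function.iterate_succ_apply']
    refine (sum_neighbourSum_le (iterate_neighbourSum_nonneg hf l)).trans ?_
    rw [pow_succ', mul_assoc]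
    exact mul_le_mul_of_nonneg_left ih (by norm_num)

/-- A cell at the end of a path appears among the nonnegative terms of the iterated sum. This
replaces the counting of paths. -/
lemma le_iterate_neighbourSum {f : Fin M.n → ℝ} (hf : ∀ K, 0 ≤ f K) (path : ℕ → Fin M.n) (l : ℕ)
    (h : ∀ i < l, ∃ e, M.IsGhostFace Ωf Ωs (path i) e (path (i + 1))) :
    f (path l) ≤ (M.neighbourSum Ωf Ωs)^[l] f (path 0) := by
  induction l generalizing path with
  | zero => exact le_rfl
  | succ l ih =>
    rw [Function.iterate_succ_apply']
    obtain ⟨e, he⟩ := h 0 (Nat.succ_pos l)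
    refine le_trans ?_ (le_neighbourSum (iterate_neighbourSum_nonneg hf l) he)
    exact ih (fun i => path (i + 1)) fun i hi => h (i + 1) (Nat.succ_lt_succ hi)

/-- Summation along a path. -/
lemma le_of_path {X G : Fin M.n → ℝ} {C : ℝ} (hC : 1 ≤ C) (hX : ∀ K, 0 ≤ X K) (hG : ∀ K, 0 ≤ G K)
    (hstep : ∀ K e K', M.IsGhostFace Ωf Ωs K e K' → X K ≤ C * (X K' + G K))
    (path : ℕ → Fin M.n) (k : ℕ)
    (h : ∀ i < k, ∃ e, M.IsGhostFace Ωf Ωs (path i) e (path (i + 1))) :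
    X (path 0) ≤ C ^ k * (X (path k) + ∑ l ∈ Finset.range k, G (path l)) := by
  induction k with
  | zero => simp
  | succ k ih =>
    have h1 := ih fun i hi => h i (hi.trans (Nat.lt_succ_self k))
    obtain ⟨e, he⟩ := h k (Nat.lt_succ_self k)
    have h2 := hstep _ _ _ he
    refine h1.trans ?_
    rw [pow_succ, mul_assoc]
    refine mul_le_mul_of_nonneg_left ?_ (by positivity)
    rw [Finset.sum_range_succ]
    have h3 : 0 ≤ ∑ l ∈ Finset.range k, G (path l) := Finset.sum_nonneg fun l _ => hG _
    nlinarith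

open Classical in
/-- The jumps over all ghost faces of a cell. -/
def jumpSum (M : QuadMesh Ω) (Ωf Ωs : Set E) (r : ℕ) (φ : E → ℝ) (K : Fin M.n) : ℝ :=
  ∑ e, ∑ K', if M.IsGhostFace Ωf Ωs K e K' then M.faceJump r φ K e K' else 0

lemma jumpSum_nonneg (r : ℕ) (φ : E → ℝ) (K : Fin M.n) : 0 ≤ M.jumpSum Ωf Ωs r φ K :=
  Finset.sum_nonneg fun _ _ => Finset.sum_nonneg fun _ _ => by
    split_ifs
    · exact faceJump_nonneg ..
    · exact le_rfl

lemma faceJump_le_jumpSum {r : ℕ} {φ : E → ℝ} {K K' : Fin M.n} {e : Fin 4}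
    (h : M.IsGhostFace Ωf Ωs K e K') : M.faceJump r φ K e K' ≤ M.jumpSum Ωf Ωs r φ K := by
  classical
  have h0 : ∀ e K'', 0 ≤ if M.IsGhostFace Ωf Ωs K e K'' then M.faceJump r φ K e K'' else 0 :=
    fun e K'' => by
      split_ifs
      · exact faceJump_nonneg ..
      · exact le_rfl
  refine le_trans ?_ (Finset.single_le_sum (f := fun e => ∑ K', if M.IsGhostFace Ωf Ωs K e K' then
    M.faceJump r φ K e K' else 0)
    (fun e _ => Finset.sum_nonneg fun K'' _ => h0 e K'') (Finset.mem_univ e))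
  refine le_trans ?_ (Finset.single_le_sum (f := fun K' => if M.IsGhostFace Ωf Ωs K e K' then
    M.faceJump r φ K e K' else 0) (fun K'' _ => h0 e K'') (Finset.mem_univ K'))
  simp [h]

/-- The fraction is at most one, so the exponent is at least `-1`. -/
lemma le_weight {wmax : ℝ} (hw : 1 ≤ wmax) (D : Set E) (K : Fin M.n) :
    1 / 2 * wmax⁻¹ ≤ M.weight D wmax K := by
  have h1 : M.fraction D K ≤ 1 := by
    refine div_le_one_of_le₀ (measureReal_mono inter_subset_left ?_) measureReal_nonneg
    exact ((isBounded_closure_cell K).subset subset_closure).measure_lt_top.ne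
  rw [weight]
  refine mul_le_mul_of_nonneg_left ?_ (by norm_num)
  rw [← Real.rpow_neg_one]
  exact Real.rpow_le_rpow_of_exponent_le hw (by linarith)

/-- The two weights of a face add up to at least `wmax⁻¹`, and each factorial is at most `(m - 1)!`.
-/
lemma jumpSum_le_ghostPenalty {m : ℕ} {γp wmax : ℝ} (hγ : 0 < γp) (hw : 1 ≤ wmax) (φ : E → ℝ) :
    γp * (1 / 2 * (wmax⁻¹ / ((m - 1).factorial : ℝ) ^ 2)) * ∑ K, M.jumpSum Ωf Ωs (m - 1) φ K ≤
      M.ghostPenalty Ωf Ωs m γp wmax φ φ := by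
  classical
  rw [ghostPenalty, mul_assoc]
  refine mul_le_mul_of_nonneg_left ?_ hγ.le
  rw [mul_assoc]
  refine mul_le_mul_of_nonneg_left ?_ (by norm_num)
  rw [Finset.mul_sum]
  refine Finset.sum_le_sum fun K _ => ?_
  rw [jumpSum, Finset.mul_sum]
  refine Finset.sum_le_sum fun e _ => ?_
  rw [Finset.mul_sum]
  refine Finset.sum_le_sum fun K' _ => ?_
  split_ifs with h
  · have h1 : wmax⁻¹ ≤ M.weight Ωf wmax K + M.weight Ωf wmax K' := by
      linarith [M.le_weight hw Ωf K, M.le_weight hw Ωf K']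
    have hw0 : 0 < wmax⁻¹ := by positivity
    rw [div_eq_mul_inv, mul_assoc]
    have hj : (((m - 1).factorial : ℝ) ^ 2)⁻¹ * M.faceJump (m - 1) φ K e K' ≤
      ∑ l ∈ Finset.Icc 1 (m - 1), M.size ^ (2 * l + 1) / (l.factorial : ℝ) ^ 2 *
        ∫ x in M.edge K e, M.jump K e K' l φ x * M.jump K e K' l φ x ∂μH[1] := by
      rw [faceJump, Finset.mul_sum]
      refine Finset.sum_le_sum fun l hl => ?_
      rw [← mul_assoc]
      refine mul_le_mul_of_nonneg_right ?_ (integral_nonneg fun _ => mul_self_nonneg _)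
      rw [div_eq_inv_mul]
      refine mul_le_mul_of_nonneg_right ?_ (pow_nonneg size_nonneg _)
      have : (l.factorial : ℝ) ≤ (m - 1).factorial := by
        exact_mod_cast Nat.factorial_le (Finset.mem_Icc.1 hl).2
      have h3 : (0 : ℝ) < l.factorial := by exact_mod_cast Nat.factorial_pos l
      exact inv_anti₀ (by positivity) (pow_le_pow_left₀ h3.le this 2)
    refine mul_le_mul h1 hj ?_ (hw0.le.trans h1)
    exact mul_nonneg (by positivity) (faceJump_nonneg ..)
  · simp

lemma ghostPenalty_nonneg {m : ℕ} {γp wmax : ℝ} (hγ : 0 < γp) (hw : 1 ≤ wmax) (φ : E → ℝ) :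
    0 ≤ M.ghostPenalty Ωf Ωs m γp wmax φ φ :=
  le_trans (mul_nonneg (by positivity) (Finset.sum_nonneg fun K _ => jumpSum_nonneg ..))
    (jumpSum_le_ghostPenalty hγ hw φ)

/-- The ghost penalty extends the control of the gradient from the cells inside the fluid domain to
all fluid cells. -/
theorem exists_sum_cellGrad_le (m N : ℕ) {ε γp wmax : ℝ} (hε : 0 < ε) (hγ : 0 < γp)
    (hw : 1 ≤ wmax) : ∃ C > 0, ∀ (Ω Ωf Ωs : Set E) (M : QuadMesh Ω),
    (∀ K e, IsScaled ε M.size (rotc (M.corner K) e)) → M.HasPaths Ωf Ωs N →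
    ∀ φ ∈ M.feSpace Ωf (m - 1), M.size ^ 2 * ∑ K ∈ M.fluidCells Ωf, M.cellGrad φ K ≤
      C * (M.size ^ 2 * ∑ K ∈ M.innerCells Ωf Ωs, M.cellGrad φ K +
        M.ghostPenalty Ωf Ωs m γp wmax φ φ) := by
  obtain ⟨C, hC, hface⟩ := exists_cellGrad_le (m - 1) hε
  set c0 := γp * (1 / 2 * (wmax⁻¹ / ((m - 1).factorial : ℝ) ^ 2)) with hc0
  have hc0p : 0 < c0 := by
    have : 0 < ((m - 1).factorial : ℝ) := by exact_mod_cast Nat.factorial_pos _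
    positivity
  have hC0 : 0 < C := one_pos.trans_le hC
  set B : ℝ := ∑ l ∈ Finset.range N, (16 : ℝ) ^ l with hB
  have hB0 : 0 ≤ B := Finset.sum_nonneg fun l _ => by positivity
  -- Along a path the constant grows to at most `C ^ N`. The factor `N` bounds the multiplicity of
  -- end cells, `B` the multiplicity of each jump, and `c0` compares jumps with the penalty.
  refine ⟨1 + C ^ N * (N + B / c0), by positivity, fun Ω Ωf Ωs M hsc hpath φ hφ => ?_⟩
  obtain ⟨a, ha, hcount⟩ := hpath
  set X : Fin M.n → ℝ := fun K => M.size ^ 2 * M.cellGrad φ K with hX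
  set G := M.jumpSum Ωf Ωs (m - 1) φ with hG
  have hX0 : ∀ K, 0 ≤ X K := fun K => mul_nonneg (sq_nonneg _) (cellGrad_nonneg φ K)
  have hG0 : ∀ K, 0 ≤ G K := fun K => jumpSum_nonneg _ _ K
  have hstep : ∀ K e K', M.IsGhostFace Ωf Ωs K e K' → X K ≤ C * (X K' + G K) := by
    intro K e K' h
    refine (hface Ω M hsc Ωf φ hφ K e K' h.1 h.2.1 h.2.2.1 h.2.2.2.1).trans ?_
    exact mul_le_mul_of_nonneg_left (add_le_add le_rfl (faceJump_le_jumpSum h)) hC0.le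
  have hcut : ∀ K ∈ M.cutCells Ωf Ωs, X K ≤ C ^ N * (X (a K) +
      ∑ l ∈ Finset.range N, (M.neighbourSum Ωf Ωs)^[l] G K) := by
    intro K hK
    obtain ⟨-, k, hk, path, h0, h1, h2⟩ := ha K (cell_subset_zone hK)
    have h3 := le_of_path hC hX0 hG0 hstep path k h2
    rw [h0, h1] at h3
    refine h3.trans ?_
    have h4 : ∑ l ∈ Finset.range k, G (path l) ≤
        ∑ l ∈ Finset.range N, (M.neighbourSum Ωf Ωs)^[l] G K := by
      refine le_trans (Finset.sum_le_sum (g := fun l => (M.neighbourSum Ωf Ωs)^[l] G K)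
        fun l hl => ?_) (Finset.sum_le_sum_of_subset_of_nonneg (Finset.range_mono hk)
          fun l _ _ => iterate_neighbourSum_nonneg hG0 l K)
      rw [← h0]
      exact le_iterate_neighbourSum hG0 path l fun i hi => h2 i (hi.trans (Finset.mem_range.1 hl))
    have h5 : 0 ≤ X (a K) + ∑ l ∈ Finset.range N, (M.neighbourSum Ωf Ωs)^[l] G K :=
      add_nonneg (hX0 _) (Finset.sum_nonneg fun l _ => iterate_neighbourSum_nonneg hG0 l K)
    exact mul_le_mul (pow_le_pow_right₀ hC hk) (add_le_add le_rfl h4)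
      (add_nonneg (hX0 _) (Finset.sum_nonneg fun l _ => hG0 _)) (by positivity)
  -- Grouping the cut cells by their end cell, no group has more than `N` members.
  have hXa : ∑ K ∈ M.cutCells Ωf Ωs, X (a K) ≤ N * ∑ K ∈ M.innerCells Ωf Ωs, X K := by
    classical
    rw [← Finset.sum_fiberwise_of_maps_to (t := M.innerCells Ωf Ωs) (g := a)
      fun K hK => mem_innerCells_of_subset (ha K (cell_subset_zone hK)).1, Finset.mul_sum]
    refine Finset.sum_le_sum fun K' _ => ?_
    rw [Finset.sum_congr rfl (g := fun _ => X K') fun K hK => by rw [(Finset.mem_filter.1 hK).2],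
      Finset.sum_const, nsmul_eq_mul]
    refine mul_le_mul_of_nonneg_right ?_ (hX0 _)
    refine Nat.cast_le.2 (le_trans ?_ (hcount K'))
    rw [← Set.ncard_coe_finset]
    refine Set.ncard_le_ncard (fun K hK => ?_) (Set.toFinite _)
    have hK := Finset.mem_filter.1 hK
    exact ⟨cell_subset_zone hK.1, hK.2⟩
  have hGs : ∑ K ∈ M.cutCells Ωf Ωs, ∑ l ∈ Finset.range N, (M.neighbourSum Ωf Ωs)^[l] G K ≤
      B * ∑ K, G K := by
    rw [Finset.sum_comm, hB, Finset.sum_mul]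
    refine Finset.sum_le_sum fun l _ => ?_
    exact (Finset.sum_le_sum_of_subset_of_nonneg (Finset.subset_univ _) fun K _ _ =>
      iterate_neighbourSum_nonneg hG0 l K).trans (sum_iterate_neighbourSum_le hG0 l)
  have hgp : ∑ K, G K ≤ M.ghostPenalty Ωf Ωs m γp wmax φ φ / c0 := by
    rw [le_div_iff₀ hc0p, mul_comm]
    exact jumpSum_le_ghostPenalty hγ hw φ
  set P := M.ghostPenalty Ωf Ωs m γp wmax φ φ
  have hP : 0 ≤ P := ghostPenalty_nonneg hγ hw φ
  have hI : 0 ≤ ∑ K ∈ M.innerCells Ωf Ωs, X K := Finset.sum_nonneg fun K _ => hX0 K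
  have hmain : ∑ K ∈ M.cutCells Ωf Ωs, X K ≤
      C ^ N * (N * ∑ K ∈ M.innerCells Ωf Ωs, X K + B * (P / c0)) := by
    refine (Finset.sum_le_sum hcut).trans ?_
    rw [← Finset.mul_sum, Finset.sum_add_distrib]
    refine mul_le_mul_of_nonneg_left (add_le_add hXa (hGs.trans ?_)) (by positivity)
    exact mul_le_mul_of_nonneg_left hgp hB0
  rw [Finset.mul_sum, Finset.mul_sum]
  change ∑ K ∈ M.fluidCells Ωf, X K ≤ _ * (∑ K ∈ M.innerCells Ωf Ωs, X K + P)
  rw [sum_fluidCells (Ωs := Ωs)]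
  have hCN : 0 ≤ C ^ N := by positivity
  have e1 : B * (P / c0) = B / c0 * P := by ring
  rw [e1] at hmain
  have hbc : 0 ≤ B / c0 := by positivity
  have hN : (0 : ℝ) ≤ N := Nat.cast_nonneg N
  set Y := ∑ K ∈ M.innerCells Ωf Ωs, X K
  have k1 := mul_nonneg (mul_nonneg hCN hN) hP
  have k2 := mul_nonneg (mul_nonneg hCN hbc) hI
  nlinarith

end QuadMesh

/-! ### The local velocity fields in reference coordinates -/

section Fields

variable {r : ℕ} (lam : ℝ) (S : Shape) (c : Coef r)

/-- The coefficient field of the cell bubble. -/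
def bubbleCoef (z : E) : E :=
  -- The components are exchanged, one with a sign, so that `det2` with the rotated gradient pairs
  -- each moment with its own integrand and produces a sum of squares.
  pt (∑ j, ∑ k, moment S c 1 j k * (z 0 ^ (j : ℕ) * z 1 ^ (k : ℕ)))
    (-∑ j, ∑ k, moment S c 0 j k * (z 0 ^ (j : ℕ) * z 1 ^ (k : ℕ)))

/-- The edge function of the edge `t = 0`, corrected by a cell bubble. -/
def innerField (z : E) : E :=
  -((z 0 * (1 - z 0) * (1 - z 1) * pds c (pt (z 0) 0)) • S.1 + (lam * bub z) • bubbleCoef S c z)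

/-- The field whose product with the pressure gradient has a sign everywhere. -/
def cutField (z : E) : E :=
  -((z 0 * (1 - z 0) * pds c z) • tanS S z + (z 1 * (1 - z 1) * pdt c z) • tanT S z)

lemma bubbleCoef_mem (i : Fin 2) : (fun z => bubbleCoef S c z i) ∈ Qsp (r - 1) (r - 1) := by
  have h : ∀ i : Fin 2, (fun z : E => ∑ j : Fin r, ∑ k : Fin r,
      moment S c i j k * (z 0 ^ (j : ℕ) * z 1 ^ (k : ℕ))) ∈ Qsp (r - 1) (r - 1) := fun i =>
    Qsp.sum _ fun j _ => Qsp.sum _ fun k _ =>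
      (Qsp (r - 1) (r - 1)).smul_mem (moment S c i j k)
        (Qsp.monomial (Nat.le_sub_one_of_lt j.2) (Nat.le_sub_one_of_lt k.2))
  fin_cases i
  · exact h 1
  · exact Qsp.neg (h 0)

lemma omega_mem_fst : (fun z : E => z 0 * (1 - z 0)) ∈ Qsp 2 0 :=
  Qsp.mul' (k := 1) (l := 0) (k' := 1) (l' := 0) (f := fun z => z 0) (g := fun z => 1 - z 0)
    (Qsp.fst le_rfl) (Qsp.sub (Qsp.const 1 1 0) (Qsp.fst le_rfl)) (by norm_num) (by norm_num)

lemma omega_mem_snd : (fun z : E => z 1 * (1 - z 1)) ∈ Qsp 0 2 :=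
  Qsp.mul' (k := 0) (l := 1) (k' := 0) (l' := 1) (f := fun z => z 1) (g := fun z => 1 - z 1)
    (Qsp.snd le_rfl) (Qsp.sub (Qsp.const 1 0 1) (Qsp.snd le_rfl)) (by norm_num) (by norm_num)

lemma Qsp.comp_edge {k l : ℕ} {f : E → ℝ} (hf : f ∈ Qsp k l) :
    (fun z => f (pt (z 0) 0)) ∈ Qsp k 0 := by
  induction hf using Submodule.span_induction with
  | zero => exact zero_mem (Qsp k 0)
  | add x y _ _ hx hy => exact add_mem hx hy
  | smul a x _ hx => exact Submodule.smul_mem _ _ hx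
  | mem x hx =>
    obtain ⟨i, hi, j, _, rfl⟩ := hx
    have := (Qsp k 0).smul_mem ((0 : ℝ) ^ j) (Qsp.monomial hi le_rfl)
    convert this using 1
    ext z
    simp [mul_comm]

/-- The bubble has degree two and its coefficient field degree `r - 1`, which together give exactly
the velocity degree `r + 1`. -/
lemma innerField_mem (hr : 1 ≤ r) (i : Fin 2) :
    (fun z => innerField lam S c z i) ∈ Qsp (r + 1) (r + 1) := by
  have h0 : (fun z : E => z 0 * (1 - z 0) * (1 - z 1)) ∈ Qsp 2 1 :=
    Qsp.mul' (f := fun z => z 0 * (1 - z 0)) (g := fun z => 1 - z 1) omega_mem_fst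
      (Qsp.sub (Qsp.const 1 0 1) (Qsp.snd le_rfl)) (by norm_num) (by norm_num)
  have h1 : (fun z : E => z 0 * (1 - z 0) * (1 - z 1) * pds c (pt (z 0) 0)) ∈ Qsp (r + 1) (r + 1) :=
    Qsp.mul' (f := fun z => z 0 * (1 - z 0) * (1 - z 1)) (g := fun z => pds c (pt (z 0) 0))
      h0 (Qsp.comp_edge (pds_mem_Qsp c)) (by omega) (by omega)
  have hb : bub ∈ Qsp 2 2 :=
    Qsp.mul' (f := fun z => z 0 * (1 - z 0)) (g := fun z => z 1 * (1 - z 1)) omega_mem_fst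
      omega_mem_snd (by norm_num) (by norm_num)
  have h2 : (fun z : E => lam * bub z * bubbleCoef S c z i) ∈ Qsp (r + 1) (r + 1) :=
    Qsp.mul' (f := fun z => lam * bub z) (g := fun z => bubbleCoef S c z i)
      ((Qsp 2 2).smul_mem lam hb) (bubbleCoef_mem S c i) (by omega) (by omega)
  have h3 := Qsp.mul' (K := r + 1) (L := r + 1) h1 (Qsp.const (S.1 i) 0 0) le_rfl le_rfl
  exact Qsp.neg (Qsp.add h3 h2)

/-- The derivative lowers the degree in its own variable, where the quadratic weight acts; the
tangent vector adds one degree in the other variable only. -/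
lemma cutField_mem (hr : 1 ≤ r) (i : Fin 2) :
    (fun z => cutField S c z i) ∈ Qsp (r + 1) (r + 1) := by
  have h1 : (fun z => tanS S z i) ∈ Qsp 0 1 :=
    Qsp.add (Qsp.const (S.1 i) 0 1) (Qsp.mul' (f := fun z => z 1) (g := fun _ => S.2.1 i)
      (Qsp.snd (k := 0) le_rfl) (Qsp.const (S.2.1 i) 0 0) le_rfl le_rfl)
  have h2 : (fun z => tanT S z i) ∈ Qsp 1 0 :=
    Qsp.add (Qsp.const (S.2.2 i) 1 0) (Qsp.mul' (f := fun z => z 0) (g := fun _ => S.2.1 i)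
      (Qsp.fst (l := 0) le_rfl) (Qsp.const (S.2.1 i) 0 0) le_rfl le_rfl)
  have h3 : (fun z => z 0 * (1 - z 0) * pds c z) ∈ Qsp (r + 1) r :=
    Qsp.mul' (f := fun z => z 0 * (1 - z 0)) (g := pds c) omega_mem_fst (pds_mem_Qsp c)
      (by omega) (by omega)
  have h4 : (fun z => z 1 * (1 - z 1) * pdt c z) ∈ Qsp r (r + 1) :=
    Qsp.mul' (f := fun z => z 1 * (1 - z 1)) (g := pdt c) omega_mem_snd (pdt_mem_Qsp c)
      (by omega) (by omega)
  have h5 := Qsp.mul' (K := r + 1) (L := r + 1) h3 h1 (by omega) (by omega)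
  have h6 := Qsp.mul' (K := r + 1) (L := r + 1) h4 h2 (by omega) (by omega)
  exact Qsp.neg (Qsp.add h5 h6)

lemma innerField_edge (s : ℝ) :
    innerField lam S c (pt s 0) = -((s * (1 - s) * pds c (pt s 0)) • S.1) := by
  simp [innerField, bub]

lemma innerField_eq_zero {z : E} (hz : z 0 = 0 ∨ z 0 = 1 ∨ z 1 = 1) : innerField lam S c z = 0 := by
  rcases hz with h | h | h <;> simp [innerField, bub, h]

/-- The trace agrees with `innerField_edge`, so cut and uncut cells fit together. -/
lemma cutField_edge (s : ℝ) :
    cutField S c (pt s 0) = -((s * (1 - s) * pds c (pt s 0)) • S.1) := by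
  simp [cutField, tanS]

/-- By `IsConvexQuad.jac_mul_dot`, the sign of `-w · ∇p` at every point of a cut cell follows,
however the interface cuts it. -/
lemma neg_det2_cutField (z : E) : -det2 (cutField S c z) (vvec S c z) =
    jac S z * (z 0 * (1 - z 0) * pds c z ^ 2 + z 1 * (1 - z 1) * pdt c z ^ 2) := by
  simp only [cutField, vvec, jac, det2, PiLp.add_apply, PiLp.smul_apply, PiLp.neg_apply,
    PiLp.sub_apply, smul_eq_mul]
  ring

lemma integral_det2_bubbleCoef :
    ∫ z in sq, bub z * det2 (bubbleCoef S c z) (vvec S c z) = bubbleForm S c := by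
  have hv : ∀ i, Continuous fun z => vvec S c z i := fun i =>
    (continuous_coord i).comp (continuous_vvec S c)
  have hint : ∀ i (j k : Fin r), IntegrableOn (fun z => moment S c i j k *
      (bub z * (z 0 ^ (j : ℕ) * z 1 ^ (k : ℕ)) * vvec S c z i)) sq := fun i j k => by
    have hm : Continuous fun z : E => z 0 ^ (j : ℕ) * z 1 ^ (k : ℕ) := by fun_prop
    exact integrableOn_sq
      (continuous_const.mul ((continuous_bub.mul hm).mul (hv i))).continuousOn
  have h1 : ∀ i, ∑ j, ∑ k, moment S c i j k ^ 2 = ∫ z in sq, ∑ j, ∑ k, moment S c i j k *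
      (bub z * (z 0 ^ (j : ℕ) * z 1 ^ (k : ℕ)) * vvec S c z i) := fun i => by
    rw [integral_finsetSum _ fun j _ => integrable_finsetSum _ fun k _ => hint i j k]
    refine Finset.sum_congr rfl fun j _ => ?_
    rw [integral_finsetSum _ fun k _ => hint i j k]
    refine Finset.sum_congr rfl fun k _ => ?_
    rw [integral_const_mul, pow_two, moment]
  rw [bubbleForm, Fin.sum_univ_two, h1, h1, ← integral_add]
  · refine integral_congr_ae (Filter.Eventually.of_forall fun z => ?_)
    simp only [det2, bubbleCoef, pt_zero, pt_one]
    rw [neg_mul, sub_neg_eq_add, mul_add, Finset.sum_mul, Finset.sum_mul, Finset.mul_sum,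
      Finset.mul_sum, add_comm]
    congr 1 <;> refine Finset.sum_congr rfl fun j _ => ?_ <;>
      rw [Finset.sum_mul, Finset.mul_sum] <;> exact Finset.sum_congr rfl fun k _ => by ring
  · exact integrable_finsetSum _ fun j _ => integrable_finsetSum _ fun k _ => hint 0 j k
  · exact integrable_finsetSum _ fun j _ => integrable_finsetSum _ fun k _ => hint 1 j k

lemma continuous_pt_fst : Continuous fun z : E => pt (z 0) 0 :=
  contDiff_pt.continuous.comp (by fun_prop : Continuous fun z : E => (z 0, (0 : ℝ)))

lemma continuous_bubbleCoef : Continuous (bubbleCoef S c) :=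
  contDiff_pt.continuous.comp (by fun_prop : Continuous fun z : E =>
    ((∑ j, ∑ k, moment S c 1 j k * (z 0 ^ (j : ℕ) * z 1 ^ (k : ℕ))),
    (-∑ j, ∑ k, moment S c 0 j k * (z 0 ^ (j : ℕ) * z 1 ^ (k : ℕ)))))

lemma integral_neg_det2_innerField :
    ∫ z in sq, -det2 (innerField lam S c z) (vvec S c z) = edgeForm S c + lam * bubbleForm S c := by
  have hd : ∀ {f g : E → E}, Continuous f → Continuous g → Continuous fun z => det2 (f z) (g z) :=
    fun hf hg => continuous_det2.comp (hf.prodMk hg)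
  have hv := continuous_vvec S c
  have h1 := hd (continuous_const (y := S.1)) hv
  have h2 := hd (continuous_bubbleCoef S c) hv
  have h3 : Continuous fun z : E => pds c (pt (z 0) 0) := (continuous_pds c).comp continuous_pt_fst
  have hb := continuous_bub
  rw [← integral_det2_bubbleCoef, edgeForm, ← integral_const_mul, ← integral_add]
  · refine integral_congr_ae (Filter.Eventually.of_forall fun z => ?_)
    simp only [innerField, det2_neg_left, det2_add_left, det2_smul_left]
    ring
  · exact integrableOn_sq (by fun_prop)
  · exact integrableOn_sq (by fun_prop)

end Fields

/-! ### Rotation of polynomials and of the local fields. -/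

/-- The coefficients of the rotated polynomial. -/
lemma exists_rotCoef {r : ℕ} (c : Coef r) (n : ℕ) :
    ∃ d : Coef r, ∀ z, pev d z = pev c (rot^[n] z) := by
  obtain ⟨d, hd⟩ := exists_coef (Qsp.comp_rot_iterate (pev_mem_Qsp c) n)
  exact ⟨d, fun z => (congrFun hd z).symm⟩

/-- The coefficients of a polynomial composed with the `n`-fold rotation of the square. -/
def rotCoef {r : ℕ} (c : Coef r) (n : ℕ) : Coef r := (exists_rotCoef c n).choose

lemma pev_rotCoef {r : ℕ} (c : Coef r) (n : ℕ) (z : E) :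
    pev (rotCoef c n) z = pev c (rot^[n] z) := (exists_rotCoef c n).choose_spec z

lemma rotCoef_succ {r : ℕ} (c : Coef r) (n : ℕ) : rotCoef c (n + 1) = rotCoef (rotCoef c n) 1 := by
  have : ∀ z, pev (rotCoef c (n + 1)) z = pev (rotCoef (rotCoef c n) 1) z := fun z => by
    rw [pev_rotCoef, pev_rotCoef, pev_rotCoef, Function.iterate_one, Function.iterate_succ_apply]
  have h : rotCoef c (n + 1) - rotCoef (rotCoef c n) 1 = 0 := eq_zero_of_pev fun z _ => by
    have := sub_eq_zero.2 (this z)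
    rw [← this]
    simp only [pev, Pi.sub_apply, sub_mul, Finset.sum_sub_distrib]
  exact sub_eq_zero.1 h

lemma rotCoef_zero {r : ℕ} (c : Coef r) : rotCoef c 0 = c := by
  have h : rotCoef c 0 - c = 0 := eq_zero_of_pev fun z _ => by
    have := sub_eq_zero.2 (pev_rotCoef c 0 z)
    rw [Function.iterate_zero, id] at this
    rw [← this]
    simp only [pev, Pi.sub_apply, sub_mul, Finset.sum_sub_distrib]
  exact sub_eq_zero.1 h

lemma pds_pdt_rotCoef {r : ℕ} (c : Coef r) (z : E) :
    pds (rotCoef c 1) z = pdt c (rot z) ∧ pdt (rotCoef c 1) z = -pds c (rot z) := by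
  set R : E →L[ℝ] E := (EuclideanSpace.proj 1 : E →L[ℝ] ℝ).smulRight (pt (-1) 0) +
    (EuclideanSpace.proj 0 : E →L[ℝ] ℝ).smulRight (pt 0 1) with hR
  have hrot : HasFDerivAt rot R z := by
    have h1 : rot = fun z => pt 1 0 + R z := by
      ext z i; fin_cases i <;> simp [rot, hR]
      ring
    rw [h1]
    exact R.hasFDerivAt.const_add _
  have h1 := (hasFDerivAt_pev c (rot z)).comp z hrot
  have h2 := hasFDerivAt_pev (rotCoef c 1) z
  rw [show pev (rotCoef c 1) = pev c ∘ rot from funext (pev_rotCoef c 1)] at h2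
  have h3 := h2.unique h1
  constructor
  · have := DFunLike.congr_fun h3 (pt 1 0)
    simpa [pgrad_apply, hR] using this
  · have := DFunLike.congr_fun h3 (pt 0 1)
    simpa [pgrad_apply, hR] using this

/-- A quarter turn exchanges the two summands of the field, and the sign changes of derivative and
tangent vector cancel. So the field does not depend on the numbering of the corners, and its trace
is needed on one edge only. -/
lemma cutField_rot {r : ℕ} (A : Fin 4 → E) (c : Coef r) (z : E) :
    cutField (shape (rotc A 1)) (rotCoef c 1) z = cutField (shape A) c (rot z) := by
  obtain ⟨h1, h2⟩ := pds_pdt_rotCoef c z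
  have e1 : (1 : Fin 4) + 1 = 2 := rfl
  have e2 : (2 : Fin 4) + 1 = 3 := rfl
  have e3 : (3 : Fin 4) + 1 = 0 := rfl
  ext i
  simp only [cutField, h1, h2, tanS, tanT, shape, rotc, rot, pt_zero, pt_one, e1, e2, e3, zero_add,
    PiLp.add_apply, PiLp.smul_apply, PiLp.neg_apply, PiLp.sub_apply, smul_eq_mul]
  ring

lemma rotc_add (A : Fin 4 → E) (e e' : Fin 4) : rotc A (e + e') = rotc (rotc A e) e' := by
  funext i; simp only [rotc, add_assoc, add_comm e e']

lemma cutField_rotc {r : ℕ} (A : Fin 4 → E) (c : Coef r) (e : Fin 4) (z : E) :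
    cutField (shape (rotc A e)) (rotCoef c e) z = cutField (shape A) c (rot^[(e : ℕ)] z) := by
  have h0 : rotc A 0 = A := by funext i; simp [rotc]
  have h1 := fun z => cutField_rot A c z
  have h2 : ∀ z, cutField (shape (rotc A 2)) (rotCoef c 2) z = cutField (shape A) c (rot (rot z)) :=
    fun z => by
      rw [show (2 : Fin 4) = 1 + 1 from rfl, rotc_add, rotCoef_succ c 1, cutField_rot, h1]
  have h3 : ∀ z, cutField (shape (rotc A 3)) (rotCoef c 3) z =
      cutField (shape A) c (rot (rot (rot z))) := fun z => by
    rw [show (3 : Fin 4) = 2 + 1 from rfl, rotc_add, rotCoef_succ c 2, cutField_rot, h2]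
  fin_cases e
  · change cutField (shape (rotc A 0)) (rotCoef c 0) z = _
    rw [h0, rotCoef_zero]; rfl
  · exact h1 z
  · exact h2 z
  · exact h3 z

/-- A quarter turn that leads from one edge to another takes the edge `t = 0` to the rest of the
boundary. -/
lemma rot_iterate_edge {e e' : Fin 4} (h : e' ≠ e) (s : ℝ) :
    (rot^[4 - (e' : ℕ)] (rot^[(e : ℕ)] (pt s 0))) 0 = 0 ∨
    (rot^[4 - (e' : ℕ)] (rot^[(e : ℕ)] (pt s 0))) 0 = 1 ∨
    (rot^[4 - (e' : ℕ)] (rot^[(e : ℕ)] (pt s 0))) 1 = 1 := by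
  rw [← Function.iterate_add_apply]
  fin_cases e <;> fin_cases e' <;> first
    | exact absurd rfl h
    | simp [rot, Function.iterate_succ_apply]

lemma rot_iterate_cancel (e : Fin 4) (z : E) : rot^[4 - (e : ℕ)] (rot^[(e : ℕ)] z) = z ∧
    rot^[(e : ℕ)] (rot^[4 - (e : ℕ)] z) = z := by
  rw [← Function.iterate_add_apply, ← Function.iterate_add_apply, Nat.sub_add_cancel e.2.le,
    Nat.add_sub_cancel' e.2.le]
  exact ⟨rot_rot_rot_rot z, rot_rot_rot_rot z⟩

lemma IsScaled.norm_tan_le {ε h : ℝ} {A : Fin 4 → E} (hA : IsScaled ε h A) {z : E} (hz : z ∈ csq) :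
    ‖tanS (shape A) z‖ ≤ 4 * h ∧ ‖tanT (shape A) z‖ ≤ 4 * h := by
  obtain ⟨h1, h2⟩ := CutFEM.norm_tan_le hA.2 hz
  have e1 : tanS (shape A) z = h • tanS (h⁻¹ • shape A) z := by
    simp only [tanS, Prod.smul_fst, Prod.smul_snd, smul_add, smul_smul, mul_inv_cancel₀ hA.1.ne',
      one_smul, mul_comm h, mul_assoc, inv_mul_cancel₀ hA.1.ne', mul_one]
  have e2 : tanT (shape A) z = h • tanT (h⁻¹ • shape A) z := by
    simp only [tanT, Prod.smul_fst, Prod.smul_snd, smul_add, smul_smul, mul_inv_cancel₀ hA.1.ne',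
      one_smul, mul_comm h, mul_assoc, inv_mul_cancel₀ hA.1.ne', mul_one]
  rw [e1, e2, norm_smul, norm_smul, Real.norm_eq_abs, abs_of_pos hA.1]
  constructor <;> nlinarith [hA.1]

/-- The local fields are bounded in terms of the derivatives of the pressure. -/
lemma exists_field_le (r : ℕ) {lam : ℝ} (hlam : 0 ≤ lam) : ∃ C > 0, ∀ (S : Shape) (c : Coef r)
    (h D : ℝ), 0 ≤ h → 0 ≤ D → (∀ z ∈ csq, ‖tanS S z‖ ≤ 4 * h ∧ ‖tanT S z‖ ≤ 4 * h) →
    (∀ z ∈ csq, |pds c z| ≤ D ∧ |pdt c z| ≤ D) → ∀ z ∈ csq, ∀ i,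
      |innerField lam S c z i| ≤ C * (h * D) ∧ |cutField S c z i| ≤ C * (h * D) := by
  set V := volume.real sq with hV
  have hV0 : 0 ≤ V := measureReal_nonneg
  -- The summand `8` covers the two terms of `cutField`, each at most `4 h D`; the other one comes
  -- from the `r ^ 2` moments, each at most `8 h D V`.
  refine ⟨8 + lam * (r * (r * (8 * V))), by positivity, fun S c h D hh hD hS hc z hz i => ?_⟩
  have hhD : 0 ≤ h * D := mul_nonneg hh hD
  have hom : ∀ t : ℝ, 0 ≤ t → t ≤ 1 → |t * (1 - t)| ≤ 1 := fun t h0 h1 => by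
    rw [abs_of_nonneg (by nlinarith)]; nlinarith
  have hb : ∀ z ∈ csq, |bub z| ≤ 1 := fun z hz => by
    rw [bub, abs_mul]
    exact mul_le_one₀ (hom _ hz.1 hz.2.1) (abs_nonneg _) (hom _ hz.2.2.1 hz.2.2.2)
  have hmono : ∀ z ∈ csq, ∀ j k : ℕ, |z 0 ^ j * z 1 ^ k| ≤ 1 := fun z hz j k => by
    rw [abs_mul, abs_of_nonneg (pow_nonneg hz.1 _), abs_of_nonneg (pow_nonneg hz.2.2.1 _)]
    exact mul_le_one₀ (pow_le_one₀ hz.1 hz.2.1) (pow_nonneg hz.2.2.1 _)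
      (pow_le_one₀ hz.2.2.1 hz.2.2.2)
  have hprod : ∀ {a b A B : ℝ}, |a| ≤ A → |b| ≤ B → |a * b| ≤ A * B := fun ha hb => by
    rw [abs_mul]; exact mul_le_mul ha hb (abs_nonneg _) ((abs_nonneg _).trans ha)
  have hv : ∀ z ∈ csq, ∀ i, |vvec S c z i| ≤ 8 * (h * D) := fun z hz i => by
    have h1 := hprod (hc z hz).1 ((abs_coord_le (tanT S z) i).trans (hS z hz).2)
    have h2 := hprod (hc z hz).2 ((abs_coord_le (tanS S z) i).trans (hS z hz).1)
    have h3 := abs_sub (pds c z * tanT S z i) (pdt c z * tanS S z i)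
    simp only [vvec, PiLp.sub_apply, PiLp.smul_apply, smul_eq_mul]
    linarith
  have hmom : ∀ i j k, |moment S c i j k| ≤ 8 * (h * D) * V := fun i j k => by
    rw [moment, ← Real.norm_eq_abs]
    refine norm_setIntegral_le_of_norm_le_const volume_sq_lt_top fun z hz => ?_
    have hz := sq_subset_csq hz
    have := hprod (hprod (hb z hz) (hmono z hz j k)) (hv z hz i)
    rwa [one_mul, one_mul] at this
  have hsum : ∀ i, |∑ j, ∑ k, moment S c i j k * (z 0 ^ (j : ℕ) * z 1 ^ (k : ℕ))| ≤
      r * (r * (8 * (h * D) * V)) := fun i => by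
    refine (Finset.abs_sum_le_sum_abs _ _).trans ?_
    refine (Finset.sum_le_sum fun j _ => (Finset.abs_sum_le_sum_abs _ _).trans
      (Finset.sum_le_sum fun k _ => hprod (hmom i j k) (hmono z hz j k))).trans ?_
    simp
  have hq : |bubbleCoef S c z i| ≤ r * (r * (8 * (h * D) * V)) := by
    fin_cases i
    · exact hsum 1
    · have := hsum 0
      rw [← abs_neg] at this
      exact this
  constructor
  · have h0 : |pds c (pt (z 0) 0)| ≤ D := (hc _ (pt_mem_csq ⟨hz.1, hz.2.1⟩)).1
    have h1 : |1 - z 1| ≤ 1 := abs_le.2 ⟨by linarith [hz.2.2.2], by linarith [hz.2.2.1]⟩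
    have h2 : |S.1 i| ≤ 4 * h := by
      have := (hS (pt 0 0) (pt_mem_csq ⟨le_rfl, zero_le_one⟩)).1
      simp only [tanS, pt_one, zero_smul, add_zero] at this
      exact (abs_coord_le _ _).trans this
    have h3 := hprod (hprod (hprod (hom _ hz.1 hz.2.1) h1) h0) h2
    have h4 := hprod (hprod (abs_of_nonneg hlam).le (hb z hz)) hq
    have h5 := abs_add_le (z 0 * (1 - z 0) * (1 - z 1) * pds c (pt (z 0) 0) * S.1 i)
      (lam * bub z * bubbleCoef S c z i)
    simp only [innerField, PiLp.neg_apply, PiLp.add_apply, PiLp.smul_apply, smul_eq_mul, abs_neg]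
    linarith
  · have h3 := hprod (hprod (hom _ hz.1 hz.2.1) (hc z hz).1)
      ((abs_coord_le (tanS S z) i).trans (hS z hz).1)
    have h4 := hprod (hprod (hom _ hz.2.2.1 hz.2.2.2) (hc z hz).2)
      ((abs_coord_le (tanT S z) i).trans (hS z hz).2)
    have h5 := abs_add_le (z 0 * (1 - z 0) * pds c z * tanS S z i)
      (z 1 * (1 - z 1) * pdt c z * tanT S z i)
    have h6 : 0 ≤ lam * (r * (r * (8 * V))) * (h * D) := by positivity
    simp only [cutField, PiLp.neg_apply, PiLp.add_apply, PiLp.smul_apply, smul_eq_mul, abs_neg]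
    linarith

/-! ### The velocity field -/

/-- The reason for `vvec`: the determinant with it is the product with the physical gradient, freed
from the denominator of the inverse Jacobian. -/
lemma IsConvexQuad.jac_mul_dot {A : Fin 4 → E} (hA : IsConvexQuad A) {r : ℕ} {c : Coef r}
    {φ : E → ℝ} (hφ : ∀ z ∈ csq, φ (xi A z) = pev c z) (u : E) {z : E} (hz : z ∈ sq) :
    jac (shape A) z * ∑ i, u i * pderiv i φ (xi A z) = det2 u (vvec (shape A) c z) := by
  have hj : jac (shape A) z ≠ 0 := ne_of_gt (hA.sq_subset hz)
  simp only [Fin.sum_univ_two, hA.pderiv_eq hφ _ hz, pgrad_apply, jacInv, pt_zero, pt_one]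
  simp only [det2, PiLp.single_apply, vvec, PiLp.sub_apply, PiLp.smul_apply, smul_eq_mul]
  field_simp
  simp
  ring

lemma IsConvexQuad.integral_neg_dot {A : Fin 4 → E} (hA : IsConvexQuad A) {r : ℕ} {c : Coef r}
    {φ : E → ℝ} (hφ : ∀ z ∈ csq, φ (xi A z) = pev c z) {u f : E → E}
    (hu : ∀ z ∈ sq, u (xi A z) = f z) :
    ∫ x in quad A, -∑ i, u x i * pderiv i φ x = ∫ z in sq, -det2 (f z) (vvec (shape A) c z) := by
  rw [hA.integral_quad]
  refine setIntegral_congr_fun isOpen_sq.measurableSet fun z hz => ?_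
  simp only [mul_neg, hu z hz]
  rw [hA.jac_mul_dot hφ _ hz]

lemma IsConvexQuad.continuousOn_comp_xiInv {A : Fin 4 → E} (hA : IsConvexQuad A) {X : Type*}
    [TopologicalSpace X] {f : E → X} (hf : Continuous f) :
    ContinuousOn (fun x => f (xiInv A x)) (closure (quad A)) := by
  rw [closure_quad]
  rintro _ ⟨z, hz, rfl⟩
  exact (hf.continuousAt.comp (contDiffAt_xiInv A (hA.csq_subset hz) (n := 1)
    (by simp)).continuousAt).continuousWithinAt

/-- Bounds for a mapped polynomial in terms of its maximum. -/
lemma exists_mapped_le (r : ℕ) {ε : ℝ} (hε : 0 < ε) : ∃ C > 0, ∀ (h : ℝ) (A : Fin 4 → E),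
    IsScaled ε h A → IsConvexQuad A → ∀ (c : Coef r) (φ : E → ℝ),
      (∀ z ∈ csq, φ (xi A z) = pev c z) → ∀ B, (∀ z ∈ csq, |pev c z| ≤ B) →
      ∫ x in quad A, φ x ^ 2 ≤ C * (h ^ 2 * B ^ 2) ∧
      ∫ x in quad A, ∑ i, ‖pderiv i φ x‖ ^ 2 ≤ C * B ^ 2 := by
  obtain ⟨κ₁, hκ₁, κ₂, hκ₂, hequiv⟩ := exists_gradient_equiv r hε
  obtain ⟨C1, hC1, hinv⟩ := exists_grad_le_of_abs_le r
  obtain ⟨κ, hκ, hred⟩ := exists_red_le_integral r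
  set V := volume.real sq with hV
  have hV0 : 0 ≤ V := measureReal_nonneg
  refine ⟨16 * V + κ₂ * (C1 * V / κ) + 1, by positivity, fun h A hA hA' c φ hφ B hB => ?_⟩
  have hB2 : 0 ≤ B ^ 2 := sq_nonneg B
  have hh2 : 0 ≤ h ^ 2 := sq_nonneg h
  constructor
  · have h1 : ∫ x in quad A, φ x ^ 2 ≤ ∫ z in sq, 16 * h ^ 2 * B ^ 2 := by
      rw [hA'.integral_quad]
      refine setIntegral_mono_on ?_ ?_ isOpen_sq.measurableSet fun z hz => ?_
      · refine (integrableOn_sq (f := fun z => jac (shape A) z * pev c z ^ 2)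
          ((continuous_jac _).mul ((continuous_pev c).pow 2)).continuousOn).congr_fun
          (fun z hz => ?_) isOpen_sq.measurableSet
        simp only [hφ z (sq_subset_csq hz)]
      · exact integrableOn_const volume_sq_lt_top.ne
      · have hz' := sq_subset_csq hz
        rw [hφ z hz']
        have h3 : pev c z ^ 2 ≤ B ^ 2 := by
          rw [← sq_abs]; exact pow_le_pow_left₀ (abs_nonneg _) (hB z hz') 2
        exact mul_le_mul (hA.jac_bounds hz').2 h3 (sq_nonneg _) (by positivity)
    rw [setIntegral_const, smul_eq_mul] at h1
    have h2 : 0 ≤ (κ₂ * (C1 * V / κ) + 1) * (h ^ 2 * B ^ 2) := by positivity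
    linarith
  · refine ((hequiv h A hA hA' c φ hφ).2).trans ?_
    have h1 : ∫ z in sq, (pds c z ^ 2 + pdt c z ^ 2) ≤ ∫ z in sq, C1 * B ^ 2 := by
      refine setIntegral_mono_on ?_ ?_ isOpen_sq.measurableSet fun z hz =>
        hinv c B hB z (sq_subset_csq hz)
      · exact integrableOn_sq
          (((continuous_pds c).pow 2).add ((continuous_pdt c).pow 2)).continuousOn
      · exact integrableOn_const volume_sq_lt_top.ne
    rw [setIntegral_const, smul_eq_mul] at h1
    have h2 : ‖red c‖ ^ 2 ≤ C1 * V / κ * B ^ 2 := by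
      rw [div_mul_eq_mul_div, le_div_iff₀ hκ]
      linarith [hred c]
    have h3 := mul_le_mul_of_nonneg_left h2 hκ₂.le
    have h4 : 0 ≤ (16 * V + 1) * B ^ 2 := by positivity
    linarith

namespace QuadMesh

variable {Ω Ωf Ωs : Set E} {M : QuadMesh Ω}

lemma rotc_zero (A : Fin 4 → E) : rotc A 0 = A := by funext i; simp [rotc]

section Velocity

variable (M) {r : ℕ} (lam : ℝ) (c : Fin M.n → Coef r)

open Classical in
/-- The velocity on a cell, in reference coordinates. -/
def localField (Ωs : Set E) (K : Fin M.n) (z : E) : E :=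
  -- A bubble correction has a sign only after integration over a full cell, so it is not available
  -- on cells that meet the solid.
  if K ∈ M.sub Ωs then cutField (shape (M.corner K)) (c K) z
  -- The rotation by `4 - e` quarter turns brings the edge `e` to the position `t = 0`. Edges on the
  -- outer boundary receive no function.
  else ∑ e, if M.Shared K e then
    innerField lam (shape (rotc (M.corner K) e)) (rotCoef (c K) e) (rot^[4 - (e : ℕ)] z) else 0

open Classical in
/-- The velocity field. -/
def velocity (Ωf Ωs : Set E) (x : E) : E :=
  if h : ∃ K ∈ M.sub Ωf, x ∈ closure (M.cell K) then
    M.localField lam c Ωs h.choose (xiInv (M.corner h.choose) x) else 0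

variable {M lam c}

lemma localField_mem (hr : 1 ≤ r) (K : Fin M.n) (i : Fin 2) :
    (fun z => M.localField lam c Ωs K z i) ∈ Qsp (r + 1) (r + 1) := by
  classical
  by_cases hK : K ∈ M.sub Ωs
  · simp only [localField, hK, if_true]
    exact cutField_mem _ _ hr i
  · simp only [localField, hK, if_false, WithLp.ofLp_sum, Finset.sum_apply]
    refine Qsp.sum _ fun e _ => ?_
    by_cases he : M.Shared K e
    · simp only [he, if_true]
      exact Qsp.comp_rot_iterate (innerField_mem _ _ _ hr i) _
    · simp only [he, if_false]
      exact Qsp.const 0 _ _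

open Classical in
/-- The trace of the velocity on an edge. -/
lemma localField_edge {K : Fin M.n} (hcut : K ∈ M.sub Ωs → ∀ e, M.Shared K e) (e : Fin 4) (s : ℝ) :
    M.localField lam c Ωs K (rot^[(e : ℕ)] (pt s 0)) = if M.Shared K e then
      -((s * (1 - s) * pds (rotCoef (c K) e) (pt s 0)) • (shape (rotc (M.corner K) e)).1) else 0 := by
  by_cases hK : K ∈ M.sub Ωs
  · rw [localField, if_pos hK, if_pos (hcut hK e), ← cutField_rotc, cutField_edge]
  · rw [localField, if_neg hK, Finset.sum_eq_single e]
    · rw [(rot_iterate_cancel e _).1, innerField_edge]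
    · intro e' _ he'
      rw [innerField_eq_zero _ _ _ (rot_iterate_edge he' s), ite_self]
    · simp

lemma localField_corner {K : Fin M.n} (hcut : K ∈ M.sub Ωs → ∀ e, M.Shared K e) (e : Fin 4) {s : ℝ}
    (hs : s * (1 - s) = 0) : M.localField lam c Ωs K (rot^[(e : ℕ)] (pt s 0)) = 0 := by
  rw [localField_edge hcut, hs]; simp

lemma eq_of_xi_eq {K : Fin M.n} {e : Fin 4} {z z' : E} (hz : z ∈ csq) (hz' : z' ∈ csq)
    (h : xi (rotc (M.corner K) e) z' = xi (M.corner K) z) : z = rot^[(e : ℕ)] z' := by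
  rw [xi_rotc] at h
  exact (xi_injOn _ ((M.isConvex K).csq_subset (rot_iterate_mem_csq _ hz'))
    ((M.isConvex K).csq_subset hz) h).symm

variable {p : E → ℝ} (hc : ∀ K ∈ M.sub Ωf, ∀ z ∈ csq, p (xi (M.corner K) z) = pev (c K) z)
include hc

lemma pev_rotCoef_eq {K : Fin M.n} (hK : K ∈ M.sub Ωf) (e : Fin 4) :
    ∀ z ∈ csq, p (xi (rotc (M.corner K) e) z) = pev (rotCoef (c K) e) z := fun z hz => by
  rw [xi_rotc, hc K hK _ (rot_iterate_mem_csq _ hz), pev_rotCoef]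

variable (hcut : ∀ K, K ∈ M.sub Ωf → K ∈ M.sub Ωs → ∀ e, M.Shared K e)
include hcut

/-- The chosen cell does not matter. At a common corner both fields vanish. On a common edge the two
sides run in opposite directions, which changes the sign of both the tangent and the tangential
derivative of `p`. -/
lemma localField_eq {K K' : Fin M.n} (hK : K ∈ M.sub Ωf) (hK' : K' ∈ M.sub Ωf) {z z' : E}
    (hz : z ∈ csq) (hz' : z' ∈ csq) (h : xi (M.corner K) z = xi (M.corner K') z') :
    M.localField lam c Ωs K z = M.localField lam c Ωs K' z' := by
  by_cases hKK : K = K'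
  · subst hKK
    rw [xi_injOn _ ((M.isConvex K).csq_subset hz) ((M.isConvex K).csq_subset hz') h]
  have hmem : ∀ (L : Fin M.n) {y : E}, y ∈ csq → xi (M.corner L) y ∈ closure (M.cell L) :=
    fun L y hy => by rw [cell, closure_quad]; exact mem_image_of_mem _ hy
  have hx : xi (M.corner K) z ∈ closure (M.cell K) ∩ closure (M.cell K') :=
    ⟨hmem K hz, by rw [h]; exact hmem K' hz'⟩
  have hcorner : ∀ {L : Fin M.n} (_ : L ∈ M.sub Ωf) {y : E} (_ : y ∈ csq) (a : Fin 4),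
      xi (M.corner L) y = M.corner L a → M.localField lam c Ωs L y = 0 := by
    intro L hL y hy a ha
    have h1 : xi (rotc (M.corner L) a) (pt 0 0) = xi (M.corner L) y := by
      rw [xi_pt_zero, ha]; simp [rotc]
    rw [eq_of_xi_eq hy (pt_mem_csq ⟨le_rfl, zero_le_one⟩) h1]
    exact localField_corner (hcut L hL) a (by simp)
  rcases M.conforming K K' hKK with h1 | ⟨a, a', haa, h1⟩ | ⟨e, e', hee, h1⟩
  · have h1 : closure (M.cell K) ∩ closure (M.cell K') = ∅ := h1
    rw [h1] at hx; exact hx.elim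
  · have h1 : closure (M.cell K) ∩ closure (M.cell K') = {M.corner K a} := h1
    rw [h1] at hx
    have hx : xi (M.corner K) z = M.corner K a := hx
    rw [hcorner hK hz a hx, hcorner hK' hz' a' (by rw [← h, hx, haa])]
  · have h1 : closure (M.cell K) ∩ closure (M.cell K') = M.edge K e := h1
    have hee : M.edge K e = M.edge K' e' := hee
    have hx2 := hx
    rw [h1, M.edge_eq, quadEdge_subset_closure] at hx2
    obtain ⟨s, hs, hsx⟩ := hx2
    have hs' : 1 - s ∈ Icc (0 : ℝ) 1 := ⟨by linarith [hs.2], by linarith [hs.1]⟩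
    have e1 := eq_of_xi_eq hz (pt_mem_csq hs) hsx
    have e2 := eq_of_xi_eq hz' (pt_mem_csq hs') (by rw [← xi_opposite hKK hee, ← h]; exact hsx)
    have sh1 : M.Shared K e := ⟨K', hKK, h1⟩
    have sh2 : M.Shared K' e' := ⟨K, Ne.symm hKK, by rw [inter_comm, h1, hee]⟩
    rw [e1, e2, localField_edge (hcut K hK), localField_edge (hcut K' hK'), if_pos sh1, if_pos sh2]
    obtain ⟨o1, o2⟩ := opposite hKK hee
    have e3 : (shape (rotc (M.corner K') e')).1 = -(shape (rotc (M.corner K) e)).1 := by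
      simp only [shape, o1, o2, neg_sub]
    rw [e3]
    rcases eq_or_ne (s * (1 - s)) 0 with h0 | h0
    · rw [h0, show (1 - s) * (1 - (1 - s)) = 0 by linarith]; simp
    · have hs0 : s ≠ 0 := left_ne_zero_of_mul h0
      have hs1 : 1 - s ≠ 0 := right_ne_zero_of_mul h0
      rw [pds_opposite hKK hee (pev_rotCoef_eq hc hK e) (pev_rotCoef_eq hc hK' e') s
        ⟨lt_of_le_of_ne hs.1 hs0.symm, lt_of_le_of_ne hs.2 fun h => hs1 (by linarith)⟩]
      rw [smul_neg, neg_neg, ← neg_smul]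
      congr 1; ring

lemma velocity_xi {K : Fin M.n} (hK : K ∈ M.sub Ωf) {z : E} (hz : z ∈ csq) :
    M.velocity lam c Ωf Ωs (xi (M.corner K) z) = M.localField lam c Ωs K z := by
  have h : ∃ K' ∈ M.sub Ωf, xi (M.corner K) z ∈ closure (M.cell K') :=
    ⟨K, hK, by rw [cell, closure_quad]; exact mem_image_of_mem _ hz⟩
  have key : ∀ L ∈ M.sub Ωf, xi (M.corner K) z ∈ closure (M.cell L) →
      M.localField lam c Ωs L (xiInv (M.corner L) (xi (M.corner K) z)) =
        M.localField lam c Ωs K z := by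
    intro L hL h2
    rw [cell, closure_quad] at h2
    obtain ⟨z', hz', h3⟩ := h2
    rw [← h3, xiInv_xi _ ((M.isConvex _).csq_subset hz')]
    exact localField_eq hc hcut hL hK hz' hz h3
  rw [velocity, dif_pos h]
  exact key _ h.choose_spec.1 h.choose_spec.2

lemma velocity_mem (hr : 1 ≤ r) (hΩ : IsFSIDomain Ω Ωf Ωs) :
    M.velocity lam c Ωf Ωs ∈ M.velocitySpace Ωf (r + 1) := by
  refine ⟨fun i => ⟨?_, fun K hK => ?_⟩, fun x hx => ?_⟩
  · have hU : M.compDomain Ωf = ⋃ K : M.sub Ωf, closure (M.cell K) := by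
      rw [compDomain, biUnion_eq_iUnion]
    rw [hU]
    refine (locallyFinite_of_finite _).continuousOn_iUnion (fun _ => isClosed_closure) fun K => ?_
    have h1 := (M.isConvex K.1).continuousOn_comp_xiInv
      (continuous_of_mem_Qsp (localField_mem (Ωs := Ωs) (lam := lam) (c := c) hr K.1 i))
    refine h1.congr fun x hx => ?_
    have hx : x ∈ closure (quad (M.corner K.1)) := hx
    rw [closure_quad] at hx
    obtain ⟨z, hz, rfl⟩ := hx
    simp only [velocity_xi hc hcut K.2 hz, xiInv_xi _ ((M.isConvex K.1).csq_subset hz)]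
  · obtain ⟨q, hq, h⟩ := exists_mvPolynomial
      (localField_mem (Ωs := Ωs) (lam := lam) (c := c) hr K i)
    refine ⟨q, hq, fun s hs t ht => ?_⟩
    have hz : pt s t ∈ csq := ⟨hs.1.le, hs.2.le, ht.1.le, ht.2.le⟩
    have := velocity_xi (lam := lam) hc hcut hK hz
    change M.velocity lam c Ωf Ωs (xi (M.corner K) (pt s t)) i = _
    rw [this, h (pt s t), pt_zero, pt_one]
  · obtain ⟨hxf, hxΩ⟩ := hx
    rw [hΩ.isOpen.frontier_eq] at hxΩ
    have h1 := M.closure_fluid_subset hΩ (frontier_subset_closure hxf)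
    rw [compDomain, mem_iUnion₂] at h1
    obtain ⟨K, hK, hxK⟩ := h1
    -- Interior points of shared edges belong to `Ω`. So a point of the outer boundary is an end
    -- point of an edge, where the field vanishes, or lies on an edge without edge function.
    obtain ⟨e, s, hs, hsx⟩ := exists_edge_of_mem_closure hxK
      fun hcell => hxΩ.2 (M.cell_subset hΩ K hcell)
    rw [← hsx, xi_rotc, velocity_xi hc hcut hK (rot_iterate_mem_csq _ (pt_mem_csq hs))]
    by_cases hse : M.Shared K e
    · refine localField_corner (hcut K hK) e ?_
      by_contra h0
      have hs0 : s ≠ 0 := left_ne_zero_of_mul h0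
      have hs1 : 1 - s ≠ 0 := right_ne_zero_of_mul h0
      have := hse.mem_interior (s := s)
        ⟨lt_of_le_of_ne hs.1 hs0.symm, lt_of_le_of_ne hs.2 fun h => hs1 (by linarith)⟩
      rw [hsx] at this
      exact hxΩ.2 (hΩ.interior_closure_subset this)
    · classical
      rw [localField_edge (hcut K hK), if_neg hse]

end Velocity

end QuadMesh

/-! ### Scaling of the forms, integrals of vector fields, and the local estimates of the velocity.
-/

lemma vvec_smul_shape {r : ℕ} (h : ℝ) (S : Shape) (c : Coef r) (z : E) :
    vvec (h • S) c z = h • vvec S c z := by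
  ext i
  simp only [vvec, tanS, tanT, Prod.smul_fst, Prod.smul_snd, PiLp.sub_apply, PiLp.add_apply,
    PiLp.smul_apply, smul_eq_mul]
  ring

lemma edgeForm_smul_shape {r : ℕ} (h : ℝ) (S : Shape) (c : Coef r) :
    edgeForm (h • S) c = h ^ 2 * edgeForm S c := by
  rw [edgeForm, edgeForm, ← integral_const_mul]
  refine integral_congr_ae (Filter.Eventually.of_forall fun z => ?_)
  simp only [vvec_smul_shape, Prod.smul_fst, det2_smul_left, det2_smul_right]
  ring

lemma bubbleForm_smul_shape {r : ℕ} (h : ℝ) (S : Shape) (c : Coef r) :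
    bubbleForm (h • S) c = h ^ 2 * bubbleForm S c := by
  have : ∀ i j k, moment (h • S) c i j k = h * moment S c i j k := fun i j k => by
    rw [moment, moment, ← integral_const_mul]
    refine integral_congr_ae (Filter.Eventually.of_forall fun z => ?_)
    simp only [vvec_smul_shape, PiLp.smul_apply, smul_eq_mul]
    ring
  simp only [bubbleForm, this, mul_pow, Finset.mul_sum]

/-- The partial derivatives of a vector field, by components. -/
lemma norm_pderiv_sq {w : E → E} {x : E} (hw : ∀ k, DifferentiableAt ℝ (fun y => w y k) x)
    (i : Fin 2) : (∀ k, pderiv i w x k = pderiv i (fun y => w y k) x) ∧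
      ‖pderiv i w x‖ ^ 2 = ∑ k, ‖pderiv i (fun y => w y k) x‖ ^ 2 := by
  have hd : DifferentiableAt ℝ w x := differentiableAt_euclidean.2 hw
  have h1 : ∀ k, pderiv i w x k = pderiv i (fun y => w y k) x := fun k => by
    have := ((EuclideanSpace.proj k : E →L[ℝ] ℝ).hasFDerivAt.comp x hd.hasFDerivAt).fderiv
    rw [pderiv, pderiv]
    change _ = fderiv ℝ ((EuclideanSpace.proj k : E →L[ℝ] ℝ) ∘ w) x _
    rw [this]
    rfl
  refine ⟨h1, ?_⟩
  rw [norm_sq_eq, Fin.sum_univ_two, h1, h1, Real.norm_eq_abs, Real.norm_eq_abs, sq_abs, sq_abs]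

lemma IsConvexQuad.differentiableAt_of_eqOn {A : Fin 4 → E} (hA : IsConvexQuad A) {r : ℕ}
    {c : Coef r} {φ : E → ℝ} (hφ : ∀ z ∈ csq, φ (xi A z) = pev c z) {x : E} (hx : x ∈ quad A) :
    DifferentiableAt ℝ φ x := by
  rw [quad_eq_image] at hx
  obtain ⟨z, hz, rfl⟩ := hx
  obtain ⟨T, hT, -⟩ := hA.hasFDerivAt_of_eqOn hφ hz
  exact hT.differentiableAt

lemma IsConvexQuad.integrableOn_sq_of_eqOn {A : Fin 4 → E} (hA : IsConvexQuad A) {r : ℕ}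
    {c : Coef r} {φ : E → ℝ} (hφ : ∀ z ∈ csq, φ (xi A z) = pev c z) :
    IntegrableOn (fun x => φ x ^ 2) (quad A) := by
  refine IntegrableOn.mono_set (t := closure (quad A)) ?_ subset_closure
  refine ContinuousOn.integrableOn_compact (isCompact_closure_quad A) ?_
  exact ((hA.continuousOn_mapped c).congr (hA.eqOn_mapped hφ)).pow 2

lemma IsConvexQuad.integral_vector {A : Fin 4 → E} (hA : IsConvexQuad A) {r : ℕ}
    {d : Fin 2 → Coef r} {w : E → E} (hw : ∀ k, ∀ z ∈ csq, w (xi A z) k = pev (d k) z) :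
    IntegrableOn (fun x => ‖w x‖ ^ 2) (quad A) ∧
    IntegrableOn (fun x => ∑ i, ‖pderiv i w x‖ ^ 2) (quad A) ∧
    ∫ x in quad A, ‖w x‖ ^ 2 = ∑ k, ∫ x in quad A, w x k ^ 2 ∧
    ∫ x in quad A, ∑ i, ‖pderiv i w x‖ ^ 2 =
      ∑ k, ∫ x in quad A, ∑ i, ‖pderiv i (fun y => w y k) x‖ ^ 2 := by
  have h1 : ∀ k, IntegrableOn (fun x => w x k ^ 2) (quad A) := fun k =>
    hA.integrableOn_sq_of_eqOn (hw k)
  have h2 : ∀ k, IntegrableOn (fun x => ∑ i, ‖pderiv i (fun y => w y k) x‖ ^ 2) (quad A) :=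
    fun k => hA.integrableOn_pderiv (hw k)
  have e1 : EqOn (fun x => ‖w x‖ ^ 2) (fun x => ∑ k, w x k ^ 2) (quad A) := fun x _ => by
    simp only [norm_sq_eq, Fin.sum_univ_two]
  have e2 : EqOn (fun x => ∑ i, ‖pderiv i w x‖ ^ 2)
      (fun x => ∑ k, ∑ i, ‖pderiv i (fun y => w y k) x‖ ^ 2) (quad A) := fun x hx => by
    simp only
    rw [Finset.sum_comm]
    exact Finset.sum_congr rfl fun i _ =>
      (norm_pderiv_sq (fun k => hA.differentiableAt_of_eqOn (hw k) hx) i).2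
  have hm := hA.isOpen_quad.measurableSet
  refine ⟨IntegrableOn.congr_fun (integrable_finsetSum _ fun k _ => h1 k) e1.symm hm,
    IntegrableOn.congr_fun (integrable_finsetSum _ fun k _ => h2 k) e2.symm hm, ?_, ?_⟩
  · rw [setIntegral_congr_fun hm e1, integral_finsetSum _ fun k _ => h1 k]
  · rw [setIntegral_congr_fun hm e2, integral_finsetSum _ fun k _ => h2 k]

namespace QuadMesh

/-- A velocity field that controls the pressure gradient. -/
theorem exists_velocity {r : ℕ} (hr : 1 ≤ r) {ε : ℝ} (hε : 0 < ε) : ∃ κ > 0, ∃ C > 0,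
    ∀ (Ω Ωf Ωs : Set E) (M : QuadMesh Ω), IsFSIDomain Ω Ωf Ωs →
    (∀ K e, IsScaled ε M.size (rotc (M.corner K) e)) →
    (∀ K, K ∈ M.sub Ωf → K ∈ M.sub Ωs → ∀ e, M.Shared K e) → (∀ K, ∃ e, M.Shared K e) →
    ∀ p ∈ M.feSpace Ωf r, ∃ w ∈ M.velocitySpace Ωf (r + 1),
      (∀ K ∈ M.sub Ωf, w (M.corner K 0) = 0) ∧
      (∀ K ∈ M.innerCells Ωf Ωs, κ * (M.size ^ 2 * M.cellGrad p K) ≤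
        ∫ x in M.cell K, -∑ i, w x i * pderiv i p x) ∧
      (∀ K ∈ M.cutCells Ωf Ωs, ∀ x ∈ M.cell K, 0 ≤ -∑ i, w x i * pderiv i p x) ∧
      ∀ K ∈ M.fluidCells Ωf, ∫ x in M.cell K, ‖w x‖ ^ 2 ≤ C * (M.size ^ 4 * M.cellGrad p K) ∧
        ∫ x in M.cell K, ∑ i, ‖pderiv i w x‖ ^ 2 ≤ C * (M.size ^ 2 * M.cellGrad p K) := by
  classical
  obtain ⟨lam, hlam, κ, hκ, hform⟩ := exists_edgeForm_add_bubbleForm hr hε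
  obtain ⟨κ₁, hκ₁, κ₂, hκ₂, hequiv⟩ := exists_gradient_equiv r hε
  obtain ⟨C1, hC1, hgrad⟩ := exists_grad_le r
  obtain ⟨C2, hC2, hfield⟩ := exists_field_le r hlam
  obtain ⟨C3, hC3, hmap⟩ := exists_mapped_le (r + 1) hε
  -- Here `κ₂` converts coefficients to the gradient norm. The second constant combines two
  -- components, the bound `C3` for mapped polynomials, and the pointwise bound `B` of the local
  -- field.
  refine ⟨κ / κ₂, by positivity, 2 * (C3 * ((4 * C2) ^ 2 * (C1 / κ₁))), by positivity,
    fun Ω Ωf Ωs M hΩ hsc hcut hsh p hp => ?_⟩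
  have hex : ∀ K, ∃ c : Coef r, K ∈ M.sub Ωf → ∀ z ∈ csq, p (xi (M.corner K) z) = pev c z := by
    intro K
    by_cases hK : K ∈ M.sub Ωf
    · obtain ⟨c, hc⟩ := exists_coef_of_mem_feSpace hp hK 0
      rw [rotc_zero] at hc
      exact ⟨c, fun _ => hc⟩
    · exact ⟨0, fun h => absurd h hK⟩
  choose c hc using hex
  set w := M.velocity lam c Ωf Ωs with hw
  have hwxi : ∀ K ∈ M.sub Ωf, ∀ z ∈ csq, w (xi (M.corner K) z) = M.localField lam c Ωs K z :=
    fun K hK z hz => velocity_xi hc hcut hK hz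
  have hfac : ∀ K ∈ M.sub Ωf, ∀ e : Fin 4, ‖red (rotCoef (c K) e)‖ ^ 2 ≤ M.cellGrad p K / κ₁ ∧
      M.cellGrad p K ≤ κ₂ * ‖red (rotCoef (c K) e)‖ ^ 2 := fun K hK e => by
    have := hequiv M.size _ (hsc K e) (M.isConvex_rotc K e) _ p (pev_rotCoef_eq hc hK e)
    rw [M.quad_rotc_eq_cell] at this
    exact ⟨by rw [le_div_iff₀ hκ₁, mul_comm]; exact this.1, this.2⟩
  refine ⟨w, velocity_mem hc hcut hr hΩ, fun K hK => ?_, fun K hK => ?_, fun K hK x hx => ?_, fun K hK => ?_⟩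
  · have hx : xi (M.corner K) (pt 0 0) = M.corner K 0 := by rw [xi_pt_zero]; simp
    rw [← hx, hwxi K hK _ (pt_mem_csq ⟨le_rfl, zero_le_one⟩)]
    exact localField_corner (hcut K hK) 0 (by simp)
  · obtain ⟨hKf, hKs⟩ := mem_innerCells.1 hK
    set u : Fin 4 → E → E := fun e x => if M.Shared K e then
      innerField lam (shape (rotc (M.corner K) e)) (rotCoef (c K) e)
        (xiInv (rotc (M.corner K) e) x) else 0 with hu
    have hue : ∀ e, ∀ z ∈ csq, u e (xi (rotc (M.corner K) e) z) = if M.Shared K e then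
        innerField lam (shape (rotc (M.corner K) e)) (rotCoef (c K) e) z else 0 := fun e z hz => by
      simp only [hu, xiInv_xi _ ((M.isConvex_rotc K e).csq_subset hz)]
    have hwu : ∀ x ∈ M.cell K, w x = ∑ e, u e x := fun x hx => by
      rw [cell, quad_eq_image] at hx
      obtain ⟨z, hz, rfl⟩ := hx
      have hz := sq_subset_csq hz
      rw [hwxi K hKf z hz, localField, if_neg hKs]
      refine Finset.sum_congr rfl fun e _ => ?_
      have h1 : xi (M.corner K) z = xi (rotc (M.corner K) e) (rot^[4 - (e : ℕ)] z) := by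
        rw [xi_rotc, (rot_iterate_cancel e z).2]
      rw [h1, hue e _ (rot_iterate_mem_csq _ hz)]
    have hint : ∀ e, IntegrableOn (fun x => -∑ i, u e x i * pderiv i p x) (M.cell K) := fun e => by
      have hA := M.isConvex_rotc K e
      have hcu : ContinuousOn (u e) (closure (quad (rotc (M.corner K) e))) := by
        by_cases he : M.Shared K e
        · have hcf : Continuous (innerField lam (shape (rotc (M.corner K) e)) (rotCoef (c K) e)) := by
            refine (PiLp.continuous_toLp 2 _).comp (continuous_pi fun i => ?_)
            exact continuous_of_mem_Qsp (innerField_mem lam _ _ hr i)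
          simp only [hu, he, if_true]
          exact hA.continuousOn_comp_xiInv hcf
        · simp only [hu, he, if_false]
          exact continuousOn_const
      have h1 : IntegrableOn (fun x => -∑ i, u e x i *
          pderiv i (mapped (rotc (M.corner K) e) (rotCoef (c K) e)) x)
          (closure (quad (rotc (M.corner K) e))) := by
        refine ContinuousOn.integrableOn_compact (isCompact_closure_quad _) ?_
        refine (continuousOn_finsetSum _ fun i _ => ?_).neg
        exact ((continuous_coord i).comp_continuousOn hcu).mul (hA.continuousOn_pderiv_mapped _ i)
      rw [← M.quad_rotc_eq_cell K e]
      refine (h1.mono_set subset_closure).congr_fun (fun x hx => ?_) hA.isOpen_quad.measurableSet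
      simp only [hA.eqOn_pderiv (pev_rotCoef_eq hc hKf e) _ hx]
    have hval : ∀ e, ∫ x in M.cell K, -∑ i, u e x i * pderiv i p x = if M.Shared K e then
        edgeForm (shape (rotc (M.corner K) e)) (rotCoef (c K) e) +
          lam * bubbleForm (shape (rotc (M.corner K) e)) (rotCoef (c K) e) else 0 := fun e => by
      by_cases he : M.Shared K e
      · rw [if_pos he, ← integral_neg_det2_innerField, ← M.quad_rotc_eq_cell K e]
        refine (M.isConvex_rotc K e).integral_neg_dot (pev_rotCoef_eq hc hKf e) fun z hz => ?_
        rw [hue e z (sq_subset_csq hz), if_pos he]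
      · simp [hu, he]
    have hlow : ∀ e : Fin 4, κ * (M.size ^ 2 * ‖red (rotCoef (c K) e)‖ ^ 2) ≤
        edgeForm (shape (rotc (M.corner K) e)) (rotCoef (c K) e) +
          lam * bubbleForm (shape (rotc (M.corner K) e)) (rotCoef (c K) e) := fun e => by
      rw [(hsc K e).shape_eq, edgeForm_smul_shape, bubbleForm_smul_shape]
      have := mul_le_mul_of_nonneg_left (hform _ (hsc K e).2 (rotCoef (c K) e)) (sq_nonneg M.size)
      linarith
    have hsum : ∫ x in M.cell K, -∑ i, w x i * pderiv i p x =
        ∑ e, ∫ x in M.cell K, -∑ i, u e x i * pderiv i p x := by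
      rw [← integral_finsetSum _ fun e _ => hint e]
      refine setIntegral_congr_fun (M.isOpen_cell K).measurableSet fun x hx => ?_
      simp only [hwu x hx, WithLp.ofLp_sum, Finset.sum_apply, Finset.sum_mul]
      rw [Finset.sum_neg_distrib, Finset.sum_comm]
    rw [hsum]
    obtain ⟨e, he⟩ := hsh K
    -- Every shared edge contributes a nonnegative amount and already one of them controls the full
    -- gradient, so the others may be dropped.
    have hnn : ∀ e, 0 ≤ ∫ x in M.cell K, -∑ i, u e x i * pderiv i p x := fun e => by
      rw [hval]
      split_ifs
      · exact le_trans (by positivity) (hlow e)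
      · exact le_rfl
    refine le_trans ?_ (Finset.single_le_sum (fun e _ => hnn e) (Finset.mem_univ e))
    rw [hval, if_pos he]
    refine le_trans ?_ (hlow e)
    have h1 := (hfac K hKf e).2
    have h2 : κ / κ₂ * (M.size ^ 2 * M.cellGrad p K) ≤
        κ / κ₂ * (M.size ^ 2 * (κ₂ * ‖red (rotCoef (c K) e)‖ ^ 2)) :=
      mul_le_mul_of_nonneg_left (mul_le_mul_of_nonneg_left h1 (sq_nonneg _)) (by positivity)
    refine h2.trans (le_of_eq ?_)
    field_simp
  · obtain ⟨hKf, hKs⟩ := mem_cutCells.1 hK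
    rw [cell, quad_eq_image] at hx
    obtain ⟨z, hz, rfl⟩ := hx
    have hA := M.isConvex K
    have hj : 0 < jac (shape (M.corner K)) z := hA.sq_subset hz
    have h1 := hA.jac_mul_dot (hc K hKf) (w (xi (M.corner K) z)) hz
    rw [hwxi K hKf z (sq_subset_csq hz), localField, if_pos hKs] at h1
    have h2 := neg_det2_cutField (shape (M.corner K)) (c K) z
    rw [← h1] at h2
    have h3 : 0 ≤ jac (shape (M.corner K)) z * (z 0 * (1 - z 0) * pds (c K) z ^ 2 +
        z 1 * (1 - z 1) * pdt (c K) z ^ 2) := by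
      obtain ⟨k1, k2, k3, k4⟩ := hz
      have l1 : 0 ≤ z 0 * (1 - z 0) := mul_nonneg k1.le (by linarith)
      have l2 : 0 ≤ z 1 * (1 - z 1) := mul_nonneg k3.le (by linarith)
      positivity
    rw [← h2, ← mul_neg] at h3
    have h4 := nonneg_of_mul_nonneg_right h3 hj
    rw [hwxi K hKf z (sq_subset_csq hz), localField, if_pos hKs]
    exact h4
  · have hKf := mem_fluidCells.1 hK
    have hA := M.isConvex K
    have hs0 : IsScaled ε M.size (M.corner K) := by
      have := hsc K 0
      rwa [rotc_zero] at this
    -- A pointwise bound for the reference derivatives of the pressure, obtained from the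
    -- equivalence of norms.
    set D := √(C1 / κ₁ * M.cellGrad p K) with hD
    have hD2 : D ^ 2 = C1 / κ₁ * M.cellGrad p K :=
      Real.sq_sqrt (mul_nonneg (by positivity) (cellGrad_nonneg p K))
    have hder : ∀ e : Fin 4, ∀ z ∈ csq, |pds (rotCoef (c K) e) z| ≤ D ∧
        |pdt (rotCoef (c K) e) z| ≤ D := fun e z hz => by
      have h1 := hgrad (rotCoef (c K) e) z hz
      have h2 := mul_le_mul_of_nonneg_left (hfac K hKf e).1 hC1.le
      have h3 : C1 * (M.cellGrad p K / κ₁) = D ^ 2 := by rw [hD2]; ring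
      have hDn : 0 ≤ D := Real.sqrt_nonneg _
      constructor <;> refine abs_le_of_sq_le_sq ?_ hDn <;>
        nlinarith [sq_nonneg (pds (rotCoef (c K) e) z), sq_nonneg (pdt (rotCoef (c K) e) z)]
    -- The factor `4` accounts for the four edge functions of an uncut cell.
    set B := 4 * C2 * (M.size * D) with hB
    have hsD : 0 ≤ C2 * (M.size * D) :=
      mul_nonneg hC2.le (mul_nonneg size_nonneg (Real.sqrt_nonneg _))
    have hloc : ∀ z ∈ csq, ∀ i, |M.localField lam c Ωs K z i| ≤ B := fun z hz i => by
      by_cases hKs : K ∈ M.sub Ωs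
      · rw [localField, if_pos hKs]
        have hder0 := hder 0
        change ∀ z ∈ csq, |pds (rotCoef (c K) 0) z| ≤ D ∧ |pdt (rotCoef (c K) 0) z| ≤ D at hder0
        rw [rotCoef_zero] at hder0
        have := (hfield _ (c K) M.size D size_nonneg (Real.sqrt_nonneg _)
          (fun z hz => hs0.norm_tan_le hz) hder0 z hz i).2
        rw [hB]; linarith
      · rw [localField, if_neg hKs]
        simp only [WithLp.ofLp_sum, Finset.sum_apply]
        refine (Finset.abs_sum_le_sum_abs _ _).trans ?_
        refine (Finset.sum_le_sum (g := fun _ => C2 * (M.size * D)) fun e _ => ?_).trans ?_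
        · split_ifs
          · exact (hfield _ (rotCoef (c K) e) M.size D size_nonneg (Real.sqrt_nonneg _)
              (fun z hz => (hsc K e).norm_tan_le hz) (hder e) _ (rot_iterate_mem_csq _ hz) i).1
          · simpa using hsD
        · simp only [Finset.sum_const, Finset.card_univ, Fintype.card_fin, nsmul_eq_mul, hB]
          push_cast
          linarith
    have hd : ∀ k, ∃ d : Coef (r + 1), (fun z => M.localField lam c Ωs K z k) = pev d := fun k =>
      exists_coef (localField_mem hr K k)
    choose d hd using hd
    have hwd : ∀ k, ∀ z ∈ csq, w (xi (M.corner K) z) k = pev (d k) z := fun k z hz => by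
      rw [hwxi K hKf z hz, ← congrFun (hd k) z]
    have hest : ∀ k, _ := fun k => hmap M.size (M.corner K) hs0 hA (d k) (fun x => w x k) (hwd k) B
      fun z hz => by rw [← congrFun (hd k) z]; exact hloc z hz k
    obtain ⟨-, -, v1, v2⟩ := hA.integral_vector hwd
    have hB2 : B ^ 2 = (4 * C2) ^ 2 * (C1 / κ₁) * (M.size ^ 2 * M.cellGrad p K) := by
      rw [hB, mul_pow (4 * C2), mul_pow M.size, hD2]; ring
    constructor
    · rw [cell, v1, Fin.sum_univ_two]
      refine (add_le_add (hest 0).1 (hest 1).1).trans (le_of_eq ?_)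
      rw [hB2]; ring
    · rw [cell, v2, Fin.sum_univ_two]
      refine (add_le_add (hest 0).2 (hest 1).2).trans (le_of_eq ?_)
      rw [hB2]; ring

end QuadMesh

/-! ### Integrals of derivatives over the plane -/

/-- The point with the coordinate `t` in direction `i` and the other coordinate `c`. -/
def axisPt (i : Fin 2) (t c : ℝ) : E := if i = 0 then pt t c else pt c t

lemma axisPt_apply (i : Fin 2) (t c : ℝ) : axisPt i t c i = t ∧ axisPt i t c (1 - i) = c := by
  fin_cases i <;> simp [axisPt]

lemma measurePreserving_axisPt (i : Fin 2) :
    MeasurePreserving (fun q : ℝ × ℝ => axisPt i q.1 q.2) := by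
  fin_cases i
  · exact measurePreserving_pt
  · exact measurePreserving_pt.comp Measure.measurePreserving_swap

lemma measurableEmbedding_axisPt (i : Fin 2) :
    MeasurableEmbedding (fun q : ℝ × ℝ => axisPt i q.1 q.2) := by
  fin_cases i
  · exact measurableEmbedding_pt
  · exact measurableEmbedding_pt.comp MeasurableEquiv.prodComm.measurableEmbedding

/-- Almost all lines in the coordinate directions meet `Z` in a countable set. -/
def IsThin (Z : Set E) : Prop := ∀ i, ∀ᵐ c : ℝ, {t | axisPt i t c ∈ Z}.Countable

/-- A line in a coordinate direction meets the segment at most once, unless the segment has that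
direction; then only a single line meets it at all. -/
lemma isThin_segment (x y : E) : IsThin (segment ℝ x y) := by
  intro i
  have key : ∀ t c, axisPt i t c ∈ segment ℝ x y → ∃ θ : ℝ, t = x i + θ * (y i - x i) ∧
      c = x (1 - i) + θ * (y (1 - i) - x (1 - i)) := by
    intro t c h
    rw [segment_eq_image'] at h
    obtain ⟨θ, -, hθ⟩ := h
    obtain ⟨h1, h2⟩ := axisPt_apply i t c
    refine ⟨θ, ?_, ?_⟩
    · rw [← h1, ← hθ]; simp
    · rw [← h2, ← hθ]; simp
  by_cases hp : y (1 - i) - x (1 - i) = 0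
  · filter_upwards [compl_mem_ae_iff.2 (measure_singleton (x (1 - i)))] with c hc
    refine (Set.countable_empty).mono fun t ht => ?_
    obtain ⟨θ, -, h2⟩ := key t c ht
    rw [hp, mul_zero, add_zero] at h2
    exact hc h2
  · filter_upwards with c
    refine (Set.countable_singleton
      (x i + (c - x (1 - i)) / (y (1 - i) - x (1 - i)) * (y i - x i))).mono fun t ht => ?_
    obtain ⟨θ, h1, h2⟩ := key t c ht
    have : θ = (c - x (1 - i)) / (y (1 - i) - x (1 - i)) := by rw [eq_div_iff hp, h2]; ring
    rw [mem_singleton_iff, ← this, h1]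

lemma IsThin.mono {Z Z' : Set E} (h : IsThin Z') (hs : Z ⊆ Z') : IsThin Z := fun i => by
  filter_upwards [h i] with c hc
  exact hc.mono fun t ht => hs ht

lemma isThin_iUnion {ι : Type*} [Countable ι] {Z : ι → Set E} (h : ∀ k, IsThin (Z k)) :
    IsThin (⋃ k, Z k) := fun i => by
  filter_upwards [ae_all_iff.2 fun k => h k i] with c hc
  have : {t | axisPt i t c ∈ ⋃ k, Z k} = ⋃ k, {t | axisPt i t c ∈ Z k} := by ext t; simp
  rw [this]
  exact countable_iUnion hc

lemma hasDerivAt_axisPt (i : Fin 2) (t c : ℝ) :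
    HasDerivAt (fun t => axisPt i t c) (EuclideanSpace.single i 1) t := by
  have h : (fun t => axisPt i t c) =
      fun t => axisPt i 0 c + t • (EuclideanSpace.single i (1 : ℝ) : E) := by
    ext t k
    fin_cases i <;> fin_cases k <;> simp [axisPt]
  rw [h]
  simpa using ((hasDerivAt_id t).smul_const (EuclideanSpace.single i (1 : ℝ) : E)).const_add
    (axisPt i 0 c)

/-- The integral over the plane of a partial derivative of a compactly supported function that is
differentiable outside a thin set. -/
theorem integral_pderiv_eq_zero {V : E → ℝ} (hV : Continuous V) (hsupp : HasCompactSupport V)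
    {Z : Set E} (hZ : IsThin Z) (hd : ∀ x ∉ Z, DifferentiableAt ℝ V x) (i : Fin 2)
    (hi : Integrable (pderiv i V)) : ∫ x, pderiv i V x = 0 := by
  obtain ⟨R, hR0, hR⟩ : ∃ R > 0, tsupport V ⊆ Metric.ball 0 R := by
    obtain ⟨R, hR⟩ := hsupp.isCompact.isBounded.subset_ball 0
    exact ⟨max R 1, by positivity, hR.trans (Metric.ball_subset_ball (le_max_left _ _))⟩
  have hout : ∀ t c, t ∉ Ioo (-R) R → axisPt i t c ∉ tsupport V := fun t c ht h => by
    have h1 := hR h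
    rw [mem_ball_zero_iff] at h1
    have h2 := (abs_coord_le (axisPt i t c) i).trans_lt h1
    rw [(axisPt_apply i t c).1] at h2
    exact ht (abs_lt.1 h2)
  have hzero : ∀ t c, t ∉ Ioo (-R) R → V (axisPt i t c) = 0 ∧ pderiv i V (axisPt i t c) = 0 :=
    fun t c ht => by
      refine ⟨image_eq_zero_of_notMem_tsupport (hout t c ht), ?_⟩
      have h1 : V =ᶠ[𝓝 (axisPt i t c)] fun _ => 0 := by
        filter_upwards [(isClosed_tsupport V).isOpen_compl.mem_nhds (hout t c ht)] with y hy
          using image_eq_zero_of_notMem_tsupport hy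
      rw [pderiv, h1.fderiv_eq]
      simp
  have hi2 : Integrable (fun q : ℝ × ℝ => pderiv i V (axisPt i q.1 q.2)) :=
    (measurePreserving_axisPt i).integrable_comp_emb (measurableEmbedding_axisPt i) |>.2 hi
  rw [← (measurePreserving_axisPt i).integral_comp (measurableEmbedding_axisPt i),
    Measure.volume_eq_prod, integral_prod_symm _ (by rwa [← Measure.volume_eq_prod])]
  refine (integral_congr_ae (g := fun _ => 0) ?_).trans (by simp)
  have hi3 := Integrable.prod_left_ae (by rwa [← Measure.volume_eq_prod] : Integrable
    (fun q : ℝ × ℝ => pderiv i V (axisPt i q.1 q.2)) (volume.prod volume))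
  filter_upwards [hi3, hZ i] with c h1 h2
  -- On almost every line the function is continuous and differentiable off a countable set, so the
  -- fundamental theorem of calculus applies between two points where it vanishes.
  rw [← setIntegral_eq_integral_of_forall_compl_eq_zero (s := Ioc (-R) R)
    fun t ht => (hzero t c fun h => ht (Ioo_subset_Ioc_self h)).2,
    ← intervalIntegral.integral_of_le (by linarith),
    integral_eq_of_hasDerivAt_off_countable (fun t => V (axisPt i t c)) _ h2 ?_ ?_
      h1.intervalIntegrable]
  · rw [(hzero R c (by simp)).1, (hzero (-R) c (by simp)).1, sub_zero]
  · refine (hV.comp ?_).continuousOn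
    exact continuous_iff_continuousAt.2 fun t => (hasDerivAt_axisPt i t c).continuousAt
  · intro t ht
    exact (hd _ ht.2).hasFDerivAt.comp_hasDerivAt t (hasDerivAt_axisPt i t c)

/-! ### The length measure on a curve -/

/-- A local comparison of measures on the line, with constants close to one. -/
lemma measure_le_of_locally {μ ν : Measure ℝ}
    (h : ∀ c : ℝ, 1 < c → ∀ s, ∃ I ∈ 𝓝 s, ∀ A ⊆ I, MeasurableSet A →
      μ A ≤ ENNReal.ofReal c * ν A) : μ ≤ ν := by
  refine Measure.le_iff.2 fun A hA => ?_
  have key : ∀ c : ℝ, 1 < c → μ A ≤ ENNReal.ofReal c * ν A := by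
    intro c hc
    -- Countably many of these neighbourhoods cover the line; made disjoint, they allow the local
    -- inequalities to be added.
    choose I hI hIA using h c hc
    have hI' : ∀ s, interior (I s) ∈ 𝓝 s := fun s => interior_mem_nhds.2 (hI s)
    obtain ⟨S, hS, hcov⟩ := TopologicalSpace.countable_cover_nhds hI'
    rcases S.eq_empty_or_nonempty with hemp | hne
    · have h0 : (0 : ℝ) ∈ ⋃ x ∈ S, interior (I x) := by rw [hcov]; exact mem_univ _
      simp [hemp] at h0
    obtain ⟨f, rfl⟩ := hS.exists_eq_range hne
    rw [biUnion_range] at hcov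
    set B := disjointed fun n => interior (I (f n)) with hB
    have hBm : ∀ n, MeasurableSet (B n) := MeasurableSet.disjointed fun n =>
      isOpen_interior.measurableSet
    have hA' : A = ⋃ n, A ∩ B n := by
      rw [← inter_iUnion, hB, iUnion_disjointed, hcov, inter_univ]
    have hdisj : Pairwise (Function.onFun Disjoint fun n => A ∩ B n) := fun m n hmn =>
      (disjoint_disjointed _ hmn).mono inter_subset_right inter_subset_right
    rw [hA', measure_iUnion hdisj fun n => hA.inter (hBm n),
      measure_iUnion hdisj fun n => hA.inter (hBm n), ← ENNReal.tsum_mul_left]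
    refine ENNReal.tsum_le_tsum fun n => hIA (f n) _ ?_ (hA.inter (hBm n))
    exact inter_subset_right.trans ((disjointed_subset _ n).trans interior_subset)
  have hlim : Filter.Tendsto (fun c : ℝ => ENNReal.ofReal c * ν A) (𝓝[>] 1)
      (𝓝 (ENNReal.ofReal 1 * ν A)) := by
    refine ENNReal.Tendsto.mul_const ?_ (Or.inl (by simp))
    exact (ENNReal.continuous_ofReal.tendsto 1).mono_left nhdsWithin_le_nhds
  rw [ENNReal.ofReal_one, one_mul] at hlim
  exact ge_of_tendsto hlim (by filter_upwards [self_mem_nhdsWithin] with c hc using key c hc)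

/-- The Hausdorff measure on a curve is the pushforward of the arc length. -/
theorem comap_hausdorffMeasure {γ γ' : ℝ → E} (hγ : ∀ s, HasStrictDerivAt γ (γ' s) s)
    (hc : Continuous γ') (h1 : ∀ s, 1 ≤ ‖γ' s‖) (hemb : MeasurableEmbedding γ) :
    (μH[1] : Measure E).comap γ = volume.withDensity fun s => ENNReal.ofReal ‖γ' s‖ := by
  have key : ∀ c : ℝ, 1 < c → ∀ s₀, ∃ I ∈ 𝓝 s₀, ∃ a b : ℝ, 0 < a ∧ b ≤ c * a ∧
      (∀ s ∈ I, a ≤ ‖γ' s‖ ∧ ‖γ' s‖ ≤ b) ∧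
      ∀ s ∈ I, ∀ t ∈ I, a * |s - t| ≤ ‖γ s - γ t‖ ∧ ‖γ s - γ t‖ ≤ b * |s - t| := by
    intro c hc1 s₀
    -- This `δ` satisfies `1 + δ = c (1 - δ)`. As the speed is at least `1`, the bounds speed `± δ`
    -- then differ at most by the factor `c`.
    set δ := (c - 1) / (c + 1) with hδ
    have hδ0 : 0 < δ := div_pos (by linarith) (by linarith)
    have hδ1 : δ * (c + 1) = c - 1 := div_mul_cancel₀ _ (by linarith)
    have hδlt : δ < 1 := (div_lt_one (by linarith)).2 (by linarith)
    have e1 : ∀ᶠ q : ℝ × ℝ in 𝓝 (s₀, s₀),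
        ‖γ q.1 - γ q.2 - (q.1 - q.2) • γ' s₀‖ ≤ δ * ‖q.1 - q.2‖ := by
      have := (hγ s₀).hasStrictFDerivAt.isLittleO.def hδ0
      simpa using this
    rw [nhds_prod_eq] at e1
    obtain ⟨I, hI, hI2⟩ := Filter.eventually_prod_self_iff'.1 e1
    have e2 : ∀ᶠ s in 𝓝 s₀, |‖γ' s‖ - ‖γ' s₀‖| < δ := by
      have := hc.norm.tendsto s₀
      exact (Metric.tendsto_nhds.1 this δ hδ0)
    refine ⟨I ∩ {s | |‖γ' s‖ - ‖γ' s₀‖| < δ}, Filter.inter_mem hI e2, ‖γ' s₀‖ - δ, ‖γ' s₀‖ + δ,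
      by linarith [h1 s₀], by nlinarith [h1 s₀], fun s hs => ?_, fun s hs t ht => ?_⟩
    · have := abs_lt.1 (show |‖γ' s‖ - ‖γ' s₀‖| < δ from hs.2)
      constructor <;> linarith
    · have h2 := hI2 s hs.1 t ht.1
      simp only [Real.norm_eq_abs] at h2
      have h3 := abs_norm_sub_norm_le (γ s - γ t) ((s - t) • γ' s₀)
      rw [norm_smul, Real.norm_eq_abs] at h3
      have := abs_le.1 (h3.trans h2)
      constructor <;> linarith
  have hvol : ∀ A : Set ℝ, μH[1] A = volume A := fun A => by rw [hausdorffMeasure_real]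
  have hcmp : ∀ c : ℝ, 1 < c → ∀ s₀, ∃ I ∈ 𝓝 s₀, ∀ A ⊆ I, MeasurableSet A → ∃ a b : ℝ,
      0 < a ∧ b ≤ c * a ∧ ENNReal.ofReal a * volume A ≤ (μH[1] : Measure E).comap γ A ∧
      (μH[1] : Measure E).comap γ A ≤ ENNReal.ofReal b * volume A ∧
      ENNReal.ofReal a * volume A ≤ (volume.withDensity fun s => ENNReal.ofReal ‖γ' s‖) A ∧
      (volume.withDensity fun s => ENNReal.ofReal ‖γ' s‖) A ≤ ENNReal.ofReal b * volume A := by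
    intro c hc1 s₀
    obtain ⟨I, hI, a, b, ha, hab, h2, h3⟩ := key c hc1 s₀
    have hb : 0 < b := ha.trans_le (((h2 s₀ (mem_of_mem_nhds hI)).1).trans
      (h2 s₀ (mem_of_mem_nhds hI)).2)
    refine ⟨I, hI, fun A hA hAm => ⟨a, b, ha, hab, ?_, ?_, ?_, ?_⟩⟩
    · rw [hemb.comap_apply]
      -- Lipschitz bounds for the curve and its inverse compare Hausdorff and Lebesgue measure from
      -- both sides with the same constants as the density, so the two measures agree locally up to
      -- the factor `c`.
      have hl : LipschitzOnWith (Real.toNNReal a⁻¹) (Function.invFun γ) (γ '' A) := by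
        refine LipschitzOnWith.of_dist_le_mul ?_
        rintro _ ⟨s, hs, rfl⟩ _ ⟨t, ht, rfl⟩
        rw [Function.leftInverse_invFun hemb.injective s,
          Function.leftInverse_invFun hemb.injective t, Real.coe_toNNReal _ (by positivity),
          Real.dist_eq, dist_eq_norm, ← div_eq_inv_mul, le_div_iff₀ ha, mul_comm]
        exact (h3 s (hA hs) t (hA ht)).1
      have h4 := hl.hausdorffMeasure_image_le (d := 1) zero_le_one
      rw [← image_comp, Function.invFun_comp hemb.injective, image_id, hvol, ENNReal.rpow_one] at h4
      calc ENNReal.ofReal a * volume A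
          ≤ ENNReal.ofReal a * (ENNReal.ofReal a⁻¹ * μH[1] (γ '' A)) := by gcongr; exact h4
        _ = μH[1] (γ '' A) := by
            rw [← mul_assoc, ← ENNReal.ofReal_mul ha.le, mul_inv_cancel₀ ha.ne', ENNReal.ofReal_one,
              one_mul]
    · rw [hemb.comap_apply]
      have hl : LipschitzOnWith (Real.toNNReal b) γ A := by
        refine LipschitzOnWith.of_dist_le_mul fun s hs t ht => ?_
        rw [Real.coe_toNNReal _ hb.le, Real.dist_eq, dist_eq_norm]
        exact (h3 s (hA hs) t (hA ht)).2
      have h4 := hl.hausdorffMeasure_image_le (d := 1) zero_le_one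
      rwa [hvol, ENNReal.rpow_one] at h4
    · rw [withDensity_apply _ hAm, ← setLIntegral_const]
      exact setLIntegral_mono' hAm fun s hs => ENNReal.ofReal_le_ofReal (h2 s (hA hs)).1
    · rw [withDensity_apply _ hAm, ← setLIntegral_const]
      exact setLIntegral_mono' hAm fun s hs => ENNReal.ofReal_le_ofReal (h2 s (hA hs)).2
  have hfin : ∀ {a b c : ℝ} {v : ENNReal}, 0 < a → 1 < c → b ≤ c * a →
      ENNReal.ofReal b * v ≤ ENNReal.ofReal c * (ENNReal.ofReal a * v) := fun ha hc hab => by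
    rw [← mul_assoc, ← ENNReal.ofReal_mul (by linarith)]
    gcongr
  refine le_antisymm (measure_le_of_locally fun c hc1 s => ?_)
    (measure_le_of_locally fun c hc1 s => ?_)
  · obtain ⟨I, hI, h⟩ := hcmp c hc1 s
    refine ⟨I, hI, fun A hA hAm => ?_⟩
    obtain ⟨a, b, ha, hab, -, k2, k3, -⟩ := h A hA hAm
    exact k2.trans ((hfin ha hc1 hab).trans (by gcongr))
  · obtain ⟨I, hI, h⟩ := hcmp c hc1 s
    refine ⟨I, hI, fun A hA hAm => ?_⟩
    obtain ⟨a, b, ha, hab, k1, -, -, k4⟩ := h A hA hAm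
    exact k4.trans ((hfin ha hc1 hab).trans (by gcongr))

/-- Integrals over a curve. -/
lemma integral_curve {γ γ' : ℝ → E} (hγ : ∀ s, HasStrictDerivAt γ (γ' s) s)
    (hc : Continuous γ') (h1 : ∀ s, 1 ≤ ‖γ' s‖) (hemb : MeasurableEmbedding γ) (F : E → ℝ) :
    (IntegrableOn F (range γ) μH[1] ↔ Integrable fun s => ‖γ' s‖ * F (γ s)) ∧
    ∫ x in range γ, F x ∂μH[1] = ∫ s, ‖γ' s‖ * F (γ s) := by
  have hm : Measurable fun s => Real.toNNReal ‖γ' s‖ := hc.norm.measurable.real_toNNReal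
  have e : ∀ s, (Real.toNNReal ‖γ' s‖ : ℝ) = ‖γ' s‖ := fun s => Real.coe_toNNReal _ (norm_nonneg _)
  have hmeas : (μH[1] : Measure E).restrict (range γ) =
      (volume.withDensity fun s => (Real.toNNReal ‖γ' s‖ : ENNReal)).map γ := by
    rw [← hemb.map_comap, comap_hausdorffMeasure hγ hc h1 hemb]
    rfl
  constructor
  · rw [IntegrableOn, hmeas, hemb.integrable_map_iff,
      integrable_withDensity_iff_integrable_smul hm]
    simp only [Function.comp_def, NNReal.smul_def, e, smul_eq_mul]
  · rw [hmeas, hemb.integral_map, integral_withDensity_eq_integral_smul hm]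
    simp only [NNReal.smul_def, e, smul_eq_mul]

/-! ### The divergence theorem below a graph -/

section Graph

variable (b : OrthonormalBasis (Fin 2) ℝ E) (g : ℝ → ℝ)

/-- The point with coordinates `(s, t)` with respect to the basis. -/
def gp (s t : ℝ) : E := b.repr.symm (pt s t)

@[simp] lemma repr_gp_zero (s t : ℝ) : b.repr (gp b s t) 0 = s := by simp [gp]
@[simp] lemma repr_gp_one (s t : ℝ) : b.repr (gp b s t) 1 = t := by simp [gp]

lemma gp_repr (y : E) : gp b (b.repr y 0) (b.repr y 1) = y := by rw [gp, pt_eta]; simp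

lemma gp_eq (s t : ℝ) : gp b s t = s • gp b 1 0 + t • gp b 0 1 := by
  simp only [gp, ← map_smul, ← map_add]
  congr 1
  ext i; fin_cases i <;> simp

lemma norm_gp_sq (s t : ℝ) : ‖gp b s t‖ ^ 2 = s ^ 2 + t ^ 2 := by
  rw [gp, LinearIsometryEquiv.norm_map, norm_sq_eq, pt_zero, pt_one]

lemma inner_gp (s t : ℝ) (v : E) : inner ℝ (gp b s t) v = s * b.repr v 0 + t * b.repr v 1 := by
  rw [gp, ← LinearIsometryEquiv.inner_map_map b.repr, LinearIsometryEquiv.apply_symm_apply]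
  simp [PiLp.inner_apply, Fin.sum_univ_two, mul_comm]

lemma continuous_gp : Continuous fun q : ℝ × ℝ => gp b q.1 q.2 :=
  b.repr.symm.continuous.comp contDiff_pt.continuous

lemma continuous_repr (k : Fin 2) : Continuous fun y : E => b.repr y k :=
  (continuous_coord k).comp b.repr.continuous

lemma measurePreserving_gp : MeasurePreserving fun q : ℝ × ℝ => gp b q.1 q.2 :=
  b.measurePreserving_repr_symm.comp measurePreserving_pt

lemma measurableEmbedding_gp : MeasurableEmbedding fun q : ℝ × ℝ => gp b q.1 q.2 :=
  (b.repr.symm.toHomeomorph.measurableEmbedding).comp measurableEmbedding_pt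

/-- The curve parametrizing the graph. -/
def graphCurve (s : ℝ) : E := gp b s (g s)

/-- The tangent vector of the graph. -/
def graphTangent (s : ℝ) : E := gp b 1 (deriv g s)

/-- The upward normal vector of the graph. -/
def graphNormal (s : ℝ) : E := gp b (-deriv g s) 1

/-- The height of the graph above a point. -/
def height (y : E) : ℝ := g (b.repr y 0) - b.repr y 1

@[simp] lemma height_gp (s t : ℝ) : height b g (gp b s t) = g s - t := by simp [height]

lemma norm_graphTangent (s : ℝ) : 1 ≤ ‖graphTangent b g s‖ := by
  have h := norm_gp_sq b 1 (deriv g s)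
  rw [← graphTangent] at h
  nlinarith [sq_nonneg (deriv g s), norm_nonneg (graphTangent b g s)]

lemma norm_graphNormal (s : ℝ) : ‖graphNormal b g s‖ = ‖graphTangent b g s‖ := by
  rw [← sq_eq_sq₀ (norm_nonneg _) (norm_nonneg _), graphNormal, graphTangent, norm_gp_sq, norm_gp_sq]
  ring

variable {g} (hg : ContDiff ℝ 1 g)
include hg

lemma hasStrictDerivAt_graphCurve (s : ℝ) :
    HasStrictDerivAt (graphCurve b g) (graphTangent b g s) s := by
  have h1 : graphCurve b g = fun s => s • gp b 1 0 + g s • gp b 0 1 := funext fun s => gp_eq b s (g s)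
  have h2 : HasStrictDerivAt g (deriv g s) s := hg.contDiffAt.hasStrictDerivAt (by simp)
  rw [h1, graphTangent, gp_eq b 1 (deriv g s)]
  exact ((hasStrictDerivAt_id s).smul_const (gp b 1 0)).add (h2.smul_const (gp b 0 1))

lemma continuous_graphCurve : Continuous (graphCurve b g) :=
  continuous_iff_continuousAt.2 fun s => (hasStrictDerivAt_graphCurve b hg s).hasDerivAt.continuousAt

lemma continuous_graphTangent : Continuous (graphTangent b g) :=
  (continuous_gp b).comp (continuous_const.prodMk (hg.continuous_deriv le_rfl))

lemma continuous_graphNormal : Continuous (graphNormal b g) :=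
  (continuous_gp b).comp ((hg.continuous_deriv le_rfl).neg.prodMk continuous_const)

lemma measurableEmbedding_graphCurve : MeasurableEmbedding (graphCurve b g) := by
  have h : Function.LeftInverse (fun y : E => b.repr y 0) (graphCurve b g) := fun s =>
    repr_gp_zero b s _
  exact (h.isClosedEmbedding (continuous_repr b 0) (continuous_graphCurve b hg)).measurableEmbedding

lemma continuous_height : Continuous (height b g) :=
  (hg.continuous.comp (continuous_repr b 0)).sub (continuous_repr b 1)

lemma hasFDerivAt_height (y : E) :
    HasFDerivAt (height b g) (-innerSL ℝ (graphNormal b g (b.repr y 0))) y := by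
  have hp : ∀ k : Fin 2, HasFDerivAt (fun y : E => b.repr y k)
      ((EuclideanSpace.proj k : E →L[ℝ] ℝ) ∘L (b.repr.toContinuousLinearEquiv : E →L[ℝ] E)) y :=
    fun k => ((EuclideanSpace.proj k : E →L[ℝ] ℝ) ∘L
      (b.repr.toContinuousLinearEquiv : E →L[ℝ] E)).hasFDerivAt
  have h1 : HasDerivAt g (deriv g (b.repr y 0)) (b.repr y 0) :=
    (hg.differentiable (by simp) _).hasDerivAt
  refine ((h1.comp_hasFDerivAt y (hp 0)).sub (hp 1)).congr_fderiv ?_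
  ext v
  simp [graphNormal, inner_gp]
  ring

end Graph

/-- The derivative of the smooth transition function. -/
lemma deriv_smoothTransition_eq_zero {t : ℝ} (ht : t ∉ Icc (0 : ℝ) 1) :
    deriv Real.smoothTransition t = 0 := by
  rw [mem_Icc, not_and_or, not_le, not_le] at ht
  rcases ht with h | h
  · have : Real.smoothTransition =ᶠ[𝓝 t] fun _ => 0 := by
      filter_upwards [isOpen_Iio.mem_nhds h] with s hs using Real.smoothTransition.zero_of_nonpos
        (le_of_lt hs)
    rw [this.deriv_eq, deriv_const]
  · have : Real.smoothTransition =ᶠ[𝓝 t] fun _ => 1 := by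
      filter_upwards [isOpen_Ioi.mem_nhds h] with s hs using Real.smoothTransition.one_of_one_le
        (le_of_lt hs)
    rw [this.deriv_eq, deriv_const]

lemma continuous_deriv_smoothTransition : Continuous (deriv Real.smoothTransition) :=
  (Real.smoothTransition.contDiff (n := 1)).continuous_deriv le_rfl

lemma integrable_deriv_smoothTransition : Integrable (deriv Real.smoothTransition) :=
  continuous_deriv_smoothTransition.integrable_of_hasCompactSupport
    (HasCompactSupport.intro isCompact_Icc fun _ ht => deriv_smoothTransition_eq_zero ht)

lemma integral_deriv_smoothTransition : ∫ t, deriv Real.smoothTransition t = 1 := by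
  rw [← setIntegral_eq_integral_of_forall_compl_eq_zero (s := Icc (0 : ℝ) 1)
    fun t ht => deriv_smoothTransition_eq_zero ht, integral_Icc_eq_integral_Ioc,
    ← intervalIntegral.integral_of_le zero_le_one,
    intervalIntegral.integral_deriv_eq_sub
      (fun t _ => (Real.smoothTransition.contDiff (n := 1)).differentiable (by simp) t)
      (continuous_deriv_smoothTransition.intervalIntegrable _ _)]
  simp

section Divergence

variable {b : OrthonormalBasis (Fin 2) ℝ E} {g : ℝ → ℝ} (hg : ContDiff ℝ 1 g) {f : E → ℝ}
  (hf : ContinuousOn f {y | 0 ≤ height b g y}) (hsupp : HasCompactSupport f)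
include hg hf hsupp

omit hsupp in
lemma continuousAt_of_height_pos {y : E} (hy : 0 < height b g y) : ContinuousAt f y :=
  hf.continuousAt <| Filter.mem_of_superset
    ((isOpen_lt continuous_const (continuous_height b hg)).mem_nhds hy)
      fun z (h : 0 < height b g z) => h.le

/-- A weight that vanishes near and above the graph makes `f` continuous. -/
lemma continuous_mul_of_height {ρ : E → ℝ} (hρ : Continuous ρ) {δ : ℝ} (hδ : 0 < δ)
    (h0 : ∀ y, height b g y < δ → ρ y = 0) : Continuous fun y => ρ y * f y := by
  refine continuous_iff_continuousAt.2 fun y => ?_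
  rcases lt_or_ge 0 (height b g y) with hy | hy
  · exact hρ.continuousAt.mul (continuousAt_of_height_pos hg hf hy)
  · have : (fun y => ρ y * f y) =ᶠ[𝓝 y] fun _ => 0 := by
      filter_upwards [(isOpen_lt (continuous_height b hg) continuous_const).mem_nhds
        (show height b g y < δ by linarith)] with z hz
      rw [h0 z hz, zero_mul]
    exact continuousAt_const.congr this.symm

/-- The boundary layer integrals tend to the integral over the graph. -/
lemma tendsto_boundary_layer {N : ℝ → ℝ} (hN : Continuous N) :
    Filter.Tendsto (fun n : ℕ => ∫ y, (deriv Real.smoothTransition ((n + 1) * height b g y - 1) *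
      ((n + 1) * N (b.repr y 0))) * f y) Filter.atTop (𝓝 (∫ s, f (graphCurve b g s) * N s)) := by
  set S' := deriv Real.smoothTransition with hS'
  have hS'c : Continuous S' := continuous_deriv_smoothTransition
  -- The substitution `t = g s - (τ + 1) / (n + 1)` stretches the boundary layer to the fixed strip
  -- `0 ≤ τ ≤ 1` and absorbs the factor `n + 1`. What is left is dominated convergence.
  set H : ℕ → ℝ × ℝ → ℝ := fun n q => f (gp b q.1 (g q.1 - (q.2 + 1) / (n + 1))) * N q.1 * S' q.2
    with hH
  obtain ⟨R, hR⟩ : ∃ R, tsupport f ⊆ Metric.closedBall 0 R :=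
    hsupp.isCompact.isBounded.subset_closedBall 0
  obtain ⟨B, hB⟩ : ∃ B, ∀ y, 0 ≤ height b g y → |f y| ≤ B := by
    have hcl : IsClosed {y | 0 ≤ height b g y} := isClosed_le continuous_const (continuous_height b hg)
    obtain ⟨B, hB⟩ := (hsupp.isCompact.inter_right hcl).exists_bound_of_continuousOn
      (hf.mono inter_subset_right)
    refine ⟨max B 0, fun y hy => ?_⟩
    by_cases hy' : y ∈ tsupport f
    · exact (hB y ⟨hy', hy⟩).trans (le_max_left _ _)
    · rw [image_eq_zero_of_notMem_tsupport hy', abs_zero]; exact le_max_right _ _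
  have hfs : ∀ s t, s ∉ Icc (-R) R → f (gp b s t) = 0 := fun s t hs => by
    refine image_eq_zero_of_notMem_tsupport fun h => hs ?_
    have h1 := hR h
    rw [mem_closedBall_zero_iff] at h1
    have h2 := abs_coord_le (b.repr (gp b s t)) 0
    rw [LinearIsometryEquiv.norm_map, repr_gp_zero] at h2
    exact abs_le.1 (h2.trans h1)
  have hHc : ∀ n, Continuous (H n) := by
    intro n
    refine continuous_iff_continuousAt.2 fun q => ?_
    have hn : (0 : ℝ) < n + 1 := by positivity
    have hNq : ContinuousAt (fun q : ℝ × ℝ => N q.1) q := (hN.comp continuous_fst).continuousAt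
    have hSq : ContinuousAt (fun q : ℝ × ℝ => S' q.2) q := (hS'c.comp continuous_snd).continuousAt
    rcases lt_or_ge (-1) q.2 with hq | hq
    · refine ContinuousAt.mul (ContinuousAt.mul ?_ hNq) hSq
      refine ContinuousAt.comp (f := fun q : ℝ × ℝ => gp b q.1 (g q.1 - (q.2 + 1) / (n + 1)))
        (continuousAt_of_height_pos hg hf ?_) ?_
      · rw [height_gp]
        have : 0 < (q.2 + 1) / ((n : ℝ) + 1) := div_pos (by linarith) hn
        linarith
      · have hgc := hg.continuous
        exact ((continuous_gp b).comp (by fun_prop : Continuous fun q : ℝ × ℝ =>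
          (q.1, g q.1 - (q.2 + 1) / (n + 1)))).continuousAt
    · have : H n =ᶠ[𝓝 q] fun _ => 0 := by
        filter_upwards [(isOpen_lt continuous_snd continuous_const).mem_nhds
          (show q.2 < 0 by linarith)] with z hz
        have hz : z.2 < 0 := hz
        simp only [hH, hS', deriv_smoothTransition_eq_zero fun h : z.2 ∈ Icc (0 : ℝ) 1 =>
          not_le.2 hz h.1, mul_zero]
      exact continuousAt_const.congr this.symm
  set bound : ℝ × ℝ → ℝ := fun q => (Icc (-R) R).indicator (fun s => |N s|) q.1 * (B * |S' q.2|)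
    with hbound
  have hbi : Integrable bound := by
    refine Integrable.mul_prod (f := (Icc (-R) R).indicator fun s => |N s|)
      (g := fun t => B * |S' t|) ?_ ?_
    · rw [integrable_indicator_iff measurableSet_Icc]
      exact hN.abs.continuousOn.integrableOn_compact isCompact_Icc
    · exact integrable_deriv_smoothTransition.abs.const_mul B
  have hHb : ∀ n q, ‖H n q‖ ≤ bound q := by
    intro n q
    have hB0 : 0 ≤ B := (abs_nonneg _).trans (hB (gp b 0 (g 0)) (by simp))
    by_cases hq : q.2 ∈ Icc (0 : ℝ) 1
    · by_cases hs : q.1 ∈ Icc (-R) R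
      · have hh : 0 ≤ height b g (gp b q.1 (g q.1 - (q.2 + 1) / (n + 1))) := by
          rw [height_gp]
          have : 0 ≤ (q.2 + 1) / ((n : ℝ) + 1) := div_nonneg (by linarith [hq.1]) (by positivity)
          linarith
        simp only [hH, hbound, indicator_of_mem hs, norm_mul, Real.norm_eq_abs]
        have := mul_le_mul_of_nonneg_right (hB _ hh)
          (mul_nonneg (abs_nonneg (N q.1)) (abs_nonneg (S' q.2)))
        linarith
      · simp [hH, hbound, hfs _ _ hs, hs]
    · simp [hH, hbound, hS', deriv_smoothTransition_eq_zero hq]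
  have hHi : ∀ n, Integrable (H n) := fun n => hbi.mono' (hHc n).aestronglyMeasurable
    (Filter.Eventually.of_forall (hHb n))
  have heq : ∀ n : ℕ, ∫ y, (S' ((n + 1) * height b g y - 1) * ((n + 1) * N (b.repr y 0))) * f y =
      ∫ q, H n q := by
    intro n
    have hn : (0 : ℝ) < n + 1 := by positivity
    set G : E → ℝ := fun y => (S' ((n + 1) * height b g y - 1) * ((n + 1) * N (b.repr y 0))) * f y
      with hG
    have hGi : Integrable G := by
      refine Continuous.integrable_of_hasCompactSupport ?_ hsupp.mul_left
      refine continuous_mul_of_height hg hf hsupp ?_ (δ := 1 / (n + 1)) (by positivity) fun y hy => ?_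
      · exact (hS'c.comp ((continuous_const.mul (continuous_height b hg)).sub continuous_const)).mul
          (continuous_const.mul (hN.comp (continuous_repr b 0)))
      · rw [lt_div_iff₀ hn] at hy
        rw [hS', deriv_smoothTransition_eq_zero, zero_mul]
        intro h
        linarith [h.1]
    have hGi' : Integrable (fun q : ℝ × ℝ => G (gp b q.1 q.2)) (volume.prod volume) := by
      rw [← Measure.volume_eq_prod]
      exact ((measurePreserving_gp b).integrable_comp_emb (measurableEmbedding_gp b)).2 hGi
    have hHi' := hHi n
    rw [Measure.volume_eq_prod] at hHi'
    rw [← (measurePreserving_gp b).integral_comp (measurableEmbedding_gp b) G,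
      Measure.volume_eq_prod, integral_prod _ hGi', integral_prod _ hHi']
    refine integral_congr_ae (Filter.Eventually.of_forall fun s => ?_)
    simp only
    have e1 : ∫ t, G (gp b s t) = ∫ x, G (gp b s (g s - 1 / (n + 1) - x)) :=
      (integral_sub_left_eq_self (fun t => G (gp b s t)) volume _).symm
    have e2 := Measure.integral_comp_mul_left (fun x => G (gp b s (g s - 1 / (n + 1) - x)))
      ((n : ℝ) + 1)⁻¹
    rw [inv_inv, abs_of_pos hn, smul_eq_mul] at e2
    rw [e1, ← mul_right_inj' hn.ne', ← e2, ← integral_const_mul]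
    refine integral_congr_ae (Filter.Eventually.of_forall fun τ => ?_)
    have e3 : g s - 1 / ((n : ℝ) + 1) - ((n : ℝ) + 1)⁻¹ * τ = g s - (τ + 1) / (n + 1) := by
      field_simp; ring
    have e4 : ((n : ℝ) + 1) * (g s - (g s - (τ + 1) / (n + 1))) - 1 = τ := by field_simp; ring
    simp only [hG, hH, e3, height_gp, repr_gp_zero, e4]
    ring
  have hlim : ∫ s, f (graphCurve b g s) * N s = ∫ q : ℝ × ℝ, f (graphCurve b g q.1) * N q.1 * S' q.2 := by
    rw [Measure.volume_eq_prod, integral_prod_mul (fun s => f (graphCurve b g s) * N s) S',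
      hS', integral_deriv_smoothTransition, mul_one]
  rw [hlim]
  simp only [heq]
  refine tendsto_integral_of_dominated_convergence bound (fun n => (hHc n).aestronglyMeasurable) hbi
    (fun n => Filter.Eventually.of_forall (hHb n)) (Filter.Eventually.of_forall fun q => ?_)
  by_cases hq : q.2 ∈ Icc (0 : ℝ) 1
  · refine Filter.Tendsto.mul_const _ (Filter.Tendsto.mul_const _ ?_)
    have hmem : graphCurve b g q.1 ∈ {y | 0 ≤ height b g y} := by simp [graphCurve]
    refine (hf _ hmem).tendsto.comp (tendsto_nhdsWithin_iff.2 ⟨?_, ?_⟩)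
    · have h1 : Filter.Tendsto (fun n : ℕ => g q.1 - (q.2 + 1) / ((n : ℝ) + 1)) Filter.atTop
          (𝓝 (g q.1 - 0)) := by
        refine tendsto_const_nhds.sub ?_
        have := (tendsto_one_div_add_atTop_nhds_zero_nat (𝕜 := ℝ)).const_mul (q.2 + 1)
        rw [mul_zero] at this
        refine this.congr fun n => by ring
      rw [sub_zero] at h1
      have h2 : Continuous fun t => gp b q.1 t :=
        (continuous_gp b).comp (by fun_prop : Continuous fun t : ℝ => (q.1, t))
      exact (h2.tendsto _).comp h1
    · refine Filter.Eventually.of_forall fun n => ?_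
      change 0 ≤ height b g _
      rw [height_gp]
      have : 0 ≤ (q.2 + 1) / ((n : ℝ) + 1) := div_nonneg (by linarith [hq.1]) (by positivity)
      linarith
  · have h0 : S' q.2 = 0 := deriv_smoothTransition_eq_zero hq
    simp only [hH, h0, mul_zero]
    exact tendsto_const_nhds

/-- The divergence theorem below a graph, for one component. -/
theorem integral_pderiv_graph {Z : Set E} (hZ : IsThin Z) (hZ0 : volume Z = 0)
    (hd : ∀ y ∉ Z, 0 < height b g y → DifferentiableAt ℝ f y) (i : Fin 2)
    (hi : IntegrableOn (pderiv i f) {y | 0 < height b g y}) :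
    ∫ y in {y | 0 < height b g y}, pderiv i f y =
      ∫ s, f (graphCurve b g s) * graphNormal b g s i := by
  set P := {y | 0 < height b g y} with hP
  have hPo : IsOpen P := isOpen_lt continuous_const (continuous_height b hg)
  -- A cutoff that vanishes near and above the graph. The integral of the derivative of `η n * f`
  -- over the plane is zero, so the integral of `η n * ∂ᵢ f` equals the boundary layer integral of
  -- `G n`.
  set η : ℕ → E → ℝ := fun n y => Real.smoothTransition ((n + 1) * height b g y - 1) with hη
  set G : ℕ → E → ℝ := fun n y => (deriv Real.smoothTransition ((n + 1) * height b g y - 1) *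
      ((n + 1) * graphNormal b g (b.repr y 0) i)) * f y with hG
  have hNc : Continuous fun s => graphNormal b g s i :=
    (continuous_coord i).comp (continuous_graphNormal b hg)
  have hηc : ∀ n, Continuous (η n) := fun n => Real.smoothTransition.continuous.comp
    ((continuous_const.mul (continuous_height b hg)).sub continuous_const)
  have hη0 : ∀ n : ℕ, ∀ y, height b g y < 1 / (n + 1) → η n y = 0 := fun n y hy => by
    rw [lt_div_iff₀ (by positivity)] at hy
    exact Real.smoothTransition.zero_of_nonpos (by linarith)
  have hηd : ∀ n y, HasFDerivAt (η n) (deriv Real.smoothTransition ((n + 1) * height b g y - 1) •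
      (((n : ℝ) + 1) • -innerSL ℝ (graphNormal b g (b.repr y 0)))) y := fun n y => by
    have h1 : HasDerivAt Real.smoothTransition _ ((n + 1) * height b g y - 1) :=
      ((Real.smoothTransition.contDiff (n := 1)).differentiable (by simp) _).hasDerivAt
    exact h1.comp_hasFDerivAt y (((hasFDerivAt_height b hg y).const_mul ((n : ℝ) + 1)).sub_const 1)
  have hGc : ∀ n, Continuous (G n) := fun n => by
    refine continuous_mul_of_height hg hf hsupp ?_ (δ := 1 / (n + 1)) (by positivity) fun y hy => ?_
    · exact (continuous_deriv_smoothTransition.comp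
        ((continuous_const.mul (continuous_height b hg)).sub continuous_const)).mul
        (continuous_const.mul (hNc.comp (continuous_repr b 0)))
    · rw [lt_div_iff₀ (by positivity)] at hy
      rw [deriv_smoothTransition_eq_zero, zero_mul]
      intro h
      linarith [h.1]
  have hGi : ∀ n, Integrable (G n) := fun n =>
    (hGc n).integrable_of_hasCompactSupport hsupp.mul_left
  have hout : ∀ n y, y ∉ P → (fun y => η n y * f y) =ᶠ[𝓝 y] fun _ => 0 := fun n y hy => by
    have hy : height b g y ≤ 0 := not_lt.1 hy
    filter_upwards [(isOpen_lt (continuous_height b hg) continuous_const).mem_nhds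
      (show height b g y < 1 / ((n : ℝ) + 1) from hy.trans_lt (by positivity))] with z hz
    rw [hη0 n z hz, zero_mul]
  have hpd : ∀ n, ∀ y ∉ Z, pderiv i (fun y => η n y * f y) y =
      P.indicator (fun y => η n y * pderiv i f y) y - G n y := fun n y hyZ => by
    by_cases hy : y ∈ P
    · rw [indicator_of_mem hy, pderiv, ((hηd n y).fun_mul (hd y hyZ hy).hasFDerivAt).fderiv]
      simp only [ContinuousLinearMap.add_apply, ContinuousLinearMap.smul_apply,
        ContinuousLinearMap.neg_apply, innerSL_apply_apply, smul_eq_mul, hG, pderiv,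
        EuclideanSpace.inner_single_right, conj_trivial, one_mul]
      ring
    · have h1 : G n y = 0 := by
        have hy : height b g y ≤ 0 := not_lt.1 hy
        simp only [hG]
        rw [deriv_smoothTransition_eq_zero, zero_mul, zero_mul]
        intro h
        have : ((n : ℝ) + 1) * height b g y ≤ 0 :=
          mul_nonpos_of_nonneg_of_nonpos (by positivity) hy
        linarith [h.1]
      rw [indicator_of_notMem hy, pderiv, (hout n y hy).fderiv_eq, h1]
      simp
  have hηi : ∀ n, IntegrableOn (fun y => η n y * pderiv i f y) P := fun n => by
    refine Integrable.bdd_mul (c := 1) hi (hηc n).aestronglyMeasurable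
      (Filter.Eventually.of_forall fun y => ?_)
    rw [Real.norm_eq_abs, abs_of_nonneg (Real.smoothTransition.nonneg _)]
    exact Real.smoothTransition.le_one _
  have hae : ∀ n, pderiv i (fun y => η n y * f y) =ᵐ[volume]
      fun y => P.indicator (fun y => η n y * pderiv i f y) y - G n y := fun n => by
    filter_upwards [measure_eq_zero_iff_ae_notMem.1 hZ0] with y hy using hpd n y hy
  have hzero : ∀ n, ∫ y in P, η n y * pderiv i f y = ∫ y, G n y := fun n => by
    have hint : Integrable fun y => P.indicator (fun y => η n y * pderiv i f y) y - G n y :=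
      ((integrable_indicator_iff hPo.measurableSet).2 (hηi n)).sub (hGi n)
    have h1 := integral_pderiv_eq_zero (V := fun y => η n y * f y)
      (continuous_mul_of_height hg hf hsupp (hηc n) (δ := 1 / (n + 1)) (by positivity) (hη0 n))
      hsupp.mul_left hZ (fun y hy => ?_) i (hint.congr (hae n).symm)
    · rw [integral_congr_ae (hae n), integral_sub
        ((integrable_indicator_iff hPo.measurableSet).2 (hηi n)) (hGi n),
        integral_indicator hPo.measurableSet, sub_eq_zero] at h1
      exact h1
    · by_cases hyP : y ∈ P
      · exact (hηd n y).differentiableAt.mul (hd y hy hyP)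
      · exact (differentiableAt_const 0).congr_of_eventuallyEq (hout n y hyP)
  have hlim := tendsto_boundary_layer hg hf hsupp hNc
  have hlim2 : Filter.Tendsto (fun n => ∫ y in P, η n y * pderiv i f y) Filter.atTop
      (𝓝 (∫ y in P, pderiv i f y)) := by
    refine tendsto_integral_of_dominated_convergence (fun y => ‖pderiv i f y‖)
      (fun n => (hηi n).aestronglyMeasurable) hi.norm (fun n => ?_) ?_
    · refine Filter.Eventually.of_forall fun y => ?_
      rw [norm_mul, Real.norm_eq_abs, abs_of_nonneg (Real.smoothTransition.nonneg _)]
      exact mul_le_of_le_one_left (norm_nonneg _) (Real.smoothTransition.le_one _)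
    · refine ae_restrict_of_forall_mem hPo.measurableSet fun y hy => ?_
      have hy : 0 < height b g y := hy
      obtain ⟨n₀, hn₀⟩ := exists_nat_gt (2 / height b g y)
      refine tendsto_const_nhds.congr' ?_
      filter_upwards [Filter.eventually_ge_atTop n₀] with n hn
      have h1 : (2 : ℝ) < n * height b g y := by
        rw [div_lt_iff₀ hy] at hn₀
        exact hn₀.trans_le (mul_le_mul_of_nonneg_right (by exact_mod_cast hn) hy.le)
      simp only [hη]
      rw [Real.smoothTransition.one_of_one_le (by linarith), one_mul]
  simp only [hzero] at hlim2
  exact tendsto_nhds_unique hlim2 hlim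

end Divergence

/-! ### The outer unit normal -/

/-- In the direction `ν' - ν` one moves into `D` according to `ν` and out of `D` according to `ν'`.
-/
lemma IsOuterUnitNormal.unique {D : Set E} {x ν ν' : E} (h : IsOuterUnitNormal D x ν)
    (h' : IsOuterUnitNormal D x ν') : ν = ν' := by
  by_contra hne
  set d := ν' - ν with hd
  have hd0 : 0 < ‖d‖ := norm_pos_iff.2 (sub_ne_zero.2 (Ne.symm hne))
  have e0 : ‖d‖ ^ 2 = 2 - 2 * inner ℝ ν ν' := by
    rw [hd, norm_sub_sq_real, h.1, h'.1, real_inner_comm]; ring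
  have e1 : inner ℝ ν d = -(‖d‖ ^ 2 / 2) := by
    rw [hd, inner_sub_right, real_inner_self_eq_norm_sq, h.1, ← hd, e0]; ring
  have e2 : inner ℝ ν' d = ‖d‖ ^ 2 / 2 := by
    rw [hd, inner_sub_right, real_inner_self_eq_norm_sq, h'.1, ← hd, e0, real_inner_comm]; ring
  have hlim : Filter.Tendsto (fun t : ℝ => x + t • d) (𝓝[>] 0) (𝓝 x) := by
    have : Continuous fun t : ℝ => x + t • d := by fun_prop
    have h1 := this.tendsto 0
    rw [zero_smul, add_zero] at h1
    exact h1.mono_left nhdsWithin_le_nhds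
  have hε : 0 < ‖d‖ / 4 := by positivity
  obtain ⟨t, ht1, ht2, ht3⟩ := ((hlim.eventually (h.2 _ hε)).and
    ((hlim.eventually (h'.2 _ hε)).and self_mem_nhdsWithin)).exists
  have ht : 0 < t := ht3
  have hn : ‖x + t • d - x‖ = t * ‖d‖ := by
    rw [add_sub_cancel_left, norm_smul, Real.norm_eq_abs, abs_of_pos ht]
  have hsq : 0 < t * ‖d‖ ^ 2 := by positivity
  refine ht2.2 ?_ (ht1.1 ?_)
  · rw [hn, add_sub_cancel_left, inner_smul_right, e2]; nlinarith
  · rw [hn, add_sub_cancel_left, inner_smul_right, e1]; nlinarith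

/-- The gradient of the height is minus the upward normal, and the linearization error is absorbed
because this normal has length at least one. -/
lemma isOuterUnitNormal_graph {b : OrthonormalBasis (Fin 2) ℝ E} {g : ℝ → ℝ} (hg : ContDiff ℝ 1 g)
    {D : Set E} {x : E} (hx : height b g x = 0) (h : ∀ᶠ y in 𝓝 x, (y ∈ D ↔ 0 < height b g y)) :
    IsOuterUnitNormal D x
      (‖graphNormal b g (b.repr x 0)‖⁻¹ • graphNormal b g (b.repr x 0)) := by
  set N := graphNormal b g (b.repr x 0) with hN
  have hN1 : 1 ≤ ‖N‖ := by rw [hN, norm_graphNormal]; exact norm_graphTangent b g _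
  have hN0 : 0 < ‖N‖ := one_pos.trans_le hN1
  refine ⟨by rw [norm_smul, norm_inv, norm_norm, inv_mul_cancel₀ hN0.ne'], fun ε hε => ?_⟩
  have h1 := (hasFDerivAt_height b hg x).isLittleO.def hε
  filter_upwards [h, h1] with y hy h2
  rw [hx, sub_zero, ContinuousLinearMap.neg_apply, innerSL_apply_apply, sub_neg_eq_add,
    Real.norm_eq_abs] at h2
  have h2 := abs_le.1 h2
  have hs : inner ℝ (‖N‖⁻¹ • N) (y - x) = inner ℝ N (y - x) / ‖N‖ := by
    rw [real_inner_smul_left, div_eq_inv_mul]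
  have h3 : ε * ‖y - x‖ ≤ ε * ‖y - x‖ * ‖N‖ := le_mul_of_one_le_right (by positivity) hN1
  rw [hs, hy, div_lt_iff₀ hN0, lt_div_iff₀ hN0]
  constructor
  · intro h4; linarith
  · intro h4; linarith

lemma outerNormal_eq {D : Set E} {x ν : E} (h : IsOuterUnitNormal D x ν) : outerNormal D x = ν := by
  have hex : ∃ ν, IsOuterUnitNormal D x ν := ⟨ν, h⟩
  rw [outerNormal, dif_pos hex]
  exact hex.choose_spec.unique h

/-! ### The divergence theorem on the fluid domain -/

namespace IsFSIDomain

variable {Ω Ωf Ωs : Set E} (hΩ : IsFSIDomain Ω Ωf Ωs)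
include hΩ

lemma isClosed_interface : IsClosed (interface Ωf Ωs) := isClosed_closure.inter isClosed_closure

lemma isCompact_closure_fluid : IsCompact (closure Ωf) :=
  (hΩ.isBounded.subset hΩ.fluid_subset).isCompact_closure

lemma notMem_fluid {x : E} (hx : x ∈ interface Ωf Ωs) : x ∉ Ωf := fun h =>
  (hΩ.disjoint.closure_right hΩ.isOpen_fluid).le_bot ⟨h, hx.2⟩

/-- Inside `Ω` and away from the closed solid domain, a neighbourhood would lie in the closure of
`Ωf`, making the point interior. -/
lemma frontier_fluid_subset {x : E} (hx : x ∈ frontier Ωf) :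
    x ∈ interface Ωf Ωs ∨ x ∈ frontier Ω := by
  by_cases hxΩ : x ∈ Ω
  · refine Or.inl ⟨frontier_subset_closure hx, ?_⟩
    by_contra hs
    rw [hΩ.isOpen_fluid.frontier_eq] at hx
    refine hx.2 (hΩ.lipschitz_fluid.interior_closure_subset ?_)
    rw [mem_interior_iff_mem_nhds]
    filter_upwards [hΩ.isOpen.mem_nhds hxΩ, isClosed_closure.isOpen_compl.mem_nhds hs] with y h1 h2
    have h3 := subset_closure h1
    rw [hΩ.closure_eq] at h3
    exact h3.resolve_right h2
  · right
    rw [hΩ.isOpen.frontier_eq]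
    exact ⟨closure_mono hΩ.fluid_subset (frontier_subset_closure hx), hxΩ⟩

/-- Near the interface, the fluid domain lies below a graph. -/
lemma exists_chart {x : E} (hx : x ∈ interface Ωf Ωs) :
    ∃ (b : OrthonormalBasis (Fin 2) ℝ E) (g : ℝ → ℝ), ContDiff ℝ 1 g ∧ ∃ ρ > 0,
      Metric.ball x ρ ⊆ Ω ∧ ∀ y ∈ Metric.ball x ρ, (y ∈ Ωf ↔ 0 < height b g y) := by
  obtain ⟨b, g, hg, h⟩ := hΩ.interface_smooth x hx
  obtain ⟨ρ, hρ, h1⟩ := Metric.mem_nhds_iff.1 (h.and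
    (hΩ.isOpen.mem_nhds (hΩ.interface_subset hx)))
  refine ⟨b, g, hg, ρ, hρ, fun y hy => (h1 hy).2, fun y hy => ?_⟩
  rw [height, sub_pos]
  exact (h1 hy).1

section Chart

variable {b : OrthonormalBasis (Fin 2) ℝ E} {g : ℝ → ℝ} (hg : ContDiff ℝ 1 g) {U : Set E}
  (hU : IsOpen U) (hUΩ : U ⊆ Ω) (hch : ∀ y ∈ U, (y ∈ Ωf ↔ 0 < height b g y))
include hg hU hUΩ hch

omit hΩ hUΩ in
lemma mem_closure_of_height {y : E} (hy : y ∈ U) (h : 0 ≤ height b g y) : y ∈ closure Ωf := by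
  have hlim : Filter.Tendsto (fun t : ℝ => gp b (b.repr y 0) (b.repr y 1 - t)) (𝓝[>] 0) (𝓝 y) := by
    have hc : Continuous fun t : ℝ => gp b (b.repr y 0) (b.repr y 1 - t) :=
      (continuous_gp b).comp (by fun_prop : Continuous fun t : ℝ => (b.repr y 0, b.repr y 1 - t))
    have h1 := hc.tendsto 0
    rw [sub_zero, gp_repr] at h1
    exact h1.mono_left nhdsWithin_le_nhds
  refine mem_closure_of_tendsto hlim ?_
  filter_upwards [hlim.eventually (hU.mem_nhds hy), self_mem_nhdsWithin] with t h1 h2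
  have h2 : 0 < t := h2
  refine (hch _ h1).2 ?_
  rw [height_gp]
  rw [height] at h
  linarith

lemma mem_interface_iff {y : E} (hy : y ∈ U) : y ∈ interface Ωf Ωs ↔ height b g y = 0 := by
  constructor
  · intro h
    refine le_antisymm (not_lt.1 fun h0 => hΩ.notMem_fluid h ((hch y hy).2 h0)) ?_
    by_contra h0
    obtain ⟨z, ⟨hz1, hz2⟩, hz3⟩ := mem_closure_iff.1 h.1 (U ∩ {z | height b g z < 0})
      (hU.inter (isOpen_lt (continuous_height b hg) continuous_const)) ⟨hy, not_le.1 h0⟩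
    exact lt_asymm hz2 ((hch z hz1).1 hz3)
  · intro h
    have h1 : y ∈ frontier Ωf := by
      rw [hΩ.isOpen_fluid.frontier_eq]
      refine ⟨mem_closure_of_height hg hU hch hy h.ge, fun h2 => ?_⟩
      have := (hch y hy).1 h2
      exact this.ne' h
    refine (hΩ.frontier_fluid_subset h1).resolve_right fun h2 => ?_
    rw [hΩ.isOpen.frontier_eq] at h2
    exact h2.2 (hUΩ hy)

/-- The divergence theorem for functions supported in a chart. -/
lemma integral_pderiv_of_chart {f : E → ℝ} (hsupp : HasCompactSupport f) (hfU : tsupport f ⊆ U)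
    (hf : ContinuousOn f (closure Ωf)) {Z : Set E} (hZ : IsThin Z) (hZ0 : volume Z = 0)
    (hd : ∀ y ∈ Ωf, y ∉ Z → DifferentiableAt ℝ f y) (i : Fin 2)
    (hi : IntegrableOn (pderiv i f) Ωf) :
    IntegrableOn (fun x => f x * outerNormal Ωf x i) (interface Ωf Ωs) μH[1] ∧
    ∫ x in Ωf, pderiv i f x = ∫ x in interface Ωf Ωs, f x * outerNormal Ωf x i ∂μH[1] := by
  have hf0 : ∀ y ∉ U, f y = 0 := fun y hy => image_eq_zero_of_notMem_tsupport fun h => hy (hfU h)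
  have hev : ∀ y ∉ tsupport f, f =ᶠ[𝓝 y] fun _ => 0 := fun y hy => by
    filter_upwards [(isClosed_tsupport f).isOpen_compl.mem_nhds hy] with z hz
      using image_eq_zero_of_notMem_tsupport hz
  have hp0 : ∀ y ∉ U, pderiv i f y = 0 := fun y hy => by
    rw [pderiv, (hev y fun h => hy (hfU h)).fderiv_eq]; simp
  set P := {y | 0 < height b g y} with hP
  have hPo : IsOpen P := isOpen_lt continuous_const (continuous_height b hg)
  have hfP : ContinuousOn f {y | 0 ≤ height b g y} := by
    intro y hy
    by_cases hyt : y ∈ tsupport f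
    · have hyU := hfU hyt
      refine (hf y (mem_closure_of_height hg hU hch hyU hy)).mono_of_mem_nhdsWithin ?_
      filter_upwards [self_mem_nhdsWithin, mem_nhdsWithin_of_mem_nhds (hU.mem_nhds hyU)] with z h1 h2
      exact mem_closure_of_height hg hU hch h2 h1
    · exact (continuousAt_const.congr (hev y hyt).symm).continuousWithinAt
  have hPU : P ∩ U = Ωf ∩ U := by
    ext y
    constructor
    · rintro ⟨h1, h2⟩; exact ⟨(hch y h2).2 h1, h2⟩
    · rintro ⟨h1, h2⟩; exact ⟨(hch y h2).1 h1, h2⟩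
  have hiP : IntegrableOn (pderiv i f) P := by
    refine IntegrableOn.of_forall_sdiff_eq_zero (s := P ∩ U) ?_ hPo.measurableSet
      fun y hy => hp0 y fun h => hy.2 ⟨hy.1, h⟩
    rw [hPU]
    exact hi.mono_set inter_subset_left
  have hdP : ∀ y ∉ Z, 0 < height b g y → DifferentiableAt ℝ f y := fun y hyZ hy => by
    by_cases hyt : y ∈ tsupport f
    · exact hd y ((hch y (hfU hyt)).2 hy) hyZ
    · exact (differentiableAt_const 0).congr_of_eventuallyEq (hev y hyt)
  have hmain := integral_pderiv_graph hg hfP hsupp hZ hZ0 hdP i hiP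
  have hL : ∫ y in Ωf, pderiv i f y = ∫ y in P, pderiv i f y := by
    rw [setIntegral_eq_of_subset_of_forall_sdiff_eq_zero hPo.measurableSet
      (inter_subset_left (s := P) (t := U)) fun y hy => hp0 y fun h => hy.2 ⟨hy.1, h⟩, hPU]
    exact setIntegral_eq_of_subset_of_forall_sdiff_eq_zero hΩ.isOpen_fluid.measurableSet
      inter_subset_left fun y hy => hp0 y fun h => hy.2 ⟨hy.1, h⟩
  have hrange : range (graphCurve b g) = {y | height b g y = 0} := by
    ext y
    constructor
    · rintro ⟨s, rfl⟩; simp [graphCurve]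
    · intro hy
      have hy : g (b.repr y 0) - b.repr y 1 = 0 := hy
      refine ⟨b.repr y 0, ?_⟩
      rw [graphCurve, sub_eq_zero.1 hy, gp_repr]
  have hΓU : interface Ωf Ωs ∩ U = range (graphCurve b g) ∩ U := by
    rw [hrange]
    ext y
    constructor
    · rintro ⟨h1, h2⟩; exact ⟨(mem_interface_iff hΩ hg hU hUΩ hch h2).1 h1, h2⟩
    · rintro ⟨h1, h2⟩; exact ⟨(mem_interface_iff hΩ hg hU hUΩ hch h2).2 h1, h2⟩
  set F : E → ℝ := fun x => f x * outerNormal Ωf x i with hF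
  have hF0 : ∀ y ∉ U, F y = 0 := fun y hy => by simp only [hF, hf0 y hy, zero_mul]
  have hΓm : MeasurableSet (interface Ωf Ωs) := hΩ.isClosed_interface.measurableSet
  have hrm : MeasurableSet (range (graphCurve b g)) :=
    (measurableEmbedding_graphCurve b hg).measurableSet_range
  have hcurve := integral_curve (hasStrictDerivAt_graphCurve b hg) (continuous_graphTangent b hg)
    (norm_graphTangent b g) (measurableEmbedding_graphCurve b hg) F
  -- The speed of the curve is the length of the unnormalized normal, so the arc length element
  -- cancels the normalization of `n`.
  have hval : ∀ s, ‖graphTangent b g s‖ * F (graphCurve b g s) =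
      f (graphCurve b g s) * graphNormal b g s i := fun s => by
    by_cases hs : graphCurve b g s ∈ U
    · have h1 : height b g (graphCurve b g s) = 0 := by simp [graphCurve]
      have h2 : b.repr (graphCurve b g s) 0 = s := repr_gp_zero b s _
      have h3 := outerNormal_eq (isOuterUnitNormal_graph hg h1
        (by filter_upwards [hU.mem_nhds hs] with y hy using hch y hy))
      rw [h2] at h3
      have h4 : ‖graphTangent b g s‖ ≠ 0 :=
        (one_pos.trans_le (norm_graphTangent b g s)).ne'
      simp only [hF, h3, norm_graphNormal, PiLp.smul_apply, smul_eq_mul]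
      field_simp
    · rw [hF0 _ hs, hf0 _ hs, mul_zero, zero_mul]
  have hcont : Continuous fun s => f (graphCurve b g s) :=
    hfP.comp_continuous (continuous_graphCurve b hg) fun s => by simp [graphCurve]
  have hint : Integrable fun s => ‖graphTangent b g s‖ * F (graphCurve b g s) := by
    simp only [hval]
    refine Continuous.integrable_of_hasCompactSupport
      (hcont.mul ((continuous_coord i).comp (continuous_graphNormal b hg))) ?_
    refine HasCompactSupport.mul_right (hsupp.comp_isClosedEmbedding ?_)
    have h : Function.LeftInverse (fun y : E => b.repr y 0) (graphCurve b g) := fun s =>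
      repr_gp_zero b s _
    exact h.isClosedEmbedding (continuous_repr b 0) (continuous_graphCurve b hg)
  constructor
  · refine IntegrableOn.of_forall_sdiff_eq_zero (s := interface Ωf Ωs ∩ U) ?_ hΓm
      fun y hy => hF0 y fun h => hy.2 ⟨hy.1, h⟩
    rw [hΓU]
    exact (hcurve.1.2 hint).mono_set inter_subset_left
  · rw [hL, hmain, setIntegral_eq_of_subset_of_forall_sdiff_eq_zero hΓm
      (inter_subset_left (s := interface Ωf Ωs) (t := U)) fun y hy => hF0 y fun h => hy.2 ⟨hy.1, h⟩,
      hΓU, ← setIntegral_eq_of_subset_of_forall_sdiff_eq_zero hrm inter_subset_left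
      fun y hy => hF0 y fun h => hy.2 ⟨hy.1, h⟩, hcurve.2]
    simp only [hval]

end Chart

/-- The divergence theorem for functions that vanish near the interface. -/
lemma integral_pderiv_of_disjoint {f : E → ℝ} (hfΓ : Disjoint (tsupport f) (interface Ωf Ωs))
    (hf : ContinuousOn f (closure Ωf)) (hf0 : ∀ x ∈ frontier Ωf ∩ frontier Ω, f x = 0)
    {Z : Set E} (hZ : IsThin Z) (hZ0 : volume Z = 0) (hZΩ : frontier Ω ⊆ Z)
    (hd : ∀ y ∈ Ωf, y ∉ Z → DifferentiableAt ℝ f y) (i : Fin 2)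
    (hi : IntegrableOn (pderiv i f) Ωf) : ∫ x in Ωf, pderiv i f x = 0 := by
  have hΓ : ∀ x ∈ interface Ωf Ωs, f =ᶠ[𝓝 x] fun _ => 0 := fun x hx => by
    filter_upwards [(isClosed_tsupport f).isOpen_compl.mem_nhds fun h => hfΓ.le_bot ⟨h, hx⟩] with z hz
      using image_eq_zero_of_notMem_tsupport hz
  -- The extension by zero is continuous: at the interface the function vanishes nearby, at the
  -- outer boundary by hypothesis. So no boundary regularity of `Ω` enters here.
  have hV : Continuous (Ωf.indicator f) := by
    refine continuous_indicator (fun x hx => ?_) hf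
    rcases hΩ.frontier_fluid_subset hx with h | h
    · exact (hΓ x h).self_of_nhds
    · exact hf0 x ⟨hx, h⟩
  have hVs : HasCompactSupport (Ωf.indicator f) :=
    HasCompactSupport.intro hΩ.isCompact_closure_fluid fun x hx =>
      indicator_of_notMem (fun h => hx (subset_closure h)) _
  have hin : ∀ x ∈ Ωf, Ωf.indicator f =ᶠ[𝓝 x] f := fun x hx => by
    filter_upwards [hΩ.isOpen_fluid.mem_nhds hx] with y hy using indicator_of_mem hy f
  have hout : ∀ x ∉ Ωf, x ∉ Z → Ωf.indicator f =ᶠ[𝓝 x] fun _ => 0 := fun x hx hxZ => by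
    by_cases hcl : x ∈ closure Ωf
    · have hfr : x ∈ frontier Ωf := by rw [hΩ.isOpen_fluid.frontier_eq]; exact ⟨hcl, hx⟩
      have := (hΩ.frontier_fluid_subset hfr).resolve_right fun h => hxZ (hZΩ h)
      filter_upwards [hΓ x this] with y hy
      by_cases hyf : y ∈ Ωf
      · rw [indicator_of_mem hyf, hy]
      · exact indicator_of_notMem hyf f
    · filter_upwards [isClosed_closure.isOpen_compl.mem_nhds hcl] with y hy
        using indicator_of_notMem (fun h => hy (subset_closure h)) f
  have hpd : pderiv i (Ωf.indicator f) =ᵐ[volume] Ωf.indicator (pderiv i f) := by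
    filter_upwards [measure_eq_zero_iff_ae_notMem.1 hZ0] with x hxZ
    by_cases hx : x ∈ Ωf
    · rw [indicator_of_mem hx, pderiv, (hin x hx).fderiv_eq, pderiv]
    · rw [indicator_of_notMem hx, pderiv, (hout x hx hxZ).fderiv_eq]; simp
  have hint := (integrable_indicator_iff hΩ.isOpen_fluid.measurableSet).2 hi
  rw [← integral_indicator hΩ.isOpen_fluid.measurableSet, ← integral_congr_ae hpd]
  refine integral_pderiv_eq_zero hV hVs hZ (fun x hxZ => ?_) i (hint.congr hpd.symm)
  by_cases hx : x ∈ Ωf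
  · exact (hd x hx hxZ).congr_of_eventuallyEq (hin x hx)
  · exact (differentiableAt_const 0).congr_of_eventuallyEq (hout x hx hxZ)

end IsFSIDomain

/-! ### Partition of unity and the divergence theorem on the fluid domain. -/

namespace IsFSIDomain

variable {Ω Ωf Ωs : Set E} (hΩ : IsFSIDomain Ω Ωf Ωs)
include hΩ

open scoped Manifold in
/-- A smooth partition of unity: one function is supported off the interface, the others in charts
of the interface. -/
lemma exists_partition : ∃ (ι : Type) (_ : Fintype ι) (χ : ι → E → ℝ) (V : ι → Prop),
    (∀ a, ContDiff ℝ ∞ (χ a)) ∧ (∀ x, ∑ a, χ a x = 1) ∧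
    (∀ a, ¬ V a → Disjoint (tsupport (χ a)) (interface Ωf Ωs)) ∧
    ∀ a, V a → ∃ (b : OrthonormalBasis (Fin 2) ℝ E) (g : ℝ → ℝ) (U : Set E), ContDiff ℝ 1 g ∧
      IsOpen U ∧ U ⊆ Ω ∧ (∀ y ∈ U, (y ∈ Ωf ↔ 0 < height b g y)) ∧ tsupport (χ a) ⊆ U ∧
      HasCompactSupport (χ a) := by
  have hΓc : IsCompact (interface Ωf Ωs) :=
    hΩ.isCompact_closure_fluid.of_isClosed_subset hΩ.isClosed_interface inter_subset_left
  choose! b g hg ρ hρ hball hch using fun x (hx : x ∈ interface Ωf Ωs) => hΩ.exists_chart hx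
  obtain ⟨t, ht, htc⟩ := hΓc.elim_nhds_subcover (fun x => Metric.ball x (ρ x))
    fun x hx => Metric.ball_mem_nhds x (hρ x hx)
  obtain ⟨χ, hχ⟩ := SmoothPartitionOfUnity.exists_isSubordinate 𝓘(ℝ, E) (s := (univ : Set E))
    -- The index `none` belongs to the complement of the interface, the others to the finitely many
    -- charts.
    isClosed_univ (fun a : Option (Fin t.card) => a.elim (interface Ωf Ωs)ᶜ
      fun k => Metric.ball (t.equivFin.symm k).1 (ρ (t.equivFin.symm k).1))
    (by
      rintro (_ | k)
      · exact hΩ.isClosed_interface.isOpen_compl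
      · exact Metric.isOpen_ball)
    (by
      intro x _
      rw [mem_iUnion]
      by_cases hx : x ∈ interface Ωf Ωs
      · obtain ⟨y, hy, hxy⟩ := mem_iUnion₂.1 (htc hx)
        exact ⟨some (t.equivFin ⟨y, hy⟩), by simpa using hxy⟩
      · exact ⟨none, hx⟩)
  refine ⟨Option (Fin t.card), inferInstance, fun a => χ a, fun a => a.isSome,
    fun a => (χ a).contMDiff.contDiff, fun x => ?_, ?_, ?_⟩
  · rw [← finsum_eq_sum_of_fintype]
    exact χ.sum_eq_one (mem_univ x)
  · rintro (_ | k) h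
    · exact disjoint_left.2 fun x hx => hχ none hx
    · exact absurd rfl h
  · rintro (_ | k) h
    · cases h
    · have hk := ht _ (t.equivFin.symm k).2
      refine ⟨_, _, _, hg _ hk, Metric.isOpen_ball, hball _ hk, hch _ hk, hχ (some k), ?_⟩
      exact Metric.isCompact_of_isClosed_isBounded (isClosed_tsupport _)
        (Metric.isBounded_ball.subset (hχ (some k)))

/-- The divergence theorem for continuous, piecewise smooth functions that vanish on the common
boundary of the fluid domain and `Ω`. -/
theorem integral_pderiv {u : E → ℝ} (hu : ContinuousOn u (closure Ωf))
    (hu0 : ∀ x ∈ frontier Ωf ∩ frontier Ω, u x = 0)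
    {Z : Set E} (hZ : IsThin Z) (hZ0 : volume Z = 0) (hZΩ : frontier Ω ⊆ Z)
    (hd : ∀ y ∈ Ωf, y ∉ Z → DifferentiableAt ℝ u y) (i : Fin 2)
    (hi : IntegrableOn (pderiv i u) Ωf) :
    IntegrableOn (fun x => u x * outerNormal Ωf x i) (interface Ωf Ωs) μH[1] ∧
    ∫ x in Ωf, pderiv i u x = ∫ x in interface Ωf Ωs, u x * outerNormal Ωf x i ∂μH[1] := by
  obtain ⟨ι, _, χ, V, hχ, hsum, hoff, hon⟩ := hΩ.exists_partition
  set f : ι → E → ℝ := fun a x => χ a x * u x with hf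
  have hΩm := hΩ.isOpen_fluid.measurableSet
  have hae : ∀ᵐ x ∂volume.restrict Ωf, x ∈ Ωf ∧ x ∉ Z := by
    filter_upwards [ae_restrict_mem hΩm, ae_restrict_of_ae (measure_eq_zero_iff_ae_notMem.1 hZ0)]
      with x h1 h2 using ⟨h1, h2⟩
  have hχd : ∀ a x, DifferentiableAt ℝ (χ a) x := fun a x =>
    ((hχ a).differentiable (by simp)).differentiableAt
  have hfd : ∀ a, ∀ y ∈ Ωf, y ∉ Z → DifferentiableAt ℝ (f a) y := fun a y hy hyZ =>
    (hχd a y).mul (hd y hy hyZ)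
  have hfc : ∀ a, ContinuousOn (f a) (closure Ωf) := fun a => (hχ a).continuous.continuousOn.mul hu
  have hpχ : ∀ a, Continuous (pderiv i (χ a)) := fun a =>
    ((hχ a).continuous_fderiv (by simp)).clm_apply continuous_const
  have hpf : ∀ a, pderiv i (f a) =ᵐ[volume.restrict Ωf]
      fun x => χ a x * pderiv i u x + pderiv i (χ a) x * u x := fun a => by
    filter_upwards [hae] with x hx
    have := (hχd a x).hasFDerivAt.fun_mul (hd x hx.1 hx.2).hasFDerivAt
    rw [pderiv, this.fderiv]
    simp [pderiv, mul_comm]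
  have hfi : ∀ a, IntegrableOn (pderiv i (f a)) Ωf := fun a => by
    refine Integrable.congr (Integrable.add ?_ ?_) (hpf a).symm
    · exact hi.continuousOn_mul_of_subset (hχ a).continuous.continuousOn
        hΩ.isCompact_closure_fluid hΩm subset_closure
    · exact (((hpχ a).continuousOn.mul hu).integrableOn_compact
        hΩ.isCompact_closure_fluid).mono_set subset_closure
  have key : ∀ a, IntegrableOn (fun x => f a x * outerNormal Ωf x i) (interface Ωf Ωs) μH[1] ∧
      ∫ x in Ωf, pderiv i (f a) x =
        ∫ x in interface Ωf Ωs, f a x * outerNormal Ωf x i ∂μH[1] := fun a => by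
    by_cases ha : V a
    · obtain ⟨b, g, U, hg, hU, hUΩ, hch, hsub, hcpt⟩ := hon a ha
      exact hΩ.integral_pderiv_of_chart hg hU hUΩ hch hcpt.mul_right
        ((tsupport_mul_subset_left).trans hsub) (hfc a) hZ hZ0 (hfd a) i (hfi a)
    -- For the function supported off the interface both sides are zero.
    · have hz : ∀ x ∈ interface Ωf Ωs, f a x * outerNormal Ωf x i = 0 := fun x hx => by
        have : χ a x = 0 := image_eq_zero_of_notMem_tsupport fun h => (hoff a ha).le_bot ⟨h, hx⟩
        simp [hf, this]
      have hΓm := hΩ.isClosed_interface.measurableSet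
      refine ⟨integrableOn_zero.congr_fun (fun x hx => (hz x hx).symm) hΓm, ?_⟩
      rw [setIntegral_eq_zero_of_forall_eq_zero hz]
      refine hΩ.integral_pderiv_of_disjoint
        ((hoff a ha).mono_left tsupport_mul_subset_left) (hfc a)
        (fun x hx => by simp [hf, hu0 x hx]) hZ hZ0 hZΩ (hfd a) i (hfi a)
  have hu' : u = fun x => ∑ a, f a x := by
    funext x
    simp only [hf]
    rw [← Finset.sum_mul, hsum, one_mul]
  have e1 : (fun x => u x * outerNormal Ωf x i) =
      fun x => ∑ a, f a x * outerNormal Ωf x i := by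
    funext x
    rw [← Finset.sum_mul, ← congrFun hu' x]
  have e2 : pderiv i u =ᵐ[volume.restrict Ωf] fun x => ∑ a, pderiv i (f a) x := by
    filter_upwards [hae] with x hx
    conv_lhs => rw [hu']
    rw [pderiv, fderiv_fun_sum fun a _ => hfd a x hx.1 hx.2]
    simp [pderiv]
  rw [integral_congr_ae e2, e1, integral_finsetSum _ fun a _ => hfi a,
    integral_finsetSum _ fun a _ => (key a).1]
  exact ⟨integrable_finsetSum _ fun a _ => (key a).1, Finset.sum_congr rfl fun a _ => (key a).2⟩

end IsFSIDomain

/-! ### Integration by parts for finite element functions. -/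

lemma IsConvexQuad.integrableOn_pderiv_mul {A : Fin 4 → E} (hA : IsConvexQuad A) {r r' : ℕ}
    {c : Coef r} {c' : Coef r'} {φ ψ : E → ℝ} (hφ : ∀ z ∈ csq, φ (xi A z) = pev c z)
    (hψ : ∀ z ∈ csq, ψ (xi A z) = pev c' z) (i : Fin 2) :
    IntegrableOn (fun x => pderiv i φ x * ψ x) (quad A) := by
  have h1 : IntegrableOn (fun x => pderiv i (mapped A c) x * mapped A c' x) (closure (quad A)) :=
    ContinuousOn.integrableOn_compact (isCompact_closure_quad A)
      ((hA.continuousOn_pderiv_mapped c i).mul (hA.continuousOn_mapped c'))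
  refine (h1.mono_set subset_closure).congr_fun (fun x hx => ?_) hA.isOpen_quad.measurableSet
  simp only [hA.eqOn_pderiv hφ i hx, hA.eqOn_mapped hψ (subset_closure hx)]

namespace QuadMesh

variable {Ω Ωf Ωs : Set E} {M : QuadMesh Ω}

/-- The union of the boundaries of all cells. -/
def skeleton (M : QuadMesh Ω) : Set E := ⋃ K, closure (M.cell K) \ M.cell K

lemma isThin_skeleton : IsThin M.skeleton := by
  refine (isThin_iUnion (Z := fun q : Fin M.n × Fin 4 => M.edge q.1 q.2)
    fun q => isThin_segment _ _).mono ?_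
  refine iUnion_subset fun K x hx => ?_
  obtain ⟨e, s, hs, h⟩ := exists_edge_of_mem_closure hx.1 hx.2
  refine mem_iUnion.2 ⟨(K, e), ?_⟩
  simp only [edge_eq]
  rw [quadEdge_subset_closure]
  exact ⟨s, hs, h⟩

lemma volume_skeleton : volume M.skeleton = 0 :=
  measure_iUnion_null fun K => volume_closure_quad_diff (M.corner K)

lemma frontier_subset_skeleton (hΩ : IsFSIDomain Ω Ωf Ωs) : frontier Ω ⊆ M.skeleton := by
  intro x hx
  rw [hΩ.isOpen.frontier_eq] at hx
  obtain ⟨K, hK⟩ := M.exists_mem_closure_cell hx.1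
  exact mem_iUnion.2 ⟨K, hK, fun h => hx.2 (M.cell_subset hΩ K h)⟩

lemma exists_mem_cell {D : Set E} {x : E} (hx : x ∈ M.compDomain D) (hxs : x ∉ M.skeleton) :
    ∃ K ∈ M.sub D, x ∈ M.cell K := by
  obtain ⟨K, hK, h⟩ := mem_iUnion₂.1 hx
  exact ⟨K, hK, by_contra fun h' => hxs (mem_iUnion.2 ⟨K, h, h'⟩)⟩

lemma compDomain_ae_eq (D : Set E) :
    M.compDomain D =ᵐ[volume] ⋃ K ∈ M.fluidCells D, M.cell K := by
  filter_upwards [measure_eq_zero_iff_ae_notMem.1 (volume_skeleton (M := M))] with x hx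
  refine propext ⟨fun h => ?_, fun h => ?_⟩
  · obtain ⟨K, hK, h1⟩ := exists_mem_cell h hx
    exact mem_iUnion₂.2 ⟨K, mem_fluidCells.2 hK, h1⟩
  · obtain ⟨K, hK, h1⟩ := mem_iUnion₂.1 h
    exact cell_subset_compDomain (mem_fluidCells.1 hK) h1

lemma integrableOn_compDomain {D : Set E} {f : E → ℝ}
    (hf : ∀ K ∈ M.sub D, IntegrableOn f (M.cell K)) : IntegrableOn f (M.compDomain D) := by
  rw [integrableOn_congr_set_ae (compDomain_ae_eq D), integrableOn_finset_iUnion]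
  exact fun K hK => hf K (mem_fluidCells.1 hK)

lemma integral_compDomain {D : Set E} {f : E → ℝ}
    (hf : ∀ K ∈ M.sub D, IntegrableOn f (M.cell K)) :
    ∫ x in M.compDomain D, f x = ∑ K ∈ M.fluidCells D, ∫ x in M.cell K, f x := by
  rw [setIntegral_congr_set (compDomain_ae_eq D)]
  exact integral_biUnion_finset _ (fun K _ => (M.isOpen_cell K).measurableSet)
    (fun K _ K' _ h => M.disjoint K K' h) fun K hK => hf K (mem_fluidCells.1 hK)

lemma exists_cell_coef {D : Set E} {r : ℕ} {φ : E → ℝ} (hφ : φ ∈ M.feSpace D r)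
    {K : Fin M.n} (hK : K ∈ M.sub D) :
    ∃ c : Coef r, ∀ z ∈ csq, φ (xi (M.corner K) z) = pev c z := by
  obtain ⟨c, hc⟩ := exists_coef_of_mem_feSpace hφ hK 0
  rw [rotc_zero] at hc
  exact ⟨c, hc⟩

lemma integrableOn_pderiv_mul {D : Set E} {r r' : ℕ} {φ ψ : E → ℝ} (hφ : φ ∈ M.feSpace D r)
    (hψ : ψ ∈ M.feSpace D r') (i : Fin 2) :
    IntegrableOn (fun x => pderiv i φ x * ψ x) (M.compDomain D) :=
  integrableOn_compDomain fun K hK => by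
    obtain ⟨c, hc⟩ := exists_cell_coef hφ hK
    obtain ⟨c', hc'⟩ := exists_cell_coef hψ hK
    exact (M.isConvex K).integrableOn_pderiv_mul hc hc' i

/-- Integration by parts for finite element functions. -/
theorem pressureForm_eq (hΩ : IsFSIDomain Ω Ωf Ωs) {r r' : ℕ} {w : E → E}
    (hw : w ∈ M.velocitySpace Ωf r') {p : E → ℝ} (hp : p ∈ M.feSpace Ωf r) :
    IntegrableOn (fun x => -∑ i, w x i * pderiv i p x) Ωf ∧
    pressureForm Ωf Ωs w p = ∫ x in Ωf, -∑ i, w x i * pderiv i p x := by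
  obtain ⟨hwi, hw0⟩ := hw
  have hsub : closure Ωf ⊆ M.compDomain Ωf := M.closure_fluid_subset hΩ
  have hsub' : Ωf ⊆ M.compDomain Ωf := subset_closure.trans hsub
  have hdiff : ∀ {n : ℕ} {φ : E → ℝ}, φ ∈ M.feSpace Ωf n → ∀ x ∈ Ωf, x ∉ M.skeleton →
      DifferentiableAt ℝ φ x := fun hφ x hx hxs => by
    obtain ⟨K, hK, hxK⟩ := exists_mem_cell (hsub' hx) hxs
    obtain ⟨c, hc⟩ := exists_cell_coef hφ hK
    exact (M.isConvex K).differentiableAt_of_eqOn hc hxK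
  set u : Fin 2 → E → ℝ := fun i x => w x i * p x with hu
  have I1 : ∀ i, IntegrableOn (fun x => pderiv i (fun y => w y i) x * p x) Ωf := fun i =>
    (integrableOn_pderiv_mul (hwi i) hp i).mono_set hsub'
  have I2 : ∀ i, IntegrableOn (fun x => pderiv i p x * w x i) Ωf := fun i =>
    (integrableOn_pderiv_mul hp (hwi i) i).mono_set hsub'
  have I3 : ∀ i, IntegrableOn (fun x => -(pderiv i p x * w x i)) Ωf := fun i => (I2 i).neg
  have hae : ∀ᵐ x ∂volume.restrict Ωf, x ∈ Ωf ∧ x ∉ M.skeleton := by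
    filter_upwards [ae_restrict_mem hΩ.isOpen_fluid.measurableSet,
      ae_restrict_of_ae (measure_eq_zero_iff_ae_notMem.1 volume_skeleton)] with x h1 h2
      using ⟨h1, h2⟩
  have hpu : ∀ i, pderiv i (u i) =ᵐ[volume.restrict Ωf]
      fun x => pderiv i (fun y => w y i) x * p x + pderiv i p x * w x i := fun i => by
    filter_upwards [hae] with x hx
    have := (hdiff (hwi i) x hx.1 hx.2).hasFDerivAt.fun_mul (hdiff hp x hx.1 hx.2).hasFDerivAt
    rw [pderiv, this.fderiv]
    simp [pderiv, mul_comm, add_comm]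
  have Iu : ∀ i, IntegrableOn (pderiv i (u i)) Ωf := fun i =>
    ((I1 i).add (I2 i)).congr (hpu i).symm
  have hdivthm := fun i => hΩ.integral_pderiv (u := u i)
    (((hwi i).1.mono hsub).mul (hp.1.mono hsub)) (fun x hx => by simp [hu, hw0 x hx])
    (isThin_skeleton (M := M)) volume_skeleton (frontier_subset_skeleton hΩ)
    (fun x hx hxs => (hdiff (hwi i) x hx hxs).mul (hdiff hp x hx hxs)) i (Iu i)
  have hdiv : (fun x => divergence w x * p x) =ᵐ[volume.restrict Ωf]
      fun x => ∑ i, pderiv i (fun y => w y i) x * p x := by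
    filter_upwards [hae] with x hx
    rw [divergence, Finset.sum_mul]
    exact Finset.sum_congr rfl fun i _ => by
      rw [(norm_pderiv_sq (fun k => hdiff (hwi k) x hx.1 hx.2) i).1 i]
  have hΓ : (fun x => inner ℝ (w x) (outerNormal Ωf x) * p x) =
      fun x => ∑ i, u i x * outerNormal Ωf x i := by
    funext x
    rw [PiLp.inner_apply, Finset.sum_mul]
    refine Finset.sum_congr rfl fun i _ => ?_
    simp [hu]
    ring
  have hneg : (fun x => -∑ i, w x i * pderiv i p x) = fun x => ∑ i, -(pderiv i p x * w x i) := by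
    funext x
    rw [← Finset.sum_neg_distrib]
    exact Finset.sum_congr rfl fun i _ => by ring
  rw [hneg]
  refine ⟨integrable_finsetSum _ fun i _ => I3 i, ?_⟩
  rw [pressureForm, integral_congr_ae hdiv, hΓ, integral_finsetSum _ fun i _ => I1 i,
    integral_finsetSum _ fun i _ => (hdivthm i).1, integral_finsetSum _ fun i _ => I3 i,
    ← Finset.sum_sub_distrib]
  refine Finset.sum_congr rfl fun i _ => ?_
  -- The product rule for `w i * p` splits the boundary integral; the part with the derivative of `w
  -- i` cancels.
  rw [← (hdivthm i).2, integral_congr_ae (hpu i), integral_add (I1 i) (I2 i), integral_neg]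
  ring

end QuadMesh

/-! ### Norms as sums over cells, and global properties of the velocity. -/

lemma pev_eq_of_red_eq_zero {r : ℕ} {c : Coef r} (h : red c = 0) (z z' : E) :
    pev c z = pev c z' := by
  refine Finset.sum_congr rfl fun i _ => Finset.sum_congr rfl fun j _ => ?_
  have hij : red c i j = 0 := by rw [h]; rfl
  by_cases h0 : i = 0 ∧ j = 0
  · simp [h0.1, h0.2]
  · rw [red, if_neg h0] at hij
    rw [hij, zero_mul, zero_mul]

lemma gradNorm_nonneg {F : Type*} [NormedAddCommGroup F] [NormedSpace ℝ F] (S : Set E) (f : E → F) :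
    0 ≤ gradNorm S f := Real.sqrt_nonneg _

lemma gradNorm_sq {F : Type*} [NormedAddCommGroup F] [NormedSpace ℝ F] (S : Set E) (f : E → F) :
    gradNorm S f ^ 2 = ∫ x in S, ∑ i, ‖pderiv i f x‖ ^ 2 :=
  Real.sq_sqrt (integral_nonneg fun _ => Finset.sum_nonneg fun _ _ => sq_nonneg _)

lemma l2Norm_sq {F : Type*} [NormedAddCommGroup F] [NormedSpace ℝ F] (S : Set E) (f : E → F) :
    l2Norm S f ^ 2 = ∫ x in S, ‖f x‖ ^ 2 :=
  Real.sq_sqrt (integral_nonneg fun _ => sq_nonneg _)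

lemma gradNorm_sq_mono {F : Type*} [NormedAddCommGroup F] [NormedSpace ℝ F] {S S' : Set E}
    (hS : S ⊆ S') {f : E → F} (hf : IntegrableOn (fun x => ∑ i, ‖pderiv i f x‖ ^ 2) S') :
    gradNorm S f ^ 2 ≤ gradNorm S' f ^ 2 := by
  rw [gradNorm_sq, gradNorm_sq]
  exact setIntegral_mono_set hf (ae_of_all _ fun _ => Finset.sum_nonneg fun _ _ => sq_nonneg _)
    hS.eventuallyLE

namespace QuadMesh

variable {Ω Ωf Ωs : Set E} {M : QuadMesh Ω}

lemma size_pos (K : Fin M.n) : 0 < M.size := by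
  obtain ⟨x, hx⟩ := M.cell_nonempty K
  refine lt_of_lt_of_le (Metric.diam_pos ?_ ((isBounded_closure_cell K).subset subset_closure))
    (diam_le_size K)
  exact (infinite_of_mem_nhds x ((M.isOpen_cell K).mem_nhds hx)).nontrivial

section Scalar

variable {r : ℕ} {p : E → ℝ} (hp : p ∈ M.feSpace Ωf r)
include hp

lemma integrableOn_cell_grad {K : Fin M.n} (hK : K ∈ M.sub Ωf) :
    IntegrableOn (fun x => ∑ i, ‖pderiv i p x‖ ^ 2) (M.cell K) := by
  obtain ⟨c, hc⟩ := exists_cell_coef hp hK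
  exact (M.isConvex K).integrableOn_pderiv hc

lemma gradNorm_compDomain_sq :
    gradNorm (M.compDomain Ωf) p ^ 2 = ∑ K ∈ M.fluidCells Ωf, M.cellGrad p K := by
  rw [gradNorm_sq]
  exact integral_compDomain fun K hK => integrableOn_cell_grad hp hK

lemma sum_innerCells_le (hΩ : IsFSIDomain Ω Ωf Ωs) :
    ∑ K ∈ M.innerCells Ωf Ωs, M.cellGrad p K ≤ gradNorm (M.innerFluid Ωf Ωs) p ^ 2 := by
  have hsub : ⋃ K ∈ M.innerCells Ωf Ωs, M.cell K ⊆ M.innerFluid Ωf Ωs := by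
    refine iUnion₂_subset fun K hK x hx => ?_
    obtain ⟨-, hKs⟩ := mem_innerCells.1 hK
    refine ⟨cell_subset_fluid hΩ hKs hx, fun h => ?_⟩
    obtain ⟨K', hK', h'⟩ := mem_iUnion₂.1 h.2
    rw [← eq_of_mem_closure hx h'] at hK'
    exact hKs hK'
  have hint : IntegrableOn (fun x => ∑ i, ‖pderiv i p x‖ ^ 2) (M.innerFluid Ωf Ωs) :=
    (integrableOn_compDomain fun K hK => integrableOn_cell_grad hp hK).mono_set
      (sdiff_subset.trans (subset_closure.trans (M.closure_fluid_subset hΩ)))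
  refine le_trans (le_of_eq ?_) (gradNorm_sq_mono hsub hint)
  rw [gradNorm_sq, integral_biUnion_finset _ (fun K _ => (M.isOpen_cell K).measurableSet)
    (fun K _ K' _ h => M.disjoint K K' h)
    fun K hK => integrableOn_cell_grad hp (mem_innerCells.1 hK).1]
  rfl

end Scalar

section Vector

variable {r : ℕ} {w : E → E} (hw : w ∈ M.velocitySpace Ωf r)
include hw

lemma exists_vector_coef {K : Fin M.n} (hK : K ∈ M.sub Ωf) :
    ∃ d : Fin 2 → Coef r, ∀ k, ∀ z ∈ csq, w (xi (M.corner K) z) k = pev (d k) z := by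
  choose d hd using fun k => exists_cell_coef (hw.1 k) hK
  exact ⟨d, hd⟩

lemma integrableOn_compDomain_grad :
    IntegrableOn (fun x => ∑ i, ‖pderiv i w x‖ ^ 2) (M.compDomain Ωf) :=
  integrableOn_compDomain fun K hK => by
    obtain ⟨d, hd⟩ := exists_vector_coef hw hK
    exact ((M.isConvex K).integral_vector hd).2.1

lemma gradNorm_compDomain_vector_sq : gradNorm (M.compDomain Ωf) w ^ 2 =
    ∑ K ∈ M.fluidCells Ωf, ∫ x in M.cell K, ∑ i, ‖pderiv i w x‖ ^ 2 := by
  rw [gradNorm_sq]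
  exact integral_compDomain fun K hK => by
    obtain ⟨d, hd⟩ := exists_vector_coef hw hK
    exact ((M.isConvex K).integral_vector hd).2.1

lemma l2Norm_compDomain_vector_sq : l2Norm (M.compDomain Ωf) w ^ 2 =
    ∑ K ∈ M.fluidCells Ωf, ∫ x in M.cell K, ‖w x‖ ^ 2 := by
  rw [l2Norm_sq]
  exact integral_compDomain fun K hK => by
    obtain ⟨d, hd⟩ := exists_vector_coef hw hK
    exact ((M.isConvex K).integral_vector hd).1

lemma gradNorm_fluid_le (hΩ : IsFSIDomain Ω Ωf Ωs) :
    gradNorm Ωf w ≤ gradNorm (M.compDomain Ωf) w :=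
  le_of_sq_le_sq (gradNorm_sq_mono (subset_closure.trans (M.closure_fluid_subset hΩ))
    (integrableOn_compDomain_grad hw)) (gradNorm_nonneg _ _)

/-- A velocity field without gradient vanishes on the inner cells, if it vanishes at a corner. -/
lemma eq_zero_of_gradNorm_eq_zero (hΩ : IsFSIDomain Ω Ωf Ωs) {ε : ℝ} (hε : 0 < ε)
    (hsc : ∀ K e, IsScaled ε M.size (rotc (M.corner K) e)) (h0 : gradNorm Ωf w = 0)
    {K : Fin M.n} (hK : K ∈ M.innerCells Ωf Ωs) (hcor : w (M.corner K 0) = 0) :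
    ∀ x ∈ M.cell K, w x = 0 := by
  obtain ⟨κ, hκ, κ₂, -, hequiv⟩ := exists_gradient_equiv r hε
  obtain ⟨hKf, hKs⟩ := mem_innerCells.1 hK
  obtain ⟨d, hd⟩ := exists_vector_coef hw hKf
  have hsK : IsScaled ε M.size (M.corner K) := by
    have := hsc K 0
    rwa [rotc_zero] at this
  have h1 : gradNorm (M.cell K) w ^ 2 ≤ gradNorm Ωf w ^ 2 :=
    gradNorm_sq_mono (cell_subset_fluid hΩ hKs) ((integrableOn_compDomain_grad hw).mono_set
      (subset_closure.trans (M.closure_fluid_subset hΩ)))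
  rw [h0, zero_pow two_ne_zero, gradNorm_sq] at h1
  have h2 := ((M.isConvex K).integral_vector hd).2.2.2
  have hred : ∀ k, red (d k) = 0 := fun k => by
    have h3 := fun k => (hequiv M.size _ hsK (M.isConvex K) (d k) (fun x => w x k) (hd k)).1
    have h4 : ∑ k, κ * ‖red (d k)‖ ^ 2 ≤ 0 := (Finset.sum_le_sum fun k _ => h3 k).trans (h2 ▸ h1)
    have h5 := Finset.single_le_sum (f := fun k => κ * ‖red (d k)‖ ^ 2)
      (fun k _ => by positivity) (Finset.mem_univ k)
    have h6 : κ * ‖red (d k)‖ ^ 2 ≤ 0 := h5.trans h4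
    have h7 : ‖red (d k)‖ ^ 2 ≤ 0 := nonpos_of_mul_nonpos_right h6 hκ
    exact norm_eq_zero.1 (pow_eq_zero_iff two_ne_zero |>.1 (le_antisymm h7 (sq_nonneg _)))
  intro x hx
  rw [cell, quad_eq_image] at hx
  obtain ⟨z, hz, rfl⟩ := hx
  ext k
  have hx : xi (M.corner K) (pt 0 0) = M.corner K 0 := by rw [xi_pt_zero]; simp
  rw [hd k z (sq_subset_csq hz), pev_eq_of_red_eq_zero (hred k) z (pt 0 0),
    ← hd k _ (pt_mem_csq ⟨le_rfl, zero_le_one⟩), hx, hcor]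

/-- After integration by parts, what remains of `Ωf` outside the uncut cells lies up to a null set
in cut cells, where the integrand has a sign. -/
lemma le_pressureForm (hΩ : IsFSIDomain Ω Ωf Ωs) {r' : ℕ} {p : E → ℝ} (hp : p ∈ M.feSpace Ωf r')
    (hcut : ∀ K ∈ M.cutCells Ωf Ωs, ∀ x ∈ M.cell K, 0 ≤ -∑ i, w x i * pderiv i p x) :
    ∑ K ∈ M.innerCells Ωf Ωs, ∫ x in M.cell K, -∑ i, w x i * pderiv i p x ≤
      pressureForm Ωf Ωs w p := by
  obtain ⟨hint, heq⟩ := pressureForm_eq hΩ hw hp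
  have hcell : ∀ K ∈ M.innerCells Ωf Ωs, M.cell K ⊆ Ωf := fun K hK =>
    cell_subset_fluid hΩ (mem_innerCells.1 hK).2
  set U := ⋃ K ∈ M.innerCells Ωf Ωs, M.cell K with hU
  have hUm : MeasurableSet U := (isOpen_biUnion fun K _ => M.isOpen_cell K).measurableSet
  have hUf : U ⊆ Ωf := iUnion₂_subset hcell
  rw [heq, ← integral_biUnion_finset _ (fun K _ => (M.isOpen_cell K).measurableSet)
    (fun K _ K' _ h => M.disjoint K K' h) fun K hK => hint.mono_set (hcell K hK), ← hU,
    ← union_sdiff_cancel hUf, setIntegral_union disjoint_sdiff_right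
      (hΩ.isOpen_fluid.measurableSet.diff hUm) (hint.mono_set hUf) (hint.mono_set sdiff_subset)]
  refine le_add_of_nonneg_right (setIntegral_nonneg_ae
    (hΩ.isOpen_fluid.measurableSet.diff hUm) ?_)
  filter_upwards [measure_eq_zero_iff_ae_notMem.1 (volume_skeleton (M := M))] with x hxs hx
  obtain ⟨K, hK, hxK⟩ := exists_mem_cell (M.closure_fluid_subset hΩ (subset_closure hx.1)) hxs
  refine hcut K (mem_cutCells.2 ⟨hK, ?_⟩) x hxK
  by_contra hKs
  exact hx.2 (mem_iUnion₂.2 ⟨K, mem_innerCells.2 ⟨hK, hKs⟩, hxK⟩)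

lemma neg_mem_velocitySpace : (fun x => -w x) ∈ M.velocitySpace Ωf r := by
  refine ⟨fun i => ⟨(hw.1 i).1.neg, fun K hK => ?_⟩, fun x hx => by simp [hw.2 x hx]⟩
  obtain ⟨q, hq, h⟩ := (hw.1 i).2 K hK
  refine ⟨-q, neg_mem hq, fun s hs t ht => ?_⟩
  rw [map_neg, ← h s hs t ht]
  rfl

lemma pressureForm_neg (hΩ : IsFSIDomain Ω Ωf Ωs) {r' : ℕ} {p : E → ℝ}
    (hp : p ∈ M.feSpace Ωf r') :
    pressureForm Ωf Ωs (fun x => -w x) p = -pressureForm Ωf Ωs w p := by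
  rw [(pressureForm_eq hΩ (neg_mem_velocitySpace hw) hp).2, (pressureForm_eq hΩ hw hp).2,
    ← integral_neg]
  simp

end Vector

lemma gradNorm_neg (S : Set E) (w : E → E) : gradNorm S (fun x => -w x) = gradNorm S w := by
  simp [gradNorm, pderiv, fderiv_fun_neg]

lemma zero_mem_velocitySpace (r : ℕ) : (fun _ => 0) ∈ M.velocitySpace Ωf r :=
  ⟨fun _ => ⟨continuousOn_const, fun _ _ => ⟨0, zero_mem _, by simp⟩⟩, fun _ _ => rfl⟩

/-- A pressure with nonzero gradient on every cell. Its velocity has nonzero gradient on `Ωf`, so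
the supremum in the inf-sup condition is over a nonempty set. -/
lemma coord_mem_feSpace {r : ℕ} (hr : 1 ≤ r) : (fun x : E => x 0) ∈ M.feSpace Ωf r := by
  refine ⟨(continuous_coord 0).continuousOn, fun K _ => ?_⟩
  have hm : (fun z : E => xi (M.corner K) z 0) ∈ Qsp r r := by
    have h := fun (i j : ℕ) (hi : i ≤ r) (hj : j ≤ r) (a : ℝ) =>
      (Qsp r r).smul_mem a (Qsp.monomial hi hj)
    have h2 := (Qsp r r).add_mem ((Qsp r r).add_mem ((Qsp r r).add_mem
      (h 0 0 (by omega) (by omega) (M.corner K 0 0))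
      (h 1 0 hr (by omega) ((shape (M.corner K)).1 0)))
      (h 0 1 (by omega) hr ((shape (M.corner K)).2.2 0)))
      (h 1 1 hr hr ((shape (M.corner K)).2.1 0))
    convert h2 using 1
    ext z
    rw [xi_eq]
    simp
    ring
  obtain ⟨q, hq, h⟩ := exists_mvPolynomial hm
  exact ⟨q, hq, fun s _ t _ => by simpa [xi] using h (pt s t)⟩

lemma cellGrad_coord_pos (K : Fin M.n) : 0 < M.cellGrad (fun x => x 0) K := by
  have h : ∀ (i : Fin 2) (x : E), pderiv i (fun x : E => x 0) x = if i = 0 then 1 else 0 := by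
    intro i x
    have := (EuclideanSpace.proj (0 : Fin 2) : E →L[ℝ] ℝ).hasFDerivAt (x := x)
    rw [pderiv]
    change fderiv ℝ (EuclideanSpace.proj (0 : Fin 2) : E →L[ℝ] ℝ) x _ = _
    rw [this.fderiv]
    fin_cases i <;> simp
  have h1 : ∀ x, ∑ i, ‖pderiv i (fun x : E => x 0) x‖ ^ 2 = 1 := fun x => by
    simp [h]
  simp only [cellGrad, h1]
  rw [setIntegral_const, smul_eq_mul, mul_one]
  have hb := ((isBounded_closure_cell K).subset subset_closure)
  exact ENNReal.toReal_pos ((M.isOpen_cell K).measure_pos volume (M.cell_nonempty K)).ne'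
    hb.measure_lt_top.ne

/-- Some cell meets the fluid, and if it is cut, it is joined to an uncut one. -/
lemma nonempty_innerCells (hΩ : IsFSIDomain Ω Ωf Ωs) {N : ℕ} (h : M.HasPaths Ωf Ωs N) :
    (M.innerCells Ωf Ωs).Nonempty := by
  obtain ⟨x, hx⟩ := hΩ.nonempty_fluid
  obtain ⟨K, hK, -⟩ := mem_iUnion₂.1 (M.closure_fluid_subset hΩ (subset_closure hx))
  by_cases hs : K ∈ M.sub Ωs
  · obtain ⟨a, ha, -⟩ := h
    exact ⟨a K, mem_innerCells_of_subset (ha K (cell_subset_zone (mem_cutCells.2 ⟨hK, hs⟩))).1⟩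
  · exact ⟨K, mem_innerCells.2 ⟨hK, hs⟩⟩

/-- A velocity field that controls the pressure gradient on the inner cells. -/
theorem exists_velocity_pressureForm {r : ℕ} (hr : 1 ≤ r) {ε : ℝ} (hε : 0 < ε) :
    ∃ κ > 0, ∃ C > 0, ∀ (Ω Ωf Ωs : Set E) (M : QuadMesh Ω), IsFSIDomain Ω Ωf Ωs →
    (∀ K e, IsScaled ε M.size (rotc (M.corner K) e)) →
    (∀ K, K ∈ M.sub Ωf → K ∈ M.sub Ωs → ∀ e, M.Shared K e) → (∀ K, ∃ e, M.Shared K e) →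
    ∀ p ∈ M.feSpace Ωf r, ∃ w ∈ M.velocitySpace Ωf (r + 1),
      κ * (M.size ^ 2 * ∑ K ∈ M.innerCells Ωf Ωs, M.cellGrad p K) ≤ pressureForm Ωf Ωs w p ∧
      l2Norm (M.compDomain Ωf) w ^ 2 ≤
        C * (M.size ^ 4 * ∑ K ∈ M.fluidCells Ωf, M.cellGrad p K) ∧
      gradNorm (M.compDomain Ωf) w ^ 2 ≤
        C * (M.size ^ 2 * ∑ K ∈ M.fluidCells Ωf, M.cellGrad p K) ∧
      (∀ K ∈ M.innerCells Ωf Ωs, 0 < M.cellGrad p K → gradNorm Ωf w ≠ 0) := by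
  obtain ⟨κ, hκ, C, hC, h⟩ := exists_velocity hr hε
  refine ⟨κ, hκ, C, hC, fun Ω Ωf Ωs M hΩ hsc hcut hsh p hp => ?_⟩
  obtain ⟨w, hw, hcor, hin, hc, hb⟩ := h Ω Ωf Ωs M hΩ hsc hcut hsh p hp
  refine ⟨w, hw, ?_, ?_, ?_, fun K hK hpos h0 => ?_⟩
  · refine le_trans ?_ (le_pressureForm hw hΩ hp hc)
    rw [Finset.mul_sum, Finset.mul_sum]
    exact Finset.sum_le_sum hin
  · rw [l2Norm_compDomain_vector_sq hw, Finset.mul_sum, Finset.mul_sum]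
    exact Finset.sum_le_sum fun K hK => (hb K hK).1
  · rw [gradNorm_compDomain_vector_sq hw, Finset.mul_sum, Finset.mul_sum]
    exact Finset.sum_le_sum fun K hK => (hb K hK).2
  -- Without gradient the velocity would be constant on the inner cell, hence zero by its value at a
  -- corner, against the lower bound on that cell.
  · have hz := eq_zero_of_gradNorm_eq_zero hw hΩ hε hsc h0 hK (hcor K (mem_innerCells.1 hK).1)
    have h1 := hin K hK
    rw [setIntegral_eq_zero_of_forall_eq_zero fun x hx => by simp [hz x hx]] at h1
    have h2 := size_pos K
    have : 0 < κ * (M.size ^ 2 * M.cellGrad p K) := by positivity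
    linarith

/-- The supremum in the inf-sup condition is nonnegative. -/
lemma zero_le_iSup_pressureForm (hΩ : IsFSIDomain Ω Ωf Ωs) {r r' : ℕ} {p : E → ℝ}
    (hp : p ∈ M.feSpace Ωf r') {v : E → E} (hv : v ∈ M.velocitySpace Ωf r)
    (hv0 : gradNorm Ωf v ≠ 0) :
    0 ≤ ⨆ w : {w // w ∈ M.velocitySpace Ωf r ∧ gradNorm Ωf w ≠ 0},
      ((pressureForm Ωf Ωs w.1 p / gradNorm Ωf w.1 : ℝ) : EReal) := by
  -- Either `v` or `-v` has a nonnegative quotient.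
  rcases le_total 0 (pressureForm Ωf Ωs v p) with h | h
  · refine le_iSup_of_le ⟨v, hv, hv0⟩ ?_
    exact_mod_cast div_nonneg h (gradNorm_nonneg _ _)
  · refine le_iSup_of_le ⟨fun x => -v x, neg_mem_velocitySpace hv, by rwa [gradNorm_neg]⟩ ?_
    simp only [pressureForm_neg hv hΩ hp]
    exact_mod_cast div_nonneg (neg_nonneg.2 h) (gradNorm_nonneg _ _)

end QuadMesh

end CutFEM

end

/-! ### The stability estimate and the inf-sup condition. -/

theorem mainTheorem5 {Ω Ωf Ωs : Set E} (hΩ : IsFSIDomain Ω Ωf Ωs)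
    {J : Type*} (𝒯 : J → QuadMesh Ω) (h𝒯 : IsQuasiUniform 𝒯) (hpaths : HasGhostPaths 𝒯 Ωf Ωs)
    (m : ℕ) (hm : 2 ≤ m) (γp wmax : ℝ) (hγp : 0 < γp) (hwmax : 1 ≤ wmax) :
    ∃ γ₁ > 0, ∃ C > 0, ∃ γ₂ > 0, ∃ h₀ > 0, ∀ j, (𝒯 j).size ≤ h₀ →
      ∀ p ∈ (𝒯 j).pressureSpace Ωf m,
        (∃ w ∈ (𝒯 j).velocitySpace Ωf m,
          γ₁ * (𝒯 j).size ^ 2 * gradNorm ((𝒯 j).compDomain Ωf) p ^ 2 ≤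
            pressureForm Ωf Ωs w p + (𝒯 j).ghostPenalty Ωf Ωs m γp wmax p p ∧
          l2Norm ((𝒯 j).compDomain Ωf) w ≤
            C * (𝒯 j).size ^ 2 * gradNorm ((𝒯 j).innerFluid Ωf Ωs) p ∧
          h1Norm ((𝒯 j).compDomain Ωf) w ≤
            C * (𝒯 j).size * gradNorm ((𝒯 j).innerFluid Ωf Ωs) p) ∧
        ((γ₂ * (𝒯 j).size * gradNorm ((𝒯 j).compDomain Ωf) p : ℝ) : EReal) ≤
          (⨆ w : {w // w ∈ (𝒯 j).velocitySpace Ωf m ∧ gradNorm Ωf w ≠ 0},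
            ((pressureForm Ωf Ωs w.1 p / gradNorm Ωf w.1 : ℝ) : EReal)) +
          ((√((𝒯 j).ghostPenalty Ωf Ωs m γp wmax p p) : ℝ) : EReal) := by
  obtain ⟨ε, hε, hsc⟩ := h𝒯.exists_isScaled
  obtain ⟨N, hN⟩ := hpaths
  obtain ⟨C₁, hC₁, hghost⟩ := QuadMesh.exists_sum_cellGrad_le m N hε hγp hwmax
  obtain ⟨κ, hκ, C, hC, hvel⟩ :=
    QuadMesh.exists_velocity_pressureForm (r := m - 1) (by omega) hε
  obtain ⟨h₁, hh₁, hshared⟩ := QuadMesh.exists_forall_shared hΩ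
  have hdiam : 0 < Metric.diam Ω := by
    obtain ⟨x, hx⟩ := hΩ.isConnected.nonempty
    exact Metric.diam_pos (infinite_of_mem_nhds x (hΩ.isOpen.mem_nhds hx)).nontrivial hΩ.isBounded
  -- Each minimum serves the two cases: the first entry of `γ₁` and the second of `γ₂` when the
  -- velocity is used, the other ones when the penalty dominates. In `C`, the factor `4` covers two
  -- summands of the `H¹` norm and the factor `2 * C₁` between the gradient norms.
  refine ⟨min κ 1 / (2 * C₁), by positivity, √(4 * C * C₁), by positivity,
    min (1 / √(2 * C₁)) (κ / (2 * C₁ * √C)), by positivity,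
    -- The bound `1` lets the `L²` part of the `H¹` norm be absorbed, `h₁` makes all edges of cut
    -- cells shared, and the diameter excludes a mesh of a single cell.
    min 1 (min h₁ (Metric.diam Ω / 2)), by positivity, fun j hj p hp => ?_⟩
  have hp' : p ∈ (𝒯 j).feSpace Ωf (m - 1) := hp
  have hh1 : (𝒯 j).size ≤ 1 := hj.trans (min_le_left _ _)
  have hcut := hshared (𝒯 j) (hj.trans ((min_le_right _ _).trans (min_le_left _ _)))
  have hsh := QuadMesh.exists_shared (M := 𝒯 j) hΩ
    ((hj.trans ((min_le_right _ _).trans (min_le_right _ _))).trans_lt (half_lt_self hdiam))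
  have hvel := hvel Ω Ωf Ωs (𝒯 j) hΩ (hsc j) hcut hsh
  rw [Nat.sub_add_cancel (by omega : 1 ≤ m)] at hvel
  obtain ⟨K₀, hK₀⟩ := QuadMesh.nonempty_innerCells hΩ (hN j)
  have hh0 : 0 < (𝒯 j).size := QuadMesh.size_pos K₀
  have hsup : 0 ≤ ⨆ w : {w // w ∈ (𝒯 j).velocitySpace Ωf m ∧ gradNorm Ωf w ≠ 0},
      ((pressureForm Ωf Ωs w.1 p / gradNorm Ωf w.1 : ℝ) : EReal) := by
    obtain ⟨v, hv, -, -, -, hv0⟩ := hvel _ (QuadMesh.coord_mem_feSpace (by omega))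
    exact QuadMesh.zero_le_iSup_pressureForm hΩ hp' hv
      (hv0 K₀ hK₀ (QuadMesh.cellGrad_coord_pos K₀))
  have hgh := hghost Ω Ωf Ωs (𝒯 j) (hsc j) (hN j) p hp'
  have hg0 := QuadMesh.ghostPenalty_nonneg (M := 𝒯 j) (Ωf := Ωf) (Ωs := Ωs) (m := m) hγp hwmax p
  have hGP := QuadMesh.gradNorm_compDomain_sq hp'
  have hin := QuadMesh.sum_innerCells_le hp' hΩ
  rw [← hGP] at hgh
  set h := (𝒯 j).size
  set g := (𝒯 j).ghostPenalty Ωf Ωs m γp wmax p p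
  set G := gradNorm ((𝒯 j).compDomain Ωf) p
  set I := gradNorm ((𝒯 j).innerFluid Ωf Ωs) p
  set S := ∑ K ∈ (𝒯 j).innerCells Ωf Ωs, (𝒯 j).cellGrad p K
  have hG0 : 0 ≤ G := gradNorm_nonneg _ _
  have hI0 : 0 ≤ I := gradNorm_nonneg _ _
  -- Of the two terms in the bound for `h ^ 2 * G ^ 2`, either the penalty or the gradient on the
  -- uncut cells makes up at least half.
  by_cases hcase : h ^ 2 * G ^ 2 ≤ 2 * C₁ * g
  · have hcase' : h ^ 2 * G ^ 2 / (2 * C₁) ≤ g := by rw [div_le_iff₀ (by positivity)]; linarith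
    refine ⟨⟨fun _ => 0, QuadMesh.zero_mem_velocitySpace m, ?_, ?_, ?_⟩, ?_⟩
    · have h0 : pressureForm Ωf Ωs (fun _ => 0) p = 0 := by
        simp [pressureForm, divergence, pderiv]
      rw [h0, zero_add]
      refine le_trans ?_ hcase'
      have : min κ 1 * (h ^ 2 * G ^ 2) ≤ 1 * (h ^ 2 * G ^ 2) :=
        mul_le_mul_of_nonneg_right (min_le_right _ _) (by positivity)
      calc min κ 1 / (2 * C₁) * h ^ 2 * G ^ 2 = min κ 1 * (h ^ 2 * G ^ 2) / (2 * C₁) := by ring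
        _ ≤ 1 * (h ^ 2 * G ^ 2) / (2 * C₁) := by gcongr
        _ = _ := by rw [one_mul]
    · have h0 : l2Norm ((𝒯 j).compDomain Ωf) (fun _ => (0 : E)) = 0 := by simp [l2Norm]
      rw [h0]
      positivity
    · have h0 : h1Norm ((𝒯 j).compDomain Ωf) (fun _ => (0 : E)) = 0 := by
        simp [h1Norm, l2Norm, gradNorm, pderiv]
      rw [h0]
      positivity
    · refine le_trans ?_ (le_add_of_nonneg_left hsup)
      refine EReal.coe_le_coe_iff.2 (Real.le_sqrt_of_sq_le (le_trans ?_ hcase'))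
      have h1 : min (1 / √(2 * C₁)) (κ / (2 * C₁ * √C)) ^ 2 ≤ (1 / √(2 * C₁)) ^ 2 :=
        pow_le_pow_left₀ (by positivity) (min_le_left _ _) 2
      rw [div_pow, one_pow, Real.sq_sqrt (by positivity)] at h1
      calc (min (1 / √(2 * C₁)) (κ / (2 * C₁ * √C)) * h * G) ^ 2
          = min (1 / √(2 * C₁)) (κ / (2 * C₁ * √C)) ^ 2 * (h ^ 2 * G ^ 2) := by ring
        _ ≤ 1 / (2 * C₁) * (h ^ 2 * G ^ 2) := by gcongr
        _ = _ := by ring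
  · rw [not_le] at hcase
    obtain ⟨w, hw, hform, hl2, hgrad, hne⟩ := hvel p hp'
    rw [← hGP] at hl2 hgrad
    change κ * (h ^ 2 * S) ≤ _ at hform
    have hGS : G ^ 2 ≤ 2 * C₁ * S := by
      have : h ^ 2 * G ^ 2 ≤ h ^ 2 * (2 * C₁ * S) := by linarith
      exact le_of_mul_le_mul_left this (by positivity)
    -- Only in this case is the gradient on the computational domain bounded by that on `Ωf ∖ G^h`
    -- alone, as the norm bounds of the velocity demand.
    have hGI : G ^ 2 ≤ 2 * C₁ * I ^ 2 := hGS.trans (by gcongr)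
    have hGpos : 0 < G := by
      refine lt_of_le_of_ne hG0 fun h0 => ?_
      rw [← h0] at hcase
      have : 0 ≤ 2 * C₁ * g := by positivity
      linarith
    have hform' : κ / (2 * C₁) * h ^ 2 * G ^ 2 ≤ pressureForm Ωf Ωs w p := by
      refine le_trans ?_ hform
      calc κ / (2 * C₁) * h ^ 2 * G ^ 2 ≤ κ / (2 * C₁) * h ^ 2 * (2 * C₁ * S) := by gcongr
        _ = _ := by field_simp
    refine ⟨⟨w, hw, ?_, ?_, ?_⟩, ?_⟩
    · refine le_trans (le_trans ?_ hform') (le_add_of_nonneg_right hg0)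
      gcongr
      exact min_le_left _ _
    · refine le_of_sq_le_sq (hl2.trans ?_) (by positivity)
      calc C * (h ^ 4 * G ^ 2) ≤ C * (h ^ 4 * (2 * C₁ * I ^ 2)) := by gcongr
        _ ≤ 4 * C * C₁ * (h ^ 4 * I ^ 2) := by
          have : 0 ≤ C * C₁ * (h ^ 4 * I ^ 2) := by positivity
          linarith
        _ = (√(4 * C * C₁) * h ^ 2 * I) ^ 2 := by
          rw [mul_pow, mul_pow, Real.sq_sqrt (by positivity)]; ring
    · refine Real.sqrt_le_left (by positivity) |>.2 ?_
      have hh4 : h ^ 4 ≤ h ^ 2 := pow_le_pow_of_le_one hh0.le hh1 (by norm_num)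
      calc _ ≤ C * (h ^ 4 * G ^ 2) + C * (h ^ 2 * G ^ 2) := add_le_add hl2 hgrad
        _ ≤ C * (h ^ 2 * (2 * C₁ * I ^ 2)) + C * (h ^ 2 * (2 * C₁ * I ^ 2)) := by gcongr
        _ = (√(4 * C * C₁) * h * I) ^ 2 := by
          rw [mul_pow, mul_pow, Real.sq_sqrt (by positivity)]; ring
    -- Since `G > 0`, some uncut cell carries a nonzero pressure gradient, which makes the velocity
    -- admissible in the supremum.
    · have hne0 : gradNorm Ωf w ≠ 0 := by
        have hS : 0 < S := by
          have : 0 < 2 * C₁ * S := (by positivity : 0 < G ^ 2).trans_le hGS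
          exact pos_of_mul_pos_right this (by positivity)
        obtain ⟨K, hK, hpos⟩ := Finset.exists_lt_of_sum_lt (s := (𝒯 j).innerCells Ωf Ωs)
          (f := fun _ => (0 : ℝ)) (g := fun K => (𝒯 j).cellGrad p K) (by rw [Finset.sum_const_zero]; exact hS)
        exact hne K hK hpos
      have hwpos : 0 < gradNorm Ωf w := lt_of_le_of_ne (gradNorm_nonneg _ _) hne0.symm
      have hwle : gradNorm Ωf w ≤ √C * h * G := by
        refine (QuadMesh.gradNorm_fluid_le hw hΩ).trans
          (le_of_sq_le_sq (hgrad.trans (le_of_eq ?_)) (by positivity))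
        rw [mul_pow, mul_pow, Real.sq_sqrt hC.le]; ring
      refine le_trans ?_ (add_le_add (le_iSup (fun w : {w // w ∈ (𝒯 j).velocitySpace Ωf m ∧
        gradNorm Ωf w ≠ 0} => ((pressureForm Ωf Ωs w.1 p / gradNorm Ωf w.1 : ℝ) : EReal))
        ⟨w, hw, hne0⟩) (EReal.coe_nonneg.2 (Real.sqrt_nonneg g)))
      rw [add_zero]
      refine EReal.coe_le_coe_iff.2 ?_
      rw [le_div_iff₀ hwpos]
      refine le_trans ?_ hform'
      have hsC : √C ≠ 0 := (Real.sqrt_pos.2 hC).ne'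
      calc _ ≤ κ / (2 * C₁ * √C) * h * G * (√C * h * G) := by
            gcongr
            exact min_le_right _ _
        _ = _ := by field_simp
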